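/- A \emph{reducing triangulation} $T$ is a triangulation of a connected oriented surface without boundary (loops and parallel edges allowed), all of whose vertices have finite degree at least eight, together with a colouring of its triangles in red and blue such that adjacent triangles have different colours. A walk traversing the directed edges $e,e'$ in this order makes a \emph{$k$-turn} ($k\ge 0$) at the intermediate vertex if it leaves exactly $k$ triangles to its left between $e$ and $e'$, and a \emph{$-k$-turn} ($k\ge 1$) if it leaves exactly $k$ triangles to its right; an integer between $-3$ and $3$ is used if possible, and the positive integer otherwise. It is a $k_r$-turn (resp. $k_b$-turn) if the triangle to the left of $e$ is red (resp. blue). The \emph{bad} turns are the $0$-, $1$-, $-1$-, $2_r$- and $-2_r$-turns. A walk is \emph{reduced} if no interior vertex makes a bad turn. A closed walk is \emph{reduced} if no vertex makes a bad turn and, unless it has length zero, its turns are not all $3_r$-turns and not all $-3_b$-turns. Let $\varphi$ be three times the length plus the number of bad turns of a walk or closed walk. The \emph{reduction moves} replace, in a walk or in its reversal, a subwalk with a given turn sequence by a homotopic one. Symbols are turns and exponents are repetitions. For a subwalk making only $2$- and $3$-turns, let the \emph{left strip} consist of the triangles incident, to the left of the subwalk, to its edges and its interior vertices. \begin{itemize}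 \item \emph{Spur} ($0$): two consecutive edges $e,e^{-1}$ are removed. \item \emph{Spike} ($1$): two consecutive sides of a triangle to the left are replaced by the third side. \item \emph{Bracket} ($2\,3^k\,2$, $k\ge0$): the subwalk is replaced by the other side of its left strip. \item \emph{Flip} ($a\,3^k\,2_r\,3^\ell\,b$ with $k,\ell\ge 0$ and $a,b\notin\{-1,0,1,2,3\}$): the subwalk from the vertex turning by $a$ to the vertex turning by $b$ is replaced by the other side of its left strip. Here $a$ (resp. $b$) may also be absent, the subwalk then starting (resp. ending) the walk. \end{itemize} The same moves apply to closed walks, where the turn sequence is cyclic, the replaced subwalk does not wrap around the closed walk, and in a flip the vertices of $a$ and $b$ may be the same vertex of the closed walk. The \emph{final move} applies to a closed walk of positive length, or its reversal, all of whose turns are $3_r$-turns, and pushes it across all the triangles incident to it on its left. Assume that $T$ is stored in the memory of a random access machine with unit-cost addition, subtraction, comparison and memory access, as follows. Each directed edge stores its reversal, its source, its number in the clockwise order (from an arbitrary starting edge) among the directed edges with the same source, and the colour of the triangle to its left. Each vertex stores its degree and a table of the directed edges with this source, indexed by their numbers. Walks are given and returned as a starting vertex, a length, and an array of directed edges. Then: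 \begin{enumerate} \item There are a program and a constant $c$, independent of $T$ and of the walk, such that on every walk $W$ of length $n\ge 0$ in $T$ the program halts after at most $c(n+1)$ steps and returns a reduced walk homotopic to $W$ (with fixed endpoints), which can be obtained from $W$ by a sequence of reduction moves. \item There are a program and a constant $c$, independent of $T$ and of the closed walk, such that on every closed walk $C$ of length $n\ge 0$ in $T$ the program halts after at most $c(n+1)$ steps and returns a reduced closed walk freely homotopic to $C$, which can be obtained from $C$ by a sequence of reduction moves followed by at most one final move. \item Every reduction move on a walk strictly decreases $\varphi$; and every sequence of reduction moves starting at a walk of length $n$ has length at most $4n$. \item Every reduction move on a closed walk strictly decreases $\varphi$, except possibly if the cyclic turn sequence of the closed walk or of its reversal is $4\,3^k\,2_r\,3^\ell$ for some $k,\ell\ge 0$, in which case $\varphi$ either strictly decreases or is unchanged; and every sequence of reduction moves starting at a closed walk of length $n$ has length at most $4n+1$. \end{enumerate} -/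

import Mathlib

open scoped unitInterval

universe u

/-!
### Reducing triangulations

A triangulation of an oriented surface without boundary is given by its combinatorial map:
its darts (directed edges), the reversal of darts, and the rotation system.
-/

/-- A reducing triangulation of a connected oriented surface without boundary, with set of
darts `D`. Loops and parallel edges are allowed. The surface need not be compact. -/
structure ReducingTriangulation (D : Type*) where
  /-- the same edge, directed the other way -/
  rev : D → D
  /-- the next dart in clockwise order around the source of a dart -/
  cw : Equiv.Perm D
  /-- whether the triangle to the left of a dart is red (otherwise it is blue) -/
  red : D → Bool
  rev_rev : ∀ d, rev (rev d) = d
  rev_ne : ∀ d, rev d ≠ d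
  /-- every face has exactly three sides; `cw (rev d)` follows `d` along the face to the left
  of `d` -/
  face_ne : ∀ d, cw (rev d) ≠ d
  face_face_face : ∀ d, cw (rev (cw (rev (cw (rev d))))) = d
  /-- the colour is a colour of the faces -/
  red_face : ∀ d, red (cw (rev d)) = red d
  /-- adjacent triangles have different colours -/
  red_rev : ∀ d, red (rev d) = !red d
  /-- every vertex has finite degree, at least eight (a minimal period of `0` would mean that
  the orbit is infinite) -/
  eight_le_degree : ∀ d, 8 ≤ Function.minimalPeriod cw d
  /-- the surface is connected -/
  connected : ∀ d d', Relation.ReflTransGen (fun x y => y = rev x ∨ y = cw x) d d'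

/-- The closed triangle. -/
abbrev Triangle : Type := stdSimplex ℝ (Fin 3)

namespace Triangle

/-- Barycentric coordinates shifted by one vertex. -/
def rotate (x : Triangle) : Triangle :=
  ⟨![x.1 1, x.1 2, x.1 0], by
    obtain ⟨h0, h1⟩ := x.2
    refine ⟨fun i => by fin_cases i <;> simp [h0], ?_⟩
    simp only [Fin.sum_univ_three] at h1 ⊢
    simp
    linarith⟩

/-- The point at parameter `t` of the side from corner `0` to corner `1`. -/
def side (t : I) : Triangle :=
  ⟨![1 - (t : ℝ), (t : ℝ), 0], by
    refine ⟨fun i => ?_, ?_⟩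
    · fin_cases i
      · simpa using t.2.2
      · simpa using t.2.1
      · simp
    · simp [Fin.sum_univ_three]⟩

theorem continuous_side : Continuous side := by
  refine Continuous.subtype_mk (continuous_pi fun i => ?_) _
  fin_cases i
  · exact (continuous_const.sub continuous_subtype_val : Continuous fun t : I => (1 : ℝ) - (t : ℝ))
  · simpa using continuous_subtype_val
  · simpa using continuous_const

theorem rotate_side_one : rotate (side 1) = side 0 := by
  apply Subtype.ext
  funext i
  fin_cases i <;> simp [rotate, side]

end Triangle

/-- Two loops are freely homotopic as closed curves: there is a continuous family of closed
curves joining them. -/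
def FreelyHomotopic {X : Type*} [TopologicalSpace X] {x y : X} (p : Path x x) (q : Path y y) :
    Prop :=
  ∃ H : C(I × I, X), (∀ s, H (0, s) = p s) ∧ (∀ s, H (1, s) = q s) ∧ ∀ t, H (t, 0) = H (t, 1)

namespace ReducingTriangulation

variable {D : Type*} (T : ReducingTriangulation D)

/-- The next dart along the triangle to the left of `d`. -/
def face (d : D) : D := T.cw (T.rev d)

/-- The vertices are the orbits of the rotation system. -/
def Vertex : Type _ := Quotient (Equiv.Perm.SameCycle.setoid T.cw)

/-- The source of a dart. -/
def src (d : D) : T.Vertex := Quotient.mk (Equiv.Perm.SameCycle.setoid T.cw) d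

/-- The target of a dart. -/
def tgt (d : D) : T.Vertex := T.src (T.rev d)

/-- The degree of the source of `d`. -/
noncomputable def degree (d : D) : ℕ := Function.minimalPeriod T.cw d

/-! #### The surface -/

/-- The gluing of the triangles. There is one copy of the triangle for each dart `d`, which
represents the face to the left of `d`, with `d` running from corner `0` to corner `1`.
The three copies that represent the same face are identified, and the two faces incident to an
edge are glued along this edge. -/
inductive Glue : (Σ _ : D, Triangle) → (Σ _ : D, Triangle) → Prop
  | same_face (d : D) (x : Triangle) : Glue ⟨d, x⟩ ⟨T.face d, Triangle.rotate x⟩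
  | edge (d : D) (t : I) : Glue ⟨d, Triangle.side t⟩ ⟨T.rev d, Triangle.side (σ t)⟩

/-- The triangulated surface, as a topological space. -/
def Surface : Type _ := Quot T.Glue

instance : TopologicalSpace T.Surface := inferInstanceAs (TopologicalSpace (Quot T.Glue))

/-- The point of the surface with given coordinates in the triangle to the left of `d`. -/
def toSurface (d : D) (x : Triangle) : T.Surface := Quot.mk _ ⟨d, x⟩

theorem continuous_toSurface (d : D) : Continuous (T.toSurface d) :=
  continuous_quot_mk.comp continuous_sigmaMk

theorem toSurface_side_one (d : D) :
    T.toSurface d (Triangle.side 1) = T.toSurface (T.face d) (Triangle.side 0) := by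
  have h := Quot.sound (Glue.same_face (T := T) d (Triangle.side 1))
  rw [Triangle.rotate_side_one] at h
  exact h

theorem toSurface_cw (d : D) :
    T.toSurface (T.cw d) (Triangle.side 0) = T.toSurface d (Triangle.side 0) := by
  have h := Quot.sound (Glue.edge (T := T) d 0)
  have h' := T.toSurface_side_one (T.rev d)
  simp only [unitInterval.symm_zero] at h
  rw [face, T.rev_rev] at h'
  exact h'.symm.trans h.symm

theorem toSurface_zpow_cw (n : ℤ) (d : D) :
    T.toSurface ((T.cw ^ n) d) (Triangle.side 0) = T.toSurface d (Triangle.side 0) := by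
  induction n with
  | zero => simp
  | succ n ih => rw [add_comm, zpow_add, zpow_one, Equiv.Perm.mul_apply, toSurface_cw, ih]
  | pred n ih =>
    rw [← ih, ← T.toSurface_cw ((T.cw ^ (-(n : ℤ) - 1)) d), ← Equiv.Perm.mul_apply,
      ← zpow_one_add]
    congr 3
    ring_nf

/-- The point of the surface at a vertex. -/
def point (v : T.Vertex) : T.Surface :=
  Quotient.lift (s := Equiv.Perm.SameCycle.setoid T.cw)
    (fun d => T.toSurface d (Triangle.side 0))
    (fun a b h => by
      obtain ⟨n, hn⟩ := h
      rw [← hn, toSurface_zpow_cw]) v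

/-- The path on the surface that traverses the dart `d`. -/
def dartPath (d : D) : Path (T.point (T.src d)) (T.point (T.tgt d)) where
  toFun t := T.toSurface d (Triangle.side t)
  continuous_toFun := (T.continuous_toSurface d).comp Triangle.continuous_side
  source' := rfl
  target' := by
    rw [toSurface_side_one]
    exact T.toSurface_cw (T.rev d)

/-! #### Walks -/

/-- The list `l` is the list of darts of a walk from `u` to `v`. -/
def IsWalk : T.Vertex → List D → T.Vertex → Prop
  | u, [], v => u = v
  | u, d :: l, v => u = T.src d ∧ IsWalk (T.tgt d) l v

/-- A walk from `u` to `v`, possibly of length zero. -/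
structure Walk (u v : T.Vertex) where
  darts : List D
  isWalk : T.IsWalk u darts v

/-- The path on the surface that traverses a list of darts. -/
noncomputable def listPath : ∀ (u : T.Vertex) (l : List D) (v : T.Vertex), T.IsWalk u l v →
    Path (T.point u) (T.point v)
  | u, [], _, h => (Path.refl (T.point u)).cast rfl (congrArg T.point h).symm
  | _, d :: l, v, h =>
    ((T.dartPath d).trans (listPath (T.tgt d) l v h.2)).cast (congrArg T.point h.1) rfl

/-- The path on the surface that follows a walk. -/
noncomputable def Walk.path {T : ReducingTriangulation D} {u v : T.Vertex} (W : T.Walk u v) :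
    Path (T.point u) (T.point v) :=
  T.listPath u W.darts v W.isWalk

/-! #### Turns and reduced walks -/

/-- If the source of `e'` is the target of `e`: the number of triangles to the left of the walk
`e, e'`, between `e` and `e'`. -/
noncomputable def leftCount (e e' : D) : ℕ := sInf {k : ℕ | (T.cw)^[k] (T.rev e) = e'}

/-- The integer `k` such that `e, e'` forms a `k`-turn: an integer between `-3` and `3` if
possible, and otherwise the positive one. -/
noncomputable def turn (e e' : D) : ℤ :=
  if T.leftCount e e' ≤ 3 then (T.leftCount e e' : ℤ)
  else if T.degree (T.rev e) ≤ T.leftCount e e' + 3 then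
    (T.leftCount e e' : ℤ) - (T.degree (T.rev e) : ℤ)
  else (T.leftCount e e' : ℤ)

/-- A bad turn: `0`, `1`, `-1`, `2_r` or `-2_r`. -/
def BadTurn (e e' : D) : Prop :=
  T.turn e e' = 0 ∨ T.turn e e' = 1 ∨ T.turn e e' = -1 ∨
    (T.turn e e' = 2 ∧ T.red e = true) ∨ (T.turn e e' = -2 ∧ T.red e = true)

/-- The pairs of consecutive darts of a walk, one for each interior vertex. -/
def corners (l : List D) : List (D × D) := l.zip l.tail

/-- The pairs of cyclically consecutive darts of a closed walk, one for each vertex. -/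
def cyclicCorners (l : List D) : List (D × D) := l.zip (l.rotate 1)

/-- The walk is reduced. -/
def Reduced (l : List D) : Prop := ∀ p ∈ corners l, ¬ T.BadTurn p.1 p.2

/-- The closed walk is reduced: no bad turn, not only `3_r`-turns, and not only `-3_b`-turns.
A closed walk of length zero makes no turn, and is reduced. -/
def ClosedReduced (l : List D) : Prop :=
  (∀ p ∈ cyclicCorners l, ¬ T.BadTurn p.1 p.2) ∧
  (l ≠ [] → ¬ ∀ p ∈ cyclicCorners l, T.turn p.1 p.2 = 3 ∧ T.red p.1 = true) ∧
  (l ≠ [] → ¬ ∀ p ∈ cyclicCorners l, T.turn p.1 p.2 = -3 ∧ T.red p.1 = false)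

open Classical in
/-- Three times the length of the walk plus its number of bad turns. -/
noncomputable def potential (l : List D) : ℕ :=
  3 * l.length + (corners l).countP (fun p => decide (T.BadTurn p.1 p.2))

open Classical in
/-- Three times the length of the closed walk plus its number of bad turns. -/
noncomputable def closedPotential (l : List D) : ℕ :=
  3 * l.length + (cyclicCorners l).countP (fun p => decide (T.BadTurn p.1 p.2))

/-! #### Reduction moves -/

/-- The list of turns of a walk at its interior vertices. -/
noncomputable def turns (l : List D) : List ℤ := (corners l).map fun p => T.turn p.1 p.2

/-- The reversal of a walk. -/
def reversal (l : List D) : List D := (l.map T.rev).reverse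

/-- If the target `v` of `e` has exactly three triangles to its left, this is the side opposite
to `v` of the second of them, directed forward. -/
def push (e : D) : D := T.rev (T.face (T.face (T.rev (T.face e))))

/-- What remains of `leftSide` after its first dart. -/
noncomputable def leftTail : List D → List D
  | [] => []
  | [e] => [T.rev (T.face e)]
  | e :: e' :: l => (if T.turn e e' = 3 then [T.push e] else []) ++ leftTail (e' :: l)

/-- For a walk making only `2`-turns and `3`-turns: the walk with the same endpoints that goes
along the other side of the strip of triangles that are incident, to the left of the walk, to
its edges and its interior vertices. -/
noncomputable def leftSide : List D → List D
  | [] => []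
  | e :: l => T.rev (T.face (T.face e)) :: T.leftTail (e :: l)

/-- The local rule of a reduction move, which replaces the subwalk `s` by `s'`. Here `before`
and `after` are the darts of the walk just before and just after `s` (none if `s` starts or
ends the walk). -/
inductive Replace (before after : Option D) : List D → List D → Prop
  /-- turn `0` -/
  | spur (e e' : D) (h : T.turn e e' = 0) : Replace before after [e, e'] []
  /-- turn `1` -/
  | spike (e e' : D) (h : T.turn e e' = 1) :
      Replace before after [e, e'] [T.rev (T.face (T.face e))]
  /-- turns `2 3^k 2` -/
  | bracket (s : List D) (k : ℕ) (h : T.turns s = 2 :: (List.replicate k 3 ++ [2])) :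
      Replace before after s (T.leftSide s)
  /-- turns `a 3^k 2_r 3^m b` with `a` and `b` not in `{-1, 0, 1, 2, 3}`, where `a` or `b` is
  absent if `s` starts or ends the walk -/
  | flip (s₁ s₂ : List D) (e e' : D) (k m : ℕ)
      (h₁ : T.turns (s₁ ++ [e]) = List.replicate k 3)
      (h : T.turn e e' = 2) (hr : T.red e = true)
      (h₂ : T.turns (e' :: s₂) = List.replicate m 3)
      (ha : ∀ f ∈ before, ∀ g ∈ (s₁ ++ [e]).head?,
        T.turn f g ∉ ({-1, 0, 1, 2, 3} : Set ℤ))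
      (hb : ∀ f ∈ (e' :: s₂).getLast?, ∀ g ∈ after,
        T.turn f g ∉ ({-1, 0, 1, 2, 3} : Set ℤ)) :
      Replace before after (s₁ ++ [e] ++ e' :: s₂) (T.leftSide (s₁ ++ [e] ++ e' :: s₂))

/-- A reduction move on a walk, on the left. -/
def LeftMove (l l' : List D) : Prop :=
  ∃ pre s s' post, l = pre ++ s ++ post ∧ l' = pre ++ s' ++ post ∧
    T.Replace pre.getLast? post.head? s s'

/-- A reduction move (spur, spike, bracket or flip) on a walk or on its reversal. -/
def Move (l l' : List D) : Prop :=
  T.LeftMove l l' ∨ T.LeftMove (T.reversal l) (T.reversal l')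

/-- A reduction move on a closed walk, on the left. A closed walk is seen up to rotation, and
the subwalk `s` that is replaced does not wrap around the closed walk. -/
def ClosedLeftMove (l l' : List D) : Prop :=
  ∃ s s' post, l.IsRotated (s ++ post) ∧ l'.IsRotated (s' ++ post) ∧
    T.Replace (s ++ post).getLast? (post ++ s).head? s s'

/-- A reduction move (spur, spike, bracket or flip) on a closed walk or on its reversal. -/
def ClosedMove (l l' : List D) : Prop :=
  T.ClosedLeftMove l l' ∨ T.ClosedLeftMove (T.reversal l) (T.reversal l')

/-- The cyclic turn sequence of the closed walk has the form `4 3^k 2_r 3^m`. -/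
def LeftHeart (l : List D) : Prop :=
  ∃ (s₁ s₂ : List D) (e e' : D) (k m : ℕ), l.IsRotated (s₁ ++ [e] ++ e' :: s₂) ∧
    T.turns (s₁ ++ [e]) = List.replicate k 3 ∧ T.turn e e' = 2 ∧ T.red e = true ∧
    T.turns (e' :: s₂) = List.replicate m 3 ∧
    ∀ f ∈ (e' :: s₂).getLast?, ∀ g ∈ (s₁ ++ [e]).head?, T.turn f g = 4

/-- The cyclic turn sequence of the closed walk, or of its reversal, has the form
`4 3^k 2_r 3^m`. -/
def Heart (l : List D) : Prop := T.LeftHeart l ∨ T.LeftHeart (T.reversal l)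

/-- All the turns of the closed walk `l` are `3_r`-turns, and `l'` is obtained by pushing `l`
to its left, across the triangles that are incident to it on its left. -/
def LeftFinalMove (l l' : List D) : Prop :=
  l ≠ [] ∧ (∀ p ∈ cyclicCorners l, T.turn p.1 p.2 = 3 ∧ T.red p.1 = true) ∧
    l'.IsRotated (l.map T.push)

/-- The final move, on a closed walk making only `3_r`-turns or on the reversal of such a
closed walk. -/
def FinalMove (l l' : List D) : Prop :=
  T.LeftFinalMove l l' ∨ T.LeftFinalMove (T.reversal l) (T.reversal l')

end ReducingTriangulation

/-!
### The machine model

A random access machine on integers, programmed in a language with assignments, conditionals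
and loops, and with unit-cost elementary operations (addition, subtraction, comparison, and
direct or indirect memory access). A program uses finitely many registers and arrays.
-/

namespace RAM

/-- A memory: the content of the registers, and of the cells of the arrays. -/
structure Memory where
  reg : ℕ → ℤ
  arr : ℕ → ℤ → ℤ

/-- Write in a register. -/
def Memory.setReg (s : Memory) (x : ℕ) (v : ℤ) : Memory :=
  { s with reg := Function.update s.reg x v }

/-- Write in a cell of an array. -/
def Memory.setArr (s : Memory) (a : ℕ) (i v : ℤ) : Memory :=
  { s with arr := Function.update s.arr a (Function.update (s.arr a) i v) }

/-- Expressions. -/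
inductive Term : Type
  | const (k : ℤ)
  | reg (x : ℕ)
  | read (a : ℕ) (i : Term)
  | add (e f : Term)
  | sub (e f : Term)
  | lt (e f : Term)
  | eq (e f : Term)

/-- The value of an expression; comparisons have value `1` or `0`. -/
def Term.eval (s : Memory) : Term → ℤ
  | .const k => k
  | .reg x => s.reg x
  | .read a i => s.arr a (i.eval s)
  | .add e f => e.eval s + f.eval s
  | .sub e f => e.eval s - f.eval s
  | .lt e f => if e.eval s < f.eval s then 1 else 0
  | .eq e f => if e.eval s = f.eval s then 1 else 0

/-- The number of elementary operations in the evaluation of an expression. -/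
def Term.cost : Term → ℕ
  | .const _ => 1
  | .reg _ => 1
  | .read _ i => i.cost + 1
  | .add e f => e.cost + f.cost + 1
  | .sub e f => e.cost + f.cost + 1
  | .lt e f => e.cost + f.cost + 1
  | .eq e f => e.cost + f.cost + 1

/-- Programs. -/
inductive Program : Type
  | skip
  | assign (x : ℕ) (e : Term)
  | write (a : ℕ) (i e : Term)
  | seq (p q : Program)
  | ite (b : Term) (p q : Program)
  | while (b : Term) (p : Program)

/-- `Run p s s' t`: started on the memory `s`, the program `p` halts after `t` steps with the
memory `s'`. Tests succeed when their value is not `0`. -/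
inductive Run : Program → Memory → Memory → ℕ → Prop
  | skip (s : Memory) : Run .skip s s 1
  | assign (s : Memory) (x : ℕ) (e : Term) :
      Run (.assign x e) s (s.setReg x (e.eval s)) (e.cost + 1)
  | write (s : Memory) (a : ℕ) (i e : Term) :
      Run (.write a i e) s (s.setArr a (i.eval s) (e.eval s)) (i.cost + e.cost + 1)
  | seq {p q : Program} {s s' s'' : Memory} {t t' : ℕ} :
      Run p s s' t → Run q s' s'' t' → Run (.seq p q) s s'' (t + t' + 1)
  | ite_true {b : Term} {p q : Program} {s s' : Memory} {t : ℕ} :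
      b.eval s ≠ 0 → Run p s s' t → Run (.ite b p q) s s' (b.cost + t + 1)
  | ite_false {b : Term} {p q : Program} {s s' : Memory} {t : ℕ} :
      b.eval s = 0 → Run q s s' t → Run (.ite b p q) s s' (b.cost + t + 1)
  | while_true {b : Term} {p : Program} {s s' s'' : Memory} {t t' : ℕ} :
      b.eval s ≠ 0 → Run p s s' t → Run (.while b p) s' s'' t' →
        Run (.while b p) s s'' (b.cost + t + t' + 1)
  | while_false {b : Term} {p : Program} {s : Memory} :
      b.eval s = 0 → Run (.while b p) s s (b.cost + 1)

end RAM

/-- The memory `s` contains the reducing triangulation `T`, where the dart `d` is represented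
by the pointer `dn d` and the vertex `v` by the pointer `vn v`:
* array `0` contains the reversal of each dart, and array `1` its source;
* the darts with a given source `v` are numbered `0, 1, 2, …` in clockwise order, starting at
  an arbitrary one, and array `2` contains the number of each dart;
* array `3` contains the colour of the triangle to the left of each dart;
* array `4` contains the degree of each vertex;
* array `5` contains, for each vertex, the address in array `6` of a table of the darts with
  this source, indexed by their numbers. -/
structure ReducingTriangulation.StoredIn {D : Type*} (T : ReducingTriangulation D)
    (dn : D → ℤ) (vn : T.Vertex → ℤ) (s : RAM.Memory) : Prop where
  dn_injective : Function.Injective dn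
  vn_injective : Function.Injective vn
  rev : ∀ d, s.arr 0 (dn d) = dn (T.rev d)
  src : ∀ d, s.arr 1 (dn d) = vn (T.src d)
  number_nonneg : ∀ d, 0 ≤ s.arr 2 (dn d)
  number_lt : ∀ d, s.arr 2 (dn d) < T.degree d
  number_cw : ∀ d, s.arr 2 (dn (T.cw d)) = (s.arr 2 (dn d) + 1) % (T.degree d : ℤ)
  colour : ∀ d, s.arr 3 (dn d) = if T.red d = true then 1 else 0
  degree : ∀ d, s.arr 4 (vn (T.src d)) = T.degree d
  table : ∀ d, s.arr 6 (s.arr 5 (vn (T.src d)) + s.arr 2 (dn d)) = dn d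

/-- The memory `s` contains the walk of `T` that starts at the vertex `u` and traverses the list
of darts `l`: register `0` contains its length, register `1` its first vertex, and the first
cells of the array `a` contain its darts. -/
def ReducingTriangulation.WalkIn {D : Type*} (T : ReducingTriangulation D)
    (dn : D → ℤ) (vn : T.Vertex → ℤ) (a : ℕ) (u : T.Vertex) (l : List D) (s : RAM.Memory) :
    Prop :=
  s.reg 0 = l.length ∧ s.reg 1 = vn u ∧
    ∀ (i : ℕ) (h : i < l.length), s.arr a (i : ℤ) = dn l[i]

/-! A walk is determined by its first dart and by the rotations made at its vertices (`path`,
`rot`), so that moves become arithmetic on lists of integers. Two facts drive everything. Degrees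
are at least eight, so rotations between `-3` and `4` are genuine turns (`turn_rot_small`). Colours
alternate around each vertex and across each edge, so along a walk the colour on the left is kept by
turns `3` and `-3` and changed by turns `2` and `-2`.

Termination. The other side of the strip of `2 3^k 2` makes `k + 1` turns `-3` and has one edge
less. Spurs and spikes also shorten the walk. An edge counts three, the replaced part contains a bad
turn, and at most two bad turns can appear at its ends, so the potential falls. A flip keeps the
length, but the red `2` disappears, the new interior turns are not bad because the colours are right
(`clean_flip`), and the end turns `a` and `b` become `a - 1` and `b - 1`, which are not bad. If the
flip uses the whole closed walk, then `a` and `b` are the same turn and it becomes `a - 2`: for `a =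
4` a new `2` may appear and the potential may stay the same. After such a flip there is no turn `3`
and no other `2`, and the only bad turn is that `2`. The only move that may be left is a flip, which
removes the last bad turn (`AfterHeart`). Hence at most one move of a sequence does not decrease the
potential, and then it is the last or the last but one (`length_closed_chain_le`).

Homotopy. Each edge of a strip is replaced by the two other sides of its left triangle. At a `2` the
inner edges cancel, and at a `3` they are pushed across the middle triangle (`listHom_strip`). Moves
on the right are moves on the left in the mirror image (`Shape.of_mirror`), so a sign `ε` treats
both sides at once.

Linear time. A walk is made cyclic by inserting a gap between its end and its start. A maximal
sequence of turns `3`, or of turns `-3`, can be stored as one cell, so a bracket or a flip of any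
length only touches boundedly many cells. Whether a strip ends at a given cell is seen from the four
cells before it (`Pass`). The cells sit in a double-ended queue. A cell that passes the test goes
from the front to the back, and a counter `u` bounds the number of cells still to be tested. A
change of the queue adds `16` to `u` (`Verified.modify`), which is paid by the number of remaining
moves or by the number of cells. The resulting `measure` decreases at each step and is linear at the
start.

When `u = 0`, every cell passes. The test only detects strips that end at the tested cell, so it has
to be shown that no red `2` or `-2` survives. Around such a turn, the tests of the cells on both
sides force a ring of one or two cells (`Verified.eq_of_red_two`), and these rings are excluded by
the colours or by the degrees (`Verified.no_red_two`). A closed walk with all turns `3` is then a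
single cell, so the final move takes constant time before the output.

Finally a step is a program without loops in a small language on cells, with a weakest precondition
`wp` and a translation to the machine that is proved correct once (`sim`). The running time is the
number of steps times a constant, plus the time of the input and output loops. -/

namespace ReducingTriangulation

variable {D : Type*} (T : ReducingTriangulation D)

/-! ### Rotations around a vertex -/

/-- The dart reached from `d` by `j` clockwise rotations around its source. -/
def rot (j : ℤ) (d : D) : D := (T.cw ^ j) d

@[simp] theorem rot_zero (d : D) : T.rot 0 d = d := by simp [rot]

@[simp] theorem rot_rot (i j : ℤ) (d : D) : T.rot i (T.rot j d) = T.rot (i + j) d := by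
  simp [rot, zpow_add]

theorem cw_eq_rot (d : D) : T.cw d = T.rot 1 d := by simp [rot]

@[simp] theorem rev_rev' (d : D) : T.rev (T.rev d) = d := T.rev_rev d

theorem rev_injective : Function.Injective T.rev := fun a b h => by
  rw [← T.rev_rev a, h, T.rev_rev]

/-- A face has three sides, so `rev` followed by `rot 1` has order three. This form of the relation
moves a reversal past a rotation by one, and all identities between the darts of a strip come from
it. -/
theorem rev_rot_rev (x : D) : T.rev (T.rot 1 (T.rev x)) = T.rot (-1) (T.rev (T.rot (-1) x)) := by
  have h := T.face_face_face (T.rev (T.rot (-1) x))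
  simp only [cw_eq_rot, rev_rev', rot_rot] at h
  norm_num at h
  rw [← h]
  simp

theorem rev_rot_neg_rev (x : D) :
    T.rev (T.rot (-1) (T.rev x)) = T.rot 1 (T.rev (T.rot 1 x)) := by
  have h := T.rev_rot_rev (T.rot 1 x)
  simp only [rot_rot] at h
  norm_num at h
  rw [← h]
  simp

theorem red_cw (d : D) : T.red (T.cw d) = !T.red d := by
  have h := T.red_face (T.rev d)
  rw [T.rev_rev, T.red_rev] at h
  exact h

theorem red_rot_one (d : D) : T.red (T.rot 1 d) = !T.red d := by
  rw [← cw_eq_rot, red_cw]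

theorem red_rot_neg_one (d : D) : T.red (T.rot (-1) d) = !T.red d := by
  have h := T.red_rot_one (T.rot (-1) d)
  rw [rot_rot] at h
  norm_num at h
  rw [h]; simp

theorem red_rot_add_one (j : ℤ) (d : D) : T.red (T.rot (j + 1) d) = !T.red (T.rot j d) := by
  rw [← red_rot_one, rot_rot, add_comm]

theorem red_rot_two (d : D) : T.red (T.rot 2 d) = T.red d := by
  have := T.red_rot_add_one 1 d
  norm_num at this
  rw [this, red_rot_one]; simp

theorem red_rot_neg_two (d : D) : T.red (T.rot (-2) d) = T.red d := by
  have := T.red_rot_two (T.rot (-2) d)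
  rw [rot_rot] at this
  norm_num at this
  exact this.symm

theorem red_rot_three (d : D) : T.red (T.rot 3 d) = !T.red d := by
  have := T.red_rot_add_one 2 d
  norm_num at this
  rw [this, red_rot_two]

theorem red_rot_neg_three (d : D) : T.red (T.rot (-3) d) = !T.red d := by
  have := T.red_rot_three (T.rot (-3) d)
  rw [rot_rot] at this
  norm_num at this
  rw [this]; simp

theorem rot_eq_self_iff (i : ℤ) (d : D) : T.rot i d = d ↔ (T.degree d : ℤ) ∣ i := by
  have := MulAction.zpow_smul_eq_iff_minimalPeriod_dvd (a := T.cw) (b := d) (n := i)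
  exact this

theorem rot_eq_rot_iff (i j : ℤ) (d : D) :
    T.rot i d = T.rot j d ↔ (T.degree d : ℤ) ∣ i - j := by
  rw [← rot_eq_self_iff]
  constructor
  · intro h
    have := congrArg (T.rot (-j)) h
    simp only [rot_rot] at this
    rw [show -j + j = (0 : ℤ) by ring, rot_zero] at this
    rw [show i - j = -j + i by ring, this]
  · intro h
    have := congrArg (T.rot j) h
    simp only [rot_rot] at this
    rw [← this]; congr 1; ring

theorem rot_injective (j : ℤ) : Function.Injective (T.rot j) := (T.cw ^ j).injective

theorem degree_rot (j : ℤ) (d : D) : T.degree (T.rot j d) = T.degree d := by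
  have key : ∀ i : ℤ, T.rot i (T.rot j d) = T.rot j d ↔ T.rot i d = d := by
    intro i
    rw [rot_rot, add_comm, ← rot_rot]
    exact (T.rot_injective j).eq_iff
  apply Nat.dvd_antisymm
  · have := (T.rot_eq_self_iff (T.degree d) (T.rot j d)).1
      ((key _).2 ((T.rot_eq_self_iff _ d).2 dvd_rfl))
    exact_mod_cast this
  · have := (T.rot_eq_self_iff (T.degree (T.rot j d)) d).1
      ((key _).1 ((T.rot_eq_self_iff _ _).2 dvd_rfl))
    exact_mod_cast this

theorem eight_le (d : D) : 8 ≤ T.degree d := T.eight_le_degree d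

/-! ### Corners of walks -/

/-- The dart `e'` starts where `e` ends. -/
def Adj (e e' : D) : Prop := ∃ j : ℤ, T.rot j (T.rev e) = e'

theorem tgt_eq_src_iff {e e' : D} : T.tgt e = T.src e' ↔ T.Adj e e' := Quotient.eq

theorem src_eq_iff {e e' : D} : T.src e = T.src e' ↔ ∃ j : ℤ, T.rot j e = e' := Quotient.eq

theorem src_rot (j : ℤ) (e : D) : T.src (T.rot j e) = T.src e :=
  (T.src_eq_iff.2 ⟨j, rfl⟩).symm

theorem adj_rot (j : ℤ) (e : D) : T.Adj e (T.rot j (T.rev e)) := ⟨j, rfl⟩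

theorem Adj.rev_rev {T : ReducingTriangulation D} {e e' : D} (h : T.Adj e e') :
    T.Adj (T.rev e') (T.rev e) := by
  obtain ⟨j, rfl⟩ := h
  exact ⟨-j, by simp⟩

theorem leftCount_rot (e : D) (j : ℤ) :
    (T.leftCount e (T.rot j (T.rev e)) : ℤ) = j % (T.degree (T.rev e) : ℤ) := by
  have hn : (0 : ℤ) < T.degree (T.rev e) := by have := T.eight_le (T.rev e); omega
  have h0 := Int.emod_nonneg j hn.ne'
  have hmem : ∀ k : ℕ, (T.cw)^[k] (T.rev e) = T.rot j (T.rev e) ↔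
      (T.degree (T.rev e) : ℤ) ∣ (k : ℤ) - j := by
    intro k
    rw [← rot_eq_rot_iff]
    simp [rot, Equiv.Perm.iterate_eq_pow]
  have hdiv := Int.mul_ediv_add_emod j (T.degree (T.rev e) : ℤ)
  have : T.leftCount e (T.rot j (T.rev e)) = (j % (T.degree (T.rev e) : ℤ)).toNat := by
    have hj : (j % (T.degree (T.rev e) : ℤ)).toNat ∈
        {k : ℕ | (T.cw)^[k] (T.rev e) = T.rot j (T.rev e)} := by
      rw [Set.mem_ofPred_eq, hmem, Int.toNat_of_nonneg h0]
      exact ⟨-(j / (T.degree (T.rev e) : ℤ)), by linarith⟩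
    apply le_antisymm (Nat.sInf_le hj)
    apply le_csInf ⟨_, hj⟩
    intro k hk
    rw [Set.mem_ofPred_eq, hmem] at hk
    have h2 : (k : ℤ) % (T.degree (T.rev e) : ℤ) = j % (T.degree (T.rev e) : ℤ) :=
      Int.emod_eq_emod_iff_emod_sub_eq_zero.2 (Int.emod_eq_zero_of_dvd hk)
    rw [← h2]
    have h3 : ((k % T.degree (T.rev e) : ℕ) : ℤ) ≤ k := by
      exact_mod_cast Nat.mod_le k _
    push_cast at h3
    omega
  rw [this, Int.toNat_of_nonneg h0]

theorem turn_rot (e : D) (j : ℤ) :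
    T.turn e (T.rot j (T.rev e)) =
      if j % (T.degree (T.rev e) : ℤ) ≤ 3 then j % (T.degree (T.rev e) : ℤ)
      else if (T.degree (T.rev e) : ℤ) ≤ j % (T.degree (T.rev e) : ℤ) + 3 then
        j % (T.degree (T.rev e) : ℤ) - (T.degree (T.rev e) : ℤ)
      else j % (T.degree (T.rev e) : ℤ) := by
  rw [turn, ← leftCount_rot]
  norm_cast

theorem turn_rot_of_nonneg {e : D} {j : ℤ} (h0 : 0 ≤ j) (h : j + 4 ≤ T.degree (T.rev e)) :
    T.turn e (T.rot j (T.rev e)) = j := by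
  have := T.eight_le (T.rev e)
  rw [turn_rot, Int.emod_eq_of_lt h0 (by omega)]
  split_ifs <;> omega

theorem turn_rot_of_neg {e : D} {j : ℤ} (h0 : -3 ≤ j) (h : j < 0) :
    T.turn e (T.rot j (T.rev e)) = j := by
  have := T.eight_le (T.rev e)
  have h2 : j % (T.degree (T.rev e) : ℤ) = j + T.degree (T.rev e) := by
    rw [← Int.add_emod_right, Int.emod_eq_of_lt] <;> omega
  rw [turn_rot, h2]
  split_ifs <;> omega

/-- Turns range from `-3` to the degree minus four. Since the degree is at least eight, this window
contains all integers from `-3` to `4`. -/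
theorem turn_rot_small {e : D} {j : ℤ} (h0 : -3 ≤ j) (h : j ≤ 4) :
    T.turn e (T.rot j (T.rev e)) = j := by
  have := T.eight_le (T.rev e)
  rcases lt_or_ge j 0 with h1 | h1
  · exact T.turn_rot_of_neg h0 h1
  · exact T.turn_rot_of_nonneg h1 (by omega)

/-- Every corner is a rotation by its turn. -/
theorem Adj.eq_rot_turn {T : ReducingTriangulation D} {e e' : D} (h : T.Adj e e') :
    e' = T.rot (T.turn e e') (T.rev e) := by
  obtain ⟨j, rfl⟩ := h
  rw [rot_eq_rot_iff, turn_rot]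
  have h1 := Int.mul_ediv_add_emod j (T.degree (T.rev e) : ℤ)
  set n := (T.degree (T.rev e) : ℤ)
  split_ifs
  · exact ⟨j / n, by linarith⟩
  · exact ⟨j / n + 1, by linarith⟩
  · exact ⟨j / n, by linarith⟩

theorem turn_range {e e' : D} (h : T.Adj e e') :
    -3 ≤ T.turn e e' ∧ T.turn e e' + 4 ≤ T.degree (T.rev e) := by
  obtain ⟨j, rfl⟩ := h
  have h8 := T.eight_le (T.rev e)
  have hp : (0 : ℤ) < T.degree (T.rev e) := by omega
  rw [turn_rot]
  have h1 := Int.emod_nonneg j hp.ne'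
  have h2 := Int.emod_lt_of_pos j hp
  split_ifs <;> omega

theorem turn_eq_iff {e e' : D} (h : T.Adj e e') {j : ℤ} (h0 : -3 ≤ j) (h4 : j ≤ 4) :
    T.turn e e' = j ↔ e' = T.rot j (T.rev e) := by
  constructor
  · intro hj
    rw [← hj]; exact h.eq_rot_turn
  · rintro rfl
    exact T.turn_rot_small h0 h4

/-- For darts that do not meet, `leftCount` is the infimum of an empty set, which is `0`. A nonzero
turn therefore certifies that the darts are consecutive. -/
theorem adj_of_turn {e e' : D} (h : T.turn e e' ≠ 0) : T.Adj e e' := by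
  by_contra hn
  apply h
  have : T.leftCount e e' = 0 := by
    rw [leftCount, Nat.sInf_eq_zero]
    right
    ext k
    simp only [Set.mem_ofPred_eq, Set.mem_empty_iff_false, iff_false]
    intro hk
    exact hn ⟨k, by simpa [rot, Equiv.Perm.iterate_eq_pow] using hk⟩
  simp [turn, this]

theorem eq_rot_of_turn {e e' : D} {j : ℤ} (h : T.turn e e' = j) (hj : j ≠ 0) :
    e' = T.rot j (T.rev e) := by
  have := (T.adj_of_turn (by rw [h]; exact hj)).eq_rot_turn
  rwa [h] at this

theorem eq_rot_swap {e e' : D} {j : ℤ} :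
    T.rev e = T.rot (-j) (T.rev (T.rev e')) ↔ e' = T.rot j (T.rev e) := by
  constructor
  · intro h; rw [h]; simp
  · rintro rfl; simp

/-- The range stops at `3` because a reversed turn `4` is again recorded by a positive integer,
which depends on the degree. -/
theorem turn_rev_rev_small {e e' : D} (h : T.Adj e e') {j : ℤ} (h0 : -3 ≤ j) (h4 : j ≤ 3) :
    T.turn (T.rev e') (T.rev e) = -j ↔ T.turn e e' = j := by
  rw [T.turn_eq_iff h h0 (by omega), T.turn_eq_iff h.rev_rev (by omega) (by omega), eq_rot_swap]

/-- Reversal negates the turn. For a turn `2` or `-2`, an even rotation keeps the colour, so the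
triangle to the left of `rev e'` has the colour of the triangle to the left of `e`, and a red turn
stays red. -/
theorem badTurn_rev_rev {e e' : D} (h : T.Adj e e') :
    T.BadTurn (T.rev e') (T.rev e) ↔ T.BadTurn e e' := by
  have hc : ∀ j : ℤ, (j = 2 ∨ j = -2) → T.turn e e' = j → T.red (T.rev e') = T.red e := by
    intro j hj ht
    have := T.eq_rot_of_turn ht (by omega)
    rw [this, T.red_rev]
    rcases hj with rfl | rfl
    · rw [red_rot_two, T.red_rev]; simp
    · rw [red_rot_neg_two, T.red_rev]; simp
  have e0 := T.turn_rev_rev_small h (j := 0) (by norm_num) (by norm_num)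
  have e1 := T.turn_rev_rev_small h (j := 1) (by norm_num) (by norm_num)
  have e2 := T.turn_rev_rev_small h (j := -1) (by norm_num) (by norm_num)
  have e3 := T.turn_rev_rev_small h (j := 2) (by norm_num) (by norm_num)
  have e4 := T.turn_rev_rev_small h (j := -2) (by norm_num) (by norm_num)
  norm_num at e0 e2 e4
  have hc2 := hc 2 (by simp)
  have hc3 := hc (-2) (by simp)
  unfold BadTurn
  rw [e0, e1, e2, e3, e4]
  constructor
  · rintro (h | h | h | ⟨h, h'⟩ | ⟨h, h'⟩)
    · simp [h]
    · simp [h]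
    · simp [h]
    · rw [hc3 h] at h'; simp [h, h']
    · rw [hc2 h] at h'; simp [h, h']
  · rintro (h | h | h | ⟨h, h'⟩ | ⟨h, h'⟩)
    · simp [h]
    · simp [h]
    · simp [h]
    · rw [← hc2 h] at h'; simp [h, h']
    · rw [← hc3 h] at h'; simp [h, h']

/-- A rotation by at least three triangles on each side is not bad. -/
theorem not_badTurn_rot {e : D} {j : ℤ} (h3 : 3 ≤ j) (h : j + 3 ≤ T.degree (T.rev e)) :
    ¬ T.BadTurn e (T.rot j (T.rev e)) := by
  have h8 := T.eight_le (T.rev e)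
  have : T.turn e (T.rot j (T.rev e)) = j ∨ T.turn e (T.rot j (T.rev e)) = -3 := by
    rw [turn_rot, Int.emod_eq_of_lt (by omega) (by omega)]
    split_ifs <;> omega
  rintro (h | h | h | ⟨h, -⟩ | ⟨h, -⟩) <;> omega

end ReducingTriangulation

namespace ReducingTriangulation

/-! ### Corners of lists -/

section corners

variable {α : Type*}

@[simp] theorem corners_nil : corners ([] : List α) = [] := rfl

@[simp] theorem corners_singleton (a : α) : corners [a] = [] := rfl

@[simp] theorem corners_cons_cons (a b : α) (l : List α) :
    corners (a :: b :: l) = (a, b) :: corners (b :: l) := rfl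

theorem corners_append_cons (l : List α) (x : α) (l' : List α) :
    corners (l ++ x :: l') = corners (l ++ [x]) ++ corners (x :: l') := by
  induction l with
  | nil => simp
  | cons a l ih => cases l with
    | nil => simp
    | cons b l => simpa using ih

theorem zip_tail_append (a x : α) (l : List α) :
    (a :: l).zip (l ++ [x]) = corners (a :: l ++ [x]) := by
  induction l generalizing a with
  | nil => rfl
  | cons b l ih =>
    simp only [List.cons_append, corners_cons_cons, List.zip_cons_cons]
    rw [ih b]; rfl

/-- Repeating the first dart at the end reduces statements on closed walks to statements on walks.
-/
theorem cyclicCorners_cons (a : α) (l : List α) :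
    cyclicCorners (a :: l) = corners (a :: l ++ [a]) := by
  rw [cyclicCorners, List.rotate_cons_succ, List.rotate_zero, zip_tail_append]

@[simp] theorem cyclicCorners_nil : cyclicCorners ([] : List α) = [] := rfl

theorem cyclicCorners_rotate (l : List α) (n : ℕ) :
    cyclicCorners (l.rotate n) = (cyclicCorners l).rotate n := by
  unfold cyclicCorners
  rw [List.rotate_rotate, Nat.add_comm n 1, ← List.rotate_rotate]
  exact (List.zipWith_rotate_distrib _ _ _ _ (by simp)).symm

theorem mem_cyclicCorners_of_isRotated {l l' : List α} (h : l.IsRotated l') (p : α × α) :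
    p ∈ cyclicCorners l ↔ p ∈ cyclicCorners l' := by
  obtain ⟨n, rfl⟩ := h
  rw [cyclicCorners_rotate, List.mem_rotate]

theorem isRotated_append_comm (l l' : List α) : (l ++ l').IsRotated (l' ++ l) :=
  List.isRotated_append

end corners

variable {D : Type*} (T : ReducingTriangulation D)

/-! ### Paths with given rotations -/

/-- The list of darts starting with `d`, and rotating by the given numbers. -/
def path (d : D) : List ℤ → List D
  | [] => [d]
  | j :: js => d :: path (T.rot j (T.rev d)) js

/-- The last dart of `T.path d js`. -/
def pathLast (d : D) : List ℤ → D
  | [] => d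
  | j :: js => pathLast (T.rot j (T.rev d)) js

@[simp] theorem path_nil (d : D) : T.path d [] = [d] := rfl

@[simp] theorem path_cons (d : D) (j : ℤ) (js : List ℤ) :
    T.path d (j :: js) = d :: T.path (T.rot j (T.rev d)) js := rfl

@[simp] theorem pathLast_nil (d : D) : T.pathLast d [] = d := rfl

@[simp] theorem pathLast_cons (d : D) (j : ℤ) (js : List ℤ) :
    T.pathLast d (j :: js) = T.pathLast (T.rot j (T.rev d)) js := rfl

theorem pathLast_append (d : D) (js js' : List ℤ) :
    T.pathLast d (js ++ js') = T.pathLast (T.pathLast d js) js' := by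
  induction js generalizing d with
  | nil => rfl
  | cons j js ih => simp [ih]

theorem path_append_cons (d : D) (js : List ℤ) (j : ℤ) (js' : List ℤ) :
    T.path d (js ++ j :: js') =
      T.path d js ++ T.path (T.rot j (T.rev (T.pathLast d js))) js' := by
  induction js generalizing d with
  | nil => rfl
  | cons j js ih => simp [ih]

theorem path_eq_cons (d : D) (js : List ℤ) : ∃ l, T.path d js = d :: l := by
  cases js <;> simp

theorem path_eq_concat (d : D) (js : List ℤ) : ∃ l, T.path d js = l ++ [T.pathLast d js] := by
  induction js generalizing d with
  | nil => exact ⟨[], rfl⟩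
  | cons j js ih =>
    obtain ⟨l, hl⟩ := ih (T.rot j (T.rev d))
    exact ⟨d :: l, by simp [hl]⟩

@[simp] theorem path_ne_nil (d : D) (js : List ℤ) : T.path d js ≠ [] := by
  cases js <;> simp

@[simp] theorem length_path (d : D) (js : List ℤ) : (T.path d js).length = js.length + 1 := by
  induction js generalizing d with
  | nil => rfl
  | cons j js ih => simp [ih]

@[simp] theorem head?_path (d : D) (js : List ℤ) : (T.path d js).head? = some d := by
  cases js <;> simp

@[simp] theorem getLast?_path (d : D) (js : List ℤ) :
    (T.path d js).getLast? = some (T.pathLast d js) := by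
  obtain ⟨l, hl⟩ := T.path_eq_concat d js
  rw [hl]; simp

theorem turns_cons_cons (a b : D) (l : List D) :
    T.turns (a :: b :: l) = T.turn a b :: T.turns (b :: l) := rfl

@[simp] theorem turns_singleton (a : D) : T.turns [a] = [] := rfl

@[simp] theorem turns_nil : T.turns [] = [] := rfl

theorem turns_path (d : D) (js : List ℤ) (h : ∀ j ∈ js, -3 ≤ j ∧ j ≤ 4) :
    T.turns (T.path d js) = js := by
  induction js generalizing d with
  | nil => rfl
  | cons j js ih =>
    have ih' := ih (T.rot j (T.rev d)) fun i hi => h i (by simp [hi])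
    obtain ⟨l, hl⟩ := T.path_eq_cons (T.rot j (T.rev d)) js
    have hj := h j (by simp)
    rw [path_cons, hl, turns_cons_cons, ← hl, ih', T.turn_rot_small hj.1 hj.2]

/-- A nonzero turn determines the next dart. The turn `0` has to be excluded because it is also the
value for darts that do not meet. -/
theorem eq_path_of_turns {d : D} {l : List D} {js : List ℤ} (h : T.turns (d :: l) = js)
    (h0 : ∀ j ∈ js, j ≠ 0) : d :: l = T.path d js := by
  induction l generalizing d js with
  | nil =>
    simp at h; subst h; rfl
  | cons e l ih =>
    rw [turns_cons_cons] at h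
    subst h
    have h1 := T.eq_rot_of_turn rfl (h0 (T.turn d e) (by simp))
    rw [path_cons, ← h1]
    exact congrArg _ (ih rfl fun j hj => h0 j (by simp [hj]))

theorem pathLast_eq_of_path_eq {d e : D} {js : List ℤ} {l : List D}
    (h : T.path d js = l ++ [e]) : T.pathLast d js = e := by
  have := T.getLast?_path d js
  rw [h] at this
  simpa using this.symm

theorem red_rot_rev_three (d : D) : T.red (T.rot 3 (T.rev d)) = T.red d := by
  rw [red_rot_three, red_rev]; simp

theorem red_rot_rev_two (d : D) : T.red (T.rot 2 (T.rev d)) = !T.red d := by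
  rw [red_rot_two, red_rev]

theorem red_pathLast_three (d : D) (k : ℕ) :
    T.red (T.pathLast d (List.replicate k 3)) = T.red d := by
  induction k generalizing d with
  | zero => rfl
  | succ k ih => rw [List.replicate_succ, pathLast_cons, ih, red_rot_rev_three]

theorem red_rot_rev_neg_three (d : D) : T.red (T.rot (-3) (T.rev d)) = T.red d := by
  rw [red_rot_neg_three, red_rev]; simp

theorem red_pathLast_neg_three (d : D) (k : ℕ) :
    T.red (T.pathLast d (List.replicate k (-3))) = T.red d := by
  induction k generalizing d with
  | zero => rfl
  | succ k ih => rw [List.replicate_succ, pathLast_cons, ih, red_rot_rev_neg_three]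

/-! ### The other side of a strip -/

/-- The number of triangles of the strip at the first apex, for given turns. -/
def apexCount : List ℤ → ℤ
  | [] => 1
  | j :: js => if j = 3 then 2 else apexCount js + 1

/-- The rotations of `leftTail`, for given turns. -/
def tailTurns : List ℤ → List ℤ
  | [] => []
  | j :: js => if j = 3 then -(apexCount js + 1) :: tailTurns js else tailTurns js

theorem push_eq (e : D) : T.push e = T.rot (-2) (T.rev (T.rot (-1) e)) := by
  have h := T.rev_rot_rev (T.rot 1 (T.rev (T.rev (T.rot 1 (T.rev e)))))
  simp only [push, face, cw_eq_rot, rev_rev', rot_rot] at h ⊢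
  norm_num at h ⊢
  rw [h, rev_rot_rev]
  simp

theorem rev_face_eq (e : D) : T.rev (T.face e) = T.rot (-1) (T.rev (T.rot (-1) e)) := by
  rw [face, cw_eq_rot, rev_rot_rev]

theorem rev_face_face_eq (e : D) : T.rev (T.face (T.face e)) = T.rot (-1) e := by
  have h := T.rev_rot_rev (T.rot 1 (T.rev e))
  simp only [face, cw_eq_rot, rot_rot] at h ⊢
  norm_num at h
  exact h

/-- At a `2` the left triangles of the two edges share their apex, so the count at this apex goes
on. At a `3` the middle triangle contributes a new outer edge, which separates two apexes and
belongs to the count of both. -/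
theorem leftTail_path (e : D) (js : List ℤ) (h : ∀ j ∈ js, j = 2 ∨ j = 3) :
    T.leftTail (T.path e js) =
      T.path (T.rot (-apexCount js) (T.rev (T.rot (-1) e))) (tailTurns js) := by
  induction js generalizing e with
  | nil => simp [leftTail, rev_face_eq, apexCount, tailTurns]
  | cons j js ih =>
    obtain ⟨l, hl⟩ := T.path_eq_cons (T.rot j (T.rev e)) js
    have ih' := ih (T.rot j (T.rev e)) fun i hi => h i (by simp [hi])
    rw [hl] at ih'
    rcases h j (by simp) with rfl | rfl
    · have h2 := T.turn_rot_small (e := e) (j := 2) (by norm_num) (by norm_num)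
      rw [path_cons, hl]
      simp only [leftTail, h2, ih', apexCount, tailTurns]
      norm_num
      congr 1
      have := T.rev_rot_rev e
      rw [this, rot_rot]
      congr 1; ring
    · have h2 := T.turn_rot_small (e := e) (j := 3) (by norm_num) (by norm_num)
      rw [path_cons, hl]
      simp only [leftTail, h2, ih', apexCount, tailTurns, push_eq]
      norm_num
      congr 1
      have h5 := T.rev_rot_rev (T.rev (T.rot 1 (T.rev e)))
      have h6 := T.rev_rot_rev e
      rw [rev_rev', rot_rot, h6, rot_rot] at h5
      norm_num at h5
      rw [h5, rot_rot]
      congr 1; ring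

theorem leftSide_path (e : D) (js : List ℤ) (h : ∀ j ∈ js, j = 2 ∨ j = 3) :
    T.leftSide (T.path e js) = T.path (T.rot (-1) e) (-apexCount js :: tailTurns js) := by
  have := T.leftTail_path e js h
  obtain ⟨l, hl⟩ := T.path_eq_cons e js
  rw [hl] at this ⊢
  rw [leftSide, this, rev_face_face_eq, path_cons]

/-- The last outer dart is needed to compute the turn that the new walk makes at the end of the
strip. -/
theorem pathLast_tailTurns (e : D) (js : List ℤ) (h : ∀ j ∈ js, j = 2 ∨ j = 3) :
    T.pathLast (T.rot (-1) e) (-apexCount js :: tailTurns js) =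
      T.rev (T.face (T.pathLast e js)) := by
  have h1 := T.leftSide_path e js h
  have h2 : ∀ l : List D, l ≠ [] →
      (T.leftTail l).getLast? = l.getLast?.map fun z => T.rev (T.face z) := by
    intro l
    induction l with
    | nil => simp
    | cons a l ih => cases l with
      | nil => simp [leftTail]
      | cons b l =>
        intro _
        have := ih (by simp)
        rw [leftTail, List.getLast?_append, this, List.getLast?_cons_cons]
        simp [List.getLast?_eq_some_getLast]
  have h3 := T.getLast?_path (T.rot (-1) e) (-apexCount js :: tailTurns js)
  rw [← h1] at h3
  obtain ⟨l, hl⟩ := T.path_eq_cons e js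
  have h4 := h2 (T.path e js) (by simp)
  rw [getLast?_path] at h4
  rw [hl] at h3 h4
  rw [leftSide, List.getLast?_cons, h4] at h3
  simpa using h3.symm

theorem apexCount_three (k : ℕ) (js : List ℤ) :
    apexCount (List.replicate (k + 1) 3 ++ js) = 2 := by
  simp [List.replicate_succ, apexCount]

theorem tailTurns_three_append (k : ℕ) (js : List ℤ) :
    tailTurns (List.replicate (k + 1) 3 ++ js) =
      List.replicate k (-3) ++ -(apexCount js + 1) :: tailTurns js := by
  induction k with
  | zero => simp [tailTurns]
  | succ k ih =>
    rw [List.replicate_succ, List.cons_append, tailTurns, if_pos rfl, ih, apexCount_three]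
    simp [List.replicate_succ]

theorem tailTurns_three (k : ℕ) :
    tailTurns (List.replicate (k + 1) 3) = List.replicate k (-3) ++ [-2] := by
  have := tailTurns_three_append k []
  simpa [apexCount, tailTurns] using this

/-- Each of the `k + 1` apexes is incident to three triangles of the strip. An inner apex has the
triangle of one edge and two middle triangles, and at the extreme apexes a `2` replaces a middle
triangle by the triangle of another edge. -/
theorem bracket_turns (k : ℕ) :
    -apexCount (2 :: (List.replicate k 3 ++ [2])) ::
      tailTurns (2 :: (List.replicate k 3 ++ [2])) = List.replicate (k + 1) (-3) := by
  cases k with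
  | zero => simp [apexCount, tailTurns]
  | succ k =>
    simp only [apexCount, tailTurns, tailTurns_three_append, apexCount_three]
    norm_num
    rw [List.replicate_succ, List.replicate_succ']

/-- The rotations of the other side of the strip of a flip. -/
def flipTurns : ℕ → ℕ → List ℤ
  | 0, 0 => [-2]
  | 0, m + 1 => List.replicate (m + 1) (-3) ++ [-2]
  | k + 1, 0 => -2 :: List.replicate (k + 1) (-3)
  | k + 1, m + 1 => -2 :: (List.replicate k (-3) ++ -4 :: (List.replicate m (-3) ++ [-2]))

/-- If `k` and `m` are positive, the extreme apexes see two triangles, the apex above the `2` sees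
four (two on edges and two middle ones), and every other apex sees three. If `k` or `m` is `0`, the
apex above the `2` is itself extreme and loses one triangle per such side. -/
theorem flip_turns (k m : ℕ) :
    -apexCount (List.replicate k 3 ++ 2 :: List.replicate m 3) ::
      tailTurns (List.replicate k 3 ++ 2 :: List.replicate m 3) = flipTurns k m := by
  have a2 : apexCount (List.replicate (m + 1) 3) = 2 := by
    simpa using apexCount_three m []
  cases k with
  | zero => cases m with
    | zero => simp [apexCount, tailTurns, flipTurns]
    | succ m =>
      have a2 : apexCount (List.replicate (m + 1) 3) = 2 := by
        simpa using apexCount_three m []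
      simp only [List.replicate_zero, List.nil_append, apexCount, tailTurns, flipTurns,
        tailTurns_three, a2]
      norm_num
      simp [List.replicate_succ]
  | succ k => cases m with
    | zero =>
      simp only [List.replicate_zero, apexCount_three, tailTurns_three_append, apexCount,
        tailTurns, flipTurns]
      norm_num
      rw [List.replicate_succ']
    | succ m =>
      have a2 : apexCount (List.replicate (m + 1) 3) = 2 := by
        simpa using apexCount_three m []
      simp only [apexCount_three, tailTurns_three_append, apexCount,
        tailTurns, flipTurns, tailTurns_three, a2]
      norm_num

theorem leftSide_bracket (e : D) (k : ℕ) :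
    T.leftSide (T.path e (2 :: (List.replicate k 3 ++ [2]))) =
      T.path (T.rot (-1) e) (List.replicate (k + 1) (-3)) := by
  rw [leftSide_path, bracket_turns]
  intro j hj
  simp only [List.mem_cons, List.mem_append, List.mem_replicate, List.not_mem_nil, or_false] at hj
  omega

theorem mem_flip_turns {k m : ℕ} : ∀ j ∈ (List.replicate k 3 ++ 2 :: List.replicate m 3 : List ℤ),
    j = 2 ∨ j = 3 := by
  intro j hj
  simp only [List.mem_cons, List.mem_append, List.mem_replicate] at hj
  omega

theorem leftSide_flip (e : D) (k m : ℕ) :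
    T.leftSide (T.path e (List.replicate k 3 ++ 2 :: List.replicate m 3)) =
      T.path (T.rot (-1) e) (flipTurns k m) := by
  rw [leftSide_path _ _ _ mem_flip_turns, flip_turns]

theorem pathLast_flip (e : D) (k m : ℕ) :
    T.pathLast (T.rot (-1) e) (flipTurns k m) =
      T.rev (T.face (T.pathLast e (List.replicate k 3 ++ 2 :: List.replicate m 3))) := by
  rw [← pathLast_tailTurns _ _ _ mem_flip_turns, flip_turns]

theorem pathLast_bracket (e : D) (k : ℕ) :
    T.pathLast (T.rot (-1) e) (List.replicate (k + 1) (-3)) =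
      T.rev (T.face (T.pathLast e (2 :: (List.replicate k 3 ++ [2])))) := by
  rw [← pathLast_tailTurns, bracket_turns]
  intro j hj
  simp only [List.mem_cons, List.mem_append, List.mem_replicate, List.not_mem_nil, or_false] at hj
  omega

theorem length_flipTurns (k m : ℕ) : (flipTurns k m).length = k + m + 1 := by
  cases k <;> cases m <;> (simp [flipTurns]; try omega)

/-- The shape of a reduction move. -/
inductive Shape (before after : Option D) : List D → List D → Prop
  | spur (e : D) : Shape before after [e, T.rev e] []
  | spike (e : D) : Shape before after (T.path e [1]) [T.rot (-1) e]
  | bracket (e : D) (k : ℕ) :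
      Shape before after (T.path e (2 :: (List.replicate k 3 ++ [2])))
        (T.path (T.rot (-1) e) (List.replicate (k + 1) (-3)))
  | flip (e : D) (k m : ℕ) (hr : T.red e = true)
      (ha : ∀ f ∈ before, T.turn f e ∉ ({-1, 0, 1, 2, 3} : Set ℤ))
      (hb : ∀ g ∈ after,
        T.turn (T.pathLast e (List.replicate k 3 ++ 2 :: List.replicate m 3)) g ∉
          ({-1, 0, 1, 2, 3} : Set ℤ)) :
      Shape before after (T.path e (List.replicate k 3 ++ 2 :: List.replicate m 3))
        (T.path (T.rot (-1) e) (flipTurns k m))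

theorem Replace.shape {T : ReducingTriangulation D} {before after : Option D} {s s' : List D}
    (h : T.Replace before after s s') (hs : ∀ p ∈ corners s, T.Adj p.1 p.2) :
    T.Shape before after s s' := by
  cases h with
  | spur e e' h =>
    -- The value `0` of the turn does not imply that the darts meet, so this comes from the walk.
    have : T.Adj e e' := hs (e, e') (by simp)
    rw [T.turn_eq_iff this (by norm_num) (by norm_num), rot_zero] at h
    subst h
    exact .spur e
  | spike e e' h =>
    have := T.eq_rot_of_turn h (by norm_num)
    subst this
    rw [rev_face_face_eq]
    exact .spike e
  | bracket s k h =>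
    cases s with
    | nil => simp at h
    | cons e s =>
      rw [T.eq_path_of_turns h, leftSide_bracket]
      · exact .bracket e k
      · intro j hj
        simp only [List.mem_cons, List.mem_append, List.mem_replicate, List.not_mem_nil,
          or_false] at hj
        omega
  | flip s₁ s₂ e e' k m h₁ h hr h₂ ha hb =>
    have h0 : ∀ n : ℕ, ∀ j ∈ List.replicate n (3 : ℤ), j ≠ 0 := by
      intro n j hj
      simp only [List.mem_replicate] at hj
      omega
    have hs2 := T.eq_path_of_turns h₂ (h0 m)
    obtain ⟨d, l, hd⟩ : ∃ d l, s₁ ++ [e] = d :: l := by cases s₁ <;> simp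
    rw [hd] at h₁
    have hs1 := T.eq_path_of_turns h₁ (h0 k)
    have hl : T.pathLast d (List.replicate k 3) = e :=
      T.pathLast_eq_of_path_eq (l := s₁) (by rw [← hs1, hd])
    have he' := T.eq_rot_of_turn h (by norm_num)
    have hs : s₁ ++ [e] ++ e' :: s₂ = T.path d (List.replicate k 3 ++ 2 :: List.replicate m 3) := by
      rw [hd, hs1, hs2, path_append_cons, hl, he']
    rw [hs, leftSide_flip]
    refine .flip d k m ?_ ?_ ?_
    · rw [← hl, red_pathLast_three] at hr; exact hr
    · intro f hf
      exact ha f hf d (by rw [hd]; simp)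
    · intro g hg
      refine hb _ ?_ g hg
      rw [hs2, getLast?_path, pathLast_append, hl, pathLast_cons, ← he']
      rfl

end ReducingTriangulation

namespace ReducingTriangulation

variable {D : Type*} (T : ReducingTriangulation D)

/-! ### Walks -/

theorem isWalk_append {u v : T.Vertex} {l l' : List D} :
    T.IsWalk u (l ++ l') v ↔ ∃ w, T.IsWalk u l w ∧ T.IsWalk w l' v := by
  induction l generalizing u with
  | nil => simp [IsWalk]
  | cons d l ih => simp [IsWalk, ih, and_assoc]

theorem isWalk_path {u v : T.Vertex} {d : D} {js : List ℤ} :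
    T.IsWalk u (T.path d js) v ↔ u = T.src d ∧ v = T.tgt (T.pathLast d js) := by
  induction js generalizing u d with
  | nil => simp [IsWalk, eq_comm]
  | cons j js ih =>
    rw [path_cons, IsWalk, ih, pathLast_cons]
    have : T.tgt d = T.src (T.rot j (T.rev d)) := (T.src_rot _ _).symm
    simp [this]

theorem IsWalk.adj {T : ReducingTriangulation D} {u v : T.Vertex} {l : List D}
    (h : T.IsWalk u l v) : ∀ p ∈ corners l, T.Adj p.1 p.2 := by
  induction l generalizing u with
  | nil => simp
  | cons d l ih => cases l with
    | nil => simp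
    | cons e l =>
      intro p hp
      rw [corners_cons_cons, List.mem_cons] at hp
      rcases hp with rfl | hp
      · exact T.tgt_eq_src_iff.1 h.2.1
      · exact ih h.2 p hp

theorem IsWalk.cyclic_adj {T : ReducingTriangulation D} {u : T.Vertex} {l : List D}
    (h : T.IsWalk u l u) : ∀ p ∈ cyclicCorners l, T.Adj p.1 p.2 := by
  cases l with
  | nil => simp
  | cons d l =>
    rw [cyclicCorners_cons]
    have h2 : T.IsWalk u (d :: l ++ [d]) (T.tgt d) :=
      T.isWalk_append.2 ⟨u, h, h.1, rfl⟩
    exact h2.adj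

theorem IsWalk.isRotated {T : ReducingTriangulation D} {u : T.Vertex} {l l' : List D}
    (h : T.IsWalk u l u) (hl : l.IsRotated l') : ∃ w, T.IsWalk w l' w := by
  obtain ⟨n, rfl⟩ := hl
  rw [List.rotate_eq_drop_append_take_mod]
  rw [← List.take_append_drop (n % l.length) l] at h
  obtain ⟨w, h1, h2⟩ := T.isWalk_append.1 h
  exact ⟨w, T.isWalk_append.2 ⟨u, h2, h1⟩⟩

theorem reversal_append (l l' : List D) :
    T.reversal (l ++ l') = T.reversal l' ++ T.reversal l := by simp [reversal]

theorem reversal_cons (d : D) (l : List D) : T.reversal (d :: l) = T.reversal l ++ [T.rev d] := by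
  simp [reversal]

@[simp] theorem reversal_nil : T.reversal [] = [] := rfl

@[simp] theorem reversal_reversal (l : List D) : T.reversal (T.reversal l) = l := by
  simp [reversal, Function.comp_def]

@[simp] theorem length_reversal (l : List D) : (T.reversal l).length = l.length := by
  simp [reversal]

theorem reversal_isRotated {l l' : List D} (h : l.IsRotated l') :
    (T.reversal l).IsRotated (T.reversal l') := (h.map T.rev).reverse

theorem IsWalk.reversal {T : ReducingTriangulation D} {u v : T.Vertex} {l : List D}
    (h : T.IsWalk u l v) : T.IsWalk v (T.reversal l) u := by
  induction l generalizing u with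
  | nil => exact h.symm
  | cons d l ih =>
    rw [reversal_cons, isWalk_append]
    refine ⟨_, ih h.2, rfl, ?_⟩
    rw [tgt, rev_rev']
    exact h.1.symm

theorem tgt_rev_face (z : D) : T.tgt (T.rev (T.face z)) = T.tgt z := by
  rw [tgt, rev_rev', face, cw_eq_rot, src_rot]; rfl

theorem Shape.isWalk {T : ReducingTriangulation D} {b a : Option D} {s s' : List D}
    (h : T.Shape b a s s') {u v : T.Vertex} (hs : T.IsWalk u s v) : T.IsWalk u s' v := by
  cases h with
  | spur e =>
    obtain ⟨h1, -, h2⟩ := hs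
    simp only [IsWalk, tgt, rev_rev'] at h2 ⊢
    exact h1.trans h2
  | spike e =>
    rw [isWalk_path] at hs
    obtain ⟨rfl, rfl⟩ := hs
    refine ⟨(T.src_rot _ _).symm, ?_⟩
    simp only [tgt, pathLast_cons, pathLast_nil]
    rw [rev_rot_rev, src_rot]
    rfl
  | bracket e k =>
    rw [isWalk_path] at hs ⊢
    rw [src_rot, pathLast_bracket, tgt_rev_face]
    exact hs
  | flip e k m =>
    rw [isWalk_path] at hs ⊢
    rw [src_rot, pathLast_flip, tgt_rev_face]
    exact hs

/-! ### Counting bad turns -/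

open Classical in
/-- The number of bad turns of a walk. -/
noncomputable def nbad (l : List D) : ℕ :=
  (corners l).countP fun p => decide (T.BadTurn p.1 p.2)

open Classical in
/-- The number of bad turns of a closed walk. -/
noncomputable def cbad (l : List D) : ℕ :=
  (cyclicCorners l).countP fun p => decide (T.BadTurn p.1 p.2)

theorem potential_eq (l : List D) : T.potential l = 3 * l.length + T.nbad l := rfl

theorem closedPotential_eq (l : List D) : T.closedPotential l = 3 * l.length + T.cbad l := rfl

theorem nbad_append_cons (l : List D) (x : D) (l' : List D) :
    T.nbad (l ++ x :: l') = T.nbad (l ++ [x]) + T.nbad (x :: l') := by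
  simp [nbad, corners_append_cons l x l']

@[simp] theorem nbad_singleton (x : D) : T.nbad [x] = 0 := rfl

theorem nbad_pair_le (x y : D) : T.nbad [x, y] ≤ 1 :=
  (List.countP_le_length).trans (by simp)

theorem nbad_eq_zero_iff {l : List D} :
    T.nbad l = 0 ↔ ∀ p ∈ corners l, ¬ T.BadTurn p.1 p.2 := by
  simp [nbad, List.countP_eq_zero]

theorem cbad_eq_zero_iff {l : List D} :
    T.cbad l = 0 ↔ ∀ p ∈ cyclicCorners l, ¬ T.BadTurn p.1 p.2 := by
  simp [cbad, List.countP_eq_zero]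

theorem nbad_pair_eq_zero {x y : D} (h : ¬ T.BadTurn x y) : T.nbad [x, y] = 0 := by
  simpa [nbad_eq_zero_iff] using h

theorem nbad_pos {l : List D} {p : D × D} (hp : p ∈ corners l) (h : T.BadTurn p.1 p.2) :
    0 < T.nbad l := by
  rw [nbad, List.countP_pos_iff]
  exact ⟨p, hp, by simpa using h⟩

theorem cbad_cons (a : D) (l : List D) : T.cbad (a :: l) = T.nbad (a :: l ++ [a]) := by
  rw [cbad, cyclicCorners_cons]; rfl

theorem cyclicCorners_perm {α : Type*} {l l' : List α} (h : l.IsRotated l') :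
    (cyclicCorners l).Perm (cyclicCorners l') := by
  obtain ⟨n, rfl⟩ := h
  rw [cyclicCorners_rotate]
  exact (List.rotate_perm _ n).symm

theorem cbad_isRotated {l l' : List D} (h : l.IsRotated l') : T.cbad l = T.cbad l' :=
  (cyclicCorners_perm h).countP_eq _

theorem closedPotential_isRotated {l l' : List D} (h : l.IsRotated l') :
    T.closedPotential l = T.closedPotential l' := by
  rw [closedPotential_eq, closedPotential_eq, T.cbad_isRotated h, h.perm.length_eq]

theorem nbad_reversal {l : List D} (h : ∀ p ∈ corners l, T.Adj p.1 p.2) :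
    T.nbad (T.reversal l) = T.nbad l := by
  induction l with
  | nil => rfl
  | cons a l ih => cases l with
    | nil => rfl
    | cons b l =>
      have ih' := ih fun p hp => h p (by simp [hp])
      have hab : T.BadTurn (T.rev b) (T.rev a) ↔ T.BadTurn a b :=
        T.badTurn_rev_rev (h (a, b) (by simp))
      rw [reversal_cons] at ih'
      rw [reversal_cons, reversal_cons, List.append_assoc, List.singleton_append,
        nbad_append_cons, ih']
      have : T.nbad (a :: b :: l) = T.nbad [a, b] + T.nbad (b :: l) := T.nbad_append_cons [a] b l
      rw [this, add_comm]
      congr 1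
      by_cases hb : T.BadTurn a b
      · simp [nbad, hb, hab.2 hb]
      · simp [nbad, hb, mt hab.1 hb]

theorem cbad_reversal {l : List D} (h : ∀ p ∈ cyclicCorners l, T.Adj p.1 p.2) :
    T.cbad (T.reversal l) = T.cbad l := by
  cases l with
  | nil => rfl
  | cons a l =>
    rw [cyclicCorners_cons] at h
    have h1 : (T.reversal (a :: l)).IsRotated (T.rev a :: T.reversal l) := by
      rw [reversal_cons]
      exact isRotated_append_comm _ _
    rw [T.cbad_isRotated h1, cbad_cons, cbad_cons, ← T.nbad_reversal h]
    simp [reversal]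

/-! ### The effect of a reduction move on the bad turns -/

theorem corners_path_append (d : D) (js : List ℤ) (j : ℤ) (js' : List ℤ) :
    corners (T.path d (js ++ j :: js')) = corners (T.path d js) ++
      (T.pathLast d js, T.rot j (T.rev (T.pathLast d js))) ::
        corners (T.path (T.rot j (T.rev (T.pathLast d js))) js') := by
  rw [path_append_cons]
  obtain ⟨l, hl⟩ := T.path_eq_concat d js
  obtain ⟨l', hl'⟩ := T.path_eq_cons (T.rot j (T.rev (T.pathLast d js))) js'
  rw [hl, hl', List.append_assoc, List.singleton_append, corners_append_cons, corners_cons_cons]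

theorem corners_path_cons (d : D) (j : ℤ) (js : List ℤ) :
    corners (T.path d (j :: js)) =
      (d, T.rot j (T.rev d)) :: corners (T.path (T.rot j (T.rev d)) js) := by
  simpa using T.corners_path_append d [] j js

/-- Beyond `-3` the positive integer is used, and here it is the degree minus four. -/
theorem turn_rot_neg_four (e : D) : 4 ≤ T.turn e (T.rot (-4) (T.rev e)) := by
  have := T.eight_le (T.rev e)
  have h2 : (-4) % (T.degree (T.rev e) : ℤ) = -4 + T.degree (T.rev e) := by
    rw [← Int.add_emod_right, Int.emod_eq_of_lt] <;> omega
  rw [turn_rot, h2]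
  split_ifs <;> omega

theorem turn_of_mem_corners_path {d : D} {js : List ℤ} (hj : ∀ j ∈ js, -4 ≤ j ∧ j ≤ -2)
    {p : D × D} (hp : p ∈ corners (T.path d js)) :
    T.turn p.1 p.2 = -2 ∨ T.turn p.1 p.2 = -3 ∨ 4 ≤ T.turn p.1 p.2 := by
  induction js generalizing d with
  | nil => simp at hp
  | cons j js ih =>
    rw [corners_path_cons, List.mem_cons] at hp
    rcases hp with rfl | hp
    · have h1 := hj j (by simp)
      obtain rfl | h2 : j = -4 ∨ -3 ≤ j := by omega
      · right; right; exact T.turn_rot_neg_four d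
      · simp only [T.turn_rot_small (e := d) h2 (by omega : j ≤ 4)]
        omega
    · exact ih (fun i hi => hj i (by simp [hi])) hp

/-- No bad turn on the path with rotations `-2`, `-3` or `-4`. -/
def Clean (d : D) : List ℤ → Prop
  | [] => True
  | j :: js => (j = -3 ∨ j = -4 ∨ (j = -2 ∧ T.red d = false)) ∧ Clean (T.rot j (T.rev d)) js

theorem not_badTurn_of_turn {e e' : D}
    (h : T.turn e e' = -3 ∨ T.turn e e' = 3 ∨ 4 ≤ T.turn e e') : ¬ T.BadTurn e e' := by
  rintro (h' | h' | h' | ⟨h', -⟩ | ⟨h', -⟩) <;> omega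

theorem Clean.not_badTurn {T : ReducingTriangulation D} {d : D} {js : List ℤ}
    (h : T.Clean d js) : ∀ p ∈ corners (T.path d js), ¬ T.BadTurn p.1 p.2 := by
  induction js generalizing d with
  | nil => simp
  | cons j js ih =>
    intro p hp
    rw [corners_path_cons, List.mem_cons] at hp
    rcases hp with rfl | hp
    · rcases h.1 with rfl | rfl | ⟨rfl, hr⟩
      · exact T.not_badTurn_of_turn (.inl (T.turn_rot_small (by norm_num) (by norm_num)))
      · exact T.not_badTurn_of_turn (.inr (.inr (T.turn_rot_neg_four d)))
      · have ht := T.turn_rot_small (e := d) (j := -2) (by norm_num) (by norm_num)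
        rintro (h' | h' | h' | ⟨h', -⟩ | ⟨-, h'⟩)
        iterate 4 simp only [ht] at h'; omega
        simp [hr] at h'
    · exact ih h.2 p hp

theorem clean_append {d : D} {js js' : List ℤ} :
    T.Clean d (js ++ js') ↔ T.Clean d js ∧ T.Clean (T.pathLast d js) js' := by
  induction js generalizing d with
  | nil => simp [Clean]
  | cons j js ih => simp [Clean, ih, and_assoc]

theorem clean_neg_three (d : D) (k : ℕ) : T.Clean d (List.replicate k (-3)) := by
  induction k generalizing d with
  | zero => trivial
  | succ k ih => exact ⟨.inl rfl, ih _⟩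

theorem red_rot_neg_four (d : D) : T.red (T.rot (-4) d) = T.red d := by
  have := T.red_rot_neg_two (T.rot (-2) d)
  rw [rot_rot] at this
  norm_num at this
  rw [this, red_rot_neg_two]

/-- The base of the flip starts on red, so its outer side starts on blue. Turns `-3` keep the
colour, and the first `-2` and the `-4` change it, so each `-2` is made on blue and is not bad. -/
theorem clean_flip {e : D} (hr : T.red e = true) (k m : ℕ) :
    T.Clean (T.rot (-1) e) (flipTurns k m) := by
  have h0 : T.red (T.rot (-1) e) = false := by rw [red_rot_neg_one, hr]; rfl
  have h1 : T.red (T.rot (-2) (T.rev (T.rot (-1) e))) = true := by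
    rw [red_rot_neg_two, red_rev, h0]; rfl
  cases k <;> cases m
  · simp [flipTurns, Clean, h0]
  · simp [flipTurns, clean_append, clean_neg_three, Clean, red_pathLast_neg_three, h0]
  · exact ⟨.inr (.inr ⟨rfl, h0⟩), T.clean_neg_three _ _⟩
  · refine ⟨.inr (.inr ⟨rfl, h0⟩), T.clean_append.2 ⟨T.clean_neg_three _ _, .inr (.inl rfl),
      T.clean_append.2 ⟨T.clean_neg_three _ _, .inr (.inr ⟨rfl, ?_⟩), trivial⟩⟩⟩
    rw [red_pathLast_neg_three, red_rot_neg_four, red_rev, red_pathLast_neg_three, h1]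
    rfl

theorem flipTurns_range {k m : ℕ} : ∀ j ∈ flipTurns k m, -4 ≤ j ∧ j ≤ -2 := by
  intro j hj
  cases k <;> cases m <;> simp [flipTurns, List.mem_replicate] at hj <;> omega

/-- Every shape has a bad turn among `0`, `1` and `2`. -/
theorem Shape.exists_bad {T : ReducingTriangulation D} {b a : Option D} {s s' : List D}
    (h : T.Shape b a s s') : ∃ p ∈ corners s, T.BadTurn p.1 p.2 ∧
      (T.turn p.1 p.2 = 0 ∨ T.turn p.1 p.2 = 1 ∨ T.turn p.1 p.2 = 2) := by
  cases h with
  | spur e =>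
    have : T.turn e (T.rev e) = 0 := by
      simpa using T.turn_rot_small (e := e) (j := 0) (by norm_num) (by norm_num)
    exact ⟨(e, T.rev e), by simp, .inl this, .inl this⟩
  | spike e =>
    have := T.turn_rot_small (e := e) (j := 1) (by norm_num) (by norm_num)
    exact ⟨(e, T.rot 1 (T.rev e)), by simp, .inr (.inl this), .inr (.inl this)⟩
  | bracket e k =>
    -- The two turns `2` of a bracket are on different colours, since the first changes the colour
    -- and the turns `3` keep it. Hence one of them is red.
    by_cases hr : T.red e = true
    · have := T.turn_rot_small (e := e) (j := 2) (by norm_num) (by norm_num)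
      refine ⟨(e, T.rot 2 (T.rev e)), ?_, .inr (.inr (.inr (.inl ⟨this, hr⟩))), .inr (.inr this)⟩
      rw [corners_path_cons]; simp
    · have := T.turn_rot_small (e := T.pathLast e (2 :: List.replicate k 3)) (j := 2)
        (by norm_num) (by norm_num)
      refine ⟨(T.pathLast e (2 :: List.replicate k 3),
        T.rot 2 (T.rev (T.pathLast e (2 :: List.replicate k 3)))), ?_,
        .inr (.inr (.inr (.inl ⟨this, ?_⟩))), .inr (.inr this)⟩
      · rw [← List.cons_append, corners_path_append]; simp
      · rw [pathLast_cons, red_pathLast_three, red_rot_rev_two]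
        simpa using hr
  | flip e k m hr =>
    have := T.turn_rot_small (e := T.pathLast e (List.replicate k 3)) (j := 2)
        (by norm_num) (by norm_num)
    refine ⟨(T.pathLast e (List.replicate k 3),
        T.rot 2 (T.rev (T.pathLast e (List.replicate k 3)))), ?_,
        .inr (.inr (.inr (.inl ⟨this, ?_⟩))), .inr (.inr this)⟩
    · rw [corners_path_append]; simp
    · rw [red_pathLast_three]; exact hr

theorem Shape.nbad_pos {T : ReducingTriangulation D} {b a : Option D} {s s' : List D}
    (h : T.Shape b a s s') : 0 < T.nbad s := by
  obtain ⟨p, hp, hb, -⟩ := h.exists_bad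
  exact T.nbad_pos hp hb

theorem not_badTurn_rot' {e : D} {j : ℤ} (h3 : 3 - T.degree (T.rev e) ≤ j)
    (h : j + 3 ≤ T.degree (T.rev e)) (h' : 3 ≤ j ∨ j ≤ -3) :
    ¬ T.BadTurn e (T.rot j (T.rev e)) := by
  rcases h' with h' | h'
  · exact T.not_badTurn_rot h' h
  · have : T.rot j (T.rev e) = T.rot (j + T.degree (T.rev e)) (T.rev e) := by
      rw [rot_eq_rot_iff]
      exact ⟨-1, by ring⟩
    rw [this]
    exact T.not_badTurn_rot (by linarith) (by linarith)

/-- After the last outer dart `rev (face z)`, the same next dart is reached with one rotation less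
than after `z`. -/
theorem rev_rev_face (z : D) (j : ℤ) :
    T.rot j (T.rev z) = T.rot (j - 1) (T.rev (T.rev (T.face z))) := by
  rw [rev_rev', face, cw_eq_rot, rot_rot]; congr 1; ring

theorem degree_rev_rev_face (z : D) :
    T.degree (T.rev (T.rev (T.face z))) = T.degree (T.rev z) := by
  rw [rev_rev', face, cw_eq_rot, degree_rot]

theorem turn_not_mem {e e' : D} (hadj : T.Adj e e')
    (h : T.turn e e' ∉ ({-1, 0, 1, 2, 3} : Set ℤ)) : ∃ j : ℤ, e' = T.rot j (T.rev e) ∧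
      T.turn e e' = j ∧ (j = -3 ∨ j = -2 ∨ 4 ≤ j) ∧ j + 4 ≤ T.degree (T.rev e) := by
  have hr := T.turn_range hadj
  refine ⟨_, hadj.eq_rot_turn, rfl, ?_, hr.2⟩
  simp only [Set.mem_insert_iff, Set.mem_singleton_iff, not_or] at h
  omega

/-- The rotation decreases by one. The admissible values `-3`, `-2` and at least `4` become `-4`,
`-3` and at least `3`, which leave three triangles on each side because the degree is at least
eight. -/
theorem flip_before {f e : D} (hadj : T.Adj f e)
    (h : T.turn f e ∉ ({-1, 0, 1, 2, 3} : Set ℤ)) : ¬ T.BadTurn f (T.rot (-1) e) := by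
  obtain ⟨j, rfl, -, hj, hj'⟩ := T.turn_not_mem hadj h
  have h8 := T.eight_le (T.rev f)
  rw [rot_rot]
  exact T.not_badTurn_rot' (by omega) (by omega) (by omega)

theorem flip_after {z g : D} (hadj : T.Adj z g)
    (h : T.turn z g ∉ ({-1, 0, 1, 2, 3} : Set ℤ)) : ¬ T.BadTurn (T.rev (T.face z)) g := by
  obtain ⟨j, rfl, -, hj, hj'⟩ := T.turn_not_mem hadj h
  have h8 := T.eight_le (T.rev z)
  rw [rev_rev_face]
  apply T.not_badTurn_rot' <;> try rw [degree_rev_rev_face]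
  all_goals omega

/-- If both ends of the flip are one vertex, then its rotation decreases by two. Without the value
`4`, the results `-5`, `-4` and at least `3` are not bad. The value `4` gives `2`. -/
theorem flip_both {z e : D} (hadj : T.Adj z e)
    (h : T.turn z e ∉ ({-1, 0, 1, 2, 3} : Set ℤ)) (h4 : T.turn z e ≠ 4) :
    ¬ T.BadTurn (T.rev (T.face z)) (T.rot (-1) e) := by
  obtain ⟨j, rfl, hj4, hj, hj'⟩ := T.turn_not_mem hadj h
  have h8 := T.eight_le (T.rev z)
  rw [rev_rev_face, rot_rot]
  apply T.not_badTurn_rot' <;> try rw [degree_rev_rev_face]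
  all_goals omega

theorem flip_both_four {z e : D} (h : T.turn z e = 4) :
    T.turn (T.rev (T.face z)) (T.rot (-1) e) = 2 := by
  rw [T.eq_rot_of_turn h (by norm_num), rev_rev_face, rot_rot]
  exact T.turn_rot_small (by norm_num) (by norm_num)

end ReducingTriangulation

namespace ReducingTriangulation

variable {D : Type*} (T : ReducingTriangulation D)

/-! ### Decrease of the potential -/

theorem nbad_concat (l : List D) (e : D) :
    T.nbad (l ++ [e]) = T.nbad l + l.getLast?.elim 0 fun f => T.nbad [f, e] := by
  rcases List.eq_nil_or_concat' l with rfl | ⟨l, f, rfl⟩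
  · rfl
  · simp only [List.append_assoc, List.singleton_append]
    rw [nbad_append_cons]
    simp

theorem nbad_cons (z : D) (l : List D) :
    T.nbad (z :: l) = (l.head?.elim 0 fun g => T.nbad [z, g]) + T.nbad l := by
  cases l with
  | nil => rfl
  | cons g l => exact T.nbad_append_cons [z] g l

theorem nbad_cons_concat {l : List D} (hl : l ≠ []) (z e : D) :
    T.nbad (z :: (l ++ [e])) = (l.head?.elim 0 fun g => T.nbad [z, g]) + T.nbad l +
      l.getLast?.elim 0 fun f => T.nbad [f, e] := by
  rw [nbad_cons, nbad_concat]
  cases l with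
  | nil => exact absurd rfl hl
  | cons a l => simp [add_assoc]

theorem elim_nbad_le (o : Option D) (f : D → List D) (hf : ∀ x, T.nbad (f x) ≤ 1) :
    (o.elim 0 fun x => T.nbad (f x)) ≤ 1 := by
  cases o <;> simp [hf]

theorem nbad_mid {e z : D} {s s₁ s₂ : List D} (h1 : s = e :: s₁) (h2 : s = s₂ ++ [z])
    (pre post : List D) :
    T.nbad (pre ++ s ++ post) = T.nbad (pre ++ [e]) + T.nbad s + T.nbad (z :: post) := by
  have : T.nbad (s ++ post) = T.nbad s + T.nbad (z :: post) := by
    rw [h2, List.append_assoc, List.singleton_append, nbad_append_cons]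
  rw [List.append_assoc, h1, List.cons_append, nbad_append_cons, ← List.cons_append, ← h1, this,
    add_assoc]

theorem cbad_mid {e z : D} {s s₁ s₂ : List D} (h1 : s = e :: s₁) (h2 : s = s₂ ++ [z])
    (post : List D) : T.cbad (s ++ post) = T.nbad s + T.nbad (z :: (post ++ [e])) := by
  have : T.nbad (s ++ (post ++ [e])) = T.nbad s + T.nbad (z :: (post ++ [e])) := by
    rw [h2, List.append_assoc, List.singleton_append, nbad_append_cons]
  rw [← this, h1, List.cons_append, cbad_cons]
  simp

/-- Spikes, brackets and flips get a common form, with the same first and last outer darts and no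
bad turn inside. The potential is then compared once for the moves that save an edge and once for
flips. -/
theorem Shape.cases_ends {T : ReducingTriangulation D} {b a : Option D} {s s' : List D}
    (h : T.Shape b a s s') :
    (∃ e, s = [e, T.rev e] ∧ s' = []) ∨
    ∃ e js js', s = T.path e js ∧ s' = T.path (T.rot (-1) e) js' ∧
      T.pathLast (T.rot (-1) e) js' = T.rev (T.face (T.pathLast e js)) ∧ T.nbad s' = 0 ∧
      (js'.length + 1 = js.length ∨ (js'.length = js.length ∧
        (∀ f ∈ b, T.turn f e ∉ ({-1, 0, 1, 2, 3} : Set ℤ)) ∧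
        (∀ g ∈ a, T.turn (T.pathLast e js) g ∉ ({-1, 0, 1, 2, 3} : Set ℤ)) ∧
        ∃ k m, js = List.replicate k 3 ++ 2 :: List.replicate m 3 ∧ js' = flipTurns k m ∧
          T.red e = true)) := by
  cases h with
  | spur e => exact .inl ⟨e, rfl, rfl⟩
  | spike e =>
    refine .inr ⟨e, [1], [], rfl, rfl, ?_, rfl, .inl rfl⟩
    rw [rev_face_eq]
    simp
  | bracket e k =>
    refine .inr ⟨e, _, _, rfl, rfl, T.pathLast_bracket e k, ?_, .inl (by simp)⟩
    exact T.nbad_eq_zero_iff.2 (T.clean_neg_three _ _).not_badTurn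
  | flip e k m hr ha hb =>
    refine .inr ⟨e, _, _, rfl, rfl, T.pathLast_flip e k m, ?_,
      .inr ⟨?_, ha, hb, k, m, rfl, rfl, hr⟩⟩
    · exact T.nbad_eq_zero_iff.2 (T.clean_flip hr k m).not_badTurn
    · rw [length_flipTurns]; simp; omega

/-- The part of a walk that comes before and after a reduction move. -/
theorem Shape.potential_lt {T : ReducingTriangulation D} {pre post s s' : List D}
    (h : T.Shape pre.getLast? post.head? s s')
    (hadj : ∀ p ∈ corners (pre ++ s ++ post), T.Adj p.1 p.2) :
    T.potential (pre ++ s' ++ post) < T.potential (pre ++ s ++ post) := by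
  have hpos := h.nbad_pos
  rw [potential_eq, potential_eq]
  rcases h.cases_ends with ⟨e, rfl, rfl⟩ | ⟨e, js, js', rfl, rfl, hlast, h0, hlen⟩
  · rw [T.nbad_mid (s := [e, T.rev e]) (s₁ := [T.rev e]) (s₂ := [e]) rfl rfl, nbad_concat,
      T.nbad_cons (T.rev e),
      List.append_nil]
    have : T.nbad (pre ++ post) ≤ T.nbad pre + T.nbad post + 1 := by
      cases post with
      | nil => simp; omega
      | cons g post =>
        rw [nbad_append_cons, nbad_concat]
        have := T.elim_nbad_le pre.getLast? (fun f => [f, g]) fun _ => T.nbad_pair_le _ _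
        omega
    simp only [List.length_append, List.length_cons, List.length_nil]
    omega
  · obtain ⟨s₁, h1⟩ := T.path_eq_cons e js
    obtain ⟨s₂, h2⟩ := T.path_eq_concat e js
    obtain ⟨s₁', h1'⟩ := T.path_eq_cons (T.rot (-1) e) js'
    obtain ⟨s₂', h2'⟩ := T.path_eq_concat (T.rot (-1) e) js'
    rw [T.nbad_mid h1 h2, T.nbad_mid h1' h2', h0, hlast, nbad_concat, nbad_concat, nbad_cons,
      T.nbad_cons (T.pathLast e js)]
    simp only [List.length_append, length_path]
    have b1 := T.elim_nbad_le pre.getLast? (fun f => [f, T.rot (-1) e])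
      fun _ => T.nbad_pair_le _ _
    have b2 := T.elim_nbad_le post.head? (fun g => [T.rev (T.face (T.pathLast e js)), g])
      fun _ => T.nbad_pair_le _ _
    -- A shorter outer side saves three and at least one bad turn, against at most two new bad turns
    -- at its ends. A flip saves only the bad turn, so its ends must create none.
    rcases hlen with hlen | ⟨hlen, ha, hb, -⟩
    · omega
    · have c1 : (pre.getLast?.elim 0 fun f => T.nbad [f, T.rot (-1) e]) = 0 := by
        rcases List.eq_nil_or_concat' pre with rfl | ⟨l, f, rfl⟩
        · rfl
        · simp only [List.getLast?_append, List.getLast?_singleton, Option.some_or,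
            Option.elim_some] at ha ⊢
          apply T.nbad_pair_eq_zero
          refine T.flip_before (hadj (f, e) ?_) (ha f rfl)
          rw [h1]
          simp only [List.append_assoc, List.cons_append]
          rw [corners_append_cons]
          simp
      have c2 : (post.head?.elim 0 fun g =>
          T.nbad [T.rev (T.face (T.pathLast e js)), g]) = 0 := by
        cases post with
        | nil => rfl
        | cons g post =>
          simp only [List.head?_cons, Option.elim_some] at hb ⊢
          apply T.nbad_pair_eq_zero
          refine T.flip_after (hadj (_, g) ?_) (hb g rfl)
          rw [h2, ← List.append_assoc, List.append_assoc, List.singleton_append,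
            corners_append_cons]
          simp
      omega

theorem getLast?_append_ne {α : Type*} (l : List α) {l' : List α} (h : l' ≠ []) :
    (l ++ l').getLast? = l'.getLast? := by
  rw [List.getLast?_append]
  rcases List.eq_nil_or_concat' l' with rfl | ⟨m, x, rfl⟩
  · exact absurd rfl h
  · simp

/-- A flip around a closed walk whose other turn is `4`. -/
def HeartFlip (s s' : List D) : Prop :=
  ∃ e k m, s = T.path e (List.replicate k 3 ++ 2 :: List.replicate m 3) ∧
    s' = T.path (T.rot (-1) e) (flipTurns k m) ∧ T.red e = true ∧
    T.turn (T.pathLast e (List.replicate k 3 ++ 2 :: List.replicate m 3)) e = 4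

/-- The count is the same as for walks, except if the strip is the whole closed walk. Then a single
corner joins its end to its start, and a flip changes this corner on both sides. -/
theorem Shape.closedPotential_lt {T : ReducingTriangulation D} {post s s' : List D}
    (h : T.Shape (s ++ post).getLast? (post ++ s).head? s s')
    (hadj : ∀ p ∈ cyclicCorners (s ++ post), T.Adj p.1 p.2) :
    T.closedPotential (s' ++ post) < T.closedPotential (s ++ post) ∨
      (post = [] ∧ T.HeartFlip s s' ∧ T.closedPotential s' ≤ T.closedPotential s) := by
  have hpos := h.nbad_pos
  simp only [closedPotential_eq]
  rcases h.cases_ends with ⟨e, rfl, rfl⟩ | ⟨e, js, js', rfl, rfl, hlast, h0, hlen⟩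
  · left
    rw [T.cbad_mid (s := [e, T.rev e]) (s₁ := [T.rev e]) (s₂ := [e]) rfl rfl]
    simp only [List.length_append, List.length_cons, List.length_nil, List.nil_append]
    cases post with
    | nil => simp [cbad]
    | cons g post =>
      rw [cbad_cons, nbad_concat, T.nbad_cons_concat (l := g :: post) (by simp)]
      have := T.elim_nbad_le (g :: post).getLast? (fun f => [f, g]) fun _ => T.nbad_pair_le _ _
      omega
  · obtain ⟨s₁, h1⟩ := T.path_eq_cons e js
    obtain ⟨s₂, h2⟩ := T.path_eq_concat e js
    obtain ⟨s₁', h1'⟩ := T.path_eq_cons (T.rot (-1) e) js'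
    obtain ⟨s₂', h2'⟩ := T.path_eq_concat (T.rot (-1) e) js'
    by_cases hp : post = []
    · subst hp
      simp only [List.append_nil, List.nil_append] at h hadj ⊢
      have e1 := T.cbad_mid h1 h2 []
      have e2 := T.cbad_mid h1' h2' []
      simp only [List.append_nil, List.nil_append] at e1 e2
      rw [e1, e2, h0, hlast, length_path, length_path]
      have b1 := T.nbad_pair_le (T.rev (T.face (T.pathLast e js))) (T.rot (-1) e)
      rcases hlen with hlen | ⟨hlen, ha, hb, k, m, rfl, rfl, hr⟩
      · left; omega
      · have hadj' : T.Adj (T.pathLast e (List.replicate k 3 ++ 2 :: List.replicate m 3)) e := by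
          refine hadj (_, e) ?_
          rw [h1, cyclicCorners_cons, ← h1, h2, List.append_assoc, List.singleton_append,
            corners_append_cons]
          simp
        have ha' := ha (T.pathLast e (List.replicate k 3 ++ 2 :: List.replicate m 3)) (by simp)
        by_cases h4 : T.turn (T.pathLast e (List.replicate k 3 ++ 2 :: List.replicate m 3)) e = 4
        · refine .inr ⟨trivial, ⟨e, k, m, rfl, rfl, hr, h4⟩, by omega⟩
        · left
          have := T.nbad_pair_eq_zero (T.flip_both hadj' ha' h4)
          omega
    · left
      rw [T.cbad_mid h1 h2, T.cbad_mid h1' h2', h0, hlast, nbad_cons_concat _ hp,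
        nbad_cons_concat _ hp]
      simp only [List.length_append, length_path]
      have b1 := T.elim_nbad_le post.getLast? (fun f => [f, T.rot (-1) e])
        fun _ => T.nbad_pair_le _ _
      have b2 := T.elim_nbad_le post.head? (fun g => [T.rev (T.face (T.pathLast e js)), g])
        fun _ => T.nbad_pair_le _ _
      rcases hlen with hlen | ⟨hlen, ha, hb, -⟩
      · omega
      · have c1 : (post.getLast?.elim 0 fun f => T.nbad [f, T.rot (-1) e]) = 0 := by
          rcases List.eq_nil_or_concat' post with rfl | ⟨l, f, rfl⟩
          · rfl
          · rw [getLast?_append_ne _ (by simp)] at ha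
            simp only [List.getLast?_append, List.getLast?_singleton, Option.some_or,
              Option.elim_some] at ha ⊢
            apply T.nbad_pair_eq_zero
            refine T.flip_before (hadj (f, e) ?_) (ha f rfl)
            rw [h1, List.cons_append, cyclicCorners_cons]
            have : e :: (s₁ ++ (l ++ [f])) ++ [e] = (e :: (s₁ ++ l)) ++ f :: [e] := by simp
            rw [this, corners_append_cons]
            simp
        have c2 : (post.head?.elim 0 fun g =>
            T.nbad [T.rev (T.face (T.pathLast e js)), g]) = 0 := by
          cases post with
          | nil => rfl
          | cons g post =>
            simp only [List.head?_cons, Option.elim_some, List.cons_append] at hb ⊢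
            apply T.nbad_pair_eq_zero
            refine T.flip_after (hadj (_, g) ?_) (hb g rfl)
            have : cyclicCorners (T.path e js ++ g :: post) =
                corners (s₂ ++ T.pathLast e js :: (g :: post ++ [e])) := by
              rw [h1, List.cons_append, cyclicCorners_cons, ← List.cons_append, ← h1, h2]
              simp
            rw [this, corners_append_cons]
            simp
        omega

/-! ### Sequences of moves -/

theorem LeftMove.spec {T : ReducingTriangulation D} {u v : T.Vertex} {l l' : List D}
    (hl : T.IsWalk u l v) (h : T.LeftMove l l') :
    T.IsWalk u l' v ∧ T.potential l' < T.potential l := by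
  obtain ⟨pre, s, s', post, rfl, rfl, h⟩ := h
  have hadj := hl.adj
  obtain ⟨w, hl1, hl2⟩ := T.isWalk_append.1 hl
  obtain ⟨w', hl1, hl3⟩ := T.isWalk_append.1 hl1
  have hs := h.shape hl3.adj
  exact ⟨T.isWalk_append.2 ⟨w, T.isWalk_append.2 ⟨w', hl1, hs.isWalk hl3⟩, hl2⟩,
    hs.potential_lt hadj⟩

theorem potential_reversal {u v : T.Vertex} {l : List D} (hl : T.IsWalk u l v) :
    T.potential (T.reversal l) = T.potential l := by
  rw [potential_eq, potential_eq, length_reversal, T.nbad_reversal hl.adj]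

theorem Move.spec {T : ReducingTriangulation D} {u v : T.Vertex} {l l' : List D}
    (hl : T.IsWalk u l v) (h : T.Move l l') :
    T.IsWalk u l' v ∧ T.potential l' < T.potential l := by
  rcases h with h | h
  · exact h.spec hl
  · obtain ⟨h1, h2⟩ := h.spec hl.reversal
    have h3 := h1.reversal
    have h4 := T.potential_reversal h1
    rw [reversal_reversal] at h3 h4
    refine ⟨h3, ?_⟩
    rw [h4]
    rwa [T.potential_reversal hl] at h2

theorem length_corners_le {α : Type*} (l : List α) : (corners l).length ≤ l.length := by
  simp [corners]

theorem potential_le (l : List D) : T.potential l ≤ 4 * l.length := by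
  have h1 : T.nbad l ≤ (corners l).length := List.countP_le_length
  have h2 := length_corners_le l
  rw [potential_eq]; omega

theorem closedPotential_le (l : List D) : T.closedPotential l ≤ 4 * l.length := by
  have h1 : T.cbad l ≤ (cyclicCorners l).length := List.countP_le_length
  have h2 : (cyclicCorners l).length ≤ l.length := by simp [cyclicCorners]
  rw [closedPotential_eq]; omega

theorem length_chain_le {u v : T.Vertex} {l : List D} (hl : T.IsWalk u l v)
    {L : List (List D)} (hL : List.IsChain T.Move (l :: L)) : L.length ≤ T.potential l := by
  induction L generalizing l with
  | nil => simp
  | cons m L ih =>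
    rw [List.isChain_cons_cons] at hL
    obtain ⟨h1, h2⟩ := hL.1.spec hl
    have := ih h1 hL.2
    simp only [List.length_cons]; omega

/-- The closed walk has a single bad turn, equal to `2`, and the move that it admits is a flip
after which no bad turn is left. -/
structure AfterHeart (l : List D) : Prop where
  cbad_le : T.cbad l ≤ 1
  turn_of_bad : ∀ p ∈ cyclicCorners l, T.BadTurn p.1 p.2 → T.turn p.1 p.2 = 2
  count_two : ((cyclicCorners l).countP fun p => T.turn p.1 p.2 = 2) ≤ 1
  turn_ne_three : ∀ p ∈ cyclicCorners l, T.turn p.1 p.2 ≠ 3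
  turn_ne_four : l.length = 2 → ∀ p ∈ cyclicCorners l, T.turn p.1 p.2 ≠ 4

theorem AfterHeart.isRotated {T : ReducingTriangulation D} {l l' : List D} (h : T.AfterHeart l)
    (hl : l.IsRotated l') : T.AfterHeart l' where
  cbad_le := by rw [← T.cbad_isRotated hl]; exact h.cbad_le
  turn_of_bad p hp := h.turn_of_bad p ((mem_cyclicCorners_of_isRotated hl p).2 hp)
  count_two := by rw [← (cyclicCorners_perm hl).countP_eq]; exact h.count_two
  turn_ne_three p hp := h.turn_ne_three p ((mem_cyclicCorners_of_isRotated hl p).2 hp)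
  turn_ne_four h2 p hp :=
    h.turn_ne_four (hl.perm.length_eq.trans h2) p ((mem_cyclicCorners_of_isRotated hl p).2 hp)

/-- The turns inside the outer side are `-2`, `-3` or at least `4`, and none of them is bad. The
corner where the outer side closes up makes the turn `4 - 2 = 2`. A closed walk of two edges has `k
= m = 0`, so that its turns are `-2` and `2`. -/
theorem HeartFlip.afterHeart {T : ReducingTriangulation D} {s s' : List D}
    (h : T.HeartFlip s s') : T.AfterHeart s' := by
  obtain ⟨e, k, m, rfl, rfl, hr, h4⟩ := h
  have h2 := T.flip_both_four h4
  rw [← pathLast_flip] at h2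
  obtain ⟨s₁, h1⟩ := T.path_eq_cons (T.rot (-1) e) (flipTurns k m)
  obtain ⟨s₂, h1'⟩ := T.path_eq_concat (T.rot (-1) e) (flipTurns k m)
  have hc : cyclicCorners (T.path (T.rot (-1) e) (flipTurns k m)) =
      corners (T.path (T.rot (-1) e) (flipTurns k m)) ++
        [(T.pathLast (T.rot (-1) e) (flipTurns k m), T.rot (-1) e)] := by
    rw [h1, cyclicCorners_cons, ← h1, h1', List.append_assoc, List.singleton_append,
      corners_append_cons]
    simp
  have hnb := (T.clean_flip hr k m).not_badTurn
  have ht := fun p (hp : p ∈ corners (T.path (T.rot (-1) e) (flipTurns k m))) =>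
    T.turn_of_mem_corners_path flipTurns_range hp
  constructor
  · rw [cbad, hc, List.countP_append, List.countP_eq_zero.2 (by simpa using hnb), zero_add]
    exact List.countP_le_length
  · intro p hp hb
    rw [hc, List.mem_append, List.mem_singleton] at hp
    rcases hp with hp | rfl
    · exact absurd hb (hnb p hp)
    · exact h2
  · rw [hc, List.countP_append, List.countP_eq_zero.2, zero_add]
    · exact List.countP_le_length
    · intro p hp
      have := ht p hp
      simp; omega
  · intro p hp
    rw [hc, List.mem_append, List.mem_singleton] at hp
    rcases hp with hp | rfl
    · have := ht p hp; omega
    · rw [h2]; norm_num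
  · intro hl p hp
    rw [length_path, length_flipTurns] at hl
    obtain ⟨rfl, rfl⟩ : k = 0 ∧ m = 0 := by omega
    rw [hc, List.mem_append, List.mem_singleton] at hp
    rcases hp with hp | rfl
    · simp only [flipTurns, corners_path_cons, path_nil, corners_singleton,
        List.mem_singleton] at hp
      subst hp
      simp only [T.turn_rot_small (e := T.rot (-1) e) (j := -2) (by norm_num) (by norm_num)]
      norm_num
    · rw [h2]; norm_num

theorem cyclicCorners_mid {e z : D} {s s₁ s₂ : List D} (h1 : s = e :: s₁) (h2 : s = s₂ ++ [z])
    (post : List D) :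
    cyclicCorners (s ++ post) = corners s ++ corners (z :: (post ++ [e])) := by
  have : corners (s ++ (post ++ [e])) = corners s ++ corners (z :: (post ++ [e])) := by
    rw [h2, List.append_assoc, List.singleton_append, corners_append_cons]
  rw [← this, h1, List.cons_append, cyclicCorners_cons]
  simp

theorem exists_cyclicCorners_append (s post : List D) :
    ∃ c, cyclicCorners (s ++ post) = corners s ++ c := by
  cases s with
  | nil => exact ⟨_, rfl⟩
  | cons a s =>
    obtain ⟨s₂, z, hz⟩ : ∃ s₂ z, a :: s = s₂ ++ [z] :=
      ⟨_, _, (List.dropLast_append_getLast (by simp)).symm⟩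
    exact ⟨_, cyclicCorners_mid rfl hz post⟩

theorem corners_subset_cyclicCorners (s post : List D) {p : D × D} (hp : p ∈ corners s) :
    p ∈ cyclicCorners (s ++ post) := by
  obtain ⟨c, hc⟩ := exists_cyclicCorners_append s post
  rw [hc]
  exact List.mem_append_left _ hp

theorem countP_corners_le (s post : List D) (P : D × D → Bool) :
    (corners s).countP P ≤ (cyclicCorners (s ++ post)).countP P := by
  obtain ⟨c, hc⟩ := exists_cyclicCorners_append s post
  rw [hc, List.countP_append]
  omega

/-- The last clause concerns the move that follows a heart flip. A single `2` as the only possible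
bad turn leaves room neither for a spur or a spike, nor for a bracket, which needs two. A flip keeps
the length, so if it lowers the potential it removes the only bad turn. -/
theorem ClosedLeftMove.spec {T : ReducingTriangulation D} {u : T.Vertex} {l l' : List D}
    (hl : T.IsWalk u l u) (h : T.ClosedLeftMove l l') :
    (∃ w, T.IsWalk w l' w) ∧ (∃ p ∈ cyclicCorners l, T.BadTurn p.1 p.2 ∧
      (T.turn p.1 p.2 = 0 ∨ T.turn p.1 p.2 = 1 ∨ T.turn p.1 p.2 = 2)) ∧
    (T.closedPotential l' < T.closedPotential l ∨
      (T.LeftHeart l ∧ T.closedPotential l' = T.closedPotential l ∧ T.AfterHeart l')) ∧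
    (T.AfterHeart l → T.cbad l' = 0) := by
  obtain ⟨s, s', post, hr, hr', h⟩ := h
  obtain ⟨w, hw⟩ := hl.isRotated hr
  obtain ⟨w', hw1, hw2⟩ := T.isWalk_append.1 hw
  have hs := h.shape hw1.adj
  have hw' : T.IsWalk w (s' ++ post) w := T.isWalk_append.2 ⟨w', hs.isWalk hw1, hw2⟩
  have hsp := hs.closedPotential_lt hw.cyclic_adj
  refine ⟨hw'.isRotated hr'.symm, ?_, ?_, ?_⟩
  · obtain ⟨p, hp, hb⟩ := hs.exists_bad
    exact ⟨p, (mem_cyclicCorners_of_isRotated hr p).2 (corners_subset_cyclicCorners s post hp), hb⟩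
  · rw [T.closedPotential_isRotated hr, T.closedPotential_isRotated hr']
    rcases hsp with hsp | ⟨rfl, hh, hle⟩
    · exact .inl hsp
    · simp only [List.append_nil] at *
      rcases hle.lt_or_eq with hlt | heq
      · exact .inl hlt
      · refine .inr ⟨?_, heq, hh.afterHeart.isRotated hr'.symm⟩
        obtain ⟨e, k, m, rfl, rfl, hr0, h4⟩ := hh
        obtain ⟨s₁, h1⟩ := T.path_eq_concat e (List.replicate k 3)
        obtain ⟨s₂, h2⟩ := T.path_eq_cons
          (T.rot 2 (T.rev (T.pathLast e (List.replicate k 3)))) (List.replicate m 3)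
        have h3 : ∀ n : ℕ, ∀ j ∈ List.replicate n (3 : ℤ), -3 ≤ j ∧ j ≤ 4 := by
          intro n j hj
          simp only [List.mem_replicate] at hj
          omega
        have t1 := T.turns_path e _ (h3 k)
        have t2 := T.turns_path (T.rot 2 (T.rev (T.pathLast e (List.replicate k 3)))) _ (h3 m)
        have hd1 := T.head?_path e (List.replicate k 3)
        have hd2 := T.getLast?_path
          (T.rot 2 (T.rev (T.pathLast e (List.replicate k 3)))) (List.replicate m 3)
        rw [path_append_cons, h1, h2] at hr
        rw [h1] at t1 hd1
        rw [h2] at t2 hd2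
        refine ⟨s₁, s₂, _, _, k, m, hr, t1,
          T.turn_rot_small (by norm_num) (by norm_num), ?_, t2, ?_⟩
        · rw [red_pathLast_three]; exact hr0
        · rw [hd1, hd2]
          intro f hf g hg
          simp only [Option.mem_def, Option.some.injEq] at hf hg
          subst hf; subst hg
          rw [← h4, pathLast_append, pathLast_cons]
  · intro hA
    have hA' := hA.isRotated hr
    have hbad : ∀ p ∈ corners s, T.BadTurn p.1 p.2 → T.turn p.1 p.2 = 2 := fun p hp =>
      hA'.turn_of_bad p (corners_subset_cyclicCorners s post hp)
    have h3 : ∀ p ∈ corners s, T.turn p.1 p.2 ≠ 3 := fun p hp =>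
      hA'.turn_ne_three p (corners_subset_cyclicCorners s post hp)
    rw [T.cbad_isRotated hr']
    have hcount := (countP_corners_le s post _).trans hA'.count_two
    have hflip : s'.length = s.length → T.closedPotential (s' ++ post) <
        T.closedPotential (s ++ post) → T.cbad (s' ++ post) = 0 := by
      intro h1 h2
      have := hA'.cbad_le
      simp only [closedPotential_eq, List.length_append, h1] at h2
      omega
    cases hs with
    | spur e =>
      have h0 : T.turn e (T.rev e) = 0 := by
        simpa using T.turn_rot_small (e := e) (j := 0) (by norm_num) (by norm_num)
      have := hbad (e, T.rev e) (by simp) (.inl h0)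
      simp [h0] at this
    | spike e =>
      have h0 := T.turn_rot_small (e := e) (j := 1) (by norm_num) (by norm_num)
      have := hbad (e, T.rot 1 (T.rev e)) (by simp) (.inr (.inl h0))
      simp [h0] at this
    | bracket e k =>
      have h0 := T.turn_rot_small (e := e) (j := 2) (by norm_num) (by norm_num)
      have h1 := T.turn_rot_small (e := T.pathLast e (2 :: List.replicate k 3)) (j := 2)
        (by norm_num) (by norm_num)
      rw [← List.cons_append, corners_path_append, corners_path_cons] at hcount
      simp only [pathLast_cons] at h1
      simp [h0, h1] at hcount
    | flip e k m hr0 ha hb =>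
      have hlen : (T.path (T.rot (-1) e) (flipTurns k m)).length =
          (T.path e (List.replicate k 3 ++ 2 :: List.replicate m 3)).length := by
        simp [length_flipTurns]; omega
      refine hflip hlen ?_
      rcases hsp with hsp | ⟨rfl, ⟨e', k', m', h5, -, -, h4⟩, -⟩
      · exact hsp
      -- A second heart flip would have `k' = m' = 0` since there is no turn `3`. The closed walk
      -- would then have two edges and a turn `4`, which `turn_ne_four` excludes.
      · exfalso
        have hk : k' = 0 := by
          by_contra hk
          obtain ⟨k, rfl⟩ := Nat.exists_eq_succ_of_ne_zero hk
          rw [h5, List.replicate_succ, List.cons_append, corners_path_cons] at h3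
          exact h3 (e', T.rot 3 (T.rev e')) (by simp)
            (T.turn_rot_small (by norm_num) (by norm_num))
        have hm : m' = 0 := by
          by_contra hm
          obtain ⟨m, rfl⟩ := Nat.exists_eq_succ_of_ne_zero hm
          rw [h5, List.replicate_succ', ← List.cons_append, ← List.append_assoc,
            corners_path_append] at h3
          exact h3 (T.pathLast e' (List.replicate k' 3 ++ 2 :: List.replicate m 3), T.rot 3 (T.rev
              (T.pathLast e' (List.replicate k' 3 ++ 2 :: List.replicate m 3)))) (by simp)
            (T.turn_rot_small (by norm_num) (by norm_num))
        subst hk; subst hm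
        simp only [List.append_nil] at hA'
        refine hA'.turn_ne_four (by rw [h5]; simp) (_, e') ?_ h4
        rw [h5]
        simp [cyclicCorners_cons, rot]

theorem closedPotential_reversal {u : T.Vertex} {l : List D} (hl : T.IsWalk u l u) :
    T.closedPotential (T.reversal l) = T.closedPotential l := by
  rw [closedPotential_eq, closedPotential_eq, length_reversal, T.cbad_reversal hl.cyclic_adj]

theorem corners_reversal {l : List D} {p : D × D} (hp : p ∈ corners (T.reversal l)) :
    (T.rev p.2, T.rev p.1) ∈ corners l := by
  induction l with
  | nil => simp at hp
  | cons a l ih => cases l with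
    | nil => simp [reversal] at hp
    | cons b l =>
      rw [reversal_cons, reversal_cons, List.append_assoc, List.singleton_append,
        corners_append_cons, List.mem_append, ← reversal_cons] at hp
      rw [corners_cons_cons, List.mem_cons]
      rcases hp with hp | hp
      · exact .inr (ih hp)
      · simp only [corners_cons_cons, corners_singleton, List.mem_singleton] at hp
        subst hp; simp

theorem cyclicCorners_reversal {l : List D} {p : D × D} (hp : p ∈ cyclicCorners (T.reversal l)) :
    (T.rev p.2, T.rev p.1) ∈ cyclicCorners l := by
  cases l with
  | nil => simp at hp
  | cons a l =>
    have h1 : (T.reversal (a :: l)).IsRotated (T.rev a :: T.reversal l) := by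
      rw [reversal_cons]
      exact isRotated_append_comm _ _
    rw [mem_cyclicCorners_of_isRotated h1, cyclicCorners_cons] at hp
    rw [cyclicCorners_cons]
    apply T.corners_reversal
    simpa [reversal] using hp

theorem ClosedMove.spec {T : ReducingTriangulation D} {u : T.Vertex} {l l' : List D}
    (hl : T.IsWalk u l u) (h : T.ClosedMove l l') :
    (∃ w, T.IsWalk w l' w) ∧ 0 < T.cbad l ∧
    (T.closedPotential l' < T.closedPotential l ∨
      (T.Heart l ∧ T.closedPotential l' = T.closedPotential l ∧
        (T.AfterHeart l' ∨ T.AfterHeart (T.reversal l')))) ∧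
    (T.AfterHeart l → T.cbad l' = 0) := by
  rcases h with h | h
  · obtain ⟨h1, ⟨p, hp, hb, -⟩, h3, h4⟩ := h.spec hl
    refine ⟨h1, Nat.pos_of_ne_zero fun h0 => T.cbad_eq_zero_iff.1 h0 p hp hb, ?_, h4⟩
    rcases h3 with h3 | ⟨h3, h5, h6⟩
    · exact .inl h3
    · exact .inr ⟨.inl h3, h5, .inl h6⟩
  · obtain ⟨⟨w, h1⟩, ⟨p, hp, hb, ht⟩, h3, -⟩ := h.spec hl.reversal
    have hadj := hl.reversal.cyclic_adj p hp
    have hp' := T.cyclicCorners_reversal hp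
    have hb' := (T.badTurn_rev_rev hadj).2 hb
    have h2 := h1.reversal
    have h4 := T.closedPotential_reversal h1
    rw [reversal_reversal] at h2 h4
    rw [← h4, T.closedPotential_reversal hl] at h3
    refine ⟨⟨w, h2⟩, Nat.pos_of_ne_zero fun h0 => T.cbad_eq_zero_iff.1 h0 _ hp' hb', ?_, ?_⟩
    · rcases h3 with h3 | ⟨h3, h5, h6⟩
      · exact .inl h3
      · exact .inr ⟨.inr h3, h5, .inr h6⟩
    -- A move on the reversal needs a bad turn `0`, `1` or `2` there, that is `0`, `-1` or `-2` in
    -- `l`, whereas every bad turn of `l` is `2`.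
    · intro hA
      exfalso
      have h5 : T.turn (T.rev p.2) (T.rev p.1) = 2 := hA.turn_of_bad _ hp' hb'
      have h6 := T.turn_rev_rev_small hadj (j := T.turn p.1 p.2) (by omega) (by omega)
      have h7 := h6.2 rfl
      omega

theorem AfterHeart.no_move {T : ReducingTriangulation D} {u : T.Vertex} {l l' l'' : List D}
    (hl : T.IsWalk u l u) (hA : T.AfterHeart l) (h : T.ClosedMove l l')
    (h' : T.ClosedMove l' l'') : False := by
  obtain ⟨⟨w, h1⟩, -, -, h2⟩ := h.spec hl
  have := (h'.spec h1).2.1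
  have := h2 hA
  omega

theorem ClosedMove.reversal {T : ReducingTriangulation D} {l l' : List D}
    (h : T.ClosedMove l l') : T.ClosedMove (T.reversal l) (T.reversal l') := by
  unfold ClosedMove at h ⊢
  rw [reversal_reversal, reversal_reversal]
  exact h.symm

/-- The extra `1` is for a move that keeps the potential. At most one move comes after it, by
`AfterHeart.no_move`, and the potential before it is at least `1` because a move requires a bad
turn. -/
theorem length_closed_chain_le {u : T.Vertex} {l : List D} (hl : T.IsWalk u l u)
    {L : List (List D)} (hL : List.IsChain T.ClosedMove (l :: L)) :
    L.length ≤ T.closedPotential l + 1 := by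
  induction L generalizing l u with
  | nil => simp
  | cons m L ih =>
    rw [List.isChain_cons_cons] at hL
    obtain ⟨⟨w, h1⟩, h0, h2, -⟩ := hL.1.spec hl
    rcases h2 with h2 | ⟨-, h3, h4⟩
    · have := ih h1 hL.2
      simp only [List.length_cons]; omega
    · have hpos : 2 ≤ T.closedPotential l + 1 := by
        rw [closedPotential_eq]; omega
      match L, hL.2 with
      | [], _ => simp
      | [a], _ => simpa using hpos
      | a :: b :: L, hL2 =>
        exfalso
        rw [List.isChain_cons_cons, List.isChain_cons_cons] at hL2
        rcases h4 with h4 | h4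
        · exact h4.no_move h1 hL2.1 hL2.2.1
        · exact h4.no_move h1.reversal hL2.1.reversal hL2.2.1.reversal

end ReducingTriangulation

/-! ### Homotopies of paths with propositionally equal endpoints -/

section Homotopies

variable {X : Type*} [TopologicalSpace X]

/-- The two paths have the same endpoints and are homotopic. -/
def PathHom {a b c d : X} (p : Path a b) (q : Path c d) : Prop :=
  ∃ (h₁ : a = c) (h₂ : b = d), p.Homotopic (q.cast h₁ h₂)

namespace PathHom

variable {a b c d e f : X} {p : Path a b} {q : Path c d} {r : Path e f}

theorem of_homotopic {p q : Path a b} (h : p.Homotopic q) : PathHom p q := ⟨rfl, rfl, h⟩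

theorem homotopic {p q : Path a b} (h : PathHom p q) : p.Homotopic q := h.2.2

theorem refl (p : Path a b) : PathHom p p := of_homotopic (.refl p)

theorem symm (h : PathHom p q) : PathHom q p := by
  obtain ⟨rfl, rfl, h⟩ := h
  exact of_homotopic h.symm

theorem trans (h : PathHom p q) (h' : PathHom q r) : PathHom p r := by
  obtain ⟨rfl, rfl, h⟩ := h
  obtain ⟨rfl, rfl, h'⟩ := h'
  exact of_homotopic (h.trans h')

theorem cast (p : Path a b) (h₁ : c = a) (h₂ : d = b) : PathHom (p.cast h₁ h₂) p := by
  subst h₁; subst h₂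
  exact refl _

theorem of_forall_eq (h : ∀ t, p t = q t) : PathHom p q := by
  obtain rfl : a = c := by simpa using h 0
  obtain rfl : b = d := by simpa using h 1
  obtain rfl : p = q := Path.ext (funext h)
  exact refl _

theorem comp {a b c a' b' c' : X} {p : Path a b} {q : Path b c} {p' : Path a' b'}
    {q' : Path b' c'} (h : PathHom p p') (h' : PathHom q q') :
    PathHom (p.trans q) (p'.trans q') := by
  obtain ⟨rfl, rfl, h⟩ := h
  obtain ⟨_, rfl, h'⟩ := h'
  exact of_homotopic (h.hcomp h')

theorem inv (h : PathHom p q) : PathHom p.symm q.symm := by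
  obtain ⟨rfl, rfl, h⟩ := h
  exact of_homotopic h.symm₂

theorem refl_comp (p : Path a b) : PathHom ((Path.refl a).trans p) p :=
  of_homotopic (Path.Homotopic.refl_trans p)

theorem comp_refl (p : Path a b) : PathHom (p.trans (Path.refl b)) p :=
  of_homotopic (Path.Homotopic.trans_refl p)

theorem comp_inv (p : Path a b) : PathHom (p.trans p.symm) (Path.refl a) :=
  of_homotopic (Path.Homotopic.trans_symm p)

theorem assoc {a b c d : X} (p : Path a b) (q : Path b c) (r : Path c d) :
    PathHom ((p.trans q).trans r) (p.trans (q.trans r)) :=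
  of_homotopic (Path.Homotopic.trans_assoc p q r)

end PathHom

namespace FreelyHomotopic

variable {x y z : X}

theorem iff_homotopicWith {p : Path x x} {q : Path y y} : FreelyHomotopic p q ↔
    ContinuousMap.HomotopicWith (p : C(I, X)) (q : C(I, X)) fun f => f 0 = f 1 := by
  constructor
  · rintro ⟨H, h0, h1, h⟩
    exact ⟨⟨⟨H, h0, h1⟩, h⟩⟩
  · rintro ⟨H⟩
    exact ⟨H.toContinuousMap, H.apply_zero, H.apply_one, H.prop⟩

theorem symm {p : Path x x} {q : Path y y} (h : FreelyHomotopic p q) : FreelyHomotopic q p := by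
  rw [iff_homotopicWith] at h ⊢
  exact h.symm

theorem trans {p : Path x x} {q : Path y y} {r : Path z z} (h : FreelyHomotopic p q)
    (h' : FreelyHomotopic q r) : FreelyHomotopic p r := by
  rw [iff_homotopicWith] at h h' ⊢
  exact h.trans h'

theorem of_pathHom {p : Path x x} {q : Path y y} (h : PathHom p q) : FreelyHomotopic p q := by
  obtain ⟨rfl, _, ⟨F⟩⟩ := h
  exact ⟨F.toContinuousMap, F.apply_zero, F.apply_one, fun t =>
    (F.source t).trans (F.target t).symm⟩

theorem inv {p : Path x x} {q : Path y y} (h : FreelyHomotopic p q) :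
    FreelyHomotopic p.symm q.symm := by
  obtain ⟨H, h0, h1, h⟩ := h
  refine ⟨H.comp ⟨fun s => (s.1, σ s.2), by fun_prop⟩, fun s => h0 _, fun s => h1 _, fun t => ?_⟩
  simpa using (h t).symm

theorem of_path (γ : Path x y) : FreelyHomotopic (Path.refl x) (Path.refl y) :=
  ⟨⟨fun s => γ s.1, by fun_prop⟩, fun s => by simp, fun s => by simp, fun t => rfl⟩

theorem extend_trans (p : Path x y) (q : Path y z) {t : ℝ} (ht : t ∈ I) :
    (p.trans q).extend t = if t ≤ 1 / 2 then p.extend (2 * t) else q.extend (2 * t - 1) := by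
  rw [Path.extend_apply _ ht]
  rfl

/-- The base point slides along the loop during half a period, at time `t` by `t / 2`. The
fractional part jumps at integers, which is harmless because the loop has the same value at `0` and
at `1`. -/
theorem comm (p : Path x y) (q : Path y x) :
    FreelyHomotopic (p.trans q) (q.trans p) := by
  have hc : Continuous fun s : ℝ => (p.trans q).extend (Int.fract s) :=
    ContinuousOn.comp_fract'' ((p.trans q).continuous_extend.continuousOn) (by simp)
  refine ⟨⟨fun s => (p.trans q).extend (Int.fract ((s.2 : ℝ) + (s.1 : ℝ) / 2)),
    hc.comp (by fun_prop)⟩, fun s => ?_, fun s => ?_, fun t => ?_⟩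
  · simp only [ContinuousMap.coe_mk, Set.Icc.coe_zero, zero_div, add_zero]
    rcases eq_or_lt_of_le s.2.2 with h | h
    · have : s = 1 := Subtype.ext h
      subst this
      simp
    · rw [Int.fract_eq_self.2 ⟨s.2.1, h⟩]
      simp
  · simp only [ContinuousMap.coe_mk, Set.Icc.coe_one]
    have h0 := s.2.1
    have h1 := s.2.2
    rw [← Path.extend_apply (q.trans p) s.2, extend_trans _ _ s.2]
    rcases lt_or_ge (s : ℝ) (1 / 2) with h | h
    · rw [Int.fract_eq_self.2 ⟨by linarith, by linarith⟩,
        extend_trans _ _ ⟨by linarith, by linarith⟩, if_pos h.le]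
      split_ifs with h2
      · have : (s : ℝ) = 0 := by linarith
        simp [this]
      · congr 1; ring
    · have h3 : Int.fract ((s : ℝ) + 1 / 2) = s - 1 / 2 := by
        rw [Int.fract_eq_iff]
        exact ⟨by linarith, by linarith, 1, by push_cast; ring⟩
      rw [h3, extend_trans _ _ ⟨by linarith, by linarith⟩, if_pos (by linarith)]
      split_ifs with h2
      · have : (s : ℝ) = 1 / 2 := by linarith
        simp [this]
      · congr 1; ring
  · simp only [ContinuousMap.coe_mk, Set.Icc.coe_zero, Set.Icc.coe_one, zero_add]
    rw [add_comm (1 : ℝ), Int.fract_add_one]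

end FreelyHomotopic

end Homotopies

/-! ### Homotopies in the closed triangle -/

namespace Triangle

instance : ContractibleSpace Triangle :=
  (convex_stdSimplex ℝ (Fin 3)).contractibleSpace ⟨_, (side 0).2⟩

theorem pathHom {a b c d : Triangle} (p : Path a b) (q : Path c d) (h₁ : a = c) (h₂ : b = d) :
    PathHom p q :=
  ⟨h₁, h₂, SimplyConnectedSpace.paths_homotopic _ _⟩

theorem rotate_rotate_rotate (x : Triangle) : rotate (rotate (rotate x)) = x := by
  apply Subtype.ext
  funext i
  fin_cases i <;> rfl

theorem continuous_rotate : Continuous rotate := by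
  refine Continuous.subtype_mk (continuous_pi fun i => ?_) _
  have h : ∀ j : Fin 3, Continuous fun x : Triangle => x.1 j := fun j =>
    (continuous_apply j).comp continuous_subtype_val
  fin_cases i
  · exact h 1
  · exact h 2
  · exact h 0

/-- The side from corner `0` to corner `1`, as a path. -/
def sidePath : Path (side 0) (side 1) := ⟨⟨side, continuous_side⟩, rfl, rfl⟩

theorem rotate_rotate_side_zero : rotate (rotate (side 0)) = side 1 := by
  rw [← rotate_side_one, rotate_rotate_rotate]

end Triangle

theorem PathHom.map {X Y : Type*} [TopologicalSpace X] [TopologicalSpace Y] {a b c d : X}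
    {p : Path a b} {q : Path c d} (h : PathHom p q) {f : X → Y} (hf : Continuous f) :
    PathHom (p.map hf) (q.map hf) := by
  obtain ⟨rfl, rfl, h⟩ := h
  exact PathHom.of_homotopic (h.map ⟨f, hf⟩)

/-! ### Homotopies of lists of darts on the surface -/

namespace ReducingTriangulation

variable {D : Type*} (T : ReducingTriangulation D)

theorem toSurface_face (d : D) (x : Triangle) :
    T.toSurface (T.face d) x = T.toSurface d (Triangle.rotate (Triangle.rotate x)) := by
  have h := Quot.sound (Glue.same_face (T := T) d (Triangle.rotate (Triangle.rotate x)))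
  rw [Triangle.rotate_rotate_rotate] at h
  exact h.symm

theorem dartPath_rev (d : D) : PathHom (T.dartPath (T.rev d)) (T.dartPath d).symm := by
  refine PathHom.of_forall_eq fun t => ?_
  have h := Quot.sound (Glue.edge (T := T) d (σ t))
  rw [unitInterval.symm_symm] at h
  exact h.symm

/-- Two lists of darts that, as walks, are homotopic. -/
def ListHom (l l' : List D) : Prop :=
  ∀ u v (h : T.IsWalk u l v), ∃ h' : T.IsWalk u l' v,
    PathHom (T.listPath u l v h) (T.listPath u l' v h')

theorem listPath_nil {u v : T.Vertex} (h : T.IsWalk u [] v) :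
    PathHom (T.listPath u [] v h) (Path.refl (T.point u)) := PathHom.cast _ _ _

theorem listPath_cons {u v : T.Vertex} {d : D} {l : List D} (h : T.IsWalk u (d :: l) v) :
    PathHom (T.listPath u (d :: l) v h) ((T.dartPath d).trans (T.listPath (T.tgt d) l v h.2)) :=
  PathHom.cast _ _ _

theorem listPath_singleton {u v : T.Vertex} {d : D} (h : T.IsWalk u [d] v) :
    PathHom (T.listPath u [d] v h) (T.dartPath d) :=
  (T.listPath_cons h).trans (((PathHom.refl _).comp (T.listPath_nil h.2)).trans (.comp_refl _))

theorem listPath_append {u v w : T.Vertex} {l l' : List D} (h : T.IsWalk u l w)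
    (h' : T.IsWalk w l' v) (h'' : T.IsWalk u (l ++ l') v) :
    PathHom (T.listPath u (l ++ l') v h'') ((T.listPath u l w h).trans (T.listPath w l' v h')) := by
  induction l generalizing u with
  | nil =>
    obtain rfl : u = w := id h
    exact ((T.listPath_nil h).comp (.refl _)).trans (.refl_comp _) |>.symm
  | cons d l ih =>
    have h2 : T.IsWalk (T.tgt d) (l ++ l') v := h''.2
    exact (T.listPath_cons h'').trans (((PathHom.refl _).comp (ih h.2 h2)).trans
      ((PathHom.assoc _ _ _).symm.trans ((T.listPath_cons h).symm.comp (.refl _))))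

namespace ListHom

variable {T}
variable {l l' l'' : List D}

theorem refl (l : List D) : T.ListHom l l := fun _ _ h => ⟨h, .refl _⟩

theorem trans (h : T.ListHom l l') (h' : T.ListHom l' l'') : T.ListHom l l'' := fun u v hl => by
  obtain ⟨h1, h2⟩ := h u v hl
  obtain ⟨h3, h4⟩ := h' u v h1
  exact ⟨h3, h2.trans h4⟩

theorem append {m m' : List D} (h : T.ListHom l l') (h' : T.ListHom m m') :
    T.ListHom (l ++ m) (l' ++ m') := fun u v hl => by
  obtain ⟨w, h1, h2⟩ := T.isWalk_append.1 hl
  obtain ⟨h3, h4⟩ := h _ _ h1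
  obtain ⟨h5, h6⟩ := h' _ _ h2
  have hl' := T.isWalk_append.2 ⟨w, h3, h5⟩
  exact ⟨hl', (T.listPath_append h1 h2 hl).trans
    ((h4.comp h6).trans (T.listPath_append h3 h5 hl').symm)⟩

theorem mid (h : T.ListHom l l') (p q : List D) : T.ListHom (p ++ l ++ q) (p ++ l' ++ q) :=
  ((refl p).append h).append (refl q)

end ListHom

theorem listHom_rev (e : D) : T.ListHom [e, T.rev e] [] := fun u v h => by
  obtain ⟨rfl, -, rfl⟩ := id h
  have h' : T.IsWalk (T.src e) [] (T.tgt (T.rev e)) := by simp [IsWalk, tgt]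
  refine ⟨h', (T.listPath_cons h).trans (PathHom.trans ?_ (T.listPath_nil h').symm)⟩
  exact ((PathHom.refl _).comp ((T.listPath_singleton h.2).trans (T.dartPath_rev e))).trans
    (.comp_inv _)

theorem dartPath_face (e : D) : PathHom (T.dartPath (T.face e))
    ((Triangle.sidePath.map (Triangle.continuous_rotate.comp Triangle.continuous_rotate)).map
      (T.continuous_toSurface e)) :=
  PathHom.of_forall_eq fun _ => T.toSurface_face e _

theorem dartPath_face_face (e : D) : PathHom (T.dartPath (T.face (T.face e)))
    ((Triangle.sidePath.map Triangle.continuous_rotate).map (T.continuous_toSurface e)) :=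
  PathHom.of_forall_eq fun t => by
    refine (T.toSurface_face (T.face e) _).trans ((T.toSurface_face e _).trans ?_)
    rw [Triangle.rotate_rotate_rotate]
    rfl

/-- Both sides are images of paths with the same endpoints in one closed triangle, where such paths
are homotopic. The map `toSurface` carries the homotopy to the surface. -/
theorem dartPath_triangle (e : D) (h : T.point (T.tgt e) = T.point (T.src (T.face e))) :
    PathHom ((T.dartPath e).trans ((T.dartPath (T.face e)).cast h rfl))
      (T.dartPath (T.face (T.face e))).symm := by
  have e1 : Triangle.side 1 = Triangle.rotate (Triangle.rotate (Triangle.side 0)) :=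
    Triangle.rotate_rotate_side_zero.symm
  have h1 : PathHom (Triangle.sidePath.trans ((Triangle.sidePath.map
      (Triangle.continuous_rotate.comp Triangle.continuous_rotate)).cast e1 rfl))
      (Triangle.sidePath.map Triangle.continuous_rotate).symm :=
    Triangle.pathHom _ _ Triangle.rotate_side_one.symm (by
      simp [Triangle.rotate_side_one])
  have h2 := h1.map (T.continuous_toSurface e)
  rw [Path.map_trans, Path.map_symm] at h2
  refine PathHom.trans ?_ (h2.trans (T.dartPath_face_face e).inv.symm)
  refine PathHom.comp (.of_forall_eq fun _ => rfl) ?_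
  exact (PathHom.cast _ _ _).trans ((T.dartPath_face e).trans (.of_forall_eq fun _ => rfl))

theorem tgt_eq_src_face (e : D) : T.tgt e = T.src (T.face e) :=
  T.tgt_eq_src_iff.2 ⟨1, (T.cw_eq_rot _).symm⟩

theorem listHom_face (e : D) : T.ListHom [e, T.face e] [T.rev (T.face (T.face e))] := by
  intro u v h
  obtain ⟨rfl, -, rfl⟩ := id h
  have e1 : T.tgt (T.face (T.face e)) = T.src e := by
    rw [tgt_eq_src_face]
    congr 1
    exact T.face_face_face e
  have h' : T.IsWalk (T.src e) [T.rev (T.face (T.face e))] (T.tgt (T.face e)) :=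
    ⟨e1.symm, by rw [tgt, rev_rev', ← tgt_eq_src_face]; rfl⟩
  refine ⟨h', (T.listPath_cons h).trans (PathHom.trans ?_ (T.listPath_singleton h').symm)⟩
  have hp : T.point (T.tgt e) = T.point (T.src (T.face e)) := by rw [tgt_eq_src_face]
  refine PathHom.trans ?_ ((T.dartPath_triangle e hp).trans (T.dartPath_rev _).symm)
  exact (PathHom.refl _).comp ((T.listPath_singleton h.2).trans (PathHom.cast _ _ _).symm)

theorem face_face_face' (e : D) : T.face (T.face (T.face e)) = e := T.face_face_face e

/-- The spur `face e`, `rev (face e)` is inserted after `e`, and then the first two sides are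
replaced by the third. -/
theorem listHom_split (e : D) :
    T.ListHom [e] [T.rev (T.face (T.face e)), T.rev (T.face e)] := by
  intro u v h
  obtain ⟨rfl, rfl⟩ := id h
  have h' : T.IsWalk (T.src e) [T.rev (T.face (T.face e)), T.rev (T.face e)] (T.tgt e) := by
    refine ⟨?_, ?_, ?_⟩
    · rw [← tgt, tgt_eq_src_face, face_face_face']
    · rw [tgt, rev_rev', ← tgt_eq_src_face]; rfl
    · rw [tgt, rev_rev', ← tgt_eq_src_face]; rfl
  refine ⟨h', ?_⟩
  have h0 : T.IsWalk (T.src e) [e, T.face e] (T.tgt (T.face e)) :=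
    ⟨rfl, tgt_eq_src_face T e, rfl⟩
  obtain ⟨h1, h2⟩ := T.listHom_face e _ _ h0
  have h3 : T.IsWalk (T.tgt (T.face e)) [T.rev (T.face e)] (T.tgt e) :=
    ⟨rfl, by rw [tgt, rev_rev', ← tgt_eq_src_face]; rfl⟩
  have h4 : T.IsWalk (T.tgt e) [T.face e] (T.tgt (T.face e)) := ⟨tgt_eq_src_face T e, rfl⟩
  have h5 : T.IsWalk (T.src e) ([e, T.face e] ++ [T.rev (T.face e)]) (T.tgt e) :=
    T.isWalk_append.2 ⟨_, h0, h3⟩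
  have h6 := (T.listPath_append h0 h3 h5).symm.trans
    ((T.listPath_append (l := [e]) h (l' := [T.face e, T.rev (T.face e)]) h5.2 h5))
  obtain ⟨h7, h8⟩ := T.listHom_rev (T.face e) _ _ h5.2
  have h9 := T.listPath_append (l := [T.rev (T.face (T.face e))]) h1 h3 h'
  refine PathHom.symm (h9.trans ((h2.symm.comp (.refl _)).trans (h6.trans ?_)))
  exact ((PathHom.refl _).comp (h8.trans (T.listPath_nil h7))).trans (.comp_refl _)

/-! ### Reduction moves are homotopies -/

theorem listHom_push (e : D) :
    T.ListHom [T.rev (T.face e), T.rot 2 (T.rev e)] [T.push e] := by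
  have h := T.listHom_face (T.rev (T.face e))
  have h1 : T.face (T.rev (T.face e)) = T.rot 2 (T.rev e) := by
    simp [face, cw_eq_rot]
  rwa [← push, h1] at h

/-- Each edge is split along its left triangle. The two inner edges that then meet at a vertex are
inverse to each other if the turn is `2`, and are two sides of the middle triangle if the turn is
`3`. -/
theorem listHom_strip (e : D) (js : List ℤ) (h : ∀ j ∈ js, j = 2 ∨ j = 3) :
    T.ListHom (T.path e js) (T.leftSide (T.path e js)) := by
  induction js generalizing e with
  | nil => exact T.listHom_split e
  | cons j js ih =>
    have h1 := ih (T.rot j (T.rev e)) fun i hi => h i (by simp [hi])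
    obtain ⟨l, hl⟩ := T.path_eq_cons (T.rot j (T.rev e)) js
    rw [path_cons, hl, leftSide, leftTail]
    rw [hl, leftSide] at h1
    have h2 : T.ListHom (e :: T.rot j (T.rev e) :: l) ([T.rev (T.face (T.face e))] ++
        [T.rev (T.face e), T.rev (T.face (T.face (T.rot j (T.rev e))))] ++
        T.leftTail (T.rot j (T.rev e) :: l)) :=
      (T.listHom_split e).append h1
    rw [rev_face_face_eq T (T.rot j _), rot_rot] at h2
    refine h2.trans ?_
    have ht : T.turn e (T.rot j (T.rev e)) = j :=
      T.turn_rot_small (by rcases h j (by simp) with rfl | rfl <;> norm_num)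
        (by rcases h j (by simp) with rfl | rfl <;> norm_num)
    rw [ht]
    rcases h j (by simp) with rfl | rfl
    · have h3 := (T.listHom_rev (T.rev (T.face e))).mid [T.rev (T.face (T.face e))]
        (T.leftTail (T.rot 2 (T.rev e) :: l))
      rw [rev_rev', face, cw_eq_rot] at h3
      exact h3
    · exact (T.listHom_push e).mid [T.rev (T.face (T.face e))]
        (T.leftTail (T.rot 3 (T.rev e) :: l))

theorem Shape.listHom {T : ReducingTriangulation D} {b a : Option D} {s s' : List D}
    (h : T.Shape b a s s') : T.ListHom s s' := by
  cases h with
  | spur e => exact T.listHom_rev e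
  | spike e =>
    have h := T.listHom_face e
    rw [rev_face_face_eq, face, cw_eq_rot] at h
    exact h
  | bracket e k =>
    rw [← leftSide_bracket]
    refine T.listHom_strip e _ fun j hj => ?_
    simp only [List.mem_cons, List.mem_append, List.mem_replicate, List.not_mem_nil,
      or_false] at hj
    omega
  | flip e k m hr ha hb =>
    rw [← leftSide_flip]
    exact T.listHom_strip e _ mem_flip_turns

theorem listPath_reversal {u v : T.Vertex} {l : List D} (h : T.IsWalk u l v)
    (h' : T.IsWalk v (T.reversal l) u) :
    PathHom (T.listPath v (T.reversal l) u h') (T.listPath u l v h).symm := by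
  induction l generalizing u with
  | nil =>
    obtain rfl : u = v := id h
    have := (T.listPath_nil h).symm.inv
    rw [Path.refl_symm] at this
    exact (T.listPath_nil h').trans this
  | cons d l ih =>
    have h1 : T.IsWalk v (T.reversal l) (T.tgt d) := h.2.reversal
    have h2 : T.IsWalk (T.tgt d) [T.rev d] u := ⟨rfl, by rw [h.1, tgt, rev_rev']; rfl⟩
    have h3 : T.IsWalk v (T.reversal l ++ [T.rev d]) u := T.isWalk_append.2 ⟨_, h1, h2⟩
    have h4 := T.listPath_append h1 h2 h3
    have h5 := (T.listPath_cons h).inv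
    rw [Path.trans_symm] at h5
    have h6 : PathHom (T.listPath v (T.reversal (d :: l)) u h')
        (T.listPath v (T.reversal l ++ [T.rev d]) u h3) :=
      PathHom.of_forall_eq fun t => by congr 2; exact T.reversal_cons d l
    refine h6.trans (h4.trans (PathHom.trans ?_ h5.symm))
    exact (ih h.2 h1).comp ((T.listPath_singleton h2).trans (T.dartPath_rev d))

theorem LeftMove.pathHom {T : ReducingTriangulation D} {u v : T.Vertex} {l l' : List D}
    (h : T.LeftMove l l') (hl : T.IsWalk u l v) (hl' : T.IsWalk u l' v) :
    PathHom (T.listPath u l v hl) (T.listPath u l' v hl') := by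
  obtain ⟨pre, s, s', post, rfl, rfl, h⟩ := h
  obtain ⟨w, hl1, hl2⟩ := T.isWalk_append.1 hl
  obtain ⟨w', hl1, hl3⟩ := T.isWalk_append.1 hl1
  obtain ⟨h1, h2⟩ := (h.shape hl3.adj).listHom.mid pre post _ _ hl
  exact h2

theorem Move.pathHom {T : ReducingTriangulation D} {u v : T.Vertex} {l l' : List D}
    (h : T.Move l l') (hl : T.IsWalk u l v) (hl' : T.IsWalk u l' v) :
    PathHom (T.listPath u l v hl) (T.listPath u l' v hl') := by
  rcases h with h | h
  · exact h.pathHom hl hl'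
  · have h1 := (T.listPath_reversal hl hl.reversal).symm.trans
      ((h.pathHom hl.reversal hl'.reversal).trans (T.listPath_reversal hl' hl'.reversal))
    simpa only [Path.symm_symm] using h1.inv

/-- Two lists of darts that, as closed walks, are freely homotopic. -/
def FreeHom (l l' : List D) : Prop :=
  ∀ u (h : T.IsWalk u l u) u' (h' : T.IsWalk u' l' u'),
    FreelyHomotopic (T.listPath u l u h) (T.listPath u' l' u' h')

theorem exists_path_point (u v : T.Vertex) : Nonempty (Path (T.point u) (T.point v)) := by
  obtain ⟨d, rfl⟩ := Quotient.exists_rep u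
  obtain ⟨d', rfl⟩ := Quotient.exists_rep v
  change Joined (T.point (T.src d)) (T.point (T.src d'))
  induction T.connected d d' with
  | refl => exact .refl _
  | tail h h' ih =>
    rename_i x y
    refine ih.trans ?_
    rcases h' with rfl | rfl
    · exact ⟨T.dartPath x⟩
    · rw [cw_eq_rot, src_rot]

/-- A nonempty list determines its base vertex. An empty list does not, and constant loops at
different vertices are freely homotopic because the surface is path connected between its vertices.
-/
theorem freeHom_refl (l : List D) : T.FreeHom l l := by
  intro u hl u' hl'
  cases l with
  | nil =>
    obtain ⟨γ⟩ := T.exists_path_point u u'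
    exact ((FreelyHomotopic.of_pathHom (T.listPath_nil hl)).trans (.of_path γ)).trans
      (FreelyHomotopic.of_pathHom (T.listPath_nil hl')).symm
  | cons d l =>
    obtain rfl : u = u' := hl.1.trans hl'.1.symm
    exact FreelyHomotopic.of_pathHom (.refl _)

theorem freeHom_append (a b : List D) : T.FreeHom (a ++ b) (b ++ a) := by
  intro u hl u' hl'
  obtain ⟨w, h1, h2⟩ := T.isWalk_append.1 hl
  have h3 : T.IsWalk w (b ++ a) w := T.isWalk_append.2 ⟨u, h2, h1⟩
  refine FreelyHomotopic.trans ?_ (T.freeHom_refl (b ++ a) w h3 u' hl')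
  exact ((FreelyHomotopic.of_pathHom (T.listPath_append h1 h2 hl)).trans (.comm _ _)).trans
    (FreelyHomotopic.of_pathHom (T.listPath_append h2 h1 h3)).symm

theorem freeHom_isRotated {l l' : List D} (h : l.IsRotated l') : T.FreeHom l l' := by
  obtain ⟨n, hn, rfl⟩ := List.isRotated_iff_mod.1 h
  rw [List.rotate_eq_drop_append_take hn]
  have := T.freeHom_append (l.take n) (l.drop n)
  rwa [List.take_append_drop] at this

theorem freeHom_mid {s s' : List D} (h : T.ListHom s s') (post : List D) :
    T.FreeHom (s ++ post) (s' ++ post) := by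
  intro u hl u' hl'
  obtain ⟨h1, h2⟩ := h.append (.refl post) u u hl
  exact (FreelyHomotopic.of_pathHom h2).trans (T.freeHom_refl _ u h1 u' hl')

theorem ClosedLeftMove.freeHom {T : ReducingTriangulation D} {l l' : List D}
    (h : T.ClosedLeftMove l l') : T.FreeHom l l' := by
  intro u hl u' hl'
  obtain ⟨s, s', post, hr, hr', h⟩ := h
  obtain ⟨w, hw⟩ := hl.isRotated hr
  obtain ⟨w', hw'⟩ := hl'.isRotated hr'
  obtain ⟨x, hw1, -⟩ := T.isWalk_append.1 hw
  exact ((T.freeHom_isRotated hr u hl w hw).trans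
    (T.freeHom_mid (h.shape hw1.adj).listHom post w hw w' hw')).trans
      (T.freeHom_isRotated hr'.symm w' hw' u' hl')

theorem FreeHom.of_reversal {T : ReducingTriangulation D} {l l' : List D}
    (h : T.FreeHom (T.reversal l) (T.reversal l')) : T.FreeHom l l' := by
  intro u hl u' hl'
  have h1 := h u hl.reversal u' hl'.reversal
  have h2 := ((FreelyHomotopic.of_pathHom (T.listPath_reversal hl hl.reversal)).symm.trans
    h1).trans (FreelyHomotopic.of_pathHom (T.listPath_reversal hl' hl'.reversal))
  simpa only [Path.symm_symm] using h2.inv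

theorem ClosedMove.freeHom {T : ReducingTriangulation D} {l l' : List D}
    (h : T.ClosedMove l l') : T.FreeHom l l' := by
  rcases h with h | h
  · exact h.freeHom
  · exact .of_reversal h.freeHom

theorem leftTail_three (e : D) (k : ℕ) :
    T.leftTail (T.path e (List.replicate k 3)) =
      (T.path e (List.replicate k 3)).dropLast.map T.push ++
        [T.rev (T.face (T.pathLast e (List.replicate k 3)))] := by
  induction k generalizing e with
  | zero => simp [leftTail]
  | succ k ih =>
    obtain ⟨l, hl⟩ := T.path_eq_cons (T.rot 3 (T.rev e)) (List.replicate k 3)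
    rw [List.replicate_succ, path_cons, pathLast_cons, hl, leftTail,
      T.turn_rot_small (by norm_num) (by norm_num), ← hl, ih]
    rw [if_pos rfl, hl, List.dropLast_cons_cons, ← hl]
    simp

/-- The final move, on a closed walk whose turns are all `3`. -/
theorem final_spec {u : T.Vertex} {l : List D} (hl : T.IsWalk u l u) (hne : l ≠ [])
    (h3 : ∀ p ∈ cyclicCorners l, T.turn p.1 p.2 = 3) :
    ∃ w, T.IsWalk w (l.map T.push) w ∧ T.FreeHom l (l.map T.push) := by
  obtain ⟨e, t, rfl⟩ := List.exists_cons_of_ne_nil hne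
  rw [cyclicCorners_cons] at h3
  -- Going once around and repeating `e` turns the cyclic condition into a path with prescribed
  -- rotations.
  have h4 : T.turns (e :: (t ++ [e])) = List.replicate (t.length + 1) 3 := by
    rw [List.eq_replicate_iff]
    refine ⟨by simp [turns, corners], fun j hj => ?_⟩
    rw [turns, List.mem_map] at hj
    obtain ⟨p, hp, rfl⟩ := hj
    exact h3 p hp
  have h5 := T.eq_path_of_turns h4 fun j hj => by
    simp only [List.mem_replicate] at hj; omega
  obtain ⟨s₂, h6⟩ := T.path_eq_concat e (List.replicate t.length 3)
  rw [List.replicate_succ', path_append_cons, ← List.cons_append] at h5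
  obtain ⟨h7, h8⟩ := List.append_inj' h5 rfl
  set z := T.pathLast e (List.replicate t.length 3) with hz
  simp only [path_nil, List.cons.injEq, and_true] at h8
  have h9 : T.ListHom (e :: t) _ := h7 ▸ T.listHom_strip e (List.replicate t.length 3)
    fun j hj => by simp only [List.mem_replicate] at hj; omega
  have h10 := T.leftTail_three e t.length
  rw [← h7, ← hz] at h10
  set M := (e :: t).dropLast.map T.push
  have h11 : T.leftSide (e :: t) = T.rev (T.face (T.face e)) :: (M ++ [T.rev (T.face z)]) := by
    rw [leftSide, h10]
  have h12 : (e :: t).map T.push = M ++ [T.push z] := by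
    rw [h7, h6, List.map_append]
    simp [M, h7, h6]
  rw [h11] at h9
  obtain ⟨w1, -⟩ := h9 u u hl
  -- The strip is open at the vertex where the closed walk was cut. The rotation brings together the
  -- two inner edges at this vertex, and since the turn there is also `3`, they are pushed across a
  -- middle triangle.
  have r1 : (T.rev (T.face (T.face e)) :: (M ++ [T.rev (T.face z)])).IsRotated
      ([T.rev (T.face z), T.rev (T.face (T.face e))] ++ M) :=
    isRotated_append_comm (T.rev (T.face (T.face e)) :: M) [T.rev (T.face z)]
  obtain ⟨w, w2⟩ := w1.isRotated r1
  have h13 : T.ListHom [T.rev (T.face z), T.rev (T.face (T.face e))] [T.push z] := by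
    have := T.listHom_push z
    rwa [rev_face_face_eq, h8, rot_rot]
  obtain ⟨w3, -⟩ := h13.append (.refl M) w w w2
  have r2 : ([T.push z] ++ M).IsRotated ((e :: t).map T.push) := by
    rw [h12]
    exact isRotated_append_comm _ _
  obtain ⟨w', w4⟩ := w3.isRotated r2
  refine ⟨w', w4, fun v hv v' hv' => ?_⟩
  have f1 := T.freeHom_mid h9 []
  simp only [List.append_nil] at f1
  exact (((f1 v hv u w1).trans (T.freeHom_isRotated r1 u w1 w w2)).trans
    (T.freeHom_mid h13 M w w2 w w3)).trans (T.freeHom_isRotated r2 w w3 v' hv')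

end ReducingTriangulation

namespace ReducingTriangulation

variable {D : Type*} (T : ReducingTriangulation D)

/-! ### The mirror image -/

theorem iterate_cw_inv (n : ℕ) (d : D) : (T.cw⁻¹ : Equiv.Perm D)^[n] d = T.rot (-n) d := by
  rw [Equiv.Perm.iterate_eq_pow, rot, zpow_neg, zpow_natCast, inv_pow]

theorem cw_inv_eq_rot (d : D) : (T.cw⁻¹ : Equiv.Perm D) d = T.rot (-1) d := by simp [rot]

/-- The triangulation with the opposite orientation, and the opposite colours. -/
def mirror : ReducingTriangulation D where
  rev := T.rev
  cw := T.cw⁻¹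
  red := T.red
  rev_rev := T.rev_rev
  rev_ne := T.rev_ne
  face_ne d h := T.face_ne (T.rev d) (by
    rw [rev_rev']; exact (Equiv.Perm.inv_eq_iff_eq.1 h).symm)
  face_face_face d := by
    have h := T.face_face_face (T.rev (T.cw⁻¹ (T.rev (T.cw⁻¹ (T.rev (T.cw⁻¹ (T.rev d)))))))
    simp only [rev_rev', cw_inv_eq_rot, cw_eq_rot, rot_rot] at h ⊢
    norm_num at h
    exact T.rev_injective h.symm
  red_face d := by
    have h := T.red_rot_neg_one (T.rev d)
    rw [T.red_rev, Bool.not_not] at h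
    simpa [rot] using h
  red_rev := T.red_rev
  eight_le_degree d := by
    have h : Function.minimalPeriod T.cw d ∣ Function.minimalPeriod (T.cw⁻¹ : Equiv.Perm D) d := by
      have h := Function.iterate_minimalPeriod (f := (T.cw⁻¹ : Equiv.Perm D)) (x := d)
      rw [iterate_cw_inv, rot_eq_self_iff, dvd_neg] at h
      exact_mod_cast h
    have h0 : 0 < Function.minimalPeriod (T.cw⁻¹ : Equiv.Perm D) d := by
      refine Function.IsPeriodicPt.minimalPeriod_pos
        (n := T.degree d) (by have := T.eight_le d; omega) ?_
      rw [Function.IsPeriodicPt, Function.IsFixedPt, iterate_cw_inv, rot_eq_self_iff, dvd_neg]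
    exact (T.eight_le_degree d).trans (Nat.le_of_dvd h0 h)
  connected d d' := by
    -- The degree is finite, so one clockwise step is also reached by degree minus one
    -- counterclockwise steps.
    have hcw : ∀ x, Relation.ReflTransGen
        (fun x y => y = T.rev x ∨ y = (T.cw⁻¹ : Equiv.Perm D) x) x (T.cw x) := by
      intro x
      have h : ∀ n : ℕ, Relation.ReflTransGen
          (fun x y => y = T.rev x ∨ y = (T.cw⁻¹ : Equiv.Perm D) x) x (T.rot (-n) x) := by
        intro n
        induction n with
        | zero => simpa using .refl
        | succ n ih =>
          refine ih.tail (.inr ?_)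
          have : (T.cw⁻¹ : Equiv.Perm D) (T.rot (-n) x) = T.rot (-1) (T.rot (-n) x) := by
            simp [rot]
          rw [this, rot_rot]
          push_cast
          ring_nf
      have h1 := h (T.degree x - 1)
      have h8 := T.eight_le x
      rwa [cw_eq_rot, ← (T.rot_eq_rot_iff (-((T.degree x - 1 : ℕ) : ℤ)) 1 x).2]
      exact ⟨-1, by push_cast [show 1 ≤ T.degree x by omega]; ring⟩
    induction T.connected d d' with
    | refl => exact .refl
    | tail h h' ih =>
      rcases h' with rfl | rfl
      · exact ih.tail (.inl rfl)
      · exact ih.trans (hcw _)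

theorem mirror_rot (j : ℤ) (d : D) : T.mirror.rot j d = T.rot (-j) d := by
  simp [rot, mirror]

@[simp] theorem mirror_rev (d : D) : T.mirror.rev d = T.rev d := rfl

@[simp] theorem mirror_red (d : D) : T.mirror.red d = T.red d := rfl

theorem mirror_path (e : D) (js : List ℤ) :
    T.mirror.path e js = T.path e (js.map Neg.neg) := by
  induction js generalizing e with
  | nil => rfl
  | cons j js ih => simp [ih, mirror_rot]

theorem mirror_pathLast (e : D) (js : List ℤ) :
    T.mirror.pathLast e js = T.pathLast e (js.map Neg.neg) := by
  induction js generalizing e with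
  | nil => rfl
  | cons j js ih => simp [ih, mirror_rot]

theorem reversal_path (e : D) (js : List ℤ) :
    T.reversal (T.path e js) =
      T.path (T.rev (T.pathLast e js)) (js.map Neg.neg).reverse := by
  induction js using List.reverseRecOn with
  | nil => simp [reversal]
  | append_singleton js j ih =>
    rw [path_append_cons, reversal_append, ih]
    simp [reversal, pathLast_append]

theorem mirror_adj {e e' : D} : T.mirror.Adj e e' ↔ T.Adj e e' := by
  constructor
  · rintro ⟨j, rfl⟩; exact ⟨-j, (T.mirror_rot _ _).symm⟩
  · rintro ⟨j, rfl⟩; exact ⟨-j, by rw [mirror_rot]; simp⟩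

theorem mirror_turn_eq {e e' : D} (h : T.Adj e e') {j : ℤ} (h0 : -3 ≤ j) (h4 : j ≤ 3) :
    T.mirror.turn e e' = j ↔ T.turn e e' = -j := by
  rw [T.turn_eq_iff h (by omega) (by omega),
    T.mirror.turn_eq_iff (T.mirror_adj.2 h) h0 (by omega), mirror_rot]
  rfl

theorem flipTurns_reverse (k m : ℕ) : (flipTurns k m).reverse = flipTurns m k := by
  cases k <;> cases m <;> (simp [flipTurns]; try simp [← List.replicate_succ', ← List.replicate_succ])

theorem mirror_turn_not_mem {e e' : D} (h : T.Adj e e')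
    (ht : T.mirror.turn e e' ∉ ({-1, 0, 1, 2, 3} : Set ℤ)) :
    T.turn (T.rev e') (T.rev e) ∉ ({-1, 0, 1, 2, 3} : Set ℤ) := by
  simp only [Set.mem_insert_iff, Set.mem_singleton_iff, not_or] at ht ⊢
  refine ⟨?_, ?_, ?_, ?_, ?_⟩
  all_goals
    intro h'
    have h1 := (T.turn_rev_rev_small h (j := -(T.turn (T.rev e') (T.rev e))) (by omega)
      (by omega)).1 (by omega)
    have h2 := (T.mirror_turn_eq h (j := T.turn (T.rev e') (T.rev e)) (by omega) (by omega)).2 h1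
    omega

theorem mirror_face (d : D) : T.mirror.face d = T.rot (-1) (T.rev d) := T.cw_inv_eq_rot _

theorem reversal_pathLast (e : D) (js : List ℤ) :
    T.pathLast (T.rev (T.pathLast e js)) (js.map Neg.neg).reverse = T.rev e := by
  have h1 := T.getLast?_path (T.rev (T.pathLast e js)) (js.map Neg.neg).reverse
  rw [← reversal_path, reversal, List.getLast?_reverse, List.head?_map, head?_path] at h1
  simpa using h1.symm

/-- Reflection and reversal both exchange left and right. For a flip the reversed base starts with
the reverse of the last dart, and the colour changes once at the `2` and once under reversal, so it
is red again. The lengths `k` and `m` are exchanged. -/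
theorem Shape.of_mirror {T : ReducingTriangulation D} {b a : Option D} {s s' : List D}
    (h : T.mirror.Shape b a s s') (hb : ∀ f ∈ b, ∀ e ∈ s.head?, T.Adj f e)
    (ha : ∀ g ∈ a, ∀ e ∈ s.getLast?, T.Adj e g) :
    T.Shape (a.map T.rev) (b.map T.rev) (T.reversal s) (T.reversal s') := by
  have hrev : ∀ js : List ℤ, ((js.map Neg.neg).map Neg.neg).reverse = js.reverse := by simp
  cases h with
  | spur e =>
    have := Shape.spur (T := T) (before := a.map T.rev) (after := b.map T.rev) e
    simpa [reversal] using this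
  | spike e =>
    have h1 := Shape.spike (T := T) (before := a.map T.rev) (after := b.map T.rev)
      (T.rev (T.rot (-1) (T.rev e)))
    rw [mirror_path, mirror_rot, reversal_path]
    rw [rev_rot_neg_rev, rot_rot, ← rev_rot_neg_rev] at h1
    simpa [reversal] using h1
  | bracket e k =>
    have h1 := Shape.bracket (T := T) (before := a.map T.rev) (after := b.map T.rev)
      (T.rev (T.mirror.pathLast e (2 :: (List.replicate k 3 ++ [2])))) k
    rw [mirror_path, mirror_path, reversal_path, reversal_path, ← mirror_pathLast,
      ← mirror_pathLast, T.mirror.pathLast_bracket e k, hrev, hrev, mirror_face]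
    simpa using h1
  | flip e k m hr ha' hb' =>
    have h1 := Shape.flip (T := T) (before := a.map T.rev) (after := b.map T.rev)
      (T.rev (T.mirror.pathLast e (List.replicate k 3 ++ 2 :: List.replicate m 3))) m k
    rw [mirror_path, mirror_path, reversal_path, reversal_path, ← mirror_pathLast,
      ← mirror_pathLast, T.mirror.pathLast_flip e k m, hrev, hrev, mirror_face,
      flipTurns_reverse]
    have hrv : (List.replicate k 3 ++ 2 :: List.replicate m 3 : List ℤ).reverse =
      List.replicate m 3 ++ 2 :: List.replicate k 3 := by simp
    rw [hrv]
    rw [T.mirror_rev, T.rev_rev']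
    refine h1 ?_ ?_ ?_
    · rw [T.red_rev, ← mirror_red, pathLast_append, pathLast_cons, red_pathLast_three,
        red_rot_rev_two, red_pathLast_three, hr]
      rfl
    · intro f hf
      obtain ⟨g, hg, rfl⟩ := Option.mem_map.1 hf
      refine T.mirror_turn_not_mem (ha g hg _ ?_) (hb' g hg)
      simp
    · intro f hf
      obtain ⟨g, hg, rfl⟩ := Option.mem_map.1 hf
      have h2 := T.reversal_pathLast e
        ((List.replicate k 3 ++ 2 :: List.replicate m 3 : List ℤ).map Neg.neg)
      rw [← mirror_pathLast, hrev, hrv] at h2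
      rw [h2]
      exact T.mirror_turn_not_mem (hb g hg e (by simp)) (ha' g hg)

/-- Every shape is the shape of a reduction move. -/
theorem Shape.replace {T : ReducingTriangulation D} {b a : Option D} {s s' : List D}
    (h : T.Shape b a s s') : T.Replace b a s s' := by
  cases h with
  | spur e =>
    refine .spur e _ ?_
    simpa using T.turn_rot_small (e := e) (j := 0) (by norm_num) (by norm_num)
  | spike e =>
    rw [← rev_face_face_eq]
    exact .spike e _ (T.turn_rot_small (by norm_num) (by norm_num))
  | bracket e k =>
    rw [← leftSide_bracket]
    refine .bracket _ k (T.turns_path e _ fun j hj => ?_)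
    simp only [List.mem_cons, List.mem_append, List.mem_replicate, List.not_mem_nil,
      or_false] at hj
    omega
  | flip e k m hr ha hb =>
    rw [← leftSide_flip]
    have h3 : ∀ n : ℕ, ∀ j ∈ List.replicate n (3 : ℤ), -3 ≤ j ∧ j ≤ 4 := by
      intro n j hj
      simp only [List.mem_replicate] at hj
      omega
    obtain ⟨s₁, h1⟩ := T.path_eq_concat e (List.replicate k 3)
    obtain ⟨s₂, h2⟩ := T.path_eq_cons
      (T.rot 2 (T.rev (T.pathLast e (List.replicate k 3)))) (List.replicate m 3)
    have t1 := T.turns_path e _ (h3 k)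
    have t2 := T.turns_path (T.rot 2 (T.rev (T.pathLast e (List.replicate k 3)))) _ (h3 m)
    have e1 := T.head?_path e (List.replicate k 3)
    have e2 := T.getLast?_path
      (T.rot 2 (T.rev (T.pathLast e (List.replicate k 3)))) (List.replicate m 3)
    rw [path_append_cons, h1, h2]
    rw [h1] at t1 e1
    rw [h2] at t2 e2
    refine .flip s₁ s₂ _ _ k m t1 (T.turn_rot_small (by norm_num) (by norm_num)) ?_ t2 ?_ ?_
    · rw [red_pathLast_three]; exact hr
    · rw [e1]
      intro f hf g hg
      simp only [Option.mem_def, Option.some.injEq] at hg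
      subst hg
      exact ha f hf
    · rw [e2]
      intro f hf g hg
      simp only [Option.mem_def, Option.some.injEq] at hf
      subst hf
      have := hb g hg
      rwa [pathLast_append, pathLast_cons] at this

end ReducingTriangulation

namespace ReducingTriangulation

variable {D : Type*} (T : ReducingTriangulation D)

/-! ### Both orientations -/

/-- The triangulation itself or its mirror image, according to the sign. -/
def orient (ε : ℤ) : ReducingTriangulation D := if ε = 1 then T else T.mirror

theorem orient_one : T.orient 1 = T := rfl

theorem orient_neg_one : T.orient (-1) = T.mirror := rfl

theorem orient_rev {ε : ℤ} (hε : ε = 1 ∨ ε = -1) (d : D) : (T.orient ε).rev d = T.rev d := by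
  rcases hε with rfl | rfl <;> rfl

theorem orient_red {ε : ℤ} (hε : ε = 1 ∨ ε = -1) (d : D) : (T.orient ε).red d = T.red d := by
  rcases hε with rfl | rfl <;> rfl

theorem orient_rot {ε : ℤ} (hε : ε = 1 ∨ ε = -1) (j : ℤ) (d : D) :
    (T.orient ε).rot j d = T.rot (ε * j) d := by
  rcases hε with rfl | rfl
  · rw [orient_one, one_mul]
  · rw [orient_neg_one, mirror_rot, neg_one_mul]

theorem orient_path {ε : ℤ} (hε : ε = 1 ∨ ε = -1) (e : D) (js : List ℤ) :
    (T.orient ε).path e js = T.path e (js.map (ε * ·)) := by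
  induction js generalizing e with
  | nil => rfl
  | cons j js ih => simp [ih, T.orient_rot hε, T.orient_rev hε]

theorem orient_pathLast {ε : ℤ} (hε : ε = 1 ∨ ε = -1) (e : D) (js : List ℤ) :
    (T.orient ε).pathLast e js = T.pathLast e (js.map (ε * ·)) := by
  induction js generalizing e with
  | nil => rfl
  | cons j js ih => simp [ih, T.orient_rot hε, T.orient_rev hε]

theorem orient_turn_eq {ε : ℤ} (hε : ε = 1 ∨ ε = -1) {e e' : D} (h : T.Adj e e') {j : ℤ}
    (h0 : -3 ≤ j) (h4 : j ≤ 3) : (T.orient ε).turn e e' = j ↔ T.turn e e' = ε * j := by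
  rcases hε with rfl | rfl
  · rw [orient_one, one_mul]
  · rw [orient_neg_one, T.mirror_turn_eq h h0 h4, neg_one_mul]

/-! ### Walks and closed walks as cyclic lists -/

/-- The cyclic list of darts of a closed walk, or of a walk; in the second case there is a gap
between its end and its start. -/
def ringList (lin : Bool) (l : List D) : List (Option D) :=
  if lin then none :: l.map some else l.map some

/-- The list is the list of darts of a walk, or of a closed walk. -/
def IsRingWalk (lin : Bool) (l : List D) : Prop :=
  if lin then ∃ u v, T.IsWalk u l v else ∃ u, T.IsWalk u l u

/-- A reduction move on a walk or on a closed walk. -/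
def RingMove (lin : Bool) (l l' : List D) : Prop :=
  if lin then T.Move l l' else T.ClosedMove l l'

theorem RingMove.isRingWalk {T : ReducingTriangulation D} {lin : Bool} {l l' : List D}
    (hl : T.IsRingWalk lin l) (h : T.RingMove lin l l') : T.IsRingWalk lin l' := by
  cases lin
  · obtain ⟨u, hu⟩ := hl
    exact (ClosedMove.spec hu h).1
  · obtain ⟨u, v, hu⟩ := hl
    exact ⟨u, v, (Move.spec hu h).1⟩

/-- The gap occurs only once, so it fixes the rotation. -/
theorem eq_of_isRotated_none {A B : List (Option D)} (hA : none ∉ A)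
    (h : (none :: A).IsRotated (none :: B)) : A = B := by
  obtain ⟨n, hn, h⟩ := List.isRotated_iff_mod.1 h
  rw [List.rotate_eq_drop_append_take hn] at h
  cases n with
  | zero => simpa using h
  | succ n =>
    simp only [List.drop_succ_cons, List.take_succ_cons] at h
    cases hd : A.drop n with
    | nil =>
      have : A.take n = A := by
        have := List.take_append_drop n A
        rwa [hd, List.append_nil] at this
      rw [hd, List.nil_append, this] at h
      exact List.cons_injective h
    | cons x A' =>
      rw [hd] at h
      simp only [List.cons_append, List.cons.injEq] at h
      exact absurd (List.mem_of_mem_drop (hd ▸ List.mem_cons_self : x ∈ A.drop n)) (h.1 ▸ hA)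

theorem eq_map_some_of_none_not_mem {A : List (Option D)} (h : none ∉ A) :
    ∃ l : List D, A = l.map some := by
  induction A with
  | nil => exact ⟨[], rfl⟩
  | cons a A ih =>
    simp only [List.mem_cons, not_or] at h
    obtain ⟨l, rfl⟩ := ih h.2
    cases a with
    | none => exact absurd rfl h.1
    | some d => exact ⟨d :: l, rfl⟩

theorem isRotated_of_map_some {l l' : List D}
    (h : (l.map some).IsRotated (l'.map some)) : l.IsRotated l' := by
  obtain ⟨n, hn⟩ := h
  refine ⟨n, ?_⟩
  rw [← List.map_rotate] at hn
  exact List.map_injective_iff.2 (Option.some_injective D) hn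

theorem Shape.orient_move {T : ReducingTriangulation D} {ε : ℤ} (hε : ε = 1 ∨ ε = -1)
    {pre s s' post : List D}
    (h : (T.orient ε).Shape pre.getLast? post.head? s s')
    (hadj : ∀ p ∈ corners (pre ++ s ++ post), T.Adj p.1 p.2) :
    T.Move (pre ++ s ++ post) (pre ++ s' ++ post) := by
  rcases hε with rfl | rfl
  · exact .inl ⟨pre, s, s', post, rfl, rfl, h.replace⟩
  · refine .inr ⟨T.reversal post, T.reversal s, T.reversal s', T.reversal pre, ?_, ?_, ?_⟩
    · simp [reversal_append]
    · simp [reversal_append]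
    · have := (Shape.of_mirror h ?_ ?_).replace
      · simpa [reversal] using this
      · intro f hf e he
        obtain ⟨p, rfl⟩ := List.getLast?_eq_some_iff.1 hf
        obtain ⟨q, rfl⟩ := List.head?_eq_some_iff.1 he
        refine hadj (f, e) ?_
        rw [List.append_assoc, List.append_assoc, List.singleton_append, corners_append_cons]
        simp
      · intro g hg e he
        obtain ⟨p, rfl⟩ := List.getLast?_eq_some_iff.1 he
        obtain ⟨q, rfl⟩ := List.head?_eq_some_iff.1 hg
        refine hadj (e, g) ?_
        rw [← List.append_assoc, List.append_assoc, List.singleton_append, corners_append_cons]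
        simp

theorem Shape.orient_closedMove {T : ReducingTriangulation D} {ε : ℤ} (hε : ε = 1 ∨ ε = -1)
    {s s' post : List D}
    (h : (T.orient ε).Shape (s ++ post).getLast? (post ++ s).head? s s')
    (hadj : ∀ p ∈ cyclicCorners (s ++ post), T.Adj p.1 p.2) :
    T.ClosedMove (s ++ post) (s' ++ post) := by
  rcases hε with rfl | rfl
  · exact .inl ⟨s, s', post, .refl _, .refl _, h.replace⟩
  · refine .inr ⟨T.reversal s, T.reversal s', T.reversal post, ?_, ?_, ?_⟩
    · rw [reversal_append]; exact isRotated_append_comm _ _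
    · rw [reversal_append]; exact isRotated_append_comm _ _
    · have := (Shape.of_mirror h ?_ ?_).replace
      · have e1 : (T.reversal s ++ T.reversal post).getLast? =
            (post ++ s).head?.map T.rev := by
          rw [← reversal_append, reversal, List.getLast?_reverse, List.head?_map]
        have e2 : (T.reversal post ++ T.reversal s).head? =
            (s ++ post).getLast?.map T.rev := by
          rw [← reversal_append, reversal, List.head?_reverse, List.getLast?_map]
        rw [e1, e2]
        exact this
      · intro f hf e he
        obtain ⟨p, hp⟩ := List.getLast?_eq_some_iff.1 hf
        obtain ⟨q, rfl⟩ := List.head?_eq_some_iff.1 he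
        refine hadj (f, e) ?_
        rw [List.cons_append, cyclicCorners_cons, ← List.cons_append, hp, List.append_assoc,
          List.singleton_append, corners_append_cons]
        simp
      · intro g hg e he
        obtain ⟨p, rfl⟩ := List.getLast?_eq_some_iff.1 he
        obtain ⟨q, hq⟩ := List.head?_eq_some_iff.1 hg
        refine hadj (e, g) ?_
        have h1 : ((p ++ [e]) ++ post).IsRotated (e :: (post ++ p)) := by
          have := isRotated_append_comm p ([e] ++ post)
          simpa using this
        rw [mem_cyclicCorners_of_isRotated h1, cyclicCorners_cons]
        cases post with
        | nil =>
          cases p with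
          | nil => simp at hq ⊢; exact hq.1.symm
          | cons a p => simp at hq ⊢; exact .inl hq.1.symm
        | cons a post => simp at hq ⊢; exact .inl hq.1.symm

/-- The ring may be rotated so that the strip comes first. For a closed walk the rest is the
remaining part. For a walk the rest contains the gap, which separates what follows the strip from
what precedes it. With `join`, a neighbour that is the gap counts as absent, as the flip rule
requires. -/
theorem IsRingWalk.exists_move {T : ReducingTriangulation D} {lin : Bool} {l : List D}
    (hl : T.IsRingWalk lin l) {R R' post : List (Option D)} {s s' : List D}
    (hR : R.IsRotated (ringList lin l)) (h : R.IsRotated (s.map some ++ post))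
    (h' : R'.IsRotated (s'.map some ++ post)) {ε : ℤ} (hε : ε = 1 ∨ ε = -1)
    (hs : (T.orient ε).Shape (s.map some ++ post).getLast?.join (post ++ s.map some).head?.join
      s s') :
    ∃ l', R'.IsRotated (ringList lin l') ∧ T.RingMove lin l l' := by
  have hne : s ≠ [] := by
    rcases hs.cases_ends with ⟨e, rfl, -⟩ | ⟨e, js, js', rfl, -⟩ <;> simp
  have hR' := hR.symm.trans h
  cases lin with
  | false =>
    have hn : none ∉ post := fun hn => by
      have : none ∈ ringList false l := hR'.mem_iff.2 (List.mem_append_right _ hn)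
      simp [ringList] at this
    obtain ⟨p, rfl⟩ := eq_map_some_of_none_not_mem hn
    have hr : l.IsRotated (s ++ p) := isRotated_of_map_some (by simpa [ringList] using hR')
    have e1 : (s.map some ++ p.map some).getLast?.join = (s ++ p).getLast? := by
      rw [← List.map_append, List.getLast?_map]
      cases (s ++ p).getLast? <;> rfl
    have e2 : (p.map some ++ s.map some).head?.join = (p ++ s).head? := by
      rw [← List.map_append, List.head?_map]
      cases (p ++ s).head? <;> rfl
    rw [e1, e2] at hs
    obtain ⟨u, hu⟩ := hl
    obtain ⟨w, hw⟩ := hu.isRotated hr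
    have := hs.orient_closedMove hε hw.cyclic_adj
    refine ⟨s' ++ p, by simpa [ringList] using h', ?_⟩
    change T.ClosedMove l (s' ++ p)
    rcases this with ⟨a, b, c, h1, h2, h3⟩ | ⟨a, b, c, h1, h2, h3⟩
    · exact .inl ⟨a, b, c, hr.trans h1, h2, h3⟩
    · exact .inr ⟨a, b, c, (T.reversal_isRotated hr).trans h1, h2, h3⟩
  | true =>
    have hn : none ∈ s.map some ++ post := hR'.mem_iff.1 (by simp [ringList])
    have hn' : none ∈ post := by simpa using hn
    obtain ⟨p₁, p₂, rfl⟩ := List.append_of_mem hn'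
    have hrot : (s.map some ++ (p₁ ++ none :: p₂)).IsRotated
        (none :: (p₂ ++ (s.map some ++ p₁))) := by
      have := isRotated_append_comm (s.map some ++ p₁) (none :: p₂)
      simpa using this
    have hrot' : (s'.map some ++ (p₁ ++ none :: p₂)).IsRotated
        (none :: (p₂ ++ (s'.map some ++ p₁))) := by
      have := isRotated_append_comm (s'.map some ++ p₁) (none :: p₂)
      simpa using this
    have heq : l.map some = p₂ ++ (s.map some ++ p₁) :=
      eq_of_isRotated_none (by simp) (by simpa [ringList] using hR'.trans hrot)
    have hn1 : none ∉ p₁ := fun h1 => by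
      have : none ∈ l.map some := by rw [heq]; simp [h1]
      simp at this
    have hn2 : none ∉ p₂ := fun h1 => by
      have : none ∈ l.map some := by rw [heq]; simp [h1]
      simp at this
    obtain ⟨p₁, rfl⟩ := eq_map_some_of_none_not_mem hn1
    obtain ⟨p₂, rfl⟩ := eq_map_some_of_none_not_mem hn2
    have hl' : l = p₂ ++ s ++ p₁ := by
      apply List.map_injective_iff.2 (Option.some_injective D)
      simpa using heq
    subst hl'
    obtain ⟨u, v, hu⟩ := hl
    have e1 : (s.map some ++ (p₁.map some ++ none :: p₂.map some)).getLast?.join =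
        p₂.getLast? := by
      rcases List.eq_nil_or_concat' p₂ with rfl | ⟨q, x, rfl⟩ <;> simp [List.getLast?_cons]
    have e2 : (p₁.map some ++ none :: p₂.map some ++ s.map some).head?.join = p₁.head? := by
      cases p₁ <;> simp
    rw [e1, e2] at hs
    refine ⟨p₂ ++ s' ++ p₁, ?_, hs.orient_move hε hu.adj⟩
    have := h'.trans hrot'
    simpa [ringList] using this

end ReducingTriangulation

namespace ReducingTriangulation

variable {D : Type*} (T : ReducingTriangulation D)

/-! ### Rings of cells -/

/-- A cell `(o, t, n)` represents `n` consecutive vertices of a closed walk, with the same turn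
`t`, the first of which is the target of the dart `o`. The turn `4` stands for any turn other than
`-3, …, 3`; moreover `5` is the end of a walk, `6` is a turn that has not been computed, and `7` is
the gap between the end and the start of a walk. -/
abbrev Cell (D : Type*) := Option D × ℤ × ℤ

/-- The cell describes vertices that are followed by the dart `x`. -/
inductive CellOk : Cell D → Option D → Prop
  | unknown (e : D) (x : Option D) : CellOk (some e, 6, 1) x
  | gap (x : Option D) : CellOk (none, 7, 1) x
  | fin (e : D) : CellOk (some e, 5, 1) none
  | big (e e' : D) (h : T.Adj e e') (h4 : 4 ≤ T.turn e e') : CellOk (some e, 4, 1) (some e')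
  | run (e : D) (t : ℤ) (k : ℕ) (h : -3 ≤ t ∧ t ≤ 3) (hk : k = 0 ∨ t = 3 ∨ t = -3) :
      CellOk (some e, t, k + 1) (some (T.rot t (T.rev (T.pathLast e (List.replicate k t)))))

/-- The darts that enter the vertices of a cell. -/
def cellDarts : Cell D → List (Option D)
  | (none, _, _) => [none]
  | (some e, t, n) => (T.path e (List.replicate (n - 1).toNat t)).map some

/-- The darts that enter the vertices of the cells. -/
def ringDarts (Q : List (Cell D)) : List (Option D) := Q.flatMap T.cellDarts

/-- The first dart of the cells, or `x` if there is no cell. -/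
def firstOr : List (Cell D) → Option D → Option D
  | [], x => x
  | c :: _, _ => c.1

/-- The cells are correct, when they are followed by the dart `x`. -/
def Linked : List (Cell D) → Option D → Prop
  | [], _ => True
  | c :: Q, x => T.CellOk c (firstOr Q x) ∧ Linked Q x

/-- The cells, in cyclic order, are correct. -/
def RingOk (Q : List (Cell D)) : Prop := T.Linked Q (firstOr Q none)

@[simp] theorem firstOr_nil (x : Option D) : firstOr [] x = x := rfl

@[simp] theorem firstOr_cons (c : Cell D) (Q : List (Cell D)) (x : Option D) :
    firstOr (c :: Q) x = c.1 := rfl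

@[simp] theorem firstOr_append (A B : List (Cell D)) (x : Option D) :
    firstOr (A ++ B) x = firstOr A (firstOr B x) := by cases A <;> rfl

@[simp] theorem linked_nil (x : Option D) : T.Linked [] x := trivial

@[simp] theorem linked_cons (c : Cell D) (Q : List (Cell D)) (x : Option D) :
    T.Linked (c :: Q) x ↔ T.CellOk c (firstOr Q x) ∧ T.Linked Q x := Iff.rfl

@[simp] theorem linked_append (A B : List (Cell D)) (x : Option D) :
    T.Linked (A ++ B) x ↔ T.Linked A (firstOr B x) ∧ T.Linked B x := by
  induction A with
  | nil => simp
  | cons c A ih => simp [ih, and_assoc]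

theorem ringOk_append (A B : List (Cell D)) : T.RingOk (A ++ B) ↔
    T.Linked A (firstOr B (firstOr A none)) ∧ T.Linked B (firstOr A (firstOr B none)) := by
  cases A <;> cases B <;> simp [RingOk, and_assoc]

theorem RingOk.comm {T : ReducingTriangulation D} {A B : List (Cell D)} (h : T.RingOk (A ++ B)) :
    T.RingOk (B ++ A) := by
  rw [ringOk_append] at h ⊢
  exact h.symm

@[simp] theorem ringDarts_nil : T.ringDarts [] = [] := rfl

@[simp] theorem ringDarts_cons (c : Cell D) (Q : List (Cell D)) :
    T.ringDarts (c :: Q) = T.cellDarts c ++ T.ringDarts Q := rfl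

@[simp] theorem ringDarts_append (A B : List (Cell D)) :
    T.ringDarts (A ++ B) = T.ringDarts A ++ T.ringDarts B := List.flatMap_append

@[simp] theorem cellDarts_one (o : Option D) (t : ℤ) : T.cellDarts (o, t, 1) = [o] := by
  cases o <;> simp [cellDarts]

/-- What remains of a cell without its first vertex. -/
def splitFirst : Cell D → List (Cell D)
  | (o, t, n) => if n = 1 then [] else [(o.map fun e => T.rot t (T.rev e), t, n - 1)]

theorem CellOk.splitFirst {T : ReducingTriangulation D} {c : Cell D} {x : Option D}
    (h : T.CellOk c x) : T.cellDarts c = c.1 :: T.ringDarts (T.splitFirst c) ∧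
      T.Linked ((c.1, c.2.1, 1) :: T.splitFirst c) x := by
  cases h with
  | unknown e x => simp [ReducingTriangulation.splitFirst, CellOk.unknown]
  | gap x => simp [ReducingTriangulation.splitFirst, CellOk.gap]
  | fin e => simp [ReducingTriangulation.splitFirst, CellOk.fin]
  | big e e' h h4 => simp [ReducingTriangulation.splitFirst, CellOk.big, h, h4]
  | run e t k h hk =>
    cases k with
    | zero =>
      have := CellOk.run (T := T) e t 0 h hk
      simpa [ReducingTriangulation.splitFirst] using this
    | succ k =>
      have h1 := CellOk.run (T := T) e t 0 h (.inl rfl)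
      have h2 := CellOk.run (T := T) (T.rot t (T.rev e)) t k h (.inr (by simpa using hk))
      have h0 : ¬ (k : ℤ) + 1 = 0 := by omega
      simp only [ReducingTriangulation.splitFirst]
      simp only [Nat.cast_zero, zero_add, List.replicate_zero, pathLast_nil] at h1
      simp [h0, h1, h2, List.replicate_succ, cellDarts]

/-- What remains of a cell without its last vertex. -/
def splitLast : Cell D → List (Cell D)
  | (o, t, n) => if n = 1 then [] else [(o, t, n - 1)]

/-- The dart that enters the last vertex of a cell followed by the dart `x`. -/
def lastDart (c : Cell D) (x : Option D) : Option D :=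
  if c.2.2 = 1 then c.1 else x.map fun z => T.rev (T.rot (-c.2.1) z)

/-- Undoing one rotation from the dart that follows a run gives the last dart of the run, in
constant time and without going through the run. -/
theorem CellOk.splitLast {T : ReducingTriangulation D} {c : Cell D} {x : Option D}
    (h : T.CellOk c x) : T.cellDarts c = T.ringDarts (splitLast c) ++ [T.lastDart c x] ∧
      T.Linked (splitLast c) (T.lastDart c x) := by
  cases h with
  | unknown e x => simp [ReducingTriangulation.splitLast, lastDart]
  | gap x => simp [ReducingTriangulation.splitLast, lastDart]
  | fin e => simp [ReducingTriangulation.splitLast, lastDart]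
  | big e e' h h4 => simp [ReducingTriangulation.splitLast, lastDart]
  | run e t k h hk =>
    cases k with
    | zero => simp [ReducingTriangulation.splitLast, lastDart]
    | succ k =>
      have h0 : ¬ (k : ℤ) + 1 = 0 := by omega
      have h2 := CellOk.run (T := T) e t k h (.inr (by simpa using hk))
      have h3 : T.rot t (T.rev (T.pathLast e (List.replicate k t))) =
          T.pathLast e (List.replicate (k + 1) t) := by
        rw [List.replicate_succ', pathLast_append]; rfl
      rw [h3] at h2
      simp only [ReducingTriangulation.splitLast, lastDart]
      simp [h0, h2, cellDarts]
      rw [List.replicate_succ', path_append_cons]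
      simp [pathLast_append]

/-- An unknown vertex, like the gap, is correct whatever follows. This is what is needed when the
next dart is about to change. -/
theorem CellOk.lastDart {T : ReducingTriangulation D} {c : Cell D} {x y : Option D}
    (h : T.CellOk c x) : T.CellOk (T.lastDart c x, if c.2.1 = 7 then 7 else 6, 1) y := by
  cases h with
  | unknown e x => simp [ReducingTriangulation.lastDart, CellOk.unknown]
  | gap x => simp [ReducingTriangulation.lastDart, CellOk.gap]
  | fin e => simp [ReducingTriangulation.lastDart, CellOk.unknown]
  | big e e' h h4 => simp [ReducingTriangulation.lastDart, CellOk.unknown]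
  | run e t k h hk =>
    have : ¬ t = 7 := by omega
    simp only [ReducingTriangulation.lastDart, this, if_false]
    split_ifs
    · exact .unknown _ _
    · exact .unknown _ _

/-- Replacing the strip by `N` changes the turn at the vertex just before it. This vertex is cut off
its cell and goes to the front as unknown, so no old cell has to be recomputed. The new cells `N`
are correct before any dart, so they fit in front of the rest. -/
theorem ringOk_attach {Q : List (Cell D)} {c : Cell D} {w : Option D} {N : List (Cell D)}
    (h : T.Linked (Q ++ [c]) w) (hN : ∀ z, T.Linked N z) :
    T.RingOk ((T.lastDart c w, if c.2.1 = 7 then 7 else 6, 1) :: (N ++ (Q ++ splitLast c))) ∧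
      (T.ringDarts ((T.lastDart c w, if c.2.1 = 7 then 7 else 6, 1) ::
        (N ++ (Q ++ splitLast c)))).IsRotated (T.ringDarts N ++ T.ringDarts (Q ++ [c])) := by
  simp only [linked_append, linked_cons, firstOr_cons, firstOr_nil, linked_nil, and_true] at h
  obtain ⟨h1, h2⟩ := h.2.splitLast
  constructor
  · simp only [RingOk, firstOr_cons, linked_cons, linked_append]
    refine ⟨h.2.lastDart, hN _, ?_, h2⟩
    have : firstOr (splitLast c) (T.lastDart c w) = c.1 := by
      obtain ⟨o, t, n⟩ := c
      simp only [splitLast, lastDart]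
      split_ifs <;> rfl
    rw [this]
    exact h.1
  · simp only [ringDarts_cons, ringDarts_append, cellDarts_one, ringDarts_nil, List.append_nil, h1]
    have := isRotated_append_comm [T.lastDart c w]
      (T.ringDarts N ++ (T.ringDarts Q ++ T.ringDarts (splitLast c)))
    simpa using this

/-- At most one cell, for `k` vertices with turn `t`. -/
def runCells (e : D) (t : ℤ) (k : ℕ) : List (Cell D) :=
  if k = 0 then [] else [(some e, t, k)]

theorem linked_runCells {t : ℤ} (ht : t = 3 ∨ t = -3) (e : D) (k : ℕ) :
    T.Linked (runCells e t k) (some (T.pathLast e (List.replicate k t))) := by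
  cases k with
  | zero => simp [runCells]
  | succ k =>
    have := CellOk.run (T := T) e t k (by omega) (.inr ht)
    rw [List.replicate_succ', pathLast_append]
    simpa [runCells] using this

theorem ringDarts_runCells (t : ℤ) (e : D) (k : ℕ) :
    T.ringDarts (runCells e t k) ++ [some (T.pathLast e (List.replicate k t))] =
      (T.path e (List.replicate k t)).map some := by
  cases k with
  | zero => simp [runCells]
  | succ k =>
    rw [List.replicate_succ', path_append_cons]
    simp [runCells, cellDarts, pathLast_append]

theorem CellOk.of_small {T : ReducingTriangulation D} {o x : Option D} {t n : ℤ}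
    (h : T.CellOk (o, t, n) x) (ht : -3 ≤ t ∧ t ≤ 3) : ∃ (e : D) (k : ℕ), o = some e ∧ n = k + 1 ∧
      (k = 0 ∨ t = 3 ∨ t = -3) ∧
      x = some (T.rot t (T.rev (T.pathLast e (List.replicate k t)))) := by
  cases h with
  | unknown e x => omega
  | gap x => omega
  | fin e => omega
  | big e e' h h4 => omega
  | run e t k h hk => exact ⟨e, k, rfl, rfl, hk, rfl⟩

theorem runCells_of_linked {t : ℤ} (ht : t = 3 ∨ t = -3) {e e' z : D} {k : ℕ}
    (h : T.Linked (runCells e t k) (some z)) (h' : firstOr (runCells e t k) (some z) = some e') :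
    T.pathLast e' (List.replicate k t) = z ∧
      T.ringDarts (runCells e t k) ++ [some z] = (T.path e' (List.replicate k t)).map some := by
  have key : T.pathLast e' (List.replicate k t) = z ∧ runCells e t k = runCells e' t k := by
    cases k with
    | zero => simpa [runCells, eq_comm] using h'
    | succ k =>
      simp [runCells] at h h'
      subst h'
      refine ⟨?_, rfl⟩
      obtain ⟨e₁, k₁, h1, h2, -, h3⟩ := h.of_small (by omega)
      obtain rfl : k = k₁ := by omega
      simp only [Option.some.injEq] at h1 h3
      subst h1; subst h3
      rw [List.replicate_succ', pathLast_append]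
      rfl
  rw [key.2]
  refine ⟨key.1, ?_⟩
  rw [← ringDarts_runCells, key.1]

/-- The cells that are pushed on the other side of a strip of triangles, along a sequence of `k`
edges, that starts with `e`, and is followed by `z`. -/
def pushCells (ε : ℤ) (e : D) (k : ℕ) (z : D) : List (Cell D) :=
  if k = 0 then [] else
    runCells ((T.orient ε).push e) (ε * -3) (k - 1) ++
      [(some ((T.orient ε).push (T.rev (T.rot (ε * -3) z))), 6, 1)]

/-- The outer edges above consecutive turns `3` make turns `-3`, so the push of a run is a run and
is known from its first dart. -/
theorem push_step (e : D) : T.rot (-3) (T.rev (T.push e)) = T.push (T.rot 3 (T.rev e)) := by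
  have h5 := T.rev_rot_rev (T.rev (T.rot 1 (T.rev e)))
  have h6 := T.rev_rot_rev e
  rw [rev_rev', rot_rot, h6, rot_rot] at h5
  rw [push_eq, push_eq, rot_rot]
  norm_num at h5 ⊢
  rw [h5, rot_rot]
  norm_num

theorem leftTail_append (e : D) (k : ℕ) (j : ℤ) (hj : j = 2) (js : List ℤ) :
    T.leftTail (T.path e (List.replicate k 3 ++ j :: js)) =
      (T.path e (List.replicate k 3)).dropLast.map T.push ++ T.leftTail
        (T.path (T.rot j (T.rev (T.pathLast e (List.replicate k 3)))) js) := by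
  induction k generalizing e with
  | zero =>
    subst hj
    obtain ⟨l, hl⟩ := T.path_eq_cons (T.rot 2 (T.rev e)) js
    simp only [List.replicate_zero, List.nil_append, path_cons, hl, leftTail]
    rw [T.turn_rot_small (by norm_num) (by norm_num)]
    simp [hl]
  | succ k ih =>
    obtain ⟨l, hl⟩ := T.path_eq_cons (T.rot 3 (T.rev e)) (List.replicate k 3)
    obtain ⟨l', hl'⟩ := T.path_eq_cons (T.rot 3 (T.rev e)) (List.replicate k 3 ++ j :: js)
    rw [List.replicate_succ, List.cons_append, path_cons, hl', leftTail,
      T.turn_rot_small (by norm_num) (by norm_num), ← hl', ih, if_pos rfl, path_cons, hl,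
      List.dropLast_cons_cons, ← hl]
    simp

theorem dropLast_path (e : D) (j : ℤ) (k : ℕ) :
    (T.path e (List.replicate (k + 1) j)).dropLast = T.path e (List.replicate k j) := by
  rw [List.replicate_succ', path_append_cons]
  simp

theorem map_push_path (e : D) (k : ℕ) :
    (T.path e (List.replicate k 3)).map T.push = T.path (T.push e) (List.replicate k (-3)) := by
  induction k generalizing e with
  | zero => rfl
  | succ k ih => simp [List.replicate_succ, ih, push_step]

theorem push_pathLast (e : D) (k : ℕ) :
    T.push (T.pathLast e (List.replicate k 3)) =
      T.pathLast (T.push e) (List.replicate k (-3)) := by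
  induction k generalizing e with
  | zero => rfl
  | succ k ih => simp [List.replicate_succ, ih, push_step]

/-- The `k` outer edges make `k - 1` turns between them. The turn after the last one depends on what
follows, so it is left unknown, and this makes the cells correct before any `x`. -/
theorem pushCells_spec {ε : ℤ} (hε : ε = 1 ∨ ε = -1) (e : D) (k : ℕ) :
    (∀ x, T.Linked (T.pushCells ε e k ((T.orient ε).pathLast e (List.replicate k 3))) x) ∧
      T.ringDarts (T.pushCells ε e k ((T.orient ε).pathLast e (List.replicate k 3))) =
        ((((T.orient ε).path e (List.replicate k 3)).dropLast).map (T.orient ε).push).map some := by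
  cases k with
  | zero => simp [pushCells]
  | succ k =>
    have h1 : T.rev (T.rot (ε * -3) ((T.orient ε).pathLast e (List.replicate (k + 1) 3))) =
        (T.orient ε).pathLast e (List.replicate k 3) := by
      rw [List.replicate_succ', pathLast_append, pathLast_cons, pathLast_nil, T.orient_rot hε, rot_rot,
        T.orient_rev hε]
      simp
    have h2 := (T.orient ε).push_pathLast e k
    rw [T.orient_pathLast hε _ (List.replicate k (-3)), List.map_replicate] at h2
    have h3 := T.linked_runCells (t := ε * -3) (by rcases hε with rfl | rfl <;> norm_num)
      ((T.orient ε).push e) k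
    have h4 := T.ringDarts_runCells (ε * -3) ((T.orient ε).push e) k
    rw [← h2] at h3 h4
    simp only [pushCells, h1]
    constructor
    · intro x
      simp only [Nat.add_eq_zero_iff, one_ne_zero, and_false, if_false, Nat.add_sub_cancel,
        linked_append, linked_cons, firstOr_cons, linked_nil, and_true]
      exact ⟨h3, .unknown _ _⟩
    · rw [dropLast_path, map_push_path, T.orient_path hε, List.map_replicate, ← h4]
      simp

end ReducingTriangulation

namespace ReducingTriangulation

variable {D : Type*} (T : ReducingTriangulation D)

/-! ### The number of moves that are left -/

/-- A bound on the number of moves from a walk or a closed walk. -/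
noncomputable def rank (lin : Bool) (l : List D) : ℕ :=
  if lin then T.potential l else
    sSup {n | ∃ L : List (List D), List.IsChain T.ClosedMove (l :: L) ∧ L.length = n}

theorem bddAbove_chain {u : T.Vertex} {l : List D} (hl : T.IsWalk u l u) :
    BddAbove {n | ∃ L : List (List D), List.IsChain T.ClosedMove (l :: L) ∧ L.length = n} := by
  refine ⟨T.closedPotential l + 1, ?_⟩
  rintro n ⟨L, hL, rfl⟩
  exact T.length_closed_chain_le hl hL

/-- For closed walks the potential may be unchanged by a heart flip, so the rank is the largest
number of moves in a sequence. It is finite by `length_closed_chain_le`, and a move can be put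
before a longest sequence. -/
theorem rank_lt {lin : Bool} {l l' : List D} (hl : T.IsRingWalk lin l)
    (h : T.RingMove lin l l') : T.rank lin l' < T.rank lin l := by
  cases lin with
  | true =>
    obtain ⟨u, v, hu⟩ := hl
    exact (Move.spec hu h).2
  | false =>
    obtain ⟨u, hu⟩ := hl
    obtain ⟨⟨w, hw⟩, -⟩ := ClosedMove.spec hu h
    obtain ⟨L, hL, hn⟩ : T.rank false l' ∈
        {n | ∃ L : List (List D), List.IsChain T.ClosedMove (l' :: L) ∧ L.length = n} :=
      Nat.sSup_mem ⟨0, [], by simp⟩ (T.bddAbove_chain hw)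
    refine Nat.lt_of_succ_le (le_csSup (T.bddAbove_chain hu) ⟨l' :: L, ?_, ?_⟩)
    · exact List.isChain_cons_cons.2 ⟨h, hL⟩
    · simp [← hn]

theorem rank_le {lin : Bool} {l : List D} (hl : T.IsRingWalk lin l) :
    T.rank lin l ≤ 4 * l.length + 1 := by
  cases lin with
  | true => exact (T.potential_le l).trans (Nat.le_succ _)
  | false =>
    obtain ⟨u, hu⟩ := hl
    refine csSup_le ⟨0, [], by simp, rfl⟩ ?_
    rintro n ⟨L, hL, rfl⟩
    exact (T.length_closed_chain_le hu hL).trans (Nat.succ_le_succ (T.closedPotential_le l))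

/-! ### Cells at which no move applies -/

/-- The turn of the cell at distance `i`, in a list of the cells before a given one. -/
def clsAt (ctx : List (Option D × ℤ)) (i : ℕ) : ℤ := ctx[i]?.elim 8 Prod.snd

/-- The distance to the last cell that is not a sequence of turns `3 * ε`. -/
def skipRun (ε : ℤ) (ctx : List (Option D × ℤ)) (i : ℕ) : ℕ :=
  if clsAt ctx i = ε * 3 then i + 1 else i

/-- No move applies to a strip that ends at the given cell, where `ctx` is the list of the cells
before it, the nearest first. -/
def Pass (t : ℤ) (ctx : List (Option D × ℤ)) : Prop :=
  (t ≠ 6 ∧ t ≠ 0 ∧ t ≠ 1 ∧ t ≠ -1) ∧ ∀ ε : ℤ, ε = 1 ∨ ε = -1 →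
    (t = ε * 3 → clsAt ctx 0 ≠ ε * 3) ∧
    (t ≠ ε * 3 → clsAt ctx (skipRun ε ctx 0) = ε * 2 →
      (t = ε * 2 → clsAt ctx (skipRun ε ctx 0 + 1) = 8) ∧
      (t ≠ ε * 2 → (∃ e, (ctx[skipRun ε ctx 0]?).map Prod.fst = some (some e) ∧ T.red e = true) →
        clsAt ctx (skipRun ε ctx (skipRun ε ctx 0 + 1)) ∈ ({6, 0, 1, -1, ε * 2, ε * 3} : Set ℤ)))

theorem clsAt_congr {K K' : List (Option D × ℤ)} (h : K.take 4 = K'.take 4) {i : ℕ} (hi : i < 4) :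
    K[i]? = K'[i]? := by
  rw [← List.getElem?_take_of_lt hi, h, List.getElem?_take_of_lt hi]

/-- The test goes back over at most a run, a `2`, another run and one more cell. -/
theorem Pass.congr {T : ReducingTriangulation D} {t : ℤ} {K K' : List (Option D × ℤ)}
    (h : K.take 4 = K'.take 4) (hp : T.Pass t K) : T.Pass t K' := by
  have h' : ∀ i, i < 4 → clsAt K i = clsAt K' i := fun i hi => by
    rw [clsAt, clsAt, clsAt_congr h hi]
  have hs : ∀ ε i, i < 4 → skipRun ε K i = skipRun ε K' i := fun ε i hi => by
    rw [skipRun, skipRun, h' i hi]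
  have hle : ∀ ε i, skipRun ε K' i ≤ i + 1 := fun ε i => by
    rw [skipRun]; split_ifs <;> omega
  refine ⟨hp.1, fun ε hε => ?_⟩
  have h0 := hle ε 0
  have h1 := hle ε (skipRun ε K' 0 + 1)
  have := hp.2 ε hε
  rwa [h' 0 (by omega), hs ε 0 (by omega), h' _ (by omega), h' _ (by omega),
    clsAt_congr h (by omega), hs ε (skipRun ε K' 0 + 1) (by omega), h' _ (by omega)] at this

/-- No move applies to a strip that ends at one of the cells, except possibly for the first `u`
cells. -/
def Verified (K : List (Option D × ℤ)) (u : ℕ) : Prop :=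
  ∀ A c B, K = A ++ c :: B → u ≤ A.length → T.Pass c.2 (A.reverse ++ B.reverse)

theorem Verified.rotate {T : ReducingTriangulation D} {c : Option D × ℤ} {K : List (Option D × ℤ)}
    {u : ℕ} (h : T.Verified (c :: K) (u + 1)) (hc : T.Pass c.2 K.reverse) :
    T.Verified (K ++ [c]) u := by
  intro A c' B hK hu
  rcases List.eq_nil_or_concat' B with rfl | ⟨B, b, rfl⟩
  · obtain ⟨rfl, h2⟩ := List.append_inj' hK rfl
    obtain rfl : c = c' := by simpa using h2
    simpa using hc
  · rw [← List.cons_append, ← List.append_assoc] at hK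
    obtain ⟨rfl, h2⟩ := List.append_inj' hK rfl
    obtain rfl : c = b := by simpa using h2
    have := h (c :: A) c' B (by simp) (by simpa using hu)
    simpa using this

/-- The cells `F` and `B` at the two ends are consumed, and at most twelve cells `N` and `S` come in
front of the untouched cells. The test looks back over four cells, so from sixteen positions further
on the old verdicts remain valid. -/
theorem Verified.modify {T : ReducingTriangulation D} {F M B N P S : List (Option D × ℤ)} {u : ℕ}
    (h : T.Verified (F ++ M ++ B) u) (hP : P <+: S ++ M) (hN : N.length + S.length ≤ 12) :
    T.Verified (N ++ P) (u + 16) := by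
  obtain ⟨R, hR⟩ := hP
  intro A c C hK hu
  have h1 : N ++ (S ++ M) = A ++ c :: (C ++ R) := by
    rw [← hR, ← List.append_assoc, hK]; simp
  obtain ⟨A', rfl⟩ : ∃ A', A = N ++ S ++ A' := by
    have h2 : N ++ S <+: A := List.prefix_of_prefix_length_le (l₃ := A ++ c :: (C ++ R))
      (by rw [← h1, ← List.append_assoc]; exact List.prefix_append _ M)
      (List.prefix_append A _) (by simp; omega)
    exact ⟨_, h2.choose_spec.symm⟩
  rw [← List.append_assoc, List.append_assoc (N ++ S), List.append_cancel_left_eq] at h1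
  have h3 := h (F ++ A') c (C ++ R ++ B) (by rw [h1]; simp) (by simp at hu ⊢; omega)
  refine h3.congr ?_
  have h4 : 4 ≤ A'.length := by simp at hu; omega
  simp only [List.reverse_append, List.append_assoc]
  rw [List.take_append_of_le_length (by simpa using h4),
    List.take_append_of_le_length (by simpa using h4)]

/-- The cells without the numbers of their vertices. -/
def keys (Q : List (Cell D)) : List (Option D × ℤ) := Q.map fun c => (c.1, c.2.1)

@[simp] theorem keys_nil : keys ([] : List (Cell D)) = [] := rfl

@[simp] theorem keys_cons (c : Cell D) (Q : List (Cell D)) :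
    keys (c :: Q) = (c.1, c.2.1) :: keys Q := rfl

@[simp] theorem keys_append (A B : List (Cell D)) : keys (A ++ B) = keys A ++ keys B :=
  List.map_append

@[simp] theorem length_keys (A : List (Cell D)) : (keys A).length = A.length := List.length_map _

theorem keys_splitLast_prefix (Q : List (Cell D)) (c : Cell D) :
    keys (Q ++ splitLast c) <+: keys (Q ++ [c]) := by
  obtain ⟨o, t, n⟩ := c
  simp only [keys_append, List.prefix_append_right_inj, splitLast]
  split_ifs <;> simp

/-- The number of cells, where unknown cells are counted three times. -/
def weight (Q : List (Cell D)) : ℕ := (Q.map fun c => if c.2.1 = 6 then 3 else 1).sum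

@[simp] theorem weight_nil : weight ([] : List (Cell D)) = 0 := rfl

@[simp] theorem weight_cons (c : Cell D) (Q : List (Cell D)) :
    weight (c :: Q) = (if c.2.1 = 6 then 3 else 1) + weight Q := rfl

@[simp] theorem weight_append (A B : List (Cell D)) : weight (A ++ B) = weight A + weight B := by
  simp [weight]

theorem weight_le (Q : List (Cell D)) : weight Q ≤ 3 * Q.length := by
  induction Q with
  | nil => simp
  | cons c Q ih => simp only [weight_cons, List.length_cons]; split_ifs <;> omega

theorem weight_splitFirst_le (c : Cell D) : weight (T.splitFirst c) ≤ weight [c] := by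
  obtain ⟨o, t, n⟩ := c
  simp only [splitFirst]
  split_ifs <;> simp

theorem weight_splitLast_le (c : Cell D) : weight (splitLast c) ≤ weight [c] := by
  obtain ⟨o, t, n⟩ := c
  simp only [splitLast]
  split_ifs <;> simp

theorem length_splitFirst_le (c : Cell D) : (T.splitFirst c).length ≤ 1 := by
  obtain ⟨o, t, n⟩ := c
  simp only [splitFirst]
  split_ifs <;> simp

/-- The invariant of the reduction: the cells describe the (closed) walk `l`, and no move applies
to a strip that ends after the first `u` cells. -/
structure Good (lin : Bool) (l : List D) (Q : List (Cell D)) (u : ℕ) : Prop where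
  ok : T.RingOk Q
  darts : (T.ringDarts Q).IsRotated (ringList lin l)
  walk : T.IsRingWalk lin l
  verified : T.Verified (keys Q) u

/-- The quantity that decreases at each step of the reduction. -/
noncomputable def measure (lin : Bool) (l : List D) (Q : List (Cell D)) (u : ℕ) : ℕ :=
  17 * (32 * T.rank lin l + weight Q) + u

/-- A step of the reduction. -/
def Next (lin : Bool) (l : List D) (Q : List (Cell D)) (u : ℕ) (Q' : List (Cell D)) (u' : ℕ) :
    Prop :=
  ∃ l', T.Good lin l' Q' u' ∧ (l' = l ∨ T.RingMove lin l l') ∧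
    T.measure lin l' Q' u' < T.measure lin l Q u

variable {T}

/-- The other side of the strip `W` is attached to the rest of the ring. -/
theorem Good.attach {lin : Bool} {l : List D} {Q : List (Cell D)} {u : ℕ}
    (h : T.Good lin l Q u) {W S M N F B : List (Cell D)} (hok : T.RingOk (W ++ (S ++ M)))
    (hdarts : (T.ringDarts (W ++ (S ++ M))).IsRotated (T.ringDarts Q))
    (hQ : Q = F ++ M ++ B) (hS : S.length ≤ 1) (hwS : weight (S ++ M) ≤ weight Q)
    {s s' : List D} (hW : T.ringDarts W = s.map some) (hN : ∀ x, T.Linked N x)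
    (hN' : T.ringDarts N = s'.map some) (hNl : N.length ≤ 8) {ε : ℤ} (hε : ε = 1 ∨ ε = -1)
    (hs : (T.orient ε).Shape (s.map some ++ T.ringDarts (S ++ M)).getLast?.join
      (T.ringDarts (S ++ M) ++ s.map some).head?.join s s') :
    (S ++ M = [] → T.Next lin l Q u N (u + 16)) ∧
    ∀ R c, S ++ M = R ++ [c] → T.Next lin l Q u
      ((T.lastDart c (firstOr W none), if c.2.1 = 7 then 7 else 6, 1) ::
        (N ++ (R ++ splitLast c))) (u + 16) := by
  have hv := h.verified
  rw [hQ, keys_append, keys_append] at hv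
  have hwN := weight_le N
  have hd := hdarts.trans h.darts
  rw [ringDarts_append, hW] at hd
  constructor
  · intro h0
    simp only [h0, List.append_nil, ringDarts_nil] at hd hs hok
    obtain ⟨l', h1, h2⟩ := h.walk.exists_move (R' := T.ringDarts N) (post := []) hd
      (s := s) (s' := s') (by simp [List.IsRotated.refl])
      (by rw [hN']; simp [List.IsRotated.refl]) hε (by simpa using hs)
    refine ⟨l', ⟨hN _, h1, h2.isRingWalk h.walk, ?_⟩, .inr h2, ?_⟩
    · have := hv.modify (N := keys N) (P := []) (S := []) (List.nil_prefix) (by simp; omega)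
      simpa using this
    · have := T.rank_lt h.walk h2
      simp only [measure]; omega
  · intro R c hR
    have hok' := hok
    rw [ringOk_append] at hok'
    have hl := hok'.2
    have hw : firstOr W (firstOr (S ++ M) none) = firstOr W none := by
      cases W with
      | nil =>
        have : s = [] := by simpa using hW.symm
        subst this
        rcases hs.cases_ends with ⟨e, h, -⟩ | ⟨e, js, js', h, -⟩
        · simp at h
        · exact absurd h.symm (by simp)
      | cons c W => rfl
    rw [hw, hR] at hl
    obtain ⟨h1, h2⟩ := T.ringOk_attach hl hN
    rw [hR] at hd hs
    have h2' := h2.trans (by rw [hN'])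
    obtain ⟨l', h3, h4⟩ := h.walk.exists_move hd (.refl _) h2' hε hs
    refine ⟨l', ⟨h1, h3, h4.isRingWalk h.walk, ?_⟩, .inr h4, ?_⟩
    · have hp : keys (R ++ splitLast c) <+: keys S ++ keys M := by
        rw [← keys_append, hR]
        exact keys_splitLast_prefix R c
      have := hv.modify (N := keys ((T.lastDart c (firstOr W none),
        if c.2.1 = 7 then 7 else 6, 1) :: N)) hp (by simp; omega)
      simpa using this
    -- One unit of rank is worth `32` units of weight. The at most eight cells of `N` weigh at most
    -- `24` and the vertex put in front weighs at most `3`. One unit of weight is worth `17`, more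
    -- than the `16` added to the counter.
    · have := T.rank_lt h.walk h4
      have h5 := weight_splitLast_le c
      rw [hR] at hwS
      simp only [measure, weight_cons, weight_append, weight_nil] at hwS h5 ⊢
      split_ifs at * <;> omega

end ReducingTriangulation

namespace ReducingTriangulation

variable {D : Type*} (T : ReducingTriangulation D)

/-! ### Steps of the reduction -/

theorem IsRingWalk.adj {T : ReducingTriangulation D} {lin : Bool} {l : List D}
    (hl : T.IsRingWalk lin l) {e e' : D}
    (h : (some e, some e') ∈ cyclicCorners (ringList lin l)) : T.Adj e e' := by
  have key : ∀ l : List D, (some e, some e') ∈ corners (l.map some) → (e, e') ∈ corners l := by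
    intro l hm
    rw [corners, ← List.map_tail, List.zip_map, List.mem_map] at hm
    obtain ⟨⟨a, b⟩, h1, h2⟩ := hm
    simp only [Prod.map_apply, Prod.mk.injEq, Option.some.injEq] at h2
    obtain ⟨rfl, rfl⟩ := h2
    exact h1
  cases lin with
  | false =>
    obtain ⟨u, hu⟩ := hl
    refine hu.cyclic_adj (e, e') ?_
    cases l with
    | nil => simp [ringList] at h
    | cons a l =>
      have h' : (some e, some e') ∈ cyclicCorners (some a :: l.map some) := by
        simpa [ringList] using h
      rw [cyclicCorners_cons] at h' ⊢
      exact key _ (by simpa using h')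
  | true =>
    obtain ⟨u, v, hu⟩ := hl
    refine hu.adj (e, e') (key _ ?_)
    have h' : (some e, some e') ∈ cyclicCorners (none :: l.map some) := by
      simpa [ringList] using h
    rw [cyclicCorners_cons] at h'
    generalize l.map some = A at h' ⊢
    cases A with
    | nil => simp at h'
    | cons a A =>
      rcases List.eq_nil_or_concat' (a :: A) with h0 | ⟨B, b, hB⟩
      · simp at h0
      · rw [List.cons_append, List.cons_append, corners_cons_cons, List.mem_cons,
          ← List.cons_append, hB, List.append_assoc, List.singleton_append, corners_append_cons,
          ← hB] at h'
        simpa using h'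

theorem cellDarts_eq_cons (c : Cell D) : ∃ m, T.cellDarts c = c.1 :: m := by
  obtain ⟨o, t, n⟩ := c
  cases o with
  | none => exact ⟨[], rfl⟩
  | some e =>
    obtain ⟨m, hm⟩ := T.path_eq_cons e (List.replicate (n - 1).toNat t)
    exact ⟨m.map some, by rw [cellDarts, hm]; rfl⟩

theorem ringDarts_append_singleton (Q : List (Cell D)) (x : Option D) :
    ∃ m, T.ringDarts Q ++ [x] = firstOr Q x :: m := by
  cases Q with
  | nil => exact ⟨[], rfl⟩
  | cons c Q =>
    obtain ⟨m, hm⟩ := T.cellDarts_eq_cons c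
    exact ⟨m ++ T.ringDarts Q ++ [x], by simp [hm]⟩

variable {T}

theorem Good.adj_first {lin : Bool} {l : List D} {e e' : D} {t : ℤ} {Q : List (Cell D)} {u : ℕ}
    (h : T.Good lin l ((some e, t, 1) :: Q) u) (he : firstOr Q (some e) = some e') :
    T.Adj e e' := by
  refine h.walk.adj ((mem_cyclicCorners_of_isRotated h.darts _).1 ?_)
  simp only [ringDarts_cons, cellDarts_one, List.cons_append, List.nil_append]
  rw [cyclicCorners_cons, List.cons_append]
  obtain ⟨m, hm⟩ := T.ringDarts_append_singleton Q (some e)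
  rw [hm, he]
  simp

/-- Computing a turn makes the weight of the cell fall from three to one, which pays for the sixteen
cells to be tested again. -/
theorem Good.eval {lin : Bool} {l : List D} {e : D} {t : ℤ} {Q : List (Cell D)} {u : ℕ}
    (h : T.Good lin l ((some e, 6, 1) :: Q) u) (ht : T.CellOk (some e, t, 1) (firstOr Q (some e)))
    (ht6 : t ≠ 6) : T.Next lin l ((some e, 6, 1) :: Q) u ((some e, t, 1) :: Q) (u + 16) := by
  refine ⟨l, ⟨⟨ht, h.ok.2⟩, by simpa using h.darts, h.walk, ?_⟩, .inl rfl, ?_⟩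
  · have := h.verified
    have := Verified.modify (F := [(some e, 6)]) (M := keys Q) (B := []) (S := []) (P := keys Q)
      (N := [(some e, t)]) (u := u) (by simpa using this) (by simp) (by simp)
    simpa using this
  · simp only [measure, weight_cons, ht6, if_true, if_false]; omega

theorem Good.rotate {lin : Bool} {l : List D} {c : Cell D} {Q : List (Cell D)} {u : ℕ}
    (h : T.Good lin l (c :: Q) (u + 1)) (hc : T.Pass c.2.1 (keys Q).reverse) :
    T.Next lin l (c :: Q) (u + 1) (Q ++ [c]) u := by
  refine ⟨l, ⟨?_, ?_, h.walk, ?_⟩, .inl rfl, ?_⟩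
  · exact RingOk.comm (A := [c]) h.ok
  · refine List.IsRotated.trans ?_ h.darts
    rw [ringDarts_append]
    simpa using isRotated_append_comm (T.ringDarts Q) (T.cellDarts c)
  · have := Verified.rotate (c := (c.1, c.2.1)) h.verified hc
    rw [keys_append]
    exact this
  · simp only [measure, weight_cons, weight_append, weight_nil]; omega

theorem Good.empty {lin : Bool} {l : List D} {u : ℕ} (h : T.Good lin l [] (u + 1)) :
    T.Next lin l [] (u + 1) [] u := by
  refine ⟨l, ⟨h.ok, h.darts, h.walk, ?_⟩, .inl rfl, ?_⟩
  · intro A c B h0; simp at h0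
  · simp only [measure]; omega

/-- In cyclic order the last cell precedes the first, so the two runs are consecutive. The walk is
unchanged and one cell disappears, which is worth `17` against the `16` added to the counter. -/
theorem Good.merge {lin : Bool} {l : List D} {o o' : Option D} {n m : ℤ} {M : List (Cell D)}
    {u : ℕ} {t : ℤ} (ht : t = 3 ∨ t = -3)
    (h : T.Good lin l ((o, t, n) :: (M ++ [(o', t, m)])) u) :
    T.Next lin l ((o, t, n) :: (M ++ [(o', t, m)])) u ((o', t, m + n) :: M) (u + 16) := by
  have h1 : T.RingOk ((o', t, m) :: (o, t, n) :: M) :=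
    RingOk.comm (A := (o, t, n) :: M) (B := [(o', t, m)]) (by simpa using h.ok)
  obtain ⟨h2, h3, h4⟩ := h1
  obtain ⟨e, k, rfl, rfl, -, hx⟩ := CellOk.of_small h2 (by omega)
  simp only [firstOr_cons] at hx h3
  obtain ⟨e', k', rfl, rfl, -, hx'⟩ := CellOk.of_small h3 (by omega)
  simp only [Option.some.injEq] at hx
  have hr : List.replicate (k + (k' + 1)) t = List.replicate k t ++ t :: List.replicate k' t := by
    rw [← List.replicate_append_replicate, List.replicate_succ]
  have hn : (k : ℤ) + 1 + (k' + 1) = (k + (k' + 1) : ℕ) + 1 := by push_cast; ring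
  have hd : T.cellDarts (some e, t, (k : ℤ) + 1 + (k' + 1)) =
      T.cellDarts (some e, t, (k : ℤ) + 1) ++ T.cellDarts (some e', t, (k' : ℤ) + 1) := by
    rw [hn]
    simp only [cellDarts, add_sub_cancel_right, Int.toNat_natCast]
    rw [hr, path_append_cons, ← hx, List.map_append]
  refine ⟨l, ⟨⟨?_, h4⟩, ?_, h.walk, ?_⟩, .inl rfl, ?_⟩
  · have := CellOk.run (T := T) e t (k + (k' + 1)) (by omega) (.inr ht)
    rw [hr, pathLast_append, pathLast_cons, ← hx, ← hx'] at this
    rw [hn]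
    exact this
  · refine List.IsRotated.trans ?_ h.darts
    have := isRotated_append_comm (T.cellDarts (some e, t, (k : ℤ) + 1))
      (T.cellDarts (some e', t, (k' : ℤ) + 1) ++ T.ringDarts M)
    simpa [hd] using this
  · have := Verified.modify (F := [(some e', t)]) (M := keys M) (B := [(some e, t)]) (S := [])
      (P := keys M) (N := [(some e, t)]) (u := u) (by simpa using h.verified) (by simp) (by simp)
    simpa using this
  · have : t ≠ 6 := by omega
    simp only [measure, weight_cons, weight_append, weight_nil, this, if_false]; omega

theorem RingOk.splitFirst {A : List (Cell D)} {y : Cell D} {M : List (Cell D)}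
    (h : T.RingOk (A ++ y :: M)) :
    T.RingOk ((A ++ [(y.1, y.2.1, 1)]) ++ (T.splitFirst y ++ M)) ∧
      T.ringDarts ((A ++ [(y.1, y.2.1, 1)]) ++ (T.splitFirst y ++ M)) =
        T.ringDarts (A ++ y :: M) := by
  rw [ringOk_append] at h
  obtain ⟨h1, h2, h3⟩ := h
  obtain ⟨h4, h5⟩ := CellOk.splitFirst h2
  constructor
  · rw [List.append_assoc, List.singleton_append, ringOk_append]
    simp only [linked_cons, linked_append, firstOr_cons, firstOr_append] at h1 h5 ⊢
    exact ⟨h1, h5.1, h5.2, by cases A <;> simpa using h3⟩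
  · simp [h4]

theorem Good.spur {lin : Bool} {l : List D} {o : Option D} {n : ℤ} {Q : List (Cell D)} {u : ℕ}
    (h : T.Good lin l ((o, 0, n) :: Q) u) :
    ∃ e y M, o = some e ∧ Q = y :: M ∧ y.1 = some (T.rev e) ∧
      (T.splitFirst y ++ M = [] → T.Next lin l ((o, 0, n) :: Q) u [] (u + 16)) ∧
      ∀ R c, T.splitFirst y ++ M = R ++ [c] → T.Next lin l ((o, 0, n) :: Q) u
        ((T.lastDart c (some e), if c.2.1 = 7 then 7 else 6, 1) :: (R ++ splitLast c))
        (u + 16) := by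
  obtain ⟨e, k, rfl, rfl, hk, hx⟩ := CellOk.of_small h.ok.1 (by omega)
  obtain rfl : k = 0 := by omega
  simp only [rot_zero, List.replicate_zero, pathLast_nil] at hx
  cases Q with
  -- A ring of one dart cannot make a spur, since no dart is its own reverse. Hence the strip uses a
  -- second cell.
  | nil => simp at hx; exact absurd hx.symm (T.rev_ne e)
  | cons y M =>
    have hy : y.1 = some (T.rev e) := by simpa using hx
    refine ⟨e, y, M, rfl, rfl, hy, ?_⟩
    obtain ⟨h1, h2⟩ := RingOk.splitFirst (A := [(some e, 0, (0 : ℕ) + 1)]) h.ok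
    have := h.attach (N := []) (s := [e, T.rev e]) (s' := []) (ε := 1)
      (F := [(some e, 0, (0 : ℕ) + 1), y]) (B := []) h1
      (by rw [h2]; exact .refl _) (by simp) (T.length_splitFirst_le y) ?_ (by simp [hy]) (by simp)
      rfl (by simp) (.inl rfl) (.spur (T := T) e)
    · simpa using this
    · have := T.weight_splitFirst_le y
      simp only [weight_append, weight_cons, weight_nil] at this ⊢
      omega

theorem Good.spike {lin : Bool} {l : List D} {o : Option D} {n ε : ℤ} (hε : ε = 1 ∨ ε = -1)
    {Q : List (Cell D)} {u : ℕ} (h : T.Good lin l ((o, ε, n) :: Q) u) :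
    ∃ e y M, o = some e ∧ Q = y :: M ∧ (∃ d, y.1 = some d) ∧
      (T.splitFirst y ++ M = [] → T.Next lin l ((o, ε, n) :: Q) u
        [(some (T.rot (-ε) e), 6, 1)] (u + 16)) ∧
      ∀ R c, T.splitFirst y ++ M = R ++ [c] → T.Next lin l ((o, ε, n) :: Q) u
        ((T.lastDart c (some e), if c.2.1 = 7 then 7 else 6, 1) ::
          (some (T.rot (-ε) e), 6, 1) :: (R ++ splitLast c)) (u + 16) := by
  obtain ⟨e, k, rfl, rfl, hk, hx⟩ := CellOk.of_small h.ok.1 (by omega)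
  obtain rfl : k = 0 := by omega
  simp only [List.replicate_zero, pathLast_nil] at hx
  cases Q with
  -- With one dart only, `e` would follow itself in a face, on the left or on the right according to
  -- `ε`.
  | nil =>
    simp only [firstOr_cons, firstOr_nil, Option.some.injEq] at hx
    have := (T.orient ε).face_ne e
    rw [cw_eq_rot, T.orient_rot hε, mul_one, T.orient_rev hε] at this
    exact absurd hx.symm this
  | cons y M =>
    have hy : y.1 = some (T.rot ε (T.rev e)) := by simpa using hx
    refine ⟨e, y, M, rfl, rfl, ⟨_, hy⟩, ?_⟩
    obtain ⟨h1, h2⟩ := RingOk.splitFirst (A := [(some e, ε, (0 : ℕ) + 1)]) h.ok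
    have := h.attach (N := [(some (T.rot (-ε) e), 6, 1)]) (s := (T.orient ε).path e [1])
      (s' := [(T.orient ε).rot (-1) e]) (ε := ε)
      (F := [(some e, ε, (0 : ℕ) + 1), y]) (B := []) h1
      (by rw [h2]; exact .refl _) (by simp) (T.length_splitFirst_le y) ?_
      (by simp [hy, T.orient_rot hε, T.orient_rev hε]) (by simp [CellOk.unknown])
      (by simp [T.orient_rot hε]) (by simp) hε (.spike e)
    · simpa using this
    · have := T.weight_splitFirst_le y
      simp only [weight_append, weight_cons, weight_nil] at this ⊢
      omega

theorem CellOk.of_two {ε : ℤ} (hε : ε = 1 ∨ ε = -1) {o x : Option D} {n : ℤ}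
    (h : T.CellOk (o, ε * 2, n) x) :
    ∃ e, o = some e ∧ n = 1 ∧ x = some (T.rot (ε * 2) (T.rev e)) := by
  obtain ⟨e, k, rfl, rfl, hk, hx⟩ := CellOk.of_small h (by omega)
  obtain rfl : k = 0 := by omega
  exact ⟨e, rfl, rfl, hx⟩

/-- The strip starts with the first `2` near the end of the queue, goes through the run (possibly
empty) and the `2` at the front, and ends with the first dart of `y`, which leaves the last vertex
of the bracket. The new cells are one run of turns `-3` and one unknown vertex. -/
theorem Good.bracket {lin : Bool} {l : List D} {o o₂ : Option D} {n n₂ ε : ℤ}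
    (hε : ε = 1 ∨ ε = -1) {y : Cell D} {M : List (Cell D)} {e₃ : D} {k u : ℕ}
    {Q : List (Cell D)} (hQ : Q = (o, ε * 2, n) :: y :: (M ++ (o₂, ε * 2, n₂) ::
      runCells e₃ (ε * 3) k)) (h : T.Good lin l Q u) :
    ∃ e₁ ey, o₂ = some e₁ ∧ y.1 = some ey ∧ ∀ N, N = runCells (T.rot (-ε) e₁) (ε * -3) (k + 1) ++
        [(some (T.rot (-ε) (T.rev (T.rot (-ε) ey))), 6, 1)] →
      (T.splitFirst y ++ M = [] → T.Next lin l Q u N (u + 16)) ∧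
      ∀ R c, T.splitFirst y ++ M = R ++ [c] → T.Next lin l Q u
        ((T.lastDart c (some e₁), if c.2.1 = 7 then 7 else 6, 1) :: (N ++ (R ++ splitLast c)))
        (u + 16) := by
  have hok : T.RingOk (((o₂, ε * 2, n₂) :: (runCells e₃ (ε * 3) k ++ [(o, ε * 2, n)])) ++
      y :: M) := by
    have := h.ok
    rw [hQ, ← List.cons_append, ← List.cons_append] at this
    simpa using this.comm
  have h3 : ε * 3 = 3 ∨ ε * 3 = -3 := by rcases hε with rfl | rfl <;> norm_num
  have h1 := ((T.ringOk_append _ _).1 hok).1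
  simp only [linked_cons, linked_append, firstOr_append, firstOr_cons, firstOr_nil,
    linked_nil, and_true] at h1
  obtain ⟨e₁, rfl, rfl, hx⟩ := h1.1.of_two hε
  obtain ⟨ec, rfl, rfl, hy⟩ := h1.2.2.of_two hε
  obtain ⟨h4, h5⟩ := T.runCells_of_linked h3 h1.2.1 hx
  refine ⟨e₁, _, rfl, hy, fun N hN => ?_⟩
  obtain ⟨h6, h7⟩ := hok.splitFirst
  have hs : T.ringDarts ((some e₁, ε * 2, 1) ::
      (runCells e₃ (ε * 3) k ++ [(some ec, ε * 2, 1)]) ++ [(y.1, y.2.1, 1)]) =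
      ((T.orient ε).path e₁ (2 :: (List.replicate k 3 ++ [2]))).map some := by
    rw [T.orient_path hε, List.map_cons, List.map_append, List.map_replicate, path_cons,
      List.map_cons, List.map_cons, path_append_cons, h4]
    simp [hy, ← h5]
  have hlast : T.rot (-ε) (T.rev (T.rot (-ε) (T.rot (ε * 2) (T.rev ec)))) =
      (T.orient ε).pathLast ((T.orient ε).rot (-1) e₁) (List.replicate (k + 1) (-3)) := by
    rw [(T.orient ε).pathLast_bracket, rev_face_eq, T.orient_rot hε, T.orient_rev hε,
      T.orient_rot hε, T.orient_pathLast hε, List.map_cons, List.map_append, List.map_replicate,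
      pathLast_cons, List.map_cons, pathLast_append, h4]
    simp
  have hd : T.ringDarts N = ((T.orient ε).path ((T.orient ε).rot (-1) e₁)
      (List.replicate (k + 1) (-3))).map some := by
    rw [hN, hlast, T.orient_path hε, T.orient_pathLast hε, T.orient_rot hε, List.map_replicate,
      ← ringDarts_runCells]
    simp
  have hl : ∀ x, T.Linked N x := by
    intro x
    have := T.linked_runCells (t := ε * -3) (by omega) (T.rot (-ε) e₁) (k + 1)
    rw [hN, hlast, T.orient_pathLast hε, T.orient_rot hε, List.map_replicate]
    simp only [linked_append, linked_cons, firstOr_cons, linked_nil, and_true, mul_neg_one]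
    exact ⟨this, .unknown _ _⟩
  have hNl : N.length ≤ 8 := by
    rw [hN]; simp [runCells]
  have := h.attach (ε := ε) (F := [(some ec, ε * 2, 1), y]) (M := M)
    (B := (some e₁, ε * 2, 1) :: runCells e₃ (ε * 3) k) h6 ?_ (by rw [hQ]; simp)
    (T.length_splitFirst_le y) ?_ hs hl hd hNl hε (.bracket e₁ k)
  · simpa using this
  · rw [h7, hQ]
    have := isRotated_append_comm (T.ringDarts ((some e₁, ε * 2, 1) :: runCells e₃ (ε * 3) k))
      (T.ringDarts ((some ec, ε * 2, 1) :: y :: M))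
    simpa using this
  · have := T.weight_splitFirst_le y
    simp only [hQ, weight_append, weight_cons, weight_nil] at this ⊢
    omega

theorem CellOk.turn_lastDart {c : Cell D} {e : D} (h : T.CellOk c (some e)) (h6 : c.2.1 ≠ 6)
    {f : D} (hf : T.lastDart c (some e) = some f) :
    T.Adj f e ∧ (T.turn f e = c.2.1 ∨ (c.2.1 = 4 ∧ 4 ≤ T.turn f e)) := by
  generalize hx : some e = x at h hf
  cases h with
  | unknown e x => exact absurd rfl h6
  | gap x => simp [ReducingTriangulation.lastDart] at hf
  | fin e => simp at hx
  | big e e' h h4 =>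
    simp only [ReducingTriangulation.lastDart, if_true, Option.some.injEq] at hf hx
    subst hf; subst hx
    exact ⟨h, .inr ⟨rfl, h4⟩⟩
  | run e₁ t k h hk =>
    have h1 := (CellOk.splitLast (CellOk.run (T := T) e₁ t k h hk)).1
    obtain ⟨m, hm⟩ := T.path_eq_concat e₁ (List.replicate k t)
    simp only [cellDarts, add_sub_cancel_right, Int.toNat_natCast] at h1
    rw [hm, List.map_append] at h1
    have h2 := (List.append_inj' h1 rfl).2
    rw [hf] at h2
    simp only [List.map_cons, List.map_nil, List.cons.injEq, Option.some.injEq, and_true] at h2 hx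
    rw [hx, h2]
    exact ⟨T.adj_rot _ _, .inl (T.turn_rot_small h.1 (by omega))⟩

/-- The class `4` stands for many turns, but none of them is one of the small turns that forbid a
flip, on either side. -/
theorem turn_not_mem_of_class {ε : ℤ} (hε : ε = 1 ∨ ε = -1) {f e : D} {t : ℤ}
    (h : T.Adj f e ∧ (T.turn f e = t ∨ (t = 4 ∧ 4 ≤ T.turn f e)))
    (ht : t ∉ ({6, 0, 1, -1, ε * 2, ε * 3} : Set ℤ)) :
    (T.orient ε).turn f e ∉ ({-1, 0, 1, 2, 3} : Set ℤ) := by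
  simp only [Set.mem_insert_iff, Set.mem_singleton_iff, not_or] at ht ⊢
  obtain ⟨h1, h2⟩ := h
  have key : ∀ j : ℤ, -1 ≤ j → j ≤ 3 → (T.orient ε).turn f e = j → t = ε * j := by
    intro j hj hj' hjj
    rw [T.orient_turn_eq hε h1 (by omega) hj'] at hjj
    rcases h2 with h2 | ⟨-, h2⟩
    · omega
    · rcases hε with rfl | rfl <;> omega
  refine ⟨?_, ?_, ?_, ?_, ?_⟩
  all_goals
    intro hj
    have := key _ (by norm_num) (by norm_num) hj
    rcases hε with rfl | rfl <;> omega

/-- The base of the strip ends with the first dart of the cell at the front, whose turn `t` is the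
turn `b`. The turn `a` is that of the last vertex of what remains once the strip is removed. If
nothing remains, then `a` and `b` belong to the same vertex. -/
theorem Good.flip {lin : Bool} {l : List D} {o o₂ : Option D} {t n n₂ ε : ℤ}
    (hε : ε = 1 ∨ ε = -1) {M : List (Cell D)} {e₃ e₄ : D} {k m u : ℕ}
    {Q : List (Cell D)} (hQ : Q = (o, t, n) :: (M ++ (runCells e₃ (ε * 3) k ++ (o₂, ε * 2, n₂) ::
      runCells e₄ (ε * 3) m))) (h : T.Good lin l Q u)
    (ht : t ∉ ({6, 0, 1, -1, ε * 2, ε * 3} : Set ℤ)) (hr : ∃ d, o₂ = some d ∧ T.red d = true)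
    (hM : ∀ R c, M = R ++ [c] → c.2.1 ∉ ({6, 0, 1, -1, ε * 2, ε * 3} : Set ℤ)) :
    ∃ e₁ d el, o₂ = some d ∧ o = some el ∧ firstOr (runCells e₃ (ε * 3) k) o₂ = some e₁ ∧
      ∀ N, N = (some (T.rot (-ε) e₁), 6, 1) :: (T.pushCells ε e₃ k d ++ (T.pushCells ε e₄ m el ++
        [(some (T.rot (-ε) (T.rev (T.rot (-ε) el))), 6, 1)])) →
      (T.splitFirst (o, t, n) ++ M = [] → T.Next lin l Q u N (u + 16)) ∧
      ∀ R c, T.splitFirst (o, t, n) ++ M = R ++ [c] → T.Next lin l Q u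
        ((T.lastDart c (some e₁), if c.2.1 = 7 then 7 else 6, 1) :: (N ++ (R ++ splitLast c)))
        (u + 16) := by
  obtain ⟨d, rfl, hr⟩ := hr
  have hok : T.RingOk ((runCells e₃ (ε * 3) k ++ (some d, ε * 2, n₂) ::
      runCells e₄ (ε * 3) m) ++ (o, t, n) :: M) := by
    have := h.ok
    rw [hQ, ← List.cons_append] at this
    exact this.comm
  have h3 : ε * 3 = 3 ∨ ε * 3 = -3 := by rcases hε with rfl | rfl <;> norm_num
  have h1 := ((T.ringOk_append _ _).1 hok).1
  simp only [linked_cons, linked_append, firstOr_cons] at h1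
  obtain ⟨d', hd', rfl, hx⟩ := h1.2.1.of_two hε
  obtain rfl : d = d' := by simpa using hd'
  obtain ⟨el, rfl⟩ : ∃ el, o = some el := by
    cases m with
    | zero => exact ⟨_, by simpa [runCells] using hx⟩
    | succ m =>
      have := h1.2.2
      simp only [runCells, Nat.add_eq_zero_iff, one_ne_zero, and_false, if_false, linked_cons,
        firstOr_nil, linked_nil, and_true] at this
      obtain ⟨_, _, _, _, _, h⟩ := CellOk.of_small this (by omega)
      exact ⟨_, h⟩
  obtain ⟨e₁, he₁⟩ : ∃ e₁, firstOr (runCells e₃ (ε * 3) k) (some d) = some e₁ := by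
    cases k <;> simp [runCells]
  refine ⟨e₁, d, el, rfl, rfl, he₁, fun N hN => ?_⟩
  obtain ⟨h4, h5⟩ := T.runCells_of_linked h3 h1.1 he₁
  obtain ⟨h4', h5'⟩ := T.runCells_of_linked h3 h1.2.2 hx
  obtain ⟨h6, h7⟩ := hok.splitFirst
  have hs : T.ringDarts ((runCells e₃ (ε * 3) k ++ (some d, ε * 2, 1) ::
      runCells e₄ (ε * 3) m) ++ [(some el, t, 1)]) =
      ((T.orient ε).path e₁ (List.replicate k 3 ++ 2 :: List.replicate m 3)).map some := by
    rw [T.orient_path hε, List.map_append, List.map_cons, List.map_replicate, List.map_replicate,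
      path_append_cons, h4, List.map_append, ← h5, ← h5']
    simp
  have hp : T.pushCells ε e₃ k d =
      T.pushCells ε e₁ k ((T.orient ε).pathLast e₁ (List.replicate k 3)) := by
    rw [T.orient_pathLast hε, List.map_replicate, h4]
    cases k with
    | zero => simp [pushCells]
    | succ k =>
      have : e₃ = e₁ := by simpa [runCells] using he₁
      rw [this]
  set e₅ := T.rot (ε * 2) (T.rev d) with he₅
  have hp' : T.pushCells ε e₄ m el =
      T.pushCells ε e₅ m ((T.orient ε).pathLast e₅ (List.replicate m 3)) := by
    rw [T.orient_pathLast hε, List.map_replicate, h4']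
    cases m with
    | zero => simp [pushCells]
    | succ m =>
      have : e₄ = e₅ := by simpa [runCells] using hx
      rw [this]
  obtain ⟨q1, q2⟩ := T.pushCells_spec hε e₁ k
  obtain ⟨q3, q4⟩ := T.pushCells_spec hε e₅ m
  have hd : T.ringDarts N = ((T.orient ε).path ((T.orient ε).rot (-1) e₁)
      (flipTurns k m)).map some := by
    have hh : (T.orient ε).leftSide ((T.orient ε).path e₁
        (List.replicate k 3 ++ 2 :: List.replicate m 3)) =
        (T.orient ε).rev ((T.orient ε).face ((T.orient ε).face e₁)) ::
          (T.orient ε).leftTail ((T.orient ε).path e₁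
            (List.replicate k 3 ++ 2 :: List.replicate m 3)) := by
      obtain ⟨q, hq⟩ := (T.orient ε).path_eq_cons e₁ (List.replicate k 3 ++ 2 :: List.replicate m 3)
      rw [hq]; rfl
    rw [← (T.orient ε).leftSide_flip, hh, (T.orient ε).leftTail_append _ _ _ rfl,
      (T.orient ε).leftTail_three, hN, hp, hp']
    simp only [ringDarts_cons, ringDarts_append, q2, q4, cellDarts_one, ringDarts_nil]
    have e5 : (T.orient ε).rot 2 ((T.orient ε).rev ((T.orient ε).pathLast e₁
        (List.replicate k 3))) = e₅ := by
      rw [T.orient_rot hε, T.orient_rev hε, T.orient_pathLast hε, List.map_replicate, h4]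
    rw [e5, rev_face_face_eq, rev_face_eq, T.orient_rot hε, T.orient_rot hε, T.orient_rev hε,
      T.orient_rot hε, T.orient_pathLast hε _ (List.replicate m 3), List.map_replicate, h4']
    simp
  have hl : ∀ x, T.Linked N x := by
    intro x
    rw [hN, hp, hp']
    simp only [linked_append, linked_cons, firstOr_cons, linked_nil, and_true]
    exact ⟨.unknown _ _, q1 _, q3 _, .unknown _ _⟩
  have hNl : N.length ≤ 8 := by
    rw [hN]
    simp only [List.length_cons, List.length_append, pushCells, runCells]
    split_ifs <;> simp
  have hends := (T.ringOk_append _ _).1 hok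
  have hw : firstOr (runCells e₃ (ε * 3) k ++ (some d, ε * 2, 1) :: runCells e₄ (ε * 3) m) none =
    some e₁ := by rw [firstOr_append, firstOr_cons]; exact he₁
  have hlink : T.Linked (T.splitFirst (some el, t, n) ++ M) (some e₁) := by
    have := ((T.ringOk_append _ _).1 h6).2
    rw [firstOr_append, firstOr_append] at this
    simpa [he₁] using this
  have hpl : (T.orient ε).pathLast e₁ (List.replicate k 3 ++ 2 :: List.replicate m 3) = el := by
    rw [T.orient_pathLast hε, List.map_append, List.map_cons, List.map_replicate,
      List.map_replicate, pathLast_append, pathLast_cons, h4, h4']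
  have hred : (T.orient ε).red e₁ = true := by
    rw [← (T.orient ε).red_pathLast_three e₁ k, T.orient_red hε, T.orient_pathLast hε,
      List.map_replicate, h4, hr]
  have hel : T.CellOk (some el, t, 1) (firstOr (T.splitFirst (some el, t, n) ++ M) (some e₁)) := by
    have := ((T.ringOk_append _ _).1 h6).1
    rw [linked_append] at this
    simpa [he₁] using this.2.1
  have ht6 : t ≠ 6 := by rintro rfl; simp at ht
  -- If `M` is empty, the cell before the strip is the rest of the cell at the front, with the same
  -- turn `t`.
  have hcls : ∀ R c, T.splitFirst (some el, t, n) ++ M = R ++ [c] →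
      c.2.1 ∉ ({6, 0, 1, -1, ε * 2, ε * 3} : Set ℤ) := by
    intro R c hR
    rcases List.eq_nil_or_concat' M with rfl | ⟨M', c', rfl⟩
    · simp only [splitFirst, List.append_nil] at hR
      split_ifs at hR
      · simp at hR
      · obtain ⟨-, h⟩ := List.append_inj' (s₁ := []) hR rfl
        simp only [List.cons.injEq, and_true] at h
        subst h
        exact ht
    · rw [← List.append_assoc] at hR
      obtain ⟨-, h⟩ := List.append_inj' hR rfl
      simp only [List.cons.injEq, and_true] at h
      subst h
      exact hM M' _ rfl
  have := h.attach (ε := ε) (F := [(some el, t, n)]) (M := M)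
    (B := runCells e₃ (ε * 3) k ++ (some d, ε * 2, 1) :: runCells e₄ (ε * 3) m) h6 ?_
    (by rw [hQ]; simp) (T.length_splitFirst_le _) ?_ hs hl hd hNl hε (.flip e₁ k m hred ?_ ?_)
  · simpa [he₁] using this
  · rw [h7, hQ]
    have := isRotated_append_comm (T.ringDarts (runCells e₃ (ε * 3) k ++ (some d, ε * 2, 1) ::
      runCells e₄ (ε * 3) m)) (T.ringDarts ((some el, t, n) :: M))
    simpa using this
  · have := T.weight_splitFirst_le (some el, t, n)
    simp only [hQ, weight_append, weight_cons, weight_nil] at this ⊢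
    omega
  · intro f hf
    rcases List.eq_nil_or_concat' (T.splitFirst (some el, t, n) ++ M) with h0 | ⟨R, c, hR⟩
    · rw [h0] at hel hf
      obtain ⟨q, hq⟩ := (T.orient ε).path_eq_concat e₁
        (List.replicate k 3 ++ 2 :: List.replicate m 3)
      rw [hq, hpl] at hf
      obtain rfl : el = f := by simpa using hf
      exact turn_not_mem_of_class hε (hel.turn_lastDart ht6 (by simp [lastDart])) ht
    · rw [hR, linked_append, linked_cons, firstOr_nil] at hlink
      rw [hR, ringDarts_append, ringDarts_cons, ringDarts_nil, List.append_nil,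
        (hlink.2.1.splitLast).1] at hf
      have hc := hcls R c hR
      exact turn_not_mem_of_class hε (hlink.2.1.turn_lastDart (by rintro h; simp [h] at hc)
        (by simpa using hf)) hc
  · intro g hg
    obtain ⟨q, hq⟩ := T.ringDarts_append_singleton (T.splitFirst (some el, t, n) ++ M) (some e₁)
    obtain ⟨q', hq'⟩ := (T.orient ε).path_eq_cons e₁ (List.replicate k 3 ++ 2 :: List.replicate m 3)
    rw [hq', List.map_cons, List.append_cons, hq] at hg
    have hg' : firstOr (T.splitFirst (some el, t, n) ++ M) (some e₁) = some g := by
      simpa using hg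
    rw [hpl]
    rw [hg'] at hel
    exact turn_not_mem_of_class hε (hel.turn_lastDart ht6 (by simp [lastDart])) ht

end ReducingTriangulation

namespace ReducingTriangulation

variable {D : Type*} (T : ReducingTriangulation D)

/-! ### When no move applies -/

theorem CellOk.cls_le {T : ReducingTriangulation D} {c : Cell D} {x : Option D}
    (h : T.CellOk c x) : c.2.1 ≤ 7 := by
  cases h <;> simp
  omega

/-- The left triangles of the two edges would close up around their common apex, where a rotation by
two would be trivial. This contradicts the degree. -/
theorem not_two_gon {e e' : D} (h : e' = T.rot 2 (T.rev e)) (h' : e = T.rot 2 (T.rev e')) :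
    False := by
  have key : ∀ x, T.rev (T.rot (-1) (T.rot 2 (T.rev x))) = T.rot (-1) (T.rev (T.rot (-1) x)) := by
    intro x
    rw [rot_rot, ← rev_rot_rev]
    norm_num
  have h1 := key e
  have h2 := key e'
  rw [← h] at h1
  rw [← h', h1, rot_rot] at h2
  have h3 := (T.rot_eq_self_iff _ _).1 h2.symm
  have h4 := T.eight_le (T.rev (T.rot (-1) e))
  have := Int.le_of_dvd (by norm_num) (dvd_neg.2 h3)
  omega

@[simp] theorem clsAt_nil (i : ℕ) : clsAt ([] : List (Option D × ℤ)) i = 8 := rfl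

@[simp] theorem clsAt_cons_zero (a : Option D × ℤ) (K : List (Option D × ℤ)) :
    clsAt (a :: K) 0 = a.2 := rfl

@[simp] theorem clsAt_cons_succ (a : Option D × ℤ) (K : List (Option D × ℤ)) (i : ℕ) :
    clsAt (a :: K) (i + 1) = clsAt K i := by simp [clsAt]

theorem linked_cls_le {Q : List (Cell D)} {x : Option D} (h : T.Linked Q x) :
    ∀ a ∈ keys Q, a.2 ≤ 7 := by
  induction Q with
  | nil => simp
  | cons c Q ih =>
    obtain ⟨h1, h2⟩ := h
    rw [keys_cons]
    rintro a (_ | ⟨_, ha⟩)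
    · exact h1.cls_le
    · exact ih h2 a ha

theorem Verified.comm {T : ReducingTriangulation D} {A B : List (Option D × ℤ)}
    (h : T.Verified (A ++ B) 0) : T.Verified (B ++ A) 0 := by
  induction A generalizing B with
  | nil => simpa using h
  | cons c A ih =>
    have h1 : T.Verified (c :: (A ++ B)) (0 + 1) := fun X c Y h2 _ => h X c Y h2 (Nat.zero_le _)
    have h2 := h [] c (A ++ B) rfl le_rfl
    have := ih (B := B ++ [c]) (by simpa using h1.rotate (by simpa using h2))
    simpa using this

/-- Let `b` be the first cell after the red `2` that is not a run of the same side. If `b` is also a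
`2`, the test at `b` says that no cell precedes `a` in its context, and the test at `a` then
excludes a run between `a` and `b`. Otherwise the test at `b` says that a flip is blocked on the
other side of `a`. All cells being tested and runs being merged, it can only be blocked by a `2`,
and then the test at `a` would say that the ring ends there, although `b` lies beyond. -/
theorem Verified.eq_of_red_two {T : ReducingTriangulation D} {a : Option D × ℤ}
    {R : List (Option D × ℤ)} (hv : T.Verified (a :: R) 0) (h7 : ∀ b ∈ a :: R, b.2 ≤ 7) {ε : ℤ}
    (hε : ε = 1 ∨ ε = -1) (ha : a.2 = ε * 2) (hred : ∃ e, a.1 = some e ∧ T.red e = true) :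
    R = [] ∨ ∃ b, R = [b] ∧ (b.2 = ε * 2 ∨ b.2 = ε * 3) := by
  have h23 : ε * 2 ≠ ε * 3 := by omega
  have hcore : ∀ S b L, R = S ++ b :: List.reverse L → S = [] ∨ (∃ r, S = [r] ∧ r.2 = ε * 3) →
      b.2 ≠ ε * 3 → S = [] ∧ L = [] ∧ b.2 = ε * 2 := by
    intro S b L hR hS hb
    have hSr : S.reverse = S := by rcases hS with rfl | ⟨r, rfl, -⟩ <;> rfl
    have hskip : ∀ K, skipRun ε (S ++ a :: K) 0 = S.length := by
      intro K
      rcases hS with rfl | ⟨r, rfl, hr⟩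
      · simp [skipRun, ha, h23]
      · simp [skipRun, hr]
    have hcls : ∀ K i, clsAt (S ++ a :: K) (S.length + i) = clsAt (a :: K) i := by
      intro K i; rcases hS with rfl | ⟨r, rfl, hr⟩ <;> simp [clsAt, add_comm 1 i]
    have hget : ∀ K, (S ++ a :: K)[S.length]? = some a := by simp
    have hsk : ∀ K, skipRun ε (S ++ a :: K) (S.length + 1) = S.length + 1 + skipRun ε K 0 := by
      intro K
      rcases hS with rfl | ⟨r, rfl, hr⟩
      · simp [skipRun]; split_ifs <;> rfl
      · simp [skipRun]; split_ifs <;> rfl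
    -- the cell after the strip
    have pb := ((hv (a :: S) b L.reverse (by simp [hR]) (Nat.zero_le _)).2 ε hε).2 hb
    simp only [List.reverse_cons, hSr, List.reverse_reverse, List.append_assoc,
      List.singleton_append, hskip, hget, hsk] at pb
    have h0 := hcls L 0
    have h1 := fun i => hcls L (1 + i)
    simp only [add_zero, clsAt_cons_zero] at h0
    simp only [add_comm 1, clsAt_cons_succ] at h1
    have h1' := h1 0
    rw [zero_add] at h1'
    have pb := pb (h0.trans ha)
    -- the first cell
    have pa := ((hv [] a R rfl (Nat.zero_le _)).2 ε hε).2 (by rw [ha]; exact h23)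
    simp only [hR, List.reverse_nil, List.nil_append, List.reverse_append, List.reverse_cons,
      List.reverse_reverse, hSr, List.append_assoc, List.singleton_append] at pa
    have hL7 : ∀ p ∈ L, p.2 ≤ 7 := fun p hp => h7 p (by simp [hR, hp])
    have hb7 : b.2 ≤ 7 := h7 b (by simp [hR])
    by_cases hb2 : b.2 = ε * 2
    · have h8 := pb.1 hb2
      rw [h1'] at h8
      cases L with
      | cons p L =>
        have := hL7 p (by simp)
        rw [clsAt_cons_zero] at h8
        omega
      | nil =>
        refine ⟨?_, rfl, hb2⟩
        rcases hS with rfl | ⟨r, rfl, hr⟩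
        · rfl
        · simp [skipRun, hb2, h23, ha, hr] at pa
          omega
    · have hmem := pb.2 hb2 (by obtain ⟨e, h2, h3⟩ := hred; exact ⟨e, by simp [h2], h3⟩)
      rw [add_assoc, hcls, add_comm 1, clsAt_cons_succ] at hmem
      exfalso
      have hok : ∀ p ∈ L, p.2 ≠ 6 ∧ p.2 ≠ 0 ∧ p.2 ≠ 1 ∧ p.2 ≠ -1 := fun p hp => by
        obtain ⟨X, Y, hXY⟩ := List.append_of_mem (show p ∈ a :: R by simp [hR, hp])
        exact (hv X p Y hXY (Nat.zero_le _)).1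
      have h8 : ∀ L', (∀ p ∈ L', p.2 ≤ 7) → clsAt (L' ++ b :: S) 0 ≠ 8 := by
        rintro (_ | ⟨q, L'⟩) hL'
        · simp; omega
        · have := hL' q (by simp)
          simp; omega
      simp only [Set.mem_insert_iff, Set.mem_singleton_iff] at hmem
      cases L with
      | nil => rw [clsAt_nil] at hmem; omega
      | cons p L =>
        have hp := hok p (by simp)
        by_cases hp3 : p.2 = ε * 3
        · have hs : ∀ K, skipRun ε (p :: K) 0 = 1 := fun K => by simp [skipRun, hp3]
          have h1 : ∀ K, clsAt (p :: K) 1 = clsAt K 0 := fun K => clsAt_cons_succ p K 0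
          have h2 : ∀ K, clsAt (p :: K) (1 + 1) = clsAt K 1 := fun K => clsAt_cons_succ p K 1
          simp only [hs, List.cons_append, h1, h2] at hmem pa
          cases L with
          | nil => rw [clsAt_nil] at hmem; omega
          | cons q L =>
            have hq := hok q (by simp)
            have hq3 := ((hv (a :: S ++ b :: L.reverse ++ [q]) p [] (by simp [hR])
              (Nat.zero_le _)).2 ε hε).1 hp3
            simp only [List.reverse_append, List.reverse_cons, List.reverse_nil, List.nil_append,
              List.cons_append, clsAt_cons_zero] at hq3 hmem pa
            have pa := (pa (by omega)).1 ha
            rw [show clsAt (q :: (L ++ b :: S)) 1 = clsAt (L ++ b :: S) 0 from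
              clsAt_cons_succ q _ 0] at pa
            exact h8 L (fun r hr => hL7 r (by simp [hr])) pa
        · have hs : ∀ K, skipRun ε (p :: K) 0 = 0 := fun K => by simp [skipRun, hp3]
          simp only [hs, List.cons_append, clsAt_cons_zero] at hmem pa
          have pa := (pa (by omega)).1 ha
          rw [clsAt_cons_succ] at pa
          exact h8 L (fun r hr => hL7 r (by simp [hr])) pa
  cases R with
  | nil => exact .inl rfl
  | cons r R =>
    right
    by_cases hr : r.2 = ε * 3
    · cases R with
      | nil => exact ⟨r, rfl, .inr hr⟩
      | cons b R =>
        have hb : b.2 ≠ ε * 3 := fun hb => by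
          have := ((hv [a, r] b R rfl (Nat.zero_le _)).2 ε hε).1 hb
          simp [hr] at this
        have := hcore [r] b R.reverse (by simp) (.inr ⟨r, rfl, hr⟩) hb
        simp at this
    · obtain ⟨-, h2, h3⟩ := hcore [] r R.reverse (by simp) (.inl rfl) hr
      exact ⟨r, by simpa using h2, .inl h3⟩

/-- If no move applies, then no cell consists of a `2_r`-turn or of a `-2_r`-turn. -/
theorem Verified.no_red_two {T : ReducingTriangulation D} {Q : List (Cell D)}
    (hv : T.Verified (keys Q) 0) (hok : T.RingOk Q) {ε : ℤ} (hε : ε = 1 ∨ ε = -1) {d : D} {n : ℤ}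
    (hQ : (some d, ε * 2, n) ∈ Q) : T.red d = false := by
  by_contra hred
  rw [Bool.not_eq_false] at hred
  obtain ⟨A, B, rfl⟩ := List.append_of_mem hQ
  have hok' := hok.comm
  rw [keys_append] at hv
  have hv' := hv.comm
  rw [keys_cons, List.cons_append, ← keys_append] at hv'
  rw [List.cons_append] at hok'
  obtain ⟨h1, h2⟩ := hok'
  obtain ⟨d', hd', -, hx⟩ := h1.of_two hε
  obtain rfl : d = d' := by simpa using hd'
  have h7 := T.linked_cls_le (show T.Linked ((some d, ε * 2, n) :: (B ++ A)) _ from ⟨h1, h2⟩)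
  -- The remaining rings are impossible. A single `2`, or a `2` with a run of turns `3`, would close
  -- up with a change of colour, and two turns `2` are excluded by `not_two_gon`.
  rcases hv'.eq_of_red_two h7 hε rfl ⟨d, rfl, hred⟩ with h | ⟨b, h, hb⟩
  · have h' : B ++ A = [] := by simpa [keys] using h
    simp only [h', firstOr_nil, firstOr_cons, Option.some.injEq] at hx
    have := congrArg (T.orient ε).red hx
    rw [← T.orient_rev hε, ← T.orient_rot hε, red_rot_rev_two] at this
    simp at this
  · obtain ⟨⟨o, t, m⟩, hc⟩ : ∃ c, B ++ A = [c] := by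
      rw [← List.length_eq_one_iff, ← length_keys, h]; rfl
    rw [hc] at h hx h2
    simp only [keys_cons, keys_nil, List.cons.injEq, and_true] at h
    subst h
    simp only [linked_cons, firstOr_nil, firstOr_cons, linked_nil, and_true] at h2 hx hb
    subst hx
    rcases hb with rfl | rfl
    · obtain ⟨e, he, -, hx⟩ := h2.of_two hε
      simp only [Option.some.injEq] at he hx
      refine (T.orient ε).not_two_gon (e := d) (e' := e) ?_ ?_
      · rw [T.orient_rot hε, T.orient_rev hε, he]
      · rw [T.orient_rot hε, T.orient_rev hε, hx]
    · obtain ⟨e, k, he, -, -, hx⟩ := h2.of_small (by omega)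
      simp only [Option.some.injEq] at he hx
      have := congrArg (T.orient ε).red hx
      have h3 := (T.orient ε).red_pathLast_three e (k + 1)
      rw [List.replicate_succ', pathLast_append, pathLast_cons, pathLast_nil, T.orient_rot hε,
        T.orient_rev hε, T.orient_pathLast hε, List.map_replicate, ← hx, ← he, ← T.orient_rev hε,
        ← T.orient_rot hε, red_rot_rev_two] at h3
      simp at h3

theorem turn_of_mem_corners_replicate {e f g : D} {t : ℤ} (ht : -3 ≤ t ∧ t ≤ 3) {k : ℕ}
    (h : (f, g) ∈ corners (T.path e (List.replicate k t))) : T.turn f g = t := by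
  have h1 : T.turn f g ∈ T.turns (T.path e (List.replicate k t)) := List.mem_map.2 ⟨_, h, rfl⟩
  rw [turns_path _ _ _ (fun j hj => by rw [List.eq_of_mem_replicate hj]; omega)] at h1
  exact List.eq_of_mem_replicate h1

theorem corners_map {α β : Type*} (φ : α → β) (l : List α) :
    corners (l.map φ) = (corners l).map (Prod.map φ φ) := by
  rw [corners, ← List.map_tail, List.zip_map]; rfl

theorem mem_corners_map_some {l : List D} {e e' : D} :
    (some e, some e') ∈ corners (l.map some) ↔ (e, e') ∈ corners l := by
  rw [corners_map, List.mem_map]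
  constructor
  · rintro ⟨⟨a, b⟩, h1, h2⟩
    simp only [Prod.map_apply, Prod.mk.injEq, Option.some.injEq] at h2
    obtain ⟨rfl, rfl⟩ := h2
    exact h1
  · exact fun h => ⟨_, h, rfl⟩

theorem cellDarts_run (e : D) (t : ℤ) (k : ℕ) : T.cellDarts (some e, t, (k : ℤ) + 1) ++
    [some (T.rot t (T.rev (T.pathLast e (List.replicate k t))))] =
      (T.path e (List.replicate (k + 1) t)).map some := by
  rw [List.replicate_succ', path_append_cons]
  simp [cellDarts]

theorem CellOk.corner {T : ReducingTriangulation D} {c : Cell D} {x : Option D}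
    (h : T.CellOk c x) {f g : D} (hp : (some f, some g) ∈ corners (T.cellDarts c ++ [x])) :
    c.2.1 = 6 ∨ (T.turn f g = c.2.1 ∧ (c.2.2 = 1 → c.1 = some f)) ∨ 4 ≤ T.turn f g := by
  cases h with
  | unknown e x => exact .inl rfl
  | gap x => simp at hp
  | fin e => simp at hp
  | big e e' h h4 =>
    right; right
    simp only [cellDarts_one, List.cons_append, List.nil_append, corners_cons_cons,
      corners_singleton, List.mem_cons, Prod.mk.injEq, Option.some.injEq, List.not_mem_nil,
      or_false] at hp
    rwa [hp.1, hp.2]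
  | run e t k h hk =>
    rw [cellDarts_run, mem_corners_map_some] at hp
    refine .inr (.inl ⟨T.turn_of_mem_corners_replicate h hp, fun hk' => ?_⟩)
    obtain rfl : k = 0 := by simpa using hk'
    simp at hp
    simp [hp.1]

theorem CellOk.cls_of_corners {T : ReducingTriangulation D} {c : Cell D} {x : Option D}
    (h : T.CellOk c x) {t : ℤ} (ht : t ≤ 3) (hp : ∀ p ∈ corners (T.cellDarts c ++ [x]), ∃ f g,
      p = (some f, some g) ∧ T.turn f g = t) : c.2.1 = 6 ∨ c.2.1 = t := by
  cases h with
  | unknown e x => exact .inl rfl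
  | gap x => simp at hp
  | fin e => simp at hp
  | big e e' h h4 =>
    obtain ⟨f, g, h1, h2⟩ := hp (some e, some e') (by simp)
    simp only [Prod.mk.injEq, Option.some.injEq] at h1
    rw [h1.1, h1.2] at h4
    omega
  | run e t' k h hk =>
    rw [cellDarts_run, List.replicate_succ] at hp
    obtain ⟨q, hq⟩ := T.path_eq_cons (T.rot t' (T.rev e)) (List.replicate k t')
    obtain ⟨f, g, h1, h2⟩ := hp (some e, some (T.rot t' (T.rev e))) (by simp [hq])
    simp only [Prod.mk.injEq, Option.some.injEq] at h1
    rw [← h1.1, ← h1.2, T.turn_rot_small h.1 (by omega)] at h2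
    exact .inr h2

theorem corners_ringDarts_cons (c : Cell D) (Q : List (Cell D)) (x : Option D) :
    corners (T.ringDarts (c :: Q) ++ [x]) =
      corners (T.cellDarts c ++ [firstOr Q x]) ++ corners (T.ringDarts Q ++ [x]) := by
  obtain ⟨m, hm⟩ := T.ringDarts_append_singleton Q x
  rw [ringDarts_cons, List.append_assoc, hm, corners_append_cons]

theorem Linked.corner {T : ReducingTriangulation D} {Q : List (Cell D)} {x : Option D}
    (h : T.Linked Q x) {f g : D} (hp : (some f, some g) ∈ corners (T.ringDarts Q ++ [x])) :
    ∃ c ∈ Q, (∃ y, T.CellOk c y) ∧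
      (c.2.1 = 6 ∨ (T.turn f g = c.2.1 ∧ (c.2.2 = 1 → c.1 = some f)) ∨ 4 ≤ T.turn f g) := by
  induction Q with
  | nil => simp at hp
  | cons c Q ih =>
    rw [corners_ringDarts_cons, List.mem_append] at hp
    rcases hp with hp | hp
    · exact ⟨c, by simp, ⟨_, h.1⟩, h.1.corner hp⟩
    · obtain ⟨c, h1, h2⟩ := ih h.2 hp
      exact ⟨c, by simp [h1], h2⟩

theorem Linked.cls_of_corners {T : ReducingTriangulation D} {Q : List (Cell D)} {x : Option D}
    (h : T.Linked Q x) {t : ℤ} (ht : t ≤ 3) (hp : ∀ p ∈ corners (T.ringDarts Q ++ [x]), ∃ f g,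
      p = (some f, some g) ∧ T.turn f g = t) : ∀ c ∈ Q, c.2.1 = 6 ∨ c.2.1 = t := by
  induction Q with
  | nil => simp
  | cons c Q ih =>
    rw [corners_ringDarts_cons] at hp
    rintro c' (_ | ⟨_, hc⟩)
    · exact h.1.cls_of_corners ht fun p h => hp p (List.mem_append_left _ h)
    · exact ih h.2 (fun p h => hp p (List.mem_append_right _ h)) _ hc

theorem cyclicCorners_ringDarts (Q : List (Cell D)) :
    cyclicCorners (T.ringDarts Q) = corners (T.ringDarts Q ++ [firstOr Q none]) := by
  cases Q with
  | nil => rfl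
  | cons c Q =>
    obtain ⟨m, hm⟩ := T.cellDarts_eq_cons c
    rw [ringDarts_cons, hm, firstOr_cons, List.cons_append, cyclicCorners_cons]

variable {T}

theorem Good.not_badTurn {lin : Bool} {l : List D} {Q : List (Cell D)} (h : T.Good lin l Q 0)
    {e e' : D} (hp : (some e, some e') ∈ cyclicCorners (ringList lin l)) : ¬ T.BadTurn e e' := by
  rw [← mem_cyclicCorners_of_isRotated h.darts, cyclicCorners_ringDarts] at hp
  obtain ⟨c, hc, ⟨y, hy⟩, h1⟩ := Linked.corner h.ok hp
  have hpass : c.2.1 ≠ 6 ∧ c.2.1 ≠ 0 ∧ c.2.1 ≠ 1 ∧ c.2.1 ≠ -1 := by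
    obtain ⟨X, Y, hXY⟩ := List.append_of_mem hc
    exact (h.verified (keys X) (c.1, c.2.1) (keys Y) (by simp [hXY]) (Nat.zero_le _)).1
  have key : ∀ ε : ℤ, ε = 1 ∨ ε = -1 → T.turn e e' = ε * 2 → T.red e = false := by
    intro ε hε ht
    obtain ⟨o, t, n⟩ := c
    obtain ⟨rfl, h3⟩ : t = ε * 2 ∧ (n = 1 → o = some e) := by
      rcases h1 with h1 | ⟨h1, h2⟩ | h1
      · exact absurd h1 hpass.1
      · exact ⟨by rw [← ht, h1], h2⟩
      · omega
    obtain ⟨d, rfl, rfl, -⟩ := hy.of_two hε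
    have := h3 rfl
    simp only [Option.some.injEq] at this
    subst this
    exact h.verified.no_red_two h.ok hε hc
  rintro (hb | hb | hb | ⟨hb, hr⟩ | ⟨hb, hr⟩)
  · omega
  · omega
  · omega
  · have := key 1 (.inl rfl) (by omega)
    simp [hr] at this
  · have := key (-1) (.inr rfl) (by omega)
    simp [hr] at this

theorem Good.reduced {l : List D} {Q : List (Cell D)} (h : T.Good true l Q 0) : T.Reduced l := by
  rintro ⟨e, e'⟩ hp
  refine h.not_badTurn ?_
  simp only [ringList, if_true]
  rw [cyclicCorners_cons]
  cases l with
  | nil => simp at hp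
  | cons a l =>
    rw [← mem_corners_map_some] at hp
    rw [List.map_cons, List.cons_append, List.cons_append, corners_cons_cons]
    rcases List.eq_nil_or_concat' (a :: l) with h0 | ⟨m, b, hm⟩
    · simp at h0
    · rw [← List.cons_append, ← List.map_cons, hm, List.map_append, List.append_assoc, List.map_cons,
        List.map_nil, List.singleton_append, corners_append_cons]
      rw [hm, List.map_append] at hp
      simp only [List.map_cons, List.map_nil] at hp
      simp [hp]

theorem mem_cyclicCorners_map_some {l : List D} {e e' : D} :
    (some e, some e') ∈ cyclicCorners (l.map some) ↔ (e, e') ∈ cyclicCorners l := by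
  cases l with
  | nil => simp
  | cons a l =>
    rw [List.map_cons, cyclicCorners_cons, cyclicCorners_cons,
      ← mem_corners_map_some (l := a :: l ++ [a])]
    simp

/-- All cells are runs on the same side, and two neighbouring runs would have been merged. The
applicability of the final move is thus visible on a single cell. -/
theorem Good.cls_of_corners {l : List D} {Q : List (Cell D)} (h : T.Good false l Q 0) (hl : l ≠ [])
    {ε : ℤ} (hε : ε = 1 ∨ ε = -1) (hp : ∀ p ∈ cyclicCorners l, T.turn p.1 p.2 = ε * 3) :
    ∃ o n, Q = [(o, ε * 3, n)] := by
  have h0 : ∀ p ∈ corners (T.ringDarts Q ++ [firstOr Q none]), ∃ f g,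
      p = (some f, some g) ∧ T.turn f g = ε * 3 := by
    intro p hp'
    have hd : (T.ringDarts Q).IsRotated (l.map some) := h.darts
    rw [← cyclicCorners_ringDarts, mem_cyclicCorners_of_isRotated hd] at hp'
    have hp2 : p ∈ (l.map some).zip ((l.rotate 1).map some) := by
      rw [List.map_rotate]; exact hp'
    rw [List.zip_map, List.mem_map] at hp2
    obtain ⟨⟨a, b⟩, h2, rfl⟩ := hp2
    exact ⟨a, b, rfl, hp (a, b) h2⟩
  have h1 : ∀ c ∈ Q, c.2.1 = ε * 3 := by
    intro c hc
    rcases Linked.cls_of_corners h.ok (by omega) h0 c hc with h6 | h6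
    · obtain ⟨X, Y, hXY⟩ := List.append_of_mem hc
      exact absurd h6 (h.verified (keys X) (c.1, c.2.1) (keys Y) (by simp [hXY])
        (Nat.zero_le _)).1.1
    · exact h6
  match Q, h1, h with
  | [], _, h =>
    have hd : ([] : List (Option D)).IsRotated (l.map some) := h.darts
    have := hd.perm.length_eq
    exact absurd (List.eq_nil_of_length_eq_zero (by simpa using this.symm)) hl
  | [c], h1, h => exact ⟨c.1, c.2.2, by simp [← h1 c (by simp)]⟩
  | c :: c' :: Q, h1, h =>
    have := ((h.verified [(c.1, c.2.1)] (c'.1, c'.2.1) (keys Q) rfl (Nat.zero_le _)).2 ε hε).1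
      (h1 c' (by simp))
    simp [h1 c] at this

theorem exists_mem_cyclicCorners {α : Type*} {l : List α} {a : α} (h : a ∈ l) :
    ∃ b, (a, b) ∈ cyclicCorners l := by
  obtain ⟨X, Y, rfl⟩ := List.append_of_mem h
  have h1 : (X ++ a :: Y).IsRotated (a :: (Y ++ X)) := isRotated_append_comm X (a :: Y)
  simp only [mem_cyclicCorners_of_isRotated h1]
  rw [cyclicCorners_cons]
  cases Y ++ X with
  | nil => exact ⟨a, by simp⟩
  | cons b m => exact ⟨b, by simp⟩

theorem Good.closedReduced {l : List D} {Q : List (Cell D)} (h : T.Good false l Q 0)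
    (hQ : ∀ e n, Q = [(some e, 3, n)] → T.red e = false)
    (hQ' : ∀ e n, Q = [(some e, -3, n)] → T.red e = true) : T.ClosedReduced l := by
  have key : ∀ ε : ℤ, ε = 1 ∨ ε = -1 → ∀ b, l ≠ [] →
      (∀ p ∈ cyclicCorners l, T.turn p.1 p.2 = ε * 3 ∧ T.red p.1 = b) →
      ∃ e n, Q = [(some e, ε * 3, n)] ∧ T.red e = b := by
    intro ε hε b hl hp
    obtain ⟨o, n, rfl⟩ := h.cls_of_corners hl hε fun p h => (hp p h).1
    obtain ⟨e, k, rfl, rfl, -, -⟩ := CellOk.of_small h.ok.1 (by omega)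
    refine ⟨e, _, rfl, ?_⟩
    obtain ⟨m, hm⟩ := T.path_eq_cons e (List.replicate k (ε * 3))
    have hd : (T.ringDarts [(some e, ε * 3, (k : ℤ) + 1)]).IsRotated (l.map some) := h.darts
    have he : e ∈ l := by
      have : some e ∈ l.map some := hd.mem_iff.1 (by simp [cellDarts, hm])
      simpa using this
    obtain ⟨b', hb'⟩ := exists_mem_cyclicCorners he
    exact (hp _ hb').2
  refine ⟨fun p hp => h.not_badTurn (mem_cyclicCorners_map_some.2 hp), fun hl hp => ?_,
    fun hl hp => ?_⟩
  · obtain ⟨e, n, h1, h2⟩ := key 1 (.inl rfl) true hl hp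
    simp [hQ e n (by simpa using h1)] at h2
  · obtain ⟨e, n, h1, h2⟩ := key (-1) (.inr rfl) false hl hp
    simp [hQ' e n (by simpa using h1)] at h2

theorem red_of_mem_path {e x : D} {t : ℤ} (ht : t = 3 ∨ t = -3) {k : ℕ}
    (h : x ∈ T.path e (List.replicate k t)) : T.red x = T.red e := by
  induction k generalizing e with
  | zero => simp at h; rw [h]
  | succ k ih =>
    rw [List.replicate_succ, path_cons, List.mem_cons] at h
    rcases h with rfl | h
    · rfl
    · rw [ih h]
      rcases ht with rfl | rfl
      · exact T.red_rot_rev_three e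
      · exact T.red_rot_rev_neg_three e

theorem RingOk.loop {e : D} {t : ℤ} (ht : t = 3 ∨ t = -3) {k : ℕ}
    (h : T.rot t (T.rev (T.pathLast e (List.replicate k t))) = e) :
    ∀ p ∈ cyclicCorners (T.path e (List.replicate k t)), T.turn p.1 p.2 = t ∧
      T.red p.1 = T.red e := by
  obtain ⟨m, hm⟩ := T.path_eq_cons e (List.replicate k t)
  have h1 : cyclicCorners (T.path e (List.replicate k t)) =
      corners (T.path e (List.replicate (k + 1) t)) := by
    rw [hm, cyclicCorners_cons, ← hm, List.replicate_succ', path_append_cons, h]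
    rfl
  rintro ⟨f, g⟩ hp
  refine ⟨?_, red_of_mem_path ht (List.of_mem_zip hp).1⟩
  rw [h1] at hp
  exact T.turn_of_mem_corners_replicate (by omega) hp

variable (T) in
/-- The final move, on darts. -/
def shift (ε : ℤ) (e : D) : D := if ε = 1 then T.push e else T.rev (T.push (T.rev e))

theorem red_push (e : D) : T.red (T.push e) = T.red e := by
  rw [push_eq, red_rot_neg_two, red_rev, red_rot_neg_one, Bool.not_not]

theorem red_shift {ε : ℤ} (hε : ε = 1 ∨ ε = -1) (e : D) : T.red (T.shift ε e) = T.red e := by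
  rcases hε with rfl | rfl <;> simp [shift, red_push, T.red_rev]

theorem shift_step {ε : ℤ} (hε : ε = 1 ∨ ε = -1) (e : D) :
    T.rot (-(ε * 3)) (T.rev (T.shift ε e)) = T.shift ε (T.rot (ε * 3) (T.rev e)) := by
  rcases hε with rfl | rfl
  · simpa [shift] using T.push_step e
  · have := T.push_step (T.rev (T.rot (-3) (T.rev e)))
    simp only [rev_rev', rot_rot, add_neg_cancel, rot_zero] at this
    simp [shift, ← this]

theorem map_shift_path {ε : ℤ} (hε : ε = 1 ∨ ε = -1) (e : D) (k : ℕ) :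
    (T.path e (List.replicate k (ε * 3))).map (T.shift ε) =
      T.path (T.shift ε e) (List.replicate k (-(ε * 3))) ∧
    T.shift ε (T.pathLast e (List.replicate k (ε * 3))) =
      T.pathLast (T.shift ε e) (List.replicate k (-(ε * 3))) := by
  induction k generalizing e with
  | zero => exact ⟨rfl, rfl⟩
  | succ k ih =>
    simp only [List.replicate_succ, path_cons, List.map_cons, pathLast_cons, shift_step hε]
    exact ⟨by rw [(ih _).1], (ih _).2⟩

/-- The final move. -/
theorem Good.final {l : List D} {ε : ℤ} (hε : ε = 1 ∨ ε = -1) {e : D} {n : ℤ}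
    (h : T.Good false l [(some e, ε * 3, n)] 0) (hr : T.red e = decide (ε = 1)) :
    ∃ l', T.FinalMove l l' ∧ T.ClosedReduced l' ∧ T.FreeHom l l' ∧ (∃ w, T.IsWalk w l' w) ∧
      T.ringDarts [(some (T.shift ε e), -(ε * 3), n)] = l'.map some ∧
      T.RingOk [(some (T.shift ε e), -(ε * 3), n)] := by
  obtain ⟨e', k, he', rfl, -, hx⟩ := CellOk.of_small h.ok.1 (by omega)
  obtain rfl : e = e' := by simpa using he'
  simp only [firstOr_cons, firstOr_nil, Option.some.injEq] at hx
  have hA := T.map_shift_path hε e k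
  have ht : ε * 3 = 3 ∨ ε * 3 = -3 := by omega
  have hl : l.IsRotated (T.path e (List.replicate k (ε * 3))) := by
    have hd : (T.ringDarts [(some e, ε * 3, (k : ℤ) + 1)]).IsRotated (l.map some) := h.darts
    refine (isRotated_of_map_some ?_).symm
    simpa [cellDarts] using hd
  have hx' : T.rot (-(ε * 3)) (T.rev (T.pathLast (T.shift ε e) (List.replicate k (-(ε * 3))))) =
      T.shift ε e := by
    rw [← hA.2, shift_step hε, ← hx]
  have hc := RingOk.loop ht hx.symm
  have hc' := RingOk.loop (t := -(ε * 3)) (by omega) hx'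
  have hcl : ∀ p ∈ cyclicCorners l, T.turn p.1 p.2 = ε * 3 ∧ T.red p.1 = T.red e :=
    fun p hp => hc p ((mem_cyclicCorners_of_isRotated hl p).1 hp)
  have hne : l ≠ [] := by
    rintro rfl
    have := hl.perm.length_eq
    simp at this
  obtain ⟨w, hw⟩ := h.walk
  have hl' : (T.path (T.shift ε e) (List.replicate k (-(ε * 3)))).IsRotated (l.map (T.shift ε)) := by
    rw [← hA.1]
    exact (hl.map _).symm
  have hfin : T.FinalMove l (T.path (T.shift ε e) (List.replicate k (-(ε * 3)))) ∧
      T.FreeHom l (l.map (T.shift ε)) ∧ ∃ w, T.IsWalk w (l.map (T.shift ε)) w := by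
    rcases hε with rfl | rfl
    · obtain ⟨w', h1, h2⟩ := T.final_spec hw hne fun p hp => (hcl p hp).1
      exact ⟨.inl ⟨hne, fun p hp => by simpa [hr] using hcl p hp, hl'⟩, h2, w', h1⟩
    · have hrev : T.reversal (l.map (T.shift (-1))) = (T.reversal l).map T.push := by
        simp [reversal, shift, Function.comp_def]
      -- A `-3` turn on blue is a `3` turn on red of the reversal: the odd rotation and the change
      -- of side compensate, and reversing the dart exchanges the colours.
      have hcr : ∀ p ∈ cyclicCorners (T.reversal l), T.turn p.1 p.2 = 3 ∧ T.red p.1 = true := by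
        intro p hp
        have h1 := T.cyclicCorners_reversal hp
        obtain ⟨h2, h3⟩ := hcl _ h1
        have h4 := (T.turn_rev_rev_small (hw.cyclic_adj _ h1) (j := -3) (by norm_num)
          (by norm_num)).2 (by simpa using h2)
        simp only [rev_rev', neg_neg] at h4
        have h5 := T.eq_rot_of_turn h4 (by norm_num)
        refine ⟨h4, ?_⟩
        rw [← T.red_rot_rev_three, ← h5]
        rw [T.red_rev, hr] at h3
        simpa using h3
      have hne' : T.reversal l ≠ [] := by simpa [reversal] using hne
      obtain ⟨w', h1, h2⟩ := T.final_spec hw.reversal hne' fun p hp => (hcr p hp).1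
      refine ⟨.inr ⟨hne', hcr, ?_⟩, .of_reversal (by rw [hrev]; exact h2), w', ?_⟩
      · rw [← hrev]
        exact T.reversal_isRotated hl'
      · rw [← hrev] at h1
        simpa using h1.reversal
  obtain ⟨h1, h2, w', h3⟩ := hfin
  obtain ⟨w'', h4⟩ := h3.isRotated hl'.symm
  -- The final move negates the turns and keeps the colours. Turns `3` on red become `-3` on red,
  -- and `-3` on blue become `3` on blue, so neither excluded form occurs.
  refine ⟨_, h1, ⟨fun p hp => not_badTurn_of_turn _ ?_, fun _ hp => ?_, fun _ hp => ?_⟩, ?_,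
    ⟨w'', h4⟩, by simp [cellDarts], ?_, trivial⟩
  · have := (hc' p hp).1
    omega
  · obtain ⟨m, hm⟩ := T.path_eq_cons (T.shift ε e) (List.replicate k (-(ε * 3)))
    obtain ⟨b, hb⟩ := exists_mem_cyclicCorners (show T.shift ε e ∈ T.path (T.shift ε e)
      (List.replicate k (-(ε * 3))) by simp [hm])
    have h5 := hp _ hb
    have h6 := (hc' _ hb).1
    rw [red_shift hε, hr, decide_eq_true_eq] at h5
    omega
  · obtain ⟨m, hm⟩ := T.path_eq_cons (T.shift ε e) (List.replicate k (-(ε * 3)))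
    obtain ⟨b, hb⟩ := exists_mem_cyclicCorners (show T.shift ε e ∈ T.path (T.shift ε e)
      (List.replicate k (-(ε * 3))) by simp [hm])
    have h5 := hp _ hb
    have h6 := (hc' _ hb).1
    rw [red_shift hε, hr, decide_eq_false_iff_not] at h5
    omega
  · intro v hv v' hv'
    exact (h2 v hv w' h3).trans (T.freeHom_isRotated hl'.symm w' h3 v' hv')
  · have := CellOk.run (T := T) (T.shift ε e) (-(ε * 3)) k (by omega) (by omega)
    rw [hx'] at this
    exact this

end ReducingTriangulation

/-! ### Programs without loops -/

namespace RAM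

/-- The final memory of a program without loop. -/
def exec : Program → Memory → Memory
  | .skip, m => m
  | .assign x e, m => m.setReg x (e.eval m)
  | .write a i e, m => m.setArr a (i.eval m) (e.eval m)
  | .seq p q, m => exec q (exec p m)
  | .ite b p q, m => if b.eval m = 0 then exec q m else exec p m
  | .while _ _, m => m

theorem exec_ite_zero {b : Term} {p q : Program} {m : Memory} (h : b.eval m = 0) :
    exec (.ite b p q) m = exec q m := if_pos h

theorem exec_ite_one {b : Term} {p q : Program} {m : Memory} (h : b.eval m ≠ 0) :
    exec (.ite b p q) m = exec p m := if_neg h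

/-- A bound on the number of steps of a program without loop. -/
def bound : Program → ℕ
  | .skip => 1
  | .assign _ e => e.cost + 1
  | .write _ i e => i.cost + e.cost + 1
  | .seq p q => bound p + bound q + 1
  | .ite b p q => b.cost + bound p + bound q + 1
  | .while _ _ => 0

/-- The program has no loop. -/
def LoopFree : Program → Prop
  | .seq p q => LoopFree p ∧ LoopFree q
  | .ite _ p q => LoopFree p ∧ LoopFree q
  | .while _ _ => False
  | _ => True

theorem run_exec (p : Program) (hp : LoopFree p) (m : Memory) :
    ∃ t ≤ bound p, Run p m (exec p m) t := by
  induction p generalizing m with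
  | skip => exact ⟨_, le_rfl, .skip m⟩
  | assign x e => exact ⟨_, le_rfl, .assign m x e⟩
  | write a i e => exact ⟨_, le_rfl, .write m a i e⟩
  | seq p q ihp ihq =>
    obtain ⟨t, ht, h⟩ := ihp hp.1 m
    obtain ⟨t', ht', h'⟩ := ihq hp.2 (exec p m)
    exact ⟨_, by simp only [bound]; omega, .seq h h'⟩
  | ite b p q ihp ihq =>
    by_cases hb : b.eval m = 0
    · obtain ⟨t, ht, h⟩ := ihq hp.2 m
      rw [exec, if_pos hb]
      exact ⟨_, by simp only [bound]; omega, .ite_false hb h⟩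
    · obtain ⟨t, ht, h⟩ := ihp hp.1 m
      rw [exec, if_neg hb]
      exact ⟨_, by simp only [bound]; omega, .ite_true hb h⟩
  | _ => exact hp.elim

/-- The number attached to the invariant decreases at each round, so it bounds the number of rounds.
The summand `1` in `k + 1` pays for the last test. -/
theorem run_while {b : Term} {p : Program} {c : ℕ} (Inv : Memory → ℕ → Prop)
    (h : ∀ m k, Inv m k → b.eval m ≠ 0 → ∃ m' t k', Run p m m' t ∧ t ≤ c ∧ Inv m' k' ∧ k' < k)
    (k : ℕ) : ∀ m, Inv m k → ∃ m' t k', Run (.while b p) m m' t ∧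
      t ≤ (b.cost + c + 1) * (k + 1) ∧ Inv m' k' ∧ b.eval m' = 0 := by
  induction k using Nat.strong_induction_on with
  | _ k ih =>
    intro m hm
    by_cases hb : b.eval m = 0
    · exact ⟨m, _, k, .while_false hb, by nlinarith, hm, hb⟩
    · obtain ⟨m', t, k', h1, h2, h3, h4⟩ := h m k hm hb
      obtain ⟨m'', t', k'', h5, h6, h7, h8⟩ := ih k' h4 m' h3
      refine ⟨m'', _, k'', .while_true hb h1 h5, ?_, h7, h8⟩
      have : (b.cost + c + 1) * (k' + 1) ≤ (b.cost + c + 1) * k := Nat.mul_le_mul_left _ h4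
      rw [Nat.mul_succ]
      omega

end RAM

namespace ReducingTriangulation

variable {D : Type*} (T : ReducingTriangulation D)

/-! ### A language to handle cells -/

/-- A state: the content of the registers, each of which contains a cell, and a double-ended
queue of cells. -/
structure State (D : Type*) where
  r : ℕ → Cell D
  q : List (Cell D)

/-- Write in a register. -/
def State.upd (s : State D) (i : ℕ) (c : Cell D) : State D := { s with r := Function.update s.r i c }

/-- Integer expressions. -/
inductive Expr : Type
  | const (k : ℤ)
  | cls (i : ℕ)
  | cnt (i : ℕ)
  | add (e f : Expr)
  | sub (e f : Expr)

/-- The value of an expression. -/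
def Expr.eval (s : State D) : Expr → ℤ
  | .const k => k
  | .cls i => (s.r i).2.1
  | .cnt i => (s.r i).2.2
  | .add e f => e.eval s + f.eval s
  | .sub e f => e.eval s - f.eval s

/-- Programs without loop on the states. -/
inductive Prog : Type
  | skip
  | seq (p q : Prog)
  /-- test the equality of two integers -/
  | ite (e f : Expr) (p q : Prog)
  | copy (i j : ℕ)
  /-- change the integers of a register -/
  | set (i : ℕ) (t n : Expr)
  /-- forget the dart of a register -/
  | clear (i : ℕ)
  | rev (i : ℕ)
  | rot (i : ℕ) (e : Expr)
  /-- compute the colour of the dart of register `j` -/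
  | red (i j : ℕ)
  /-- compute the turn from the dart of register `j` to the dart of register `k` -/
  | turn (i j k : ℕ)
  | popF (i : ℕ)
  | popB (i : ℕ)
  | pushF (i : ℕ)
  | pushB (i : ℕ)
  | peekF (i : ℕ)
  | peekB (i : ℕ) (e : Expr)

/-- The absent cell. -/
def noCell : Cell D := (none, 8, 0)

/-- The weakest precondition of a program. -/
def wp : Prog → (State D → Prop) → State D → Prop
  | .skip, φ, s => φ s
  | .seq p q, φ, s => wp p (wp q φ) s
  | .ite e f p q, φ, s => if e.eval s = f.eval s then wp p φ s else wp q φ s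
  | .copy i j, φ, s => φ (s.upd i (s.r j))
  | .set i t n, φ, s => φ (s.upd i ((s.r i).1, t.eval s, n.eval s))
  | .clear i, φ, s => φ (s.upd i (none, (s.r i).2))
  | .rev i, φ, s => φ (s.upd i ((s.r i).1.map T.rev, (s.r i).2))
  | .rot i e, φ, s => (-8 ≤ e.eval s ∧ e.eval s ≤ 8) ∧
      φ (s.upd i ((s.r i).1.map (T.rot (e.eval s)), (s.r i).2))
  | .red i j, φ, s => ∃ d, (s.r j).1 = some d ∧
      φ (s.upd i ((s.r i).1, if T.red d = true then 1 else 0, (s.r i).2.2))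
  | .turn i j k, φ, s => ∃ d d', (s.r j).1 = some d ∧ (s.r k).1 = some d' ∧ T.Adj d d' ∧
      φ (s.upd i ((s.r i).1, min (T.turn d d') 4, (s.r i).2.2))
  | .popF i, φ, s => ∃ c q, s.q = c :: q ∧ φ { s.upd i c with q := q }
  | .popB i, φ, s => ∃ c q, s.q = q ++ [c] ∧ φ { s.upd i c with q := q }
  | .pushF i, φ, s => φ { s with q := s.r i :: s.q }
  | .pushB i, φ, s => φ { s with q := s.q ++ [s.r i] }
  | .peekF i, φ, s => φ (s.upd i (s.q.head?.getD noCell))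
  | .peekB i e, φ, s => 0 ≤ e.eval s ∧ φ (s.upd i (s.q.reverse[(e.eval s).toNat]?.getD noCell))

/-- The address of the first of the three machine registers for a register. -/
def addr (i : ℕ) : ℕ := 3 * i + 10

/-- Translation of expressions. -/
def Expr.term : Expr → RAM.Term
  | .const k => .const k
  | .cls i => .reg (addr i + 1)
  | .cnt i => .reg (addr i + 2)
  | .add e f => .add e.term f.term
  | .sub e f => .sub e.term f.term

open RAM in
/-- Read a cell of the queue. -/
def loadCode (i : ℕ) (a : Term) : Program :=
  .seq (.assign 6 a) (.seq (.assign (addr i) (.read 10 (.reg 6)))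
    (.seq (.assign (addr i + 1) (.read 11 (.reg 6))) (.assign (addr i + 2) (.read 12 (.reg 6)))))

open RAM in
/-- Write in a cell of the queue. -/
def storeCode (i : ℕ) (a : Term) : Program :=
  .seq (.write 10 a (.reg (addr i))) (.seq (.write 11 a (.reg (addr i + 1)))
    (.write 12 a (.reg (addr i + 2))))

open RAM in
/-- Translation of programs. The first cell of the queue is at the address in register `2`, and the
first free cell after the queue is at the address in register `3`. -/
def compile : Prog → Program
  | .skip => .skip
  | .seq p q => .seq (compile p) (compile q)
  | .ite e f p q => .ite (.eq e.term f.term) (compile p) (compile q)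
  | .copy i j => .seq (.assign (addr i) (.reg (addr j)))
      (.seq (.assign (addr i + 1) (.reg (addr j + 1))) (.assign (addr i + 2) (.reg (addr j + 2))))
  | .set i t n => .seq (.assign 6 t.term) (.seq (.assign (addr i + 2) n.term)
      (.assign (addr i + 1) (.reg 6)))
  | .clear _ => .skip
  | .rev i => .assign (addr i) (.read 0 (.reg (addr i)))
  | .rot i e =>
    .seq (.assign 6 (.add (.read 2 (.reg (addr i))) e.term))
    (.seq (.assign 7 (.read 1 (.reg (addr i))))
    (.seq (.assign 8 (.read 4 (.reg 7)))
    (.seq (.ite (.lt (.reg 6) (.const 0)) (.assign 6 (.add (.reg 6) (.reg 8))) .skip)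
    (.seq (.ite (.lt (.reg 6) (.reg 8)) .skip (.assign 6 (.sub (.reg 6) (.reg 8))))
    (.assign (addr i) (.read 6 (.add (.read 5 (.reg 7)) (.reg 6))))))))
  | .red i j => .assign (addr i + 1) (.read 3 (.reg (addr j)))
  | .turn i j k =>
    .seq (.assign 6 (.sub (.read 2 (.reg (addr k))) (.read 2 (.read 0 (.reg (addr j))))))
    (.seq (.assign 8 (.read 4 (.read 1 (.reg (addr k)))))
    (.seq (.ite (.lt (.reg 6) (.const 0)) (.assign 6 (.add (.reg 6) (.reg 8))) .skip)
    (.ite (.lt (.reg 6) (.const 4)) (.assign (addr i + 1) (.reg 6))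
      (.ite (.lt (.reg 8) (.add (.reg 6) (.const 4)))
        (.assign (addr i + 1) (.sub (.reg 6) (.reg 8)))
        (.assign (addr i + 1) (.const 4))))))
  | .popF i => .seq (loadCode i (.reg 2)) (.assign 2 (.add (.reg 2) (.const 1)))
  | .popB i => .seq (.assign 3 (.sub (.reg 3) (.const 1))) (loadCode i (.reg 3))
  | .pushF i => .seq (.assign 2 (.sub (.reg 2) (.const 1))) (storeCode i (.reg 2))
  | .pushB i => .seq (storeCode i (.reg 3)) (.assign 3 (.add (.reg 3) (.const 1)))
  | .peekF i => .ite (.eq (.reg 2) (.reg 3))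
      (.seq (.assign (addr i + 1) (.const 8)) (.assign (addr i + 2) (.const 0)))
      (loadCode i (.reg 2))
  | .peekB i e => .seq (.assign 7 (.sub (.sub (.reg 3) (.const 1)) e.term))
      (.ite (.lt (.reg 7) (.reg 2))
        (.seq (.assign (addr i + 1) (.const 8)) (.assign (addr i + 2) (.const 0)))
        (loadCode i (.reg 7)))

theorem loopFree_compile (p : Prog) : RAM.LoopFree (compile p) := by
  induction p <;> simp_all [compile, RAM.LoopFree, loadCode, storeCode]

/-- The integers represent a cell. -/
def CellAt (dn : D → ℤ) (c : Cell D) (a b n : ℤ) : Prop :=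
  (∀ d, c.1 = some d → a = dn d) ∧ b = c.2.1 ∧ n = c.2.2

/-- The memory represents a state. -/
structure Rel (dn : D → ℤ) (s : State D) (m : RAM.Memory) : Prop where
  reg : ∀ i, CellAt dn (s.r i) (m.reg (addr i)) (m.reg (addr i + 1)) (m.reg (addr i + 2))
  size : m.reg 3 = m.reg 2 + s.q.length
  cell : ∀ (j : ℕ) (c : Cell D), s.q[j]? = some c → CellAt dn c (m.arr 10 (m.reg 2 + j))
    (m.arr 11 (m.reg 2 + j)) (m.arr 12 (m.reg 2 + j))

/-- What the translated programs do not modify. -/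
def Frame (m m' : RAM.Memory) : Prop :=
  (∀ a < 10, m'.arr a = m.arr a) ∧ ∀ i ∈ ({0, 1, 4, 5} : Set ℕ), m'.reg i = m.reg i

theorem Frame.refl (m : RAM.Memory) : Frame m m := ⟨fun _ _ => rfl, fun _ _ => rfl⟩

theorem Frame.trans {m m' m'' : RAM.Memory} (h : Frame m m') (h' : Frame m' m'') : Frame m m'' :=
  ⟨fun a ha => (h'.1 a ha).trans (h.1 a ha), fun i hi => (h'.2 i hi).trans (h.2 i hi)⟩

theorem StoredIn.congr {T : ReducingTriangulation D} {dn : D → ℤ} {vn : T.Vertex → ℤ}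
    {m m' : RAM.Memory} (h : T.StoredIn dn vn m) (hm : ∀ a < 10, m'.arr a = m.arr a) :
    T.StoredIn dn vn m' := by
  obtain ⟨h1, h2, h3, h4, h5, h6, h7, h8, h9, h10⟩ := h
  constructor <;> simpa only [hm 0 (by norm_num), hm 1 (by norm_num), hm 2 (by norm_num),
    hm 3 (by norm_num), hm 4 (by norm_num), hm 5 (by norm_num), hm 6 (by norm_num)]

theorem Expr.eval_term {dn : D → ℤ} {s : State D} {m : RAM.Memory} (h : Rel dn s m) (e : Expr) :
    e.term.eval m = e.eval s := by
  induction e with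
  | const k => rfl
  | cls i => exact (h.reg i).2.1
  | cnt i => exact (h.reg i).2.2
  | add e f he hf => exact congrArg₂ _ he hf
  | sub e f he hf => exact congrArg₂ _ he hf

theorem addr_injective {i j : ℕ} (h : j ≠ i) : addr j ≠ addr i ∧ addr j ≠ addr i + 1 ∧
    addr j ≠ addr i + 2 ∧ addr j + 1 ≠ addr i ∧ addr j + 1 ≠ addr i + 1 ∧ addr j + 1 ≠ addr i + 2 ∧
    addr j + 2 ≠ addr i ∧ addr j + 2 ≠ addr i + 1 ∧ addr j + 2 ≠ addr i + 2 := by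
  simp only [addr]; omega

theorem Rel.upd {dn : D → ℤ} {s : State D} {m m' : RAM.Memory} (h : Rel dn s m) (i : ℕ)
    {c : Cell D} (ha : m'.arr = m.arr) (h2 : m'.reg 2 = m.reg 2) (h3 : m'.reg 3 = m.reg 3)
    (hr : ∀ k, 10 ≤ k → k ≠ addr i → k ≠ addr i + 1 → k ≠ addr i + 2 → m'.reg k = m.reg k)
    (hc : CellAt dn c (m'.reg (addr i)) (m'.reg (addr i + 1)) (m'.reg (addr i + 2))) :
    Rel dn (s.upd i c) m' := by
  constructor
  · intro j
    by_cases hj : j = i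
    · subst hj; simpa [State.upd] using hc
    · have h0 := addr_injective hj
      have h10 : 10 ≤ addr j := by simp [addr]
      rw [hr (addr j) h10 (by omega) (by omega) (by omega), hr (addr j + 1) (by omega) (by omega)
        (by omega) (by omega), hr (addr j + 2) (by omega) (by omega) (by omega) (by omega)]
      simpa [State.upd, hj] using h.reg j
  · rw [h2, h3]; exact h.size
  · intro j c hj
    rw [ha, h2]; exact h.cell j c hj

theorem exec_load (i : ℕ) (a : RAM.Term) (m : RAM.Memory) {m' : RAM.Memory}
    (hm : m' = RAM.exec (loadCode i a) m) : m'.arr = m.arr ∧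
      m'.reg (addr i) = m.arr 10 (a.eval m) ∧ m'.reg (addr i + 1) = m.arr 11 (a.eval m) ∧
      m'.reg (addr i + 2) = m.arr 12 (a.eval m) ∧
      ∀ k, k ≠ 6 → k ≠ addr i → k ≠ addr i + 1 → k ≠ addr i + 2 → m'.reg k = m.reg k := by
  have h6 : 6 ≠ addr i ∧ 6 ≠ addr i + 1 := by simp only [addr]; omega
  subst hm
  refine ⟨rfl, ?_, ?_, ?_, fun k h1 h2 h3 h4 => ?_⟩ <;>
    simp_all [RAM.exec, loadCode, RAM.Memory.setReg, RAM.Term.eval]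

theorem frame_of_reg {m m' : RAM.Memory} (ha : m'.arr = m.arr) {i : ℕ}
    (hr : ∀ k, k ≠ 2 → k ≠ 3 → k ≠ 6 → k ≠ 7 → k ≠ 8 → k ≠ addr i → k ≠ addr i + 1 →
      k ≠ addr i + 2 → m'.reg k = m.reg k) : Frame m m' := by
  refine ⟨fun a _ => by rw [ha], fun k hk => hr k ?_ ?_ ?_ ?_ ?_ ?_ ?_ ?_⟩ <;>
  · simp only [Set.mem_insert_iff, Set.mem_singleton_iff] at hk
    have : 10 ≤ addr i := by simp [addr]
    omega

theorem Rel.sim_upd {dn : D → ℤ} {s : State D} {m m' : RAM.Memory} (h : Rel dn s m) {i : ℕ}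
    {c : Cell D} {φ : State D → Prop} (hφ : φ (s.upd i c)) (ha : m'.arr = m.arr)
    (hr : ∀ k, k ≠ 6 → k ≠ 7 → k ≠ 8 → k ≠ addr i → k ≠ addr i + 1 → k ≠ addr i + 2 →
      m'.reg k = m.reg k)
    (hc : CellAt dn c (m'.reg (addr i)) (m'.reg (addr i + 1)) (m'.reg (addr i + 2))) :
    ∃ s', Rel dn s' m' ∧ φ s' ∧ Frame m m' := by
  have h10 : 10 ≤ addr i := by simp [addr]
  refine ⟨_, h.upd i ha (hr _ ?_ ?_ ?_ ?_ ?_ ?_) (hr _ ?_ ?_ ?_ ?_ ?_ ?_)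
    (fun k hk => hr k (by omega) (by omega) (by omega)) hc, hφ,
    frame_of_reg ha fun k _ _ => hr k⟩ <;> omega

theorem degree_pos (d : D) : 0 < T.degree d := lt_of_lt_of_le (by norm_num) (T.eight_le d)

theorem StoredIn.number_rot {T : ReducingTriangulation D} {dn : D → ℤ} {vn : T.Vertex → ℤ}
    {m : RAM.Memory} (hT : T.StoredIn dn vn m) (j : ℤ) (d : D) :
    m.arr 2 (dn (T.rot j d)) = (m.arr 2 (dn d) + j) % (T.degree d : ℤ) := by
  have key : ∀ x, T.degree x = T.degree d →
      m.arr 2 (dn (T.rot 1 x)) = (m.arr 2 (dn x) + 1) % (T.degree d : ℤ) := fun x hx => by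
    rw [← cw_eq_rot, hT.number_cw, hx]
  induction j using Int.induction_on with
  | zero =>
    rw [rot_zero, add_zero, Int.emod_eq_of_lt (hT.number_nonneg d) (hT.number_lt d)]
  | succ n ih =>
    have := key (T.rot n d) (T.degree_rot _ _)
    rw [rot_rot, add_comm 1] at this
    rw [this, ih, Int.emod_add_emod, add_assoc]
  | pred n ih =>
    have h1 := key (T.rot (-n - 1) d) (T.degree_rot _ _)
    rw [rot_rot, show (1 : ℤ) + (-n - 1) = -n by ring, ih] at h1
    have h2 := Int.ModEq.sub_right 1 h1.symm
    have h3 := hT.number_nonneg (T.rot (-n - 1) d)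
    have h4 := hT.number_lt (T.rot (-n - 1) d)
    rw [T.degree_rot] at h4
    rw [Int.ModEq, add_sub_cancel_right, Int.emod_eq_of_lt h3 h4] at h2
    rw [h2, add_sub_assoc]

theorem StoredIn.table_rot {T : ReducingTriangulation D} {dn : D → ℤ} {vn : T.Vertex → ℤ}
    {m : RAM.Memory} (hT : T.StoredIn dn vn m) (j : ℤ) (d : D) :
    m.arr 6 (m.arr 5 (vn (T.src d)) + (m.arr 2 (dn d) + j) % (T.degree d : ℤ)) =
      dn (T.rot j d) := by
  rw [← hT.number_rot, ← T.src_rot j d]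
  exact hT.table _

theorem StoredIn.leftCount_eq {T : ReducingTriangulation D} {dn : D → ℤ} {vn : T.Vertex → ℤ}
    {m : RAM.Memory} (hT : T.StoredIn dn vn m) {d d' : D} (h : T.Adj d d') :
    (T.leftCount d d' : ℤ) = (m.arr 2 (dn d') - m.arr 2 (dn (T.rev d))) % (T.degree d' : ℤ) := by
  obtain ⟨j, rfl⟩ := h
  rw [leftCount_rot, hT.number_rot, T.degree_rot, Int.emod_sub_emod]
  congr 1
  ring

/-- The machine has no division. Rotations by at most eight, and differences of two numbers of
darts, leave the range of residues by at most one period, so one conditional addition or subtraction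
is enough. -/
theorem emod_of_range {a g : ℤ} (h : -g ≤ a) (h' : a < 2 * g) :
    a % g = if a < 0 then a + g else if a < g then a else a - g := by
  split_ifs with h1 h2
  · rw [← Int.add_emod_right, Int.emod_eq_of_lt (by omega) (by omega)]
  · exact Int.emod_eq_of_lt (by omega) h2
  · rw [← Int.sub_emod_right, Int.emod_eq_of_lt (by omega) (by omega)]

theorem sim_rot {T : ReducingTriangulation D} {dn : D → ℤ} {vn : T.Vertex → ℤ} {m : RAM.Memory}
    (hT : T.StoredIn dn vn m) {s : State D} (h : Rel dn s m) {i : ℕ} {e : Expr}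
    {φ : State D → Prop} (hw : T.wp (.rot i e) φ s) :
    ∃ s', Rel dn s' (RAM.exec (compile (.rot i e)) m) ∧ φ s' ∧
      Frame m (RAM.exec (compile (.rot i e)) m) := by
  have h10 : 10 ≤ addr i := by simp [addr]
  obtain ⟨⟨h8, h8'⟩, hφ⟩ := hw
  obtain ⟨hd, ht, hn⟩ := h.reg i
  refine h.sim_upd (i := i) hφ ?_ ?_ ⟨?_, ?_, ?_⟩
  · simp [compile, RAM.exec, RAM.Memory.setReg, RAM.Term.eval]
    split_ifs <;> rfl
  · intro k h6 h7 h8 ha _ _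
    simp [compile, RAM.exec, RAM.Memory.setReg, RAM.Term.eval]
    split_ifs <;> simp [Function.update_apply, *]
  · intro x hx
    obtain ⟨d, hd', rfl⟩ := Option.map_eq_some_iff.1 hx
    have h1 := hd d hd'
    have h2 := hT.number_nonneg d
    have h3 := hT.number_lt d
    have h4 := T.eight_le d
    have h5 := emod_of_range (a := m.arr 2 (dn d) + e.eval s) (g := T.degree d) (by omega) (by omega)
    have h6 := hT.table_rot (e.eval s) d
    rw [h5] at h6
    simp only [compile, RAM.exec, RAM.Memory.setReg, RAM.Term.eval, Expr.eval_term h]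
    have h7 : ∀ k < 10, k ≠ addr i := fun k hk => by omega
    have h8 : ∀ k < 10, addr i ≠ k := fun k hk => by omega
    split_ifs at h6 ⊢ <;>
      simp_all [hT.src, hT.degree]
  · rw [← ht]
    simp [compile, RAM.exec, RAM.Memory.setReg, RAM.Term.eval]
    split_ifs <;> simp [addr]
  · rw [← hn]
    simp [compile, RAM.exec, RAM.Memory.setReg, RAM.Term.eval]
    split_ifs <;> simp [addr]

/-- The right-hand side follows the tests of the translated program. Truncation at `4` gives the
classes of the cells, which do not distinguish longer turns. -/
theorem turn_eq_of_leftCount {d d' : D} (h : T.Adj d d') : min (T.turn d d') 4 =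
    if (T.leftCount d d' : ℤ) < 4 then (T.leftCount d d' : ℤ)
    else if (T.degree d' : ℤ) < T.leftCount d d' + 4 then (T.leftCount d d' : ℤ) - T.degree d'
    else 4 := by
  have hd : T.degree (T.rev d) = T.degree d' := by
    obtain ⟨j, rfl⟩ := h
    rw [T.degree_rot]
  have h1 : (T.leftCount d d' : ℤ) < T.degree d' := by
    obtain ⟨j, rfl⟩ := h
    rw [leftCount_rot, T.degree_rot]
    exact Int.emod_lt_of_pos _ (by exact_mod_cast T.degree_pos _)
  rw [turn, hd]
  split_ifs <;> omega

theorem sim_turn {T : ReducingTriangulation D} {dn : D → ℤ} {vn : T.Vertex → ℤ} {m : RAM.Memory}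
    (hT : T.StoredIn dn vn m) {s : State D} (h : Rel dn s m) {i j k : ℕ}
    {φ : State D → Prop} (hw : T.wp (.turn i j k) φ s) :
    ∃ s', Rel dn s' (RAM.exec (compile (.turn i j k)) m) ∧ φ s' ∧
      Frame m (RAM.exec (compile (.turn i j k)) m) := by
  have h10 : 10 ≤ addr i := by simp [addr]
  obtain ⟨d, d', hj, hk, hadj, hφ⟩ := hw
  have hdj := (h.reg j).1 d hj
  have hdk := (h.reg k).1 d' hk
  obtain ⟨hd, ht, hn⟩ := h.reg i
  refine h.sim_upd (i := i) hφ ?_ ?_ ⟨?_, ?_, ?_⟩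
  · simp [compile, RAM.exec, RAM.Memory.setReg, RAM.Term.eval]
    split_ifs <;> rfl
  · intro k h6 h7 h8 _ ha _
    simp [compile, RAM.exec, RAM.Memory.setReg, RAM.Term.eval]
    split_ifs <;> simp [Function.update_apply, *]
  · intro x hx
    rw [← hd x hx]
    simp [compile, RAM.exec, RAM.Memory.setReg, RAM.Term.eval]
    split_ifs <;> simp [addr]
  · have hd : T.degree (T.rev d) = T.degree d' := by
      obtain ⟨j, rfl⟩ := hadj
      rw [T.degree_rot]
    have h1 := hT.number_nonneg d'
    have h2 := hT.number_lt d'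
    have h3 := hT.number_nonneg (T.rev d)
    have h4 := hT.number_lt (T.rev d)
    rw [hd] at h4
    have h5 := emod_of_range (a := m.arr 2 (dn d') - m.arr 2 (dn (T.rev d))) (g := T.degree d')
      (by omega) (by omega)
    simp only [T.turn_eq_of_leftCount hadj, hT.leftCount_eq hadj, h5]
    have hai : addr i + 1 ≠ 6 ∧ addr i + 1 ≠ 8 ∧ 6 ≠ addr k ∧ 8 ≠ addr k := by
      simp only [addr]; omega
    have hak : addr k ≠ 6 ∧ addr k ≠ 8 := by simp only [addr]; omega
    simp only [compile, RAM.exec, RAM.Memory.setReg, RAM.Term.eval, hdj, hdk, hT.rev,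
      Function.update_apply, hak, hT.src, hT.degree, if_true, if_false]
    norm_num
    split_ifs <;> simp_all <;> omega
  · rw [← hn]
    simp [compile, RAM.exec, RAM.Memory.setReg, RAM.Term.eval]
    split_ifs <;> simp [addr]

theorem exec_store (i x : ℕ) (m : RAM.Memory) {m' : RAM.Memory}
    (hm : m' = RAM.exec (storeCode i (.reg x)) m) : m'.reg = m.reg ∧
      (∀ k < 10, m'.arr k = m.arr k) ∧
      (∀ v, m'.arr 10 v = if v = m.reg x then m.reg (addr i) else m.arr 10 v) ∧
      (∀ v, m'.arr 11 v = if v = m.reg x then m.reg (addr i + 1) else m.arr 11 v) ∧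
      ∀ v, m'.arr 12 v = if v = m.reg x then m.reg (addr i + 2) else m.arr 12 v := by
  subst hm
  refine ⟨rfl, fun k hk => ?_, fun v => ?_, fun v => ?_, fun v => ?_⟩
  · have : k ≠ 10 ∧ k ≠ 11 ∧ k ≠ 12 := by omega
    simp [RAM.exec, storeCode, RAM.Memory.setArr, this]
  all_goals simp [RAM.exec, storeCode, RAM.Memory.setArr, RAM.Term.eval, Function.update_apply]

theorem sim_popF {dn : D → ℤ} {m : RAM.Memory} {s : State D} (h : Rel dn s m) {i : ℕ} {c : Cell D}
    {q : List (Cell D)} (hq : s.q = c :: q) :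
    Rel dn { s.upd i c with q := q } (RAM.exec (compile (.popF i)) m) ∧
      Frame m (RAM.exec (compile (.popF i)) m) := by
  have h10 : 10 ≤ addr i := by simp [addr]
  obtain ⟨h1, h2, h3, h4, h5⟩ := exec_load i (.reg 2) m rfl
  set m' := RAM.exec (loadCode i (.reg 2)) m with hm'
  have hc := h.cell 0 c (by simp [hq])
  have hs := h.size
  have hu : Rel dn (s.upd i c) m' := h.upd i h1 (h5 _ (by omega) (by omega) (by omega) (by omega))
    (h5 _ (by omega) (by omega) (by omega) (by omega))
    (fun k hk => h5 k (by omega)) (by rw [h2, h3, h4]; simpa [RAM.Term.eval] using hc)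
  have he : RAM.exec (compile (.popF i)) m = m'.setReg 2 (m'.reg 2 + 1) := rfl
  have hr : ∀ k ≠ 2, (m'.setReg 2 (m'.reg 2 + 1)).reg k = m'.reg k := fun k hk => by
    simp [RAM.Memory.setReg, hk]
  have hr2 : (m'.setReg 2 (m'.reg 2 + 1)).reg 2 = m'.reg 2 + 1 := by simp [RAM.Memory.setReg]
  rw [he]
  refine ⟨⟨fun j => ?_, ?_, fun j c' hj => ?_⟩, frame_of_reg (i := i) h1 fun k k1 k2 k3 k4 k5 k6 k7 k8 => ?_⟩
  · have : 10 ≤ addr j := by simp [addr]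
    rw [hr _ (by omega), hr _ (by omega), hr _ (by omega)]
    exact hu.reg j
  · rw [hr2, hr 3 (by norm_num), hu.size]
    simp only [State.upd, hq, List.length_cons]
    push_cast; ring
  · have := hu.cell (j + 1) c' (by simpa [State.upd, hq] using hj)
    rw [hr2]
    push_cast at this
    rwa [add_comm (j : ℤ) 1, ← add_assoc] at this
  · rw [hr k k1, h5 k k3 k6 k7 k8]

theorem sim_popB {dn : D → ℤ} {m : RAM.Memory} {s : State D} (h : Rel dn s m) {i : ℕ} {c : Cell D}
    {q : List (Cell D)} (hq : s.q = q ++ [c]) :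
    Rel dn { s.upd i c with q := q } (RAM.exec (compile (.popB i)) m) ∧
      Frame m (RAM.exec (compile (.popB i)) m) := by
  have h10 : 10 ≤ addr i := by simp [addr]
  have hs := h.size
  set m₁ := m.setReg 3 (m.reg 3 - 1) with hm₁
  have hr : ∀ k ≠ 3, m₁.reg k = m.reg k := fun k hk => by
    simp [hm₁, RAM.Memory.setReg, hk]
  have hr3 : m₁.reg 3 = m.reg 2 + q.length := by
    simp only [hq, List.length_append, List.length_singleton] at hs
    push_cast at hs
    simp [hm₁, RAM.Memory.setReg]; omega
  have hu : Rel dn { s with q := q } m₁ := by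
    refine ⟨fun j => ?_, ?_, fun j c' hj => ?_⟩
    · have : 10 ≤ addr j := by simp [addr]
      rw [hr _ (by omega), hr _ (by omega), hr _ (by omega)]
      exact h.reg j
    · rw [hr3, hr 2 (by norm_num)]
    · rw [hr 2 (by norm_num)]
      refine h.cell j c' ?_
      rw [hq, List.getElem?_append_left (List.getElem?_eq_some_iff.1 hj).1]
      exact hj
  obtain ⟨h1, h2, h3, h4, h5⟩ := exec_load i (.reg 3) m₁ rfl
  have hc := h.cell q.length c (by simp [hq])
  have he : RAM.exec (compile (.popB i)) m = RAM.exec (loadCode i (.reg 3)) m₁ := rfl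
  rw [he]
  refine ⟨hu.upd i h1 (h5 _ (by omega) (by omega) (by omega) (by omega))
    (h5 _ (by omega) (by omega) (by omega) (by omega)) (fun k hk => h5 k (by omega)) ?_,
    frame_of_reg (i := i) h1 fun k k1 k2 k3 k4 k5 k6 k7 k8 => ?_⟩
  · rw [h2, h3, h4]
    simp only [RAM.Term.eval, hr3]
    exact hc
  · rw [h5 k k3 k6 k7 k8, hr k k2]

theorem sim_pushF {dn : D → ℤ} {m : RAM.Memory} {s : State D} (h : Rel dn s m) {i : ℕ} :
    Rel dn { s with q := s.r i :: s.q } (RAM.exec (compile (.pushF i)) m) ∧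
      Frame m (RAM.exec (compile (.pushF i)) m) := by
  have h10 : 10 ≤ addr i := by simp [addr]
  have hs := h.size
  set m₁ := m.setReg 2 (m.reg 2 - 1) with hm₁
  have hr : ∀ k ≠ 2, m₁.reg k = m.reg k := fun k hk => by
    simp [hm₁, RAM.Memory.setReg, hk]
  have hr2 : m₁.reg 2 = m.reg 2 - 1 := by simp [hm₁, RAM.Memory.setReg]
  obtain ⟨h1, h2, h3, h4, h5⟩ := exec_store i 2 m₁ rfl
  have he : RAM.exec (compile (.pushF i)) m = RAM.exec (storeCode i (.reg 2)) m₁ := rfl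
  rw [he]
  refine ⟨⟨fun j => ?_, ?_, fun j c' hj => ?_⟩, h2, fun k hk => ?_⟩
  · have : 10 ≤ addr j := by simp [addr]
    rw [h1, hr _ (by omega), hr _ (by omega), hr _ (by omega)]
    exact h.reg j
  · rw [h1, hr 3 (by norm_num), hr2, hs]
    simp only [List.length_cons]
    push_cast; ring
  · rw [h3, h4, h5, h1, hr2, hr (addr i) (by omega), hr (addr i + 1) (by omega),
      hr (addr i + 2) (by omega)]
    cases j with
    | zero =>
      simp only [List.getElem?_cons_zero, Option.some.injEq] at hj
      subst hj
      simpa using h.reg i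
    | succ j =>
      have h6 : ¬ m.reg 2 - 1 + ((j + 1 : ℕ) : ℤ) = m.reg 2 - 1 := by push_cast; omega
      have h7 : m.reg 2 - 1 + ((j + 1 : ℕ) : ℤ) = m.reg 2 + j := by push_cast; ring
      simp only [h6, if_false]
      rw [h7]
      exact h.cell j c' (by simpa using hj)
  · rw [h1]
    simp only [Set.mem_insert_iff, Set.mem_singleton_iff] at hk
    exact hr k (by omega)

theorem sim_pushB {dn : D → ℤ} {m : RAM.Memory} {s : State D} (h : Rel dn s m) {i : ℕ} :
    Rel dn { s with q := s.q ++ [s.r i] } (RAM.exec (compile (.pushB i)) m) ∧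
      Frame m (RAM.exec (compile (.pushB i)) m) := by
  have h10 : 10 ≤ addr i := by simp [addr]
  have hs := h.size
  obtain ⟨h1, h2, h3, h4, h5⟩ := exec_store i 3 m rfl
  set m' := RAM.exec (storeCode i (.reg 3)) m with hm'
  have he : RAM.exec (compile (.pushB i)) m = m'.setReg 3 (m'.reg 3 + 1) := rfl
  have hr : ∀ k ≠ 3, (m'.setReg 3 (m'.reg 3 + 1)).reg k = m.reg k := fun k hk => by
    simp [RAM.Memory.setReg, hk, h1]
  have hr3 : (m'.setReg 3 (m'.reg 3 + 1)).reg 3 = m.reg 3 + 1 := by simp [RAM.Memory.setReg, h1]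
  rw [he]
  refine ⟨⟨fun j => ?_, ?_, fun j c' hj => ?_⟩, h2, fun k hk => ?_⟩
  · have : 10 ≤ addr j := by simp [addr]
    rw [hr _ (by omega), hr _ (by omega), hr _ (by omega)]
    exact h.reg j
  · rw [hr3, hr 2 (by norm_num), hs]
    simp only [List.length_append, List.length_singleton]
    push_cast; ring
  · rw [hr 2 (by norm_num)]
    have ha : (m'.setReg 3 (m'.reg 3 + 1)).arr = m'.arr := rfl
    rw [ha, h3, h4, h5, hs]
    have hlt := (List.getElem?_eq_some_iff.1 hj).1
    simp only [List.length_append, List.length_singleton] at hlt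
    by_cases hjq : j = s.q.length
    · subst hjq
      simp only [List.getElem?_concat_length, Option.some.injEq] at hj
      subst hj
      simpa using h.reg i
    · have h6 : ¬ m.reg 2 + (j : ℤ) = m.reg 2 + s.q.length := by omega
      simp only [h6, if_false]
      refine h.cell j c' ?_
      rw [← hj, List.getElem?_append_left (by omega)]
  · simp only [Set.mem_insert_iff, Set.mem_singleton_iff] at hk
    exact hr k (by omega)

theorem sim_peekF {dn : D → ℤ} {m : RAM.Memory} {s : State D} (h : Rel dn s m) {i : ℕ}
    {φ : State D → Prop} (hφ : φ (s.upd i (s.q.head?.getD noCell))) :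
    ∃ s', Rel dn s' (RAM.exec (compile (.peekF i)) m) ∧ φ s' ∧
      Frame m (RAM.exec (compile (.peekF i)) m) := by
  have h10 : 10 ≤ addr i := by simp [addr]
  have hs := h.size
  obtain ⟨h1, h2, h3, h4, h5⟩ := exec_load i (.reg 2) m rfl
  cases hq : s.q with
  | nil =>
    rw [hq] at hφ
    rw [compile, RAM.exec_ite_one (by simp [RAM.Term.eval, hs, hq])]
    refine h.sim_upd hφ rfl (fun k _ _ _ k1 k2 k3 => ?_) ?_
    · simp [RAM.exec, RAM.Memory.setReg, k2, k3]
    · simp [RAM.exec, RAM.Memory.setReg, CellAt, noCell, RAM.Term.eval]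
  | cons c q =>
    rw [hq] at hφ
    rw [compile, RAM.exec_ite_zero (by
      rw [RAM.Term.eval, if_neg]; simp only [RAM.Term.eval, hs, hq, List.length_cons]; omega)]
    have hc := h.cell 0 c (by simp [hq])
    refine h.sim_upd hφ h1 (fun k k1 _ _ => h5 k k1) ?_
    rw [h2, h3, h4]
    simpa [RAM.Term.eval] using hc

theorem sim_peekB {dn : D → ℤ} {m : RAM.Memory} {s : State D} (h : Rel dn s m) {i : ℕ} {e : Expr}
    {φ : State D → Prop} (he : 0 ≤ e.eval s)
    (hφ : φ (s.upd i (s.q.reverse[(e.eval s).toNat]?.getD noCell))) :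
    ∃ s', Rel dn s' (RAM.exec (compile (.peekB i e)) m) ∧ φ s' ∧
      Frame m (RAM.exec (compile (.peekB i e)) m) := by
  have h10 : 10 ≤ addr i := by simp [addr]
  have hs := h.size
  obtain ⟨n, hn⟩ := Int.eq_ofNat_of_zero_le he
  simp only [hn, Int.toNat_natCast] at hφ
  have hm : RAM.exec (compile (.peekB i e)) m = RAM.exec (.ite (.lt (.reg 7) (.reg 2))
        (.seq (.assign (addr i + 1) (.const 8)) (.assign (addr i + 2) (.const 0)))
        (loadCode i (.reg 7))) (m.setReg 7 (m.reg 3 - 1 - n)) := by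
    rw [compile, RAM.exec]
    congr 1
    simp only [RAM.exec, RAM.Term.eval, Expr.eval_term h, hn]
  set m₁ := m.setReg 7 (m.reg 3 - 1 - n) with hm₁
  have hr : ∀ k ≠ 7, m₁.reg k = m.reg k := fun k hk => by
    simp [hm₁, RAM.Memory.setReg, hk]
  have hr7 : m₁.reg 7 = m.reg 3 - 1 - n := by simp [hm₁, RAM.Memory.setReg]
  obtain ⟨h1, h2, h3, h4, h5⟩ := exec_load i (.reg 7) m₁ rfl
  rw [hm]
  have h2' := hr 2 (by norm_num)
  simp only [RAM.Term.eval, hr7] at h2 h3 h4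
  by_cases hlt : n < s.q.length
  · rw [RAM.exec_ite_zero (by rw [RAM.Term.eval, if_neg]; simp only [RAM.Term.eval]; omega)]
    rw [List.getElem?_reverse hlt] at hφ
    have hj : s.q.length - 1 - n < s.q.length := by omega
    rw [List.getElem?_eq_getElem hj] at hφ
    have hc := h.cell _ _ (List.getElem?_eq_getElem hj)
    have hcast : m.reg 2 + ((s.q.length - 1 - n : ℕ) : ℤ) = m.reg 3 - 1 - n := by omega
    rw [hcast] at hc
    refine h.sim_upd hφ h1 (fun k k1 k2 _ k3 k4 k5 => ?_) ?_
    · rw [h5 k k1 k3 k4 k5, hr k k2]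
    · rw [h2, h3, h4]
      exact hc
  · rw [RAM.exec_ite_one (by
      rw [RAM.Term.eval, if_pos]; · norm_num
      simp only [RAM.Term.eval]; omega)]
    rw [List.getElem?_eq_none (by simpa using hlt)] at hφ
    refine h.sim_upd hφ rfl (fun k _ k0 _ k1 k2 k3 => ?_) ?_
    · simp [RAM.exec, RAM.Memory.setReg, k2, k3, hr k k0]
    · simp [RAM.exec, RAM.Memory.setReg, CellAt, noCell, RAM.Term.eval]

/-- The translation of programs is correct. -/
theorem sim {T : ReducingTriangulation D} {dn : D → ℤ} {vn : T.Vertex → ℤ} (p : Prog)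
    {m : RAM.Memory} (hT : T.StoredIn dn vn m) {s : State D} (h : Rel dn s m)
    {φ : State D → Prop} (hw : T.wp p φ s) :
    ∃ s', Rel dn s' (RAM.exec (compile p) m) ∧ φ s' ∧ Frame m (RAM.exec (compile p) m) := by
  induction p generalizing m s φ with
  | skip => exact ⟨s, h, hw, .refl m⟩
  | seq p q ihp ihq =>
    obtain ⟨s', h1, h2, h3⟩ := ihp hT h hw
    obtain ⟨s'', h4, h5, h6⟩ := ihq (hT.congr h3.1) h1 h2
    exact ⟨s'', h4, h5, h3.trans h6⟩
  | ite e f p q ihp ihq =>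
    simp only [compile, RAM.exec, RAM.Term.eval, Expr.eval_term h]
    simp only [wp] at hw
    by_cases hb : e.eval s = f.eval s
    · rw [if_pos hb] at hw
      simpa [hb] using ihp hT h hw
    · rw [if_neg hb] at hw
      simpa [hb] using ihq hT h hw
  | copy i j =>
    obtain ⟨h1, h2, h3⟩ := h.reg j
    refine h.sim_upd (i := i) hw rfl (fun k _ _ _ k1 k2 k3 => ?_) ?_
    · simp [compile, RAM.exec, RAM.Memory.setReg, k1, k2, k3]
    · by_cases hij : j = i
      · subst hij
        simpa [compile, RAM.exec, RAM.Memory.setReg, Function.update_apply, RAM.Term.eval]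
          using h.reg j
      · have := addr_injective hij
        simpa [compile, RAM.exec, RAM.Memory.setReg, Function.update_apply, RAM.Term.eval, this]
          using h.reg j
  | set i t n =>
    have h6 : 6 ≠ addr i + 2 := by simp only [addr]; omega
    -- The value of `t` waits in the scratch register `6`, so that both expressions are evaluated on
    -- the old cell.
    have hn : n.term.eval (m.setReg 6 (t.eval s)) = n.eval s := by
      have hR : Rel dn s (m.setReg 6 (t.eval s)) := by
        refine ⟨fun j => ?_, h.size, h.cell⟩
        have : addr j ≠ 6 ∧ addr j + 1 ≠ 6 ∧ addr j + 2 ≠ 6 := by simp only [addr]; omega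
        simpa [RAM.Memory.setReg, this] using h.reg j
      exact Expr.eval_term hR n
    have hx : RAM.exec (compile (.set i t n)) m = ((m.setReg 6 (t.eval s)).setReg (addr i + 2)
        (n.eval s)).setReg (addr i + 1) (t.eval s) := by
      simp only [compile, RAM.exec, Expr.eval_term h, hn, RAM.Term.eval]
      simp [RAM.Memory.setReg, h6]
    rw [hx]
    refine h.sim_upd (i := i) hw rfl (fun k k0 _ _ k1 k2 k3 => ?_) ⟨fun d hd => ?_, ?_, ?_⟩
    · simp [RAM.Memory.setReg, k0, k2, k3]
    · have : addr i ≠ 6 := by simp only [addr]; omega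
      simpa [RAM.Memory.setReg, this] using (h.reg i).1 d hd
    · simp [RAM.Memory.setReg]
    · simp [RAM.Memory.setReg]
  | clear i =>
    -- A cell without dart does not constrain the machine register of its dart, so there is nothing
    -- to execute.
    refine h.sim_upd (i := i) hw rfl (fun k _ _ _ k1 k2 k3 => rfl) ⟨by simp, (h.reg i).2⟩
  | rev i =>
    refine h.sim_upd (i := i) hw rfl (fun k _ _ _ k1 k2 k3 => ?_) ⟨fun d hd => ?_, ?_⟩
    · simp [compile, RAM.exec, RAM.Memory.setReg, k1]
    · obtain ⟨d', h1, rfl⟩ := Option.map_eq_some_iff.1 hd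
      simp [compile, RAM.exec, RAM.Memory.setReg, RAM.Term.eval, (h.reg i).1 d' h1, hT.rev]
    · simpa [compile, RAM.exec, RAM.Memory.setReg] using (h.reg i).2
  | rot i e => exact sim_rot hT h hw
  | red i j =>
    obtain ⟨d, hd, hφ⟩ := hw
    refine h.sim_upd (i := i) hφ rfl (fun k _ _ _ k1 k2 k3 => ?_) ⟨fun d' hd' => ?_, ?_, ?_⟩
    · simp [compile, RAM.exec, RAM.Memory.setReg, k2]
    · simpa [compile, RAM.exec, RAM.Memory.setReg] using (h.reg i).1 d' hd'
    · simp [compile, RAM.exec, RAM.Memory.setReg, RAM.Term.eval, (h.reg j).1 d hd, hT.colour]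
    · simpa [compile, RAM.exec, RAM.Memory.setReg] using (h.reg i).2.2
  | turn i j k => exact sim_turn hT h hw
  | popF i =>
    obtain ⟨c, q, hq, hφ⟩ := hw
    exact ⟨_, (sim_popF h hq).1, hφ, (sim_popF h hq).2⟩
  | popB i =>
    obtain ⟨c, q, hq, hφ⟩ := hw
    exact ⟨_, (sim_popB h hq).1, hφ, (sim_popB h hq).2⟩
  | pushF i => exact ⟨_, (sim_pushF h).1, hw, (sim_pushF h).2⟩
  | pushB i => exact ⟨_, (sim_pushB h).1, hw, (sim_pushB h).2⟩
  | peekF i => exact sim_peekF h hw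
  | peekB i e => exact sim_peekB h hw.1 hw.2

end ReducingTriangulation

namespace ReducingTriangulation

variable {D : Type*} (T : ReducingTriangulation D)

/-! ### The programs of the steps -/

/-- A sequence of programs. -/
def block : List Prog → Prog
  | [] => .skip
  | p :: ps => .seq p (block ps)

@[simp] theorem wp_block_nil (φ : State D → Prop) (s : State D) : T.wp (block []) φ s = φ s := rfl

@[simp] theorem wp_block_cons (p : Prog) (ps : List Prog) (φ : State D → Prop) (s : State D) :
    T.wp (block (p :: ps)) φ s = T.wp p (T.wp (block ps) φ) s := rfl

/-- Test whether the class of a register is in a list. -/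
def memTest (i : ℕ) (p q : Prog) : List ℤ → Prog
  | [] => q
  | k :: ks => .ite (.cls i) (.const k) p (memTest i p q ks)

theorem wp_memTest (i : ℕ) (p q : Prog) (ks : List ℤ) (φ : State D → Prop) (s : State D) :
    T.wp (memTest i p q ks) φ s =
      if (s.r i).2.1 ∈ ks then T.wp p φ s else T.wp q φ s := by
  induction ks with
  | nil => simp [memTest]
  | cons k ks ih =>
    simp only [memTest, wp, Expr.eval, ih, List.mem_cons]
    by_cases h1 : (s.r i).2.1 = k <;> simp [h1]

@[simp] theorem State.upd_r (s : State D) (i : ℕ) (c : Cell D) (k : ℕ) :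
    (s.upd i c).r k = if k = i then c else s.r k := by
  simp [State.upd, Function.update_apply]

@[simp] theorem State.upd_q (s : State D) (i : ℕ) (c : Cell D) : (s.upd i c).q = s.q := rfl

/-- Put back on the queue the first cell without its first vertex. -/
def dropFirst (i : ℕ) : Prog :=
  .ite (.cnt i) (.const 1) .skip
    (block [.copy 3 i, .rev 3, .rot 3 (.cls i), .set 3 (.cls i) (.sub (.cnt i) (.const 1)),
      .pushF 3])

theorem wp_dropFirst {i : ℕ} (hi : i ≠ 3) {s : State D} (hb : -3 ≤ (s.r i).2.1 ∧ (s.r i).2.1 ≤ 7)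
    {φ : State D → Prop} (h : ∀ s' : State D, s'.q = T.splitFirst (s.r i) ++ s.q →
      (∀ k ≠ 3, s'.r k = s.r k) → φ s') : T.wp (dropFirst i) φ s := by
  have h3 : ¬ i = 3 := hi
  rcases hs : s.r i with ⟨o, t, n⟩
  rw [hs] at hb h
  simp only [dropFirst, wp, Expr.eval, wp_block_cons, wp_block_nil, State.upd_r, h3, if_true,
    if_false, hs, State.upd_q]
  split_ifs with h1
  · exact h s (by simp [splitFirst, h1]) fun _ _ => rfl
  · refine ⟨⟨by simp at hb; omega, by simp at hb; omega⟩, h _ ?_ ?_⟩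
    · simp [splitFirst, h1, Function.comp_def]
    · intro k hk
      simp [hk]

/-- Take the last vertex of the queue, followed by the dart of register `i`. -/
def takeLast (i : ℕ) : Prog :=
  block [.peekF 5, .ite (.cls 5) (.const 8) .skip (block [.popB 3,
    .ite (.cnt 3) (.const 1) (.copy 6 3)
      (block [.set 3 (.cls 3) (.sub (.cnt 3) (.const 1)), .pushB 3, .copy 6 i,
        .rot 6 (.sub (.const 0) (.cls 3)), .rev 6]),
    .ite (.cls 3) (.const 7) (.set 6 (.const 7) (.const 1)) (.set 6 (.const 6) (.const 1))])]

/-- The class of register `5` is `8` exactly if the queue was empty. Otherwise register `6` receives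
the vertex that will be put in front of the new cells. -/
theorem wp_takeLast {i : ℕ} (hi : i ≠ 3 ∧ i ≠ 5 ∧ i ≠ 6) {s : State D}
    (hb : ∀ c ∈ s.q, -3 ≤ c.2.1 ∧ c.2.1 ≤ 7) {φ : State D → Prop}
    (h0 : s.q = [] → ∀ s' : State D, s'.q = [] → (s'.r 5).2.1 = 8 →
      (∀ k, k ≠ 3 → k ≠ 5 → k ≠ 6 → s'.r k = s.r k) → φ s')
    (h : ∀ R c, s.q = R ++ [c] → ∀ s' : State D, s'.q = R ++ splitLast c → (s'.r 5).2.1 ≠ 8 →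
      s'.r 6 = (T.lastDart c (s.r i).1, if c.2.1 = 7 then 7 else 6, 1) →
      (∀ k, k ≠ 3 → k ≠ 5 → k ≠ 6 → s'.r k = s.r k) → φ s') :
    T.wp (takeLast i) φ s := by
  obtain ⟨h3, h5, h6⟩ := hi
  simp only [takeLast, wp, Expr.eval, wp_block_cons, wp_block_nil, State.upd_r, State.upd_q, if_true]
  rcases List.eq_nil_or_concat' s.q with hq | ⟨R, ⟨o, t, n⟩, hq⟩
  · simp only [hq, List.head?_nil, Option.getD_none, noCell, if_true]
    refine h0 hq _ hq (by simp) fun k _ k5 _ => by simp [k5]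
  · have h8 : (s.q.head?.getD noCell).2.1 ≠ 8 := by
      obtain ⟨a, m, ham⟩ := List.exists_cons_of_ne_nil (show s.q ≠ [] by simp [hq])
      have := hb a (by simp [ham])
      rw [ham]
      simp; omega
    rw [if_neg h8]
    refine ⟨(o, t, n), R, hq, ?_⟩
    have hc := hb (o, t, n) (by simp [hq])
    have h' := h R _ hq
    simp only at hc
    simp only [lastDart, splitLast] at h'
    have hfin : ∀ s' : State D, (∀ k, k ≠ 3 → k ≠ 6 → s'.r k = if k = 5 then s.q.head?.getD noCell
        else s.r k) → s'.q = R ++ splitLast (o, t, n) →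
        s'.r 6 = (T.lastDart (o, t, n) (s.r i).1, if t = 7 then 7 else 6, 1) → φ s' :=
      fun s' hr hq' hd => h R _ hq s' hq' (by rw [hr 5 (by norm_num) (by norm_num)]; simpa using h8)
        hd fun k k3 k5 k6 => by rw [hr k k3 k6, if_neg k5]
    by_cases h1 : n = 1 <;> by_cases h7 : t = 7
    all_goals
      simp [h1, h7, h3, h5, splitLast, lastDart] at hfin ⊢
      try refine ⟨by omega, ?_⟩
      refine hfin _ (fun k k3 k6 => ?_) rfl ?_ <;> simp [*, Function.comp_def]

/-- Add `n` to the integer of register `0`. -/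
def incr (n : ℤ) : Prog := .set 0 (.add (.cls 0) (.const n)) (.cnt 0)

/-- Take the last vertex of the queue, push cells with the program `p`, and push this vertex. -/
def attach (p : Prog) : Prog :=
  block [takeLast 10, p, .ite (.cls 5) (.const 8) .skip (.pushF 6), incr 16]

/-- What a step of the reduction does. -/
def Post (lin : Bool) (l : List D) (Q : List (Cell D)) (u : ℕ) (s : State D) : Prop :=
  ∃ u' : ℕ, (s.r 0).2.1 = u' ∧ T.Next lin l Q u s.q u'

/-- The last vertex must be taken before `p` pushes the new cells, since the rest of the ring may be
empty and the vertex would then be taken from `N`. The program `p` has to preserve the counter and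
what `takeLast` has stored. -/
theorem wp_attach {lin : Bool} {l : List D} {Q N : List (Cell D)} {u : ℕ} {p : Prog} {s : State D}
    (hu : (s.r 0).2.1 = u) (hb : ∀ c ∈ s.q, -3 ≤ c.2.1 ∧ c.2.1 ≤ 7)
    (hp : ∀ (s' : State D) (φ : State D → Prop), (∀ k, k ≠ 3 → k ≠ 5 → k ≠ 6 → s'.r k = s.r k) →
      (∀ s'' : State D, s''.q = N ++ s'.q → s''.r 0 = s'.r 0 → s''.r 5 = s'.r 5 →
        s''.r 6 = s'.r 6 → φ s'') → T.wp p φ s')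
    (h : (s.q = [] → T.Next lin l Q u N (u + 16)) ∧ ∀ R c, s.q = R ++ [c] → T.Next lin l Q u
      ((T.lastDart c (s.r 10).1, if c.2.1 = 7 then 7 else 6, 1) :: (N ++ (R ++ splitLast c)))
      (u + 16)) :
    T.wp (attach p) (T.Post lin l Q u) s := by
  rw [attach, wp_block_cons]
  refine T.wp_takeLast (by norm_num) hb (fun h0 s' hq h5 hk => ?_) fun R c hR s' hq h5 h6 hk => ?_
  · rw [wp_block_cons]
    refine hp s' _ hk fun s'' hq' h0' h5' h6' => ?_
    rw [hq, List.append_nil] at hq'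
    simp only [wp, wp_block_cons, wp_block_nil, Expr.eval, incr, h5', h5, if_true]
    refine ⟨u + 16, by simp [h0', hk 0, hu], ?_⟩
    rw [State.upd_q, hq']
    exact h.1 h0
  · rw [wp_block_cons]
    refine hp s' _ hk fun s'' hq' h0' h5' h6' => ?_
    simp only [wp, wp_block_cons, wp_block_nil, Expr.eval, incr, h5', h5, if_false]
    refine ⟨u + 16, by simp [h0', hk 0, hu], ?_⟩
    rw [State.upd_q]
    dsimp only
    rw [hq', hq, h6', h6]
    exact h.2 R c hR

variable {T}

theorem CellOk.bounds {c : Cell D} {x : Option D} (h : T.CellOk c x) :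
    -3 ≤ c.2.1 ∧ c.2.1 ≤ 7 := by
  cases h <;> simp
  omega

theorem Linked.bounds {Q : List (Cell D)} {x : Option D} (h : T.Linked Q x) :
    ∀ c ∈ Q, -3 ≤ c.2.1 ∧ c.2.1 ≤ 7 := by
  induction Q with
  | nil => simp
  | cons c Q ih =>
    rintro a (_ | ⟨_, ha⟩)
    · exact h.1.bounds
    · exact ih h.2 a ha

theorem splitFirst_bounds {y : Cell D} (hy : -3 ≤ y.2.1 ∧ y.2.1 ≤ 7) {M : List (Cell D)}
    (hM : ∀ c ∈ M, -3 ≤ c.2.1 ∧ c.2.1 ≤ 7) :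
    ∀ c ∈ T.splitFirst y ++ M, -3 ≤ c.2.1 ∧ c.2.1 ≤ 7 := by
  intro c hc
  rcases List.mem_append.1 hc with hc | hc
  · obtain ⟨o, t, n⟩ := y
    simp only [splitFirst] at hc
    split_ifs at hc
    · simp at hc
    · simp only [List.mem_singleton] at hc
      subst hc
      exact hy
  · exact hM c hc

/-- The program of a spur. -/
def spurProg : Prog := block [.popF 2, dropFirst 2, .copy 10 1, attach .skip]

theorem wp_spur {lin : Bool} {l : List D} {o : Option D} {n : ℤ} {u : ℕ} {s : State D}
    (h : T.Good lin l ((o, 0, n) :: s.q) u) (hu : (s.r 0).2.1 = u) (h1 : s.r 1 = (o, 0, n)) :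
    T.wp spurProg (T.Post lin l ((o, 0, n) :: s.q) u) s := by
  have hb := Linked.bounds h.ok
  obtain ⟨e, y, M, rfl, hq, hy, hn⟩ := h.spur
  rw [hq] at hb hn ⊢
  have hby := hb y (by simp)
  have hbM : ∀ c ∈ M, -3 ≤ c.2.1 ∧ c.2.1 ≤ 7 := fun c hc => hb c (by simp [hc])
  refine ⟨y, M, hq, ?_⟩
  rw [wp_block_cons]
  refine T.wp_dropFirst (by norm_num) (by simpa using hby) fun s' hq' hk => ?_
  simp only [State.upd_r, if_true] at hq' hk
  simp only [wp_block_cons, wp]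
  refine T.wp_attach (N := []) ?_ ?_ (fun s' φ _ h => h s' rfl rfl rfl rfl) ?_
  · simp [hk, hu]
  · rw [State.upd_q, hq']
    exact splitFirst_bounds hby hbM
  · rw [State.upd_q, hq']
    simpa [hk, h1] using hn

/-- The program of a spike. -/
def spikeProg (ε : ℤ) : Prog := block [.popF 2, dropFirst 2, .copy 10 1, attach (block [.copy 7 1,
  .rot 7 (.const (-ε)), .set 7 (.const 6) (.const 1), .pushF 7])]

theorem wp_spike {lin : Bool} {l : List D} {o : Option D} {n : ℤ} {u : ℕ} {s : State D} {ε : ℤ}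
    (hε : ε = 1 ∨ ε = -1) (h : T.Good lin l ((o, ε, n) :: s.q) u) (hu : (s.r 0).2.1 = u)
    (h1 : s.r 1 = (o, ε, n)) :
    T.wp (spikeProg ε) (T.Post lin l ((o, ε, n) :: s.q) u) s := by
  have hb := Linked.bounds h.ok
  obtain ⟨e, y, M, rfl, hq, hy, hn⟩ := h.spike hε
  rw [hq] at hb hn ⊢
  have hby := hb y (by simp)
  have hbM : ∀ c ∈ M, -3 ≤ c.2.1 ∧ c.2.1 ≤ 7 := fun c hc => hb c (by simp [hc])
  refine ⟨y, M, hq, ?_⟩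
  rw [wp_block_cons]
  refine T.wp_dropFirst (by norm_num) (by simpa using hby) fun s' hq' hk => ?_
  simp only [State.upd_r, if_true] at hq' hk
  simp only [wp_block_cons, wp]
  refine T.wp_attach (N := [(some (T.rot (-ε) e), 6, 1)]) ?_ ?_ (fun s'' φ hs h => ?_) ?_
  · simp [hk, hu]
  · rw [State.upd_q, hq']
    exact splitFirst_bounds hby hbM
  · have h1' : s''.r 1 = (some e, ε, n) := by rw [hs 1] <;> simp [hk, h1]
    simp only [wp_block_cons, wp_block_nil, wp, Expr.eval, h1']
    refine ⟨by omega, h _ ?_ ?_ ?_ ?_⟩ <;> simp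
  · rw [State.upd_q, hq']
    simpa [hk, h1] using hn

end ReducingTriangulation

/-! ### Programs for brackets, flips, merging and evaluation of turns -/

namespace ReducingTriangulation

variable {D : Type*} {T : ReducingTriangulation D}

theorem wp_ite_pos {e f : Expr} {p q : Prog} {φ : State D → Prop} {s : State D}
    (h : e.eval s = f.eval s) : T.wp (.ite e f p q) φ s = T.wp p φ s := if_pos h

theorem wp_ite_neg {e f : Expr} {p q : Prog} {φ : State D → Prop} {s : State D}
    (h : e.eval s ≠ f.eval s) : T.wp (.ite e f p q) φ s = T.wp q φ s := if_neg h

/-- Take from the queue the cell of turns `3 * ε` that is announced by register `j`, if any. -/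
def takeRun (ε : ℤ) (j i : ℕ) : Prog :=
  .ite (.cls j) (.const (ε * 3)) (.popB i) (.set i (.cls i) (.const 0))

theorem wp_takeRun {ε : ℤ} {j i k : ℕ} {e : D} {A : List (Cell D)} {s : State D}
    (hq : s.q = A ++ runCells e (ε * 3) k) (hj : (s.r j).2.1 = ε * 3 ↔ k ≠ 0) {φ : State D → Prop}
    (h : ∀ s' : State D, s'.q = A → (s'.r i).2.2 = k → (k ≠ 0 → (s'.r i).1 = some e) →
      (∀ x ≠ i, s'.r x = s.r x) → φ s') : T.wp (takeRun ε j i) φ s := by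
  cases k with
  | zero =>
    rw [takeRun, wp_ite_neg (by simpa [Expr.eval] using hj)]
    refine h _ (by simpa [runCells] using hq) (by simp [Expr.eval]) (by simp) fun x hx => by
      simp [hx]
  | succ k =>
    rw [takeRun, wp_ite_pos (by simpa [Expr.eval] using hj)]
    refine ⟨_, A, by simpa [runCells] using hq, h _ rfl (by simp) (by simp) fun x hx => by simp [hx]⟩

/-- Replace the dart of a register by its push. -/
def pushDart (ε : ℤ) (i : ℕ) : List Prog :=
  [.rot i (.const (-ε)), .rev i, .rot i (.const (ε * -2))]

/-- Push on the queue the cells on the other side of a strip. -/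
def pushProg (ε : ℤ) (i j : ℕ) : Prog :=
  .ite (.cnt i) (.const 0) .skip (block [.copy 7 j, .rot 7 (.const (ε * -3)), .rev 7,
    block (pushDart ε 7), .set 7 (.const 6) (.const 1), .pushF 7,
    .ite (.cnt i) (.const 1) .skip (block [.copy 7 i, block (pushDart ε 7),
      .set 7 (.const (ε * -3)) (.sub (.cnt i) (.const 1)), .pushF 7])])

theorem orient_push {ε : ℤ} (hε : ε = 1 ∨ ε = -1) (e : D) :
    (T.orient ε).push e = T.rot (ε * -2) (T.rev (T.rot (-ε) e)) := by
  rw [push_eq, T.orient_rot hε, T.orient_rot hε, T.orient_rev hε, mul_neg_one]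

theorem wp_pushProg {ε : ℤ} (hε : ε = 1 ∨ ε = -1) {i j k : ℕ} (hi : i ≠ 7) (hj : j ≠ 7) {e z : D}
    {s : State D} (hk : (s.r i).2.2 = k) (he : k ≠ 0 → (s.r i).1 = some e)
    (hz : (s.r j).1 = some z) {φ : State D → Prop}
    (h : ∀ s' : State D, s'.q = T.pushCells ε e k z ++ s.q → (∀ x ≠ 7, s'.r x = s.r x) → φ s') :
    T.wp (pushProg ε i j) φ s := by
  have h7 : (7 : ℕ) ≠ i := hi.symm
  rcases k with _ | _ | k
  · rw [pushProg, wp_ite_pos (by simp [Expr.eval, hk])]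
    exact h s (by simp [pushCells]) fun _ _ => rfl
  · rw [pushProg, wp_ite_neg (by simp [Expr.eval, hk])]
    simp only [pushDart, wp_block_cons]
    refine ⟨by simp only [Expr.eval]; omega, ⟨by simp only [Expr.eval]; omega,
      by simp only [Expr.eval]; omega, ?_⟩⟩
    rw [wp_block_nil, wp_block_cons, wp, wp_block_cons, wp, wp_block_cons,
      wp_ite_pos (by simp [Expr.eval, hi, hk])]
    refine h _ ?_ fun x hx => by simp [hx]
    simp [pushCells, runCells, orient_push hε, Expr.eval, hz]
  · have he' := he (by simp)
    rw [pushProg, wp_ite_neg (by simp [Expr.eval, hk]; omega)]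
    simp only [pushDart, wp_block_cons]
    refine ⟨by simp only [Expr.eval]; omega, ⟨by simp only [Expr.eval]; omega,
      by simp only [Expr.eval]; omega, ?_⟩⟩
    rw [wp_block_nil, wp_block_cons, wp, wp_block_cons, wp, wp_block_cons,
      wp_ite_neg (by simp [Expr.eval, hi, hk]; omega)]
    refine ⟨by simp only [Expr.eval]; omega, by simp only [Expr.eval]; omega, ?_⟩
    refine h _ ?_ fun x hx => by simp [hx]
    simp [pushCells, runCells, orient_push hε, he', Expr.eval, hz, hk, hi]

/-- The program of a bracket. -/
def bracketProg (ε : ℤ) : Prog := block [takeRun ε 2 9, .popB 4, .popF 2, dropFirst 2, .copy 10 4,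
  attach (block [.copy 7 2, .rot 7 (.const (-ε)), .rev 7, .rot 7 (.const (-ε)),
    .set 7 (.const 6) (.const 1), .pushF 7, .copy 7 4, .rot 7 (.const (-ε)),
    .set 7 (.const (ε * -3)) (.add (.cnt 9) (.const 1)), .pushF 7])]

theorem wp_bracket {lin : Bool} {l : List D} {o o₂ : Option D} {n n₂ ε : ℤ} {y : Cell D}
    {M : List (Cell D)} {e₃ : D} {k u : ℕ} {s : State D} (hε : ε = 1 ∨ ε = -1)
    (hq : s.q = y :: (M ++ (o₂, ε * 2, n₂) :: runCells e₃ (ε * 3) k))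
    (h : T.Good lin l ((o, ε * 2, n) :: s.q) u) (hu : (s.r 0).2.1 = u)
    (h2 : (s.r 2).2.1 = ε * 3 ↔ k ≠ 0) :
    T.wp (bracketProg ε) (T.Post lin l ((o, ε * 2, n) :: s.q) u) s := by
  have hb := Linked.bounds h.ok
  obtain ⟨e₁, ey, rfl, hy, hn⟩ := h.bracket hε (by rw [hq])
  have hn := hn _ rfl
  rw [hq] at hb
  have hby := hb y (by simp)
  have hbM : ∀ c ∈ M, -3 ≤ c.2.1 ∧ c.2.1 ≤ 7 := fun c hc => hb c (by simp [hc])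
  rw [bracketProg, wp_block_cons]
  refine wp_takeRun (A := y :: (M ++ [(some e₁, ε * 2, n₂)])) (by simpa using hq) h2
    fun s₁ hq₁ h91 _ hk₁ => ?_
  refine ⟨_, y :: M, by simpa using hq₁, ?_⟩
  refine ⟨y, M, rfl, ?_⟩
  rw [wp_block_cons]
  refine T.wp_dropFirst (by norm_num) (by simpa using hby) fun s' hq' hk => ?_
  simp only [State.upd_r, if_true] at hq' hk
  simp only [wp_block_cons]
  refine T.wp_attach (N := runCells (T.rot (-ε) e₁) (ε * -3) (k + 1) ++
    [(some (T.rot (-ε) (T.rev (T.rot (-ε) ey))), 6, 1)]) ?_ ?_ (fun s'' φ hs h => ?_) ?_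
  · simp [hk, hk₁, hu]
  · rw [State.upd_q, hq']
    exact splitFirst_bounds hby hbM
  · have h1' : (s''.r 2).1 = some ey := by rw [hs 2] <;> simp [hk, hy]
    have h2' : (s''.r 4).1 = some e₁ := by rw [hs 4] <;> simp [hk]
    have h3' : (s''.r 9).2.2 = k := by rw [hs 9] <;> simp [hk, h91]
    simp only [wp_block_cons, wp_block_nil, wp, Expr.eval, State.upd_r, State.upd_q, if_true]
    refine ⟨by omega, by omega, by omega, h _ ?_ ?_ ?_ ?_⟩ <;> simp [runCells, h1', h2', h3']
  · rw [State.upd_q, hq']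
    simpa [hk] using hn

/-- The program of a flip. -/
def flipProg (ε : ℤ) : Prog := block [takeRun ε 2 9, .popB 4, takeRun ε 11 8,
  .ite (.cnt 8) (.const 0) (.copy 10 4) (.copy 10 8), dropFirst 1,
  attach (block [.copy 7 1, .rot 7 (.const (-ε)), .rev 7, .rot 7 (.const (-ε)),
    .set 7 (.const 6) (.const 1), .pushF 7, pushProg ε 9 1, pushProg ε 8 4, .copy 7 10,
    .rot 7 (.const (-ε)), .set 7 (.const 6) (.const 1), .pushF 7])]

theorem wp_flip {lin : Bool} {l : List D} {o o₂ : Option D} {t n n₂ ε : ℤ}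
    {M : List (Cell D)} {e₃ e₄ : D} {k m u : ℕ} {s : State D} (hε : ε = 1 ∨ ε = -1)
    (hq : s.q = M ++ (runCells e₃ (ε * 3) k ++ (o₂, ε * 2, n₂) :: runCells e₄ (ε * 3) m))
    (h : T.Good lin l ((o, t, n) :: s.q) u) (hu : (s.r 0).2.1 = u) (h1 : s.r 1 = (o, t, n))
    (h2 : (s.r 2).2.1 = ε * 3 ↔ m ≠ 0) (h11 : (s.r 11).2.1 = ε * 3 ↔ k ≠ 0)
    (ht : t ∉ ({6, 0, 1, -1, ε * 2, ε * 3} : Set ℤ)) (hr : ∃ d, o₂ = some d ∧ T.red d = true)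
    (hM : ∀ R c, M = R ++ [c] → c.2.1 ∉ ({6, 0, 1, -1, ε * 2, ε * 3} : Set ℤ)) :
    T.wp (flipProg ε) (T.Post lin l ((o, t, n) :: s.q) u) s := by
  have hb := Linked.bounds h.ok
  obtain ⟨e₁, d, el, rfl, rfl, he₁, hn⟩ := h.flip hε (by rw [hq]) ht hr hM
  have hn := hn _ rfl
  rw [hq] at hb
  have hbt := hb (some el, t, n) (by simp)
  have hbM : ∀ c ∈ M, -3 ≤ c.2.1 ∧ c.2.1 ≤ 7 := fun c hc => hb c (by simp [hc])
  rw [flipProg, wp_block_cons]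
  refine wp_takeRun (A := M ++ (runCells e₃ (ε * 3) k ++ [(some d, ε * 2, n₂)]))
    (by simpa using hq) h2 fun s₁ hq₁ h91 h91' hk₁ => ?_
  refine ⟨_, M ++ runCells e₃ (ε * 3) k, by simpa using hq₁, ?_⟩
  rw [wp_block_cons]
  refine wp_takeRun (A := M) (k := k) rfl (by simp [hk₁, h11]) fun s₂ hq₂ h82 h82' hk₂ => ?_
  simp only [State.upd_r] at hk₂
  have h10 : T.wp (block [dropFirst 1,
      attach (block [.copy 7 1, .rot 7 (.const (-ε)), .rev 7, .rot 7 (.const (-ε)),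
        .set 7 (.const 6) (.const 1), .pushF 7, pushProg ε 9 1, pushProg ε 8 4, .copy 7 10,
        .rot 7 (.const (-ε)), .set 7 (.const 6) (.const 1), .pushF 7])])
      (T.Post lin l ((some el, t, n) :: s.q) u) (s₂.upd 10 (if k = 0 then s₂.r 4 else s₂.r 8)) := by
    rw [wp_block_cons]
    refine T.wp_dropFirst (by norm_num) (by simpa [hk₂, hk₁, h1] using hbt) fun s' hq' hk => ?_
    have hq' : s'.q = T.splitFirst (some el, t, n) ++ M := by
      rw [hq']; simp [hk₂, hk₁, h1, hq₂]
    simp only [State.upd_r] at hk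
    simp only [wp_block_cons]
    have h4 : s'.r 4 = (some d, ε * 2, n₂) := by simp [hk, hk₂]
    have h10 : (s'.r 10).1 = some e₁ := by
      rw [← he₁]
      cases k with
      | zero => simp [hk, hk₂, runCells]
      | succ k => simp [hk, runCells, h82']
    refine T.wp_attach (N := (some (T.rot (-ε) e₁), 6, 1) :: (T.pushCells ε e₃ k d ++
      (T.pushCells ε e₄ m el ++ [(some (T.rot (-ε) (T.rev (T.rot (-ε) el))), 6, 1)]))) ?_ ?_
      (fun s'' φ hs h => ?_) ?_
    · simp [hk, hk₁, hk₂, hu]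
    · rw [hq']
      exact splitFirst_bounds hbt hbM
    · have h1' : (s''.r 1).1 = some el := by
        rw [hs 1] <;> simp [hk, hk₁, hk₂, h1]
      have h4' : (s''.r 4).1 = some d := by rw [hs 4] <;> simp [h4]
      have h9' : (s''.r 9) = s₁.r 9 := by rw [hs 9] <;> simp [hk, hk₂]
      have h8' : (s''.r 8) = s₂.r 8 := by rw [hs 8] <;> simp [hk]
      have h10' : (s''.r 10).1 = some e₁ := by rw [hs 10] <;> simp [h10]
      simp only [wp_block_cons, wp, Expr.eval]
      refine ⟨by omega, by omega, ?_⟩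
      refine wp_pushProg hε (k := m) (e := e₄) (z := el) (by norm_num) (by norm_num)
        (by simp [h9', h91]) (by simpa [h9'] using h91') (by simp [h1']) fun s₃ hq₃ hk₃ => ?_
      rw [wp_block_cons]
      refine wp_pushProg hε (k := k) (e := e₃) (z := d) (by norm_num) (by norm_num)
        (by simp [hk₃, h8', h82]) (by simpa [hk₃, h8'] using h82') (by simp [hk₃, h4'])
        fun s₄ hq₄ hk₄ => ?_
      simp only [wp_block_cons, wp_block_nil, wp, Expr.eval]
      refine ⟨by omega, h _ ?_ ?_ ?_ ?_⟩ <;> simp [hq₄, hq₃, hk₃, hk₄, h1', h10']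
    · rw [hq']
      simpa [h10] using hn
  by_cases hk0 : k = 0
  · rw [if_pos hk0] at h10
    simpa [wp, Expr.eval, h82, hk0] using h10
  · rw [if_neg hk0] at h10
    simpa [wp, Expr.eval, h82, hk0] using h10

/-- The program that merges two cells. -/
def mergeProg : Prog :=
  block [.popB 2, .set 2 (.cls 2) (.add (.cnt 2) (.cnt 1)), .pushF 2, incr 16]

theorem wp_merge {lin : Bool} {l : List D} {o o' : Option D} {t n m : ℤ} {M : List (Cell D)}
    {u : ℕ} {s : State D} (ht : t = 3 ∨ t = -3) (hq : s.q = M ++ [(o', t, m)])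
    (h : T.Good lin l ((o, t, n) :: s.q) u) (hu : (s.r 0).2.1 = u) (h1 : s.r 1 = (o, t, n)) :
    T.wp mergeProg (T.Post lin l ((o, t, n) :: s.q) u) s := by
  refine ⟨_, _, hq, ?_⟩
  simp only [wp_block_cons, wp_block_nil, wp, Expr.eval, incr]
  refine ⟨u + 16, by simp [hu], ?_⟩
  rw [hq] at h ⊢
  simpa [h1] using h.merge ht

theorem CellOk.eq_none {c : Cell D} {x : Option D} (h : T.CellOk c x) (h7 : c.2.1 = 7) :
    c.1 = none := by
  cases h with
  | gap x => rfl
  | run e t k h hk => simp at h7; omega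
  | _ => simp at h7

theorem CellOk.exists_eq_some {c : Cell D} {x : Option D} (h : T.CellOk c x) (h7 : c.2.1 ≠ 7) :
    ∃ e, c.1 = some e := by
  cases h with
  | gap x => exact absurd rfl h7
  | _ => exact ⟨_, rfl⟩

/-- The program that evaluates a turn. -/
def evalProg : Prog :=
  block [.peekF 2, .ite (.cls 2) (.const 8) (.turn 1 1 1)
    (.ite (.cls 2) (.const 7) (.set 1 (.const 5) (.const 1)) (.turn 1 1 2)), .pushF 1, incr 16]

theorem cellOk_turn {e e' : D} (h : T.Adj e e') :
    T.CellOk (some e, min (T.turn e e') 4, 1) (some e') := by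
  rcases le_or_gt 4 (T.turn e e') with h4 | h4
  · rw [min_eq_right h4]
    exact .big e e' h h4
  · rw [min_eq_left h4.le]
    have := CellOk.run (T := T) e (T.turn e e') 0 ⟨(T.turn_range h).1, by omega⟩ (.inl rfl)
    simpa [← h.eq_rot_turn] using this

/-- If the queue is empty, the closed walk is a single loop, and its dart is followed by itself. If
the gap follows, the vertex is the end of a walk and has no turn, whence the class `5`. -/
theorem wp_eval {lin : Bool} {l : List D} {o : Option D} {n : ℤ} {u : ℕ} {s : State D}
    (h : T.Good lin l ((o, 6, n) :: s.q) u) (hu : (s.r 0).2.1 = u) (h1 : s.r 1 = (o, 6, n)) :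
    T.wp evalProg (T.Post lin l ((o, 6, n) :: s.q) u) s := by
  obtain ⟨e, rfl, rfl⟩ : ∃ e, o = some e ∧ n = 1 := by
    generalize hx : firstOr s.q (firstOr ((o, 6, n) :: s.q) none) = x
    have := h.ok.1
    rw [hx] at this
    generalize ht : (6 : ℤ) = t at this
    cases this with
    | unknown e x => exact ⟨e, rfl, rfl⟩
    | run e t k h hk => omega
    | _ => simp at ht
  have key : ∀ t, T.CellOk (some e, t, 1) (firstOr s.q (some e)) → t ≠ 6 →
      T.wp (block [.pushF 1, incr 16]) (T.Post lin l ((some e, 6, 1) :: s.q) u)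
        ((s.upd 2 (s.q.head?.getD noCell)).upd 1 (some e, t, 1)) := by
    intro t ht ht6
    simp only [wp_block_cons, wp_block_nil, wp, Expr.eval, incr]
    refine ⟨u + 16, by simp [hu], ?_⟩
    simpa using h.eval ht ht6
  have hmin : ∀ e', min (T.turn e e') 4 ≠ 6 := fun e' => by omega
  rw [evalProg, wp_block_cons, wp]
  cases hq : s.q with
  | nil =>
    have hadj := h.adj_first (e' := e) (by simp [hq, firstOr])
    rw [wp_block_cons, wp_ite_pos (by simp [noCell, Expr.eval])]
    refine ⟨e, e, by simp [h1], by simp [h1], hadj, ?_⟩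
    have := key _ (by rw [hq]; exact cellOk_turn hadj) (hmin e)
    simpa [h1, hq] using this
  | cons y M =>
    have hy := h.ok.2
    rw [hq] at hy
    have hy7 := hy.1.bounds.2
    rw [wp_block_cons, wp_ite_neg (by simp [Expr.eval]; omega)]
    by_cases h7 : y.2.1 = 7
    · rw [wp_ite_pos (by simpa [Expr.eval] using h7)]
      have := key 5 (by
        rw [hq, firstOr_cons]
        rw [hy.1.eq_none h7]
        exact .fin e) (by norm_num)
      simpa [h1, hq, wp, Expr.eval] using this
    · rw [wp_ite_neg (by simpa [Expr.eval] using h7)]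
      obtain ⟨e', he'⟩ : ∃ e', y.1 = some e' := hy.1.exists_eq_some h7
      have hadj := h.adj_first (e' := e') (by simp [hq, he'])
      refine ⟨e, e', by simp [h1], by simp [he'], hadj, ?_⟩
      have := key _ (by rw [hq, firstOr_cons, he']; exact cellOk_turn hadj) (hmin e')
      simpa [h1, hq] using this

/-- The program that accepts a cell. -/
def rotateProg : Prog := block [.pushB 1, incr (-1)]

theorem wp_rotate {lin : Bool} {l : List D} {c : Cell D} {u : ℕ} {s : State D}
    (h : T.Good lin l (c :: s.q) (u + 1)) (hu : (s.r 0).2.1 = ((u + 1 : ℕ) : ℤ)) (h1 : s.r 1 = c)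
    (hc : T.Pass c.2.1 (keys s.q.reverse)) :
    T.wp rotateProg (T.Post lin l (c :: s.q) (u + 1)) s := by
  simp only [rotateProg, wp_block_cons, wp_block_nil, wp, Expr.eval, incr]
  refine ⟨u, by simp [hu], ?_⟩
  have := h.rotate (by simpa [keys] using hc)
  simpa [h1] using this

end ReducingTriangulation

/-! ### The choice of the step to be made -/

namespace ReducingTriangulation

variable {D : Type*} {T : ReducingTriangulation D}

theorem wp_block_nil' (φ : State D → Prop) : T.wp (block []) φ = φ := rfl

/-- The part of `Pass` that concerns the strips on one side. -/
theorem pass_of_side {t ε : ℤ} {K : List (Option D × ℤ)} (hε : ε = 1 ∨ ε = -1)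
    (ht : t ≠ 6 ∧ t ≠ 0 ∧ t ≠ 1 ∧ t ≠ -1) (h2 : clsAt K 0 ≠ ε * -2) (h3 : clsAt K 0 ≠ ε * -3)
    (h : (t = ε * 3 → clsAt K 0 ≠ ε * 3) ∧
      (t ≠ ε * 3 → clsAt K (skipRun ε K 0) = ε * 2 →
        (t = ε * 2 → clsAt K (skipRun ε K 0 + 1) = 8) ∧
        (t ≠ ε * 2 → (∃ e, (K[skipRun ε K 0]?).map Prod.fst = some (some e) ∧ T.red e = true) →
          clsAt K (skipRun ε K (skipRun ε K 0 + 1)) ∈ ({6, 0, 1, -1, ε * 2, ε * 3} : Set ℤ)))) :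
    T.Pass t K := by
  refine ⟨ht, fun ε' hε' => ?_⟩
  by_cases he : ε' = ε
  · rwa [he]
  · obtain rfl : ε' = -ε := by omega
    have h2' : clsAt K 0 ≠ -ε * 2 := by omega
    have h3' : clsAt K 0 ≠ -ε * 3 := by omega
    have h0 : skipRun (-ε) K 0 = 0 := by rw [skipRun, if_neg h3']
    rw [h0]
    exact ⟨fun _ => h3', fun _ h => absurd h h2'⟩

theorem clsAt_keys (L : List (Cell D)) (i : ℕ) :
    clsAt (keys L) i = (L[i]?.getD noCell).2.1 := by
  rw [clsAt, keys, List.getElem?_map]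
  cases L[i]? <;> rfl

theorem reverse_runCells (e : D) (t : ℤ) (k : ℕ) : (runCells e t k).reverse = runCells e t k := by
  rw [runCells]
  split_ifs <;> rfl

/-- The first cells of a list, when they are turns `3 * ε`. -/
theorem exists_runCells {ε : ℤ} (hε : ε = 1 ∨ ε = -1) (d : D) {L : List (Cell D)}
    (hL : ∀ c ∈ L, ∃ x, T.CellOk c x) : ∃ e k, L = runCells e (ε * 3) k ++
      L.drop (skipRun ε (keys L) 0) ∧ (clsAt (keys L) 0 = ε * 3 ↔ k ≠ 0) := by
  cases L with
  | nil => exact ⟨d, 0, by simp [runCells], by simp; omega⟩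
  | cons c L =>
    obtain ⟨o, t, n⟩ := c
    by_cases ht : t = ε * 3
    · obtain ⟨x, hx⟩ := hL (o, t, n) (by simp)
      obtain ⟨e, k, rfl, rfl, -⟩ := hx.of_small (by omega)
      exact ⟨e, k + 1, by simp [runCells, skipRun, ht], by simp [ht]⟩
    · exact ⟨d, 0, by simp [runCells, skipRun, ht], by simp [ht]⟩

theorem Linked.exists_cellOk {Q : List (Cell D)} {x : Option D} (h : T.Linked Q x) :
    ∀ c ∈ Q, ∃ x, T.CellOk c x := by
  induction Q with
  | nil => simp
  | cons c Q ih =>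
    rintro a (_ | ⟨_, ha⟩)
    · exact ⟨_, h.1⟩
    · exact ih h.2 a ha

/-- The program that looks for a bracket or a flip, once the cells are in the registers. -/
def chooseProg (ε : ℤ) : Prog :=
  .ite (.cls 4) (.const (ε * 2))
    (.ite (.cls 1) (.const (ε * 2))
      (.ite (.cls 11) (.const 8) rotateProg (bracketProg ε))
      (block [.red 13 4, .ite (.cls 13) (.const 1)
        (.ite (.cls 11) (.const (ε * 3))
          (memTest 12 rotateProg (flipProg ε) [6, 0, 1, -1, ε * 2, ε * 3])
          (memTest 11 rotateProg (flipProg ε) [6, 0, 1, -1, ε * 2, ε * 3]))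
        rotateProg])) rotateProg

/-- The tests follow the clauses of `Pass`. A branch either establishes `Pass`, and the cell goes to
the back of the queue, or exhibits the cells of a bracket or of a flip. -/
theorem wp_choose {lin : Bool} {l : List D} {o : Option D} {t n ε : ℤ} {u : ℕ} {s : State D}
    (hε : ε = 1 ∨ ε = -1) (h : T.Good lin l ((o, t, n) :: s.q) (u + 1))
    (hu : (s.r 0).2.1 = ((u + 1 : ℕ) : ℤ)) (h1 : s.r 1 = (o, t, n))
    (ht : t ≠ 6 ∧ t ≠ 0 ∧ t ≠ 1 ∧ t ≠ -1) (ht3 : t ≠ ε * 3)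
    (h2 : (s.r 2).2.1 = clsAt (keys s.q.reverse) 0)
    (h20 : clsAt (keys s.q.reverse) 0 = ε * 2 ∨ clsAt (keys s.q.reverse) 0 = ε * 3)
    (h4 : s.r 4 = s.q.reverse[skipRun ε (keys s.q.reverse) 0]?.getD noCell)
    (h11 : s.r 11 = s.q.reverse[skipRun ε (keys s.q.reverse) 0 + 1]?.getD noCell)
    (h12 : s.r 12 = s.q.reverse[skipRun ε (keys s.q.reverse) 0 + 2]?.getD noCell) :
    T.wp (chooseProg ε) (T.Post lin l ((o, t, n) :: s.q) (u + 1)) s := by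
  have hok : ∀ c ∈ s.q.reverse, ∃ x, T.CellOk c x := fun c hc =>
    h.ok.exists_cellOk c (by simp at hc; simp [hc])
  set L := s.q.reverse with hL
  set j := skipRun ε (keys L) 0 with hj
  have hside := pass_of_side (T := T) (t := t) hε ht (K := keys L) (by omega) (by omega)
  rw [← hj] at hside
  have c4 : (s.r 4).2.1 = clsAt (keys L) j := by rw [h4, clsAt_keys]
  have c11 : (s.r 11).2.1 = clsAt (keys L) (j + 1) := by rw [h11, clsAt_keys]
  have c12 : (s.r 12).2.1 = clsAt (keys L) (j + 2) := by rw [h12, clsAt_keys]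
  rw [chooseProg]
  by_cases h42 : (s.r 4).2.1 = ε * 2
  swap
  · rw [wp_ite_neg (by simpa [Expr.eval] using h42)]
    exact wp_rotate h hu h1 (hside ⟨fun h => absurd h ht3, fun _ h => absurd (c4.trans h) h42⟩)
  rw [wp_ite_pos (by simpa [Expr.eval] using h42)]
  obtain ⟨c, hc⟩ : ∃ c, L[j]? = some c := by
    cases hc : L[j]? with
    | none => rw [h4, hc] at h42; simp [noCell] at h42; omega
    | some c => exact ⟨c, rfl⟩
  rw [hc, Option.getD_some] at h4
  obtain ⟨x, hx⟩ := hok c (List.mem_of_getElem? hc)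
  rw [h4] at h42
  obtain ⟨d, hd⟩ := hx.exists_eq_some (by omega)
  obtain ⟨o₂, t₂, n₂⟩ := c
  simp only at h42 hd
  subst h42; subst hd
  obtain ⟨e₄, m, hL4, hm⟩ := exists_runCells hε d hok
  rw [← hj, List.drop_eq_getElem?_toList_append, hc] at hL4
  have hok' : ∀ c ∈ L.drop (j + 1), ∃ x, T.CellOk c x := fun c hc => hok c (List.mem_of_mem_drop hc)
  obtain ⟨e₃, k, hL3, hk⟩ := exists_runCells hε d hok'
  have hdrop : ∀ i, clsAt (keys (L.drop (j + 1))) i = clsAt (keys L) (j + 1 + i) := fun i => by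
    rw [clsAt_keys, clsAt_keys, List.getElem?_drop]
  have hq : s.q = (L.drop (j + 1)).reverse ++ (some d, ε * 2, n₂) :: runCells e₄ (ε * 3) m := by
    refine (by rw [hL, List.reverse_reverse] : s.q = L.reverse).trans
      ((congrArg List.reverse hL4).trans ?_)
    simp [reverse_runCells]
  by_cases ht2 : t = ε * 2
  · rw [wp_ite_pos (by simpa [Expr.eval, h1] using ht2)]
    by_cases h8 : (s.r 11).2.1 = 8
    · rw [wp_ite_pos (by simpa [Expr.eval] using h8)]
      exact wp_rotate h hu h1 (hside ⟨fun h => absurd h ht3, fun _ _ =>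
        ⟨fun _ => c11.symm.trans h8, fun h => absurd ht2 h⟩⟩)
    · rw [wp_ite_neg (by simpa [Expr.eval] using h8)]
      obtain ⟨y, M, hyM⟩ : ∃ y M, (L.drop (j + 1)).reverse = y :: M := by
        refine List.exists_cons_of_ne_nil fun h0 => h8 ?_
        rw [List.reverse_eq_nil_iff, List.drop_eq_nil_iff] at h0
        rw [h11, List.getElem?_eq_none h0]
        rfl
      subst ht2
      rw [hyM, List.cons_append] at hq
      exact wp_bracket hε hq h hu (by rw [h2, hm])
  · rw [wp_ite_neg (by simpa [Expr.eval, h1] using ht2), wp_block_cons]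
    refine ⟨d, by rw [h4], ?_⟩
    rw [wp_block_cons]
    by_cases hr : T.red d = true
    swap
    · rw [wp_ite_neg (by simp [Expr.eval, hr])]
      refine wp_rotate (by exact h) (by simpa using hu) (by simpa using h1)
        (hside ⟨fun h => absurd h ht3, fun _ _ =>
        ⟨fun h => absurd h ht2, ?_⟩⟩)
      rintro - ⟨e, he, hr'⟩
      rw [keys, List.getElem?_map, hc] at he
      simp at he
      rw [he] at hr
      exact absurd hr' hr
    rw [wp_ite_pos (by simp [Expr.eval, hr])]
    set s' := s.upd 13 ((s.r 13).1, if T.red d = true then 1 else 0, (s.r 13).2.2) with hs'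
    have key : ∀ i, i = 11 ∨ i = 12 → (s.r i).2.1 = clsAt (keys L) (skipRun ε (keys L) (j + 1)) →
        T.wp (memTest i rotateProg (flipProg ε) [6, 0, 1, -1, ε * 2, ε * 3])
          (T.Post lin l ((o, t, n) :: s.q) (u + 1)) s' := by
      intro i hi hcls
      have hi' : (s'.r i).2.1 = clsAt (keys L) (skipRun ε (keys L) (j + 1)) := by
        rw [← hcls, hs', State.upd_r, if_neg (by omega)]
      rw [wp_memTest, hi']
      split_ifs with hmem
      · refine wp_rotate (by exact h) (by simpa [hs'] using hu) (by simpa [hs'] using h1)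
          (hside ⟨fun h => absurd h ht3, fun _ _ =>
          ⟨fun h => absurd h ht2, fun _ _ => by simpa using hmem⟩⟩)
      · refine wp_flip (T := T) (e₃ := e₃) (e₄ := e₄) (k := k) (m := m) (n₂ := n₂)
          (M := ((L.drop (j + 1)).drop (skipRun ε (keys (L.drop (j + 1))) 0)).reverse) hε ?_ (by exact h)
          (by simpa [hs'] using hu) (by simpa [hs'] using h1) ?_ ?_ ?_ ⟨d, rfl, hr⟩ ?_
        · rw [hs', State.upd_q, hq]
          nth_rw 1 [hL3]
          rw [List.reverse_append, reverse_runCells, List.append_assoc]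
        · simp [hs', h2, hm]
        · rw [← hk, hdrop, add_zero, ← c11]
          simp [hs']
        · simp; omega
        · intro R c' hR
          rw [List.reverse_eq_iff, List.reverse_append] at hR
          have h0 : (L.drop (j + 1))[skipRun ε (keys (L.drop (j + 1))) 0]? = some c' := by
            have := congrArg (fun X : List (Cell D) => X[0]?) hR
            simpa using this
          have hs : skipRun ε (keys L) (j + 1) =
              j + 1 + skipRun ε (keys (L.drop (j + 1))) 0 := by
            simp only [skipRun, hdrop, add_zero]
            split_ifs <;> rfl
          rw [hs, ← hdrop, clsAt_keys, h0] at hmem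
          simpa using hmem
    by_cases h113 : (s.r 11).2.1 = ε * 3
    · rw [wp_ite_pos (by simpa [Expr.eval, hs'] using h113)]
      exact key 12 (by simp) (by rw [skipRun, if_pos (c11 ▸ h113), c12])
    · rw [wp_ite_neg (by simpa [Expr.eval, hs'] using h113)]
      exact key 11 (by simp) (by rw [skipRun, if_neg (c11 ▸ h113), c11])

/-- The program that deals with the strips on one side. -/
def stripProg (ε : ℤ) : Prog :=
  .ite (.cls 1) (.const (ε * 3)) (.ite (.cls 2) (.const (ε * 3)) mergeProg rotateProg)
    (block [.ite (.cls 2) (.const (ε * 3)) (.set 13 (.const 1) (.const 0))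
      (.set 13 (.const 0) (.const 0)), .peekB 4 (.cls 13), .peekB 11 (.add (.cls 13) (.const 1)),
      .peekB 12 (.add (.cls 13) (.const 2)), chooseProg ε])

theorem wp_strip {lin : Bool} {l : List D} {o : Option D} {t n ε : ℤ} {u : ℕ} {s : State D}
    (hε : ε = 1 ∨ ε = -1) (h : T.Good lin l ((o, t, n) :: s.q) (u + 1))
    (hu : (s.r 0).2.1 = ((u + 1 : ℕ) : ℤ)) (h1 : s.r 1 = (o, t, n))
    (ht : t ≠ 6 ∧ t ≠ 0 ∧ t ≠ 1 ∧ t ≠ -1) (h2 : s.r 2 = s.q.reverse[0]?.getD noCell)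
    (h20 : (s.r 2).2.1 = ε * 2 ∨ (s.r 2).2.1 = ε * 3) :
    T.wp (stripProg ε) (T.Post lin l ((o, t, n) :: s.q) (u + 1)) s := by
  have c2 : (s.r 2).2.1 = clsAt (keys s.q.reverse) 0 := by rw [h2, clsAt_keys]
  rw [stripProg]
  by_cases ht3 : t = ε * 3
  · rw [wp_ite_pos (by simpa [Expr.eval, h1] using ht3)]
    by_cases h23 : (s.r 2).2.1 = ε * 3
    · rw [wp_ite_pos (by simpa [Expr.eval] using h23)]
      rcases List.eq_nil_or_concat' s.q with hq | ⟨M, ⟨o', t', m⟩, hq⟩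
      · rw [h2, hq] at h23
        simp [noCell] at h23
        omega
      · rw [h2, hq] at h23
        simp only [List.reverse_append, List.reverse_singleton, List.singleton_append,
          List.getElem?_cons_zero, Option.getD_some] at h23
        obtain rfl : t' = t := h23.trans ht3.symm
        exact wp_merge (by omega) hq h hu h1
    · rw [wp_ite_neg (by simpa [Expr.eval] using h23)]
      exact wp_rotate h hu h1 (pass_of_side hε ht (by omega) (by omega)
        ⟨fun _ h => h23 (c2.trans h), fun h => absurd ht3 h⟩)
  · rw [wp_ite_neg (by simpa [Expr.eval, h1] using ht3)]
    have key : ∀ j : ℕ, j = skipRun ε (keys s.q.reverse) 0 →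
        T.wp (block [.peekB 4 (.cls 13), .peekB 11 (.add (.cls 13) (.const 1)),
          .peekB 12 (.add (.cls 13) (.const 2)), chooseProg ε])
          (T.Post lin l ((o, t, n) :: s.q) (u + 1)) (s.upd 13 ((s.r 13).1, j, 0)) := by
      intro j hj
      simp only [wp_block_cons, wp, Expr.eval]
      refine ⟨by simp, by simp; omega, by simp; omega, ?_⟩
      refine wp_choose hε (by exact h) (by simpa using hu) (by simpa using h1) ht ht3
        (by simpa using c2) (by simp only [State.upd_q]; omega) ?_ ?_ ?_ <;>
      · simp only [State.upd_q, ← hj]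
        simp
        try norm_cast
    rw [wp_block_cons]
    by_cases h23 : (s.r 2).2.1 = ε * 3
    · rw [wp_ite_pos (by simpa [Expr.eval] using h23)]
      exact key 1 (by rw [skipRun, if_pos (c2 ▸ h23)])
    · rw [wp_ite_neg (by simpa [Expr.eval] using h23)]
      exact key 0 (by rw [skipRun, if_neg (c2 ▸ h23)])

/-- The program of a step of the reduction. -/
def stepProg : Prog :=
  block [.peekF 1, .ite (.cls 1) (.const 8) (incr (-1)) (block [.popF 1,
    .ite (.cls 1) (.const 6) evalProg (.ite (.cls 1) (.const 0) spurProg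
    (.ite (.cls 1) (.const 1) (spikeProg 1) (.ite (.cls 1) (.const (-1)) (spikeProg (-1))
    (block [.peekB 2 (.const 0), memTest 2 (stripProg 1)
      (memTest 2 (stripProg (-1)) rotateProg [-2, -3]) [2, 3]]))))])]

/-- A strip that ends at the front cell comes from a `2` or a `3` of the appropriate sign in the
last cell of the queue. Its class thus selects at most one side, and `pass_of_side` settles the
other side. -/
theorem wp_step {lin : Bool} {l : List D} {u : ℕ} {s : State D}
    (h : T.Good lin l s.q (u + 1)) (hu : (s.r 0).2.1 = ((u + 1 : ℕ) : ℤ)) :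
    T.wp stepProg (T.Post lin l s.q (u + 1)) s := by
  rw [stepProg, wp_block_cons, wp, wp_block_cons]
  cases hq : s.q with
  | nil =>
    rw [wp_ite_pos (by simp [noCell, Expr.eval])]
    rw [hq] at h
    refine ⟨u, by simp [hu, Expr.eval], ?_⟩
    simpa [hq] using h.empty
  | cons c M =>
    rw [hq] at h
    have hb := Linked.bounds h.ok c (by simp)
    rw [wp_ite_neg (by simp [Expr.eval]; omega), wp_block_cons]
    refine ⟨c, M, by simpa using hq, ?_⟩
    set s' : State D := { (s.upd 1 c).upd 1 c with q := M } with hs'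
    have hss : ({ (s.upd 1 ((c :: M).head?.getD noCell)).upd 1 c with q := M } : State D) = s' := rfl
    rw [hss]
    obtain ⟨o, t, n⟩ := c
    have h1 : s'.r 1 = (o, t, n) := by simp [hs']
    have hu' : (s'.r 0).2.1 = ((u + 1 : ℕ) : ℤ) := by simpa [hs'] using hu
    have h' : T.Good lin l ((o, t, n) :: s'.q) (u + 1) := h
    change T.wp _ (T.Post lin l ((o, t, n) :: s'.q) (u + 1)) s'
    clear_value s'
    clear hss hb
    rw [wp_block_cons, wp_block_nil']
    by_cases h6 : t = 6
    · subst h6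
      rw [wp_ite_pos (by simp [Expr.eval, h1])]
      exact wp_eval h' hu' h1
    rw [wp_ite_neg (by simpa [Expr.eval, h1] using h6)]
    by_cases h0 : t = 0
    · subst h0
      rw [wp_ite_pos (by simp [Expr.eval, h1])]
      exact wp_spur h' hu' h1
    rw [wp_ite_neg (by simpa [Expr.eval, h1] using h0)]
    by_cases hp : t = 1
    · subst hp
      rw [wp_ite_pos (by simp [Expr.eval, h1])]
      exact wp_spike (.inl rfl) h' hu' h1
    rw [wp_ite_neg (by simpa [Expr.eval, h1] using hp)]
    by_cases hm : t = -1
    · subst hm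
      rw [wp_ite_pos (by simp [Expr.eval, h1])]
      exact wp_spike (.inr rfl) h' hu' h1
    rw [wp_ite_neg (by simpa [Expr.eval, h1] using hm), wp_block_cons]
    refine ⟨by simp [Expr.eval], ?_⟩
    rw [wp_block_cons, wp_block_nil', wp_memTest, wp_memTest]
    have h2 : ∀ P : ℤ → Prop, P (clsAt (keys s'.q.reverse) 0) ↔
        P (s'.q.reverse[0]?.getD noCell).2.1 := fun P => by rw [clsAt_keys]
    set s'' := s'.upd 2 (s'.q.reverse[((Expr.const 0).eval s').toNat]?.getD noCell) with hs''
    have hr2 : s''.r 2 = s''.q.reverse[0]?.getD noCell := by simp [hs'', Expr.eval]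
    have h1' : s''.r 1 = (o, t, n) := by simpa [hs''] using h1
    have hu'' : (s''.r 0).2.1 = ((u + 1 : ℕ) : ℤ) := by simpa [hs''] using hu'
    change T.Good lin l ((o, t, n) :: s''.q) (u + 1) at h'
    change (if _ then T.wp _ (T.Post lin l ((o, t, n) :: s''.q) (u + 1)) s'' else
      if _ then T.wp _ (T.Post lin l ((o, t, n) :: s''.q) (u + 1)) s'' else
        T.wp _ (T.Post lin l ((o, t, n) :: s''.q) (u + 1)) s'')
    clear_value s''
    split_ifs with h3 h4
    · exact wp_strip (.inl rfl) h' hu'' h1' ⟨h6, h0, hp, hm⟩ hr2 (by simpa using h3)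
    · exact wp_strip (.inr rfl) h' hu'' h1' ⟨h6, h0, hp, hm⟩ hr2 (by simpa using h4)
    · have hc : (s''.r 2).2.1 = clsAt (keys s''.q.reverse) 0 := by rw [hr2, clsAt_keys]
      simp only [List.mem_cons, List.not_mem_nil, or_false, not_or, hc] at h3 h4
      refine wp_rotate h' hu'' h1' (pass_of_side (ε := 1) (.inl rfl) ⟨h6, h0, hp, hm⟩ ?_ ?_ ?_)
      · simpa using h4.1
      · simpa using h4.2
      · refine ⟨fun _ => by simpa using h3.2, fun _ h => ?_⟩
        rw [skipRun, if_neg (by simpa using h3.2)] at h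
        exact absurd h (by simpa using h3.1)

end ReducingTriangulation

/-! ### Time bounds for sequences and loops -/

namespace RAM

/-- The program halts after at most `t` steps with a memory that satisfies `Q`. -/
def Halts (p : Program) (m : Memory) (t : ℕ) (Q : Memory → Prop) : Prop :=
  ∃ m' t', Run p m m' t' ∧ t' ≤ t ∧ Q m'

theorem Halts.seq {p q : Program} {m : Memory} {t t' : ℕ} {Q R : Memory → Prop}
    (h : Halts p m t Q) (h' : ∀ m', Q m' → Halts q m' t' R) :
    Halts (.seq p q) m (t + t' + 1) R := by
  obtain ⟨m₁, t₁, h1, h2, h3⟩ := h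
  obtain ⟨m₂, t₂, h4, h5, h6⟩ := h' m₁ h3
  exact ⟨m₂, _, .seq h1 h4, by omega, h6⟩

theorem Halts.mono {p : Program} {m : Memory} {t t' : ℕ} {Q R : Memory → Prop}
    (h : Halts p m t Q) (ht : t ≤ t') (hQ : ∀ m', Q m' → R m') : Halts p m t' R := by
  obtain ⟨m₁, t₁, h1, h2, h3⟩ := h
  exact ⟨m₁, t₁, h1, h2.trans ht, hQ _ h3⟩

theorem halts_exec {p : Program} (hp : LoopFree p) {m : Memory} {Q : Memory → Prop}
    (h : Q (exec p m)) : Halts p m (bound p) Q := by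
  obtain ⟨t, ht, h1⟩ := run_exec p hp m
  exact ⟨_, t, h1, ht, h⟩

theorem halts_while {b : Term} {p : Program} {c : ℕ} (Inv : Memory → ℕ → Prop)
    (h : ∀ m k, Inv m k → b.eval m ≠ 0 → Halts p m c fun m' => ∃ k' < k, Inv m' k')
    {m : Memory} {k K : ℕ} (hm : Inv m k) (hk : k ≤ K) :
    Halts (.while b p) m ((b.cost + c + 1) * (K + 1)) fun m' => b.eval m' = 0 ∧ ∃ k', Inv m' k' := by
  obtain ⟨m', t, k', h1, h2, h3, h4⟩ := run_while (b := b) (p := p) (c := c) Inv (fun m k hm hb => by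
    obtain ⟨m', t, h1, h2, k', h3, h4⟩ := h m k hm hb
    exact ⟨m', t, k', h1, h2, h4, h3⟩) k m hm
  exact ⟨m', t, h1, h2.trans (Nat.mul_le_mul_left _ (by omega)), h4, k', h3⟩

end RAM

namespace ReducingTriangulation

variable {D : Type*} {T : ReducingTriangulation D}

theorem halts_compile {dn : D → ℤ} {vn : T.Vertex → ℤ} (p : Prog) {m : RAM.Memory}
    (hT : T.StoredIn dn vn m) {s : State D} (h : Rel dn s m) {φ : State D → Prop}
    (hw : T.wp p φ s) : RAM.Halts (compile p) m (RAM.bound (compile p))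
      fun m' => ∃ s', Rel dn s' m' ∧ φ s' ∧ Frame m m' :=
  RAM.halts_exec (loopFree_compile p) (sim p hT h hw)

theorem Rel.congr {dn : D → ℤ} {s : State D} {m m' : RAM.Memory} (h : Rel dn s m)
    (h2 : m'.reg 2 = m.reg 2) (h3 : m'.reg 3 = m.reg 3) (hr : ∀ k, 10 ≤ k → m'.reg k = m.reg k)
    (ha : ∀ a, 10 ≤ a → m'.arr a = m.arr a) : Rel dn s m' := by
  refine ⟨fun i => ?_, by rw [h2, h3]; exact h.size, fun j c hj => ?_⟩
  · have : 10 ≤ addr i := by simp [addr]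
    rw [hr _ this, hr _ (by omega), hr _ (by omega)]
    exact h.reg i
  · rw [ha 10 le_rfl, ha 11 (by norm_num), ha 12 (by norm_num), h2]
    exact h.cell j c hj

/-! ### The input -/

/-- The cell of a vertex whose turn has not been computed. -/
def unknownCell (d : D) : Cell D := (some d, 6, 1)

/-- Put a dart of the input on the queue. -/
def pushInput : Prog := block [.set 1 (.const 6) (.const 1), .pushB 1, incr 1]

open RAM in
/-- Initialize the registers. -/
def initCode : Program :=
  .seq (.assign 2 (.const 0)) (.seq (.assign 3 (.const 0)) (.seq (.assign 4 (.const 0))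
    (.seq (.assign 5 (.const 0)) (.assign 11 (.const 0)))))

open RAM in
/-- Read a dart of the input. -/
def readCode : Program :=
  .seq (.assign (addr 1) (.read 7 (.reg 5)))
    (.seq (compile pushInput) (.assign 5 (.add (.reg 5) (.const 1))))

open RAM in
/-- Put the input on the queue. -/
def inputCode : Program := .seq initCode (.while (.lt (.reg 5) (.reg 0)) readCode)

/-- The memory when `i` darts of the input have been read, and `k` darts have not. -/
def Reading (dn : D → ℤ) (m : RAM.Memory) (l : List D) (m' : RAM.Memory) (k : ℕ) : Prop :=
  ∃ (s : State D) (i : ℕ), i + k = l.length ∧ Rel dn s m' ∧ s.q = (l.take i).map unknownCell ∧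
    (s.r 0).2.1 = i ∧ (∀ a < 10, m'.arr a = m.arr a) ∧ m'.reg 4 = 0 ∧ m'.reg 1 = m.reg 1 ∧
    m'.reg 0 = l.length ∧ m'.reg 5 = i

theorem Reading.next {dn : D → ℤ} {vn : T.Vertex → ℤ} {m : RAM.Memory} {l : List D}
    (hT : T.StoredIn dn vn m) (h7 : ∀ (i : ℕ) (h : i < l.length), m.arr 7 (i : ℤ) = dn l[i]) :
    ∀ m' k, Reading dn m l m' k → (RAM.Term.lt (.reg 5) (.reg 0)).eval m' ≠ 0 →
      RAM.Halts readCode m' (RAM.bound readCode) fun m'' => ∃ k' < k, Reading dn m l m'' k' := by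
  rintro m' k ⟨s, i, hik, hR, hq, hu, ha, hr4, hr1, hr0, hr5⟩ hb
  have hi : i < l.length := by
    simp only [RAM.Term.eval, hr5, hr0] at hb
    split_ifs at hb with hlt
    · exact_mod_cast hlt
    · exact absurd rfl hb
  set m₂ := m'.setReg (addr 1) (m'.arr 7 (m'.reg 5)) with hm₂
  have hr : ∀ x ≠ 13, m₂.reg x = m'.reg x := fun x hx => by
    simp [hm₂, RAM.Memory.setReg, addr, hx]
  have hR₂ : Rel dn (s.upd 1 (some l[i], (s.r 1).2)) m₂ := by
    refine hR.upd 1 rfl (hr 2 (by norm_num)) (hr 3 (by norm_num))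
      (fun x _ hx _ _ => hr x hx) ⟨fun d hd => ?_, ?_, ?_⟩
    · obtain rfl : l[i] = d := by simpa using hd
      simp [hm₂, RAM.Memory.setReg, hr5, ha 7, h7 i hi]
    · rw [hr _ (by simp [addr])]; exact (hR.reg 1).2.1
    · rw [hr _ (by simp [addr])]; exact (hR.reg 1).2.2
  have htake : l.take (i + 1) = l.take i ++ [l[i]] := (List.take_concat_get' l i hi).symm
  obtain ⟨s', hR', ⟨hq', hu'⟩, hF⟩ := sim (T := T) pushInput (hT.congr ha : T.StoredIn dn vn m₂)
    hR₂ (φ := fun s' => s'.q = (l.take (i + 1)).map unknownCell ∧ (s'.r 0).2.1 = (i + 1 : ℕ))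
    (by
      simp only [pushInput, wp_block_cons, wp_block_nil, wp, Expr.eval, incr, htake, List.map_append]
      simp [hq, hu, unknownCell])
  set m₃ := RAM.exec (compile pushInput) m₂ with hm₃
  refine RAM.halts_exec (by simp [readCode, RAM.LoopFree, loopFree_compile]) ?_
  have he : RAM.exec readCode m' = m₃.setReg 5 (m₃.reg 5 + 1) := rfl
  have hr' : ∀ x ≠ 5, (m₃.setReg 5 (m₃.reg 5 + 1)).reg x = m₃.reg x := fun x hx => by
    simp [RAM.Memory.setReg, hx]
  rw [he]
  have hF' := hF.2
  refine ⟨k - 1, by omega, s', i + 1, by omega, ?_, hq', hu', fun a h => (hF.1 a h).trans (ha a h),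
    ?_, ?_, ?_, ?_⟩
  · exact hR'.congr (hr' _ (by norm_num)) (hr' _ (by norm_num)) (fun x hx => hr' _ (by omega))
      fun a _ => rfl
  · rw [hr' _ (by norm_num), hF' 4 (by simp), hr _ (by norm_num), hr4]
  · rw [hr' _ (by norm_num), hF' 1 (by simp), hr _ (by norm_num), hr1]
  · rw [hr' _ (by norm_num), hF' 0 (by simp), hr _ (by norm_num), hr0]
  · simp only [RAM.Memory.setReg, Function.update_self]
    rw [hF' 5 (by simp), hr _ (by norm_num), hr5]
    push_cast; rfl

theorem halts_input {dn : D → ℤ} {vn : T.Vertex → ℤ} {m : RAM.Memory} {l : List D}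
    (hT : T.StoredIn dn vn m) (h0 : m.reg 0 = l.length)
    (h7 : ∀ (i : ℕ) (h : i < l.length), m.arr 7 (i : ℤ) = dn l[i]) :
    RAM.Halts inputCode m (RAM.bound initCode + (3 + RAM.bound readCode + 1) * (l.length + 1) + 1)
      fun m' => ∃ s : State D, Rel dn s m' ∧ s.q = l.map unknownCell ∧
        (s.r 0).2.1 = l.length ∧ (∀ a < 10, m'.arr a = m.arr a) ∧ m'.reg 4 = 0 ∧
        m'.reg 1 = m.reg 1 := by
  refine (RAM.halts_exec (p := initCode) (Q := fun m' => m'.arr = m.arr ∧ m'.reg 0 = m.reg 0 ∧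
    m'.reg 1 = m.reg 1 ∧ m'.reg 2 = 0 ∧ m'.reg 3 = 0 ∧ m'.reg 4 = 0 ∧ m'.reg 5 = 0 ∧
    m'.reg 11 = 0) (by simp [RAM.LoopFree, initCode])
    (by simp [initCode, RAM.exec, RAM.Memory.setReg, RAM.Term.eval])).seq fun m₁ hm₁ => ?_
  obtain ⟨ha, hr0, hr1, hr2, hr3, hr4, hr5, hr11⟩ := hm₁
  refine (RAM.halts_while (Reading dn m l) (Reading.next hT h7) (k := l.length)
    ?_ le_rfl).mono le_rfl ?_
  -- The registers may contain anything at the start, so the initial state copies their integers and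
  -- has no dart. Machine register `11`, the integer of register `0`, is the counter and has been
  -- set to `0`.
  · refine ⟨⟨fun i => (none, m₁.reg (addr i + 1), m₁.reg (addr i + 2)), []⟩, 0, by simp,
      ⟨fun i => ⟨by simp, rfl, rfl⟩, by simp [hr2, hr3], by simp⟩, by simp,
      by simpa [addr] using hr11, fun a _ => by rw [ha], hr4, hr1, hr0.trans h0, by simpa using hr5⟩
  · rintro m' ⟨hb, k, s, i, hik, hR, hq, hu, ha, hr4, hr1, hr0, hr5⟩
    have hi : i = l.length := by
      simp only [RAM.Term.eval, hr5, hr0] at hb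
      split_ifs at hb with hlt
      norm_cast at hlt; omega
    subst hi
    exact ⟨s, hR, by simpa using hq, hu, ha, hr4, hr1⟩

/-! ### The reduction -/

/-- The cells for a walk or a closed walk. -/
def startCells (lin : Bool) (l : List D) : List (Cell D) :=
  if lin then (none, 7, 1) :: l.map unknownCell else l.map unknownCell

theorem linked_unknown (l : List D) (x : Option D) : T.Linked (l.map unknownCell) x := by
  induction l with
  | nil => trivial
  | cons d l ih => exact ⟨.unknown d _, ih⟩

theorem ringDarts_unknown (l : List D) : T.ringDarts (l.map unknownCell) = l.map some := by
  induction l with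
  | nil => rfl
  | cons d l ih => simp [unknownCell, ih]

/-- With the number of cells as the counter, no cell is claimed to have been tested. -/
theorem good_start {lin : Bool} {l : List D} (hl : T.IsRingWalk lin l) :
    T.Good lin l (startCells lin l) (startCells lin l).length := by
  refine ⟨?_, ?_, hl, fun A c B h hu => ?_⟩
  · cases lin
    · exact T.linked_unknown l _
    · exact ⟨.gap _, T.linked_unknown l _⟩
  · cases lin <;> simp [startCells, ringList, ringDarts_unknown, List.IsRotated.refl]
  · have := congrArg List.length h
    simp at this
    omega

theorem length_le_weight (Q : List (Cell D)) : Q.length ≤ weight Q := by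
  induction Q with
  | nil => simp
  | cons c Q ih => simp only [weight_cons, List.length_cons]; split_ifs <;> omega

/-- For length `n` the bounds on rank and weight give `17 * (32 * (4 * n + 1) + 3 * (n + 1)) + (n +
1)`, which is `2228 * n + 596`. -/
theorem measure_start_le {lin : Bool} {l : List D} (hl : T.IsRingWalk lin l) :
    T.measure lin l (startCells lin l) (startCells lin l).length ≤ 2228 * (l.length + 1) := by
  have h1 := T.rank_le hl
  have h2 := weight_le (startCells lin l)
  have h3 : (startCells lin l).length ≤ l.length + 1 := by cases lin <;> simp [startCells]
  simp only [measure]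
  omega

/-- Put the gap of a walk on the queue. -/
def gapProg (lin : Bool) : Prog :=
  if lin then block [.clear 1, .set 1 (.const 7) (.const 1), .pushF 1, incr 1] else .skip

open RAM in
/-- Reduce the walk in the queue. -/
def mainCode : Program := .while (.lt (.const 0) (.reg 11)) (compile stepProg)

/-- The memory during the reduction. -/
def Reducing (T : ReducingTriangulation D) (lin : Bool) (dn : D → ℤ) (m : RAM.Memory) (l : List D)
    (m' : RAM.Memory) (k : ℕ) : Prop :=
  ∃ (s : State D) (l' : List D) (u : ℕ), T.measure lin l' s.q u = k ∧ Rel dn s m' ∧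
    T.Good lin l' s.q u ∧ (s.r 0).2.1 = u ∧ Relation.ReflTransGen (T.RingMove lin) l l' ∧
    (∀ a < 10, m'.arr a = m.arr a) ∧ m'.reg 4 = 0 ∧ m'.reg 1 = m.reg 1

theorem Reducing.next {lin : Bool} {dn : D → ℤ} {vn : T.Vertex → ℤ} {m : RAM.Memory} {l : List D}
    (hT : T.StoredIn dn vn m) : ∀ m' k, T.Reducing lin dn m l m' k →
      (RAM.Term.lt (.const 0) (.reg 11)).eval m' ≠ 0 →
      RAM.Halts (compile stepProg) m' (RAM.bound (compile stepProg))
        fun m'' => ∃ k' < k, T.Reducing lin dn m l m'' k' := by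
  rintro m' k ⟨s, l', u, rfl, hR, hg, hu, hl, ha, hr4, hr1⟩ hb
  have h11 : m'.reg 11 = u := by simpa [addr, hu] using (hR.reg 0).2.1
  obtain ⟨u, rfl⟩ : ∃ u', u = u' + 1 := by
    refine Nat.exists_eq_succ_of_ne_zero fun h0 => hb ?_
    simp [RAM.Term.eval, h11, h0]
  refine (halts_compile stepProg (hT.congr ha) hR (wp_step hg hu)).mono le_rfl ?_
  rintro m'' ⟨s', hR', ⟨u', hu', l'', hg', hl'', hm⟩, hF⟩
  refine ⟨_, hm, s', l'', u', rfl, hR', hg', hu', ?_, fun a h => (hF.1 a h).trans (ha a h),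
    (hF.2 4 (by simp)).trans hr4, (hF.2 1 (by simp)).trans hr1⟩
  rcases hl'' with rfl | hl''
  · exact hl
  · exact hl.tail hl''

/-- The program of the reduction, without the output. -/
def reduceCode (lin : Bool) : RAM.Program :=
  .seq (.seq inputCode (compile (gapProg lin))) mainCode

theorem exists_halts_reduce (lin : Bool) : ∃ c : ℕ, ∀ {D : Type u} {T : ReducingTriangulation D}
    {dn : D → ℤ} {vn : T.Vertex → ℤ} {m : RAM.Memory} {l : List D}, T.StoredIn dn vn m →
    T.IsRingWalk lin l → m.reg 0 = l.length →
    (∀ (i : ℕ) (h : i < l.length), m.arr 7 (i : ℤ) = dn l[i]) →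
    RAM.Halts (reduceCode lin) m (c * (l.length + 1)) fun m' => ∃ (s : State D) (l' : List D),
      s.q.length ≤ 2228 * (l.length + 1) ∧ Rel dn s m' ∧ T.Good lin l' s.q 0 ∧
      Relation.ReflTransGen (T.RingMove lin) l l' ∧ (∀ a < 10, m'.arr a = m.arr a) ∧
      m'.reg 4 = 0 ∧ m'.reg 1 = m.reg 1 := by
  refine ⟨RAM.bound initCode + (3 + RAM.bound readCode + 1) + RAM.bound (compile (gapProg lin)) +
    (3 + RAM.bound (compile stepProg) + 1) * 2229 + 3, fun {D T dn vn m l} hT hl h0 h7 => ?_⟩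
  refine (((halts_input hT h0 h7).seq (t' := RAM.bound (compile (gapProg lin)))
    (R := fun m' => ∃ s : State D, Rel dn s m' ∧
    s.q = startCells lin l ∧ (s.r 0).2.1 = (startCells lin l).length ∧
    (∀ a < 10, m'.arr a = m.arr a) ∧ m'.reg 4 = 0 ∧ m'.reg 1 = m.reg 1) ?_).seq
    (t' := (3 + RAM.bound (compile stepProg) + 1) * (2228 * (l.length + 1) + 1)) ?_).mono ?_
    fun _ h => h
  · rintro m' ⟨s, hR, hq, hu, ha, hr4, hr1⟩
    refine (halts_compile (gapProg lin) (hT.congr ha) hR (φ := fun s' => s'.q = startCells lin l ∧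
      (s'.r 0).2.1 = (startCells lin l).length) ?_).mono le_rfl ?_
    · cases lin
      · simp [startCells, gapProg, wp, hq, hu]
      · simp [startCells, gapProg, wp, hq, hu, incr, Expr.eval]
    · rintro m'' ⟨s', hR', ⟨hq', hu'⟩, hF⟩
      exact ⟨s', hR', hq', hu', fun a h => (hF.1 a h).trans (ha a h),
        (hF.2 4 (by simp)).trans hr4, (hF.2 1 (by simp)).trans hr1⟩
  · rintro m' ⟨s, hR, hq, hu, ha, hr4, hr1⟩
    have hm := measure_start_le hl
    rw [← hq] at hm
    -- The bound on the measure is kept in the invariant, because at the end it also bounds the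
    -- number of cells in the queue.
    refine (RAM.halts_while
      (fun m' k => k ≤ 2228 * (l.length + 1) ∧ T.Reducing lin dn m l m' k) ?_
      ⟨hm, s, l, _, rfl, hR, hq ▸ good_start hl, by rw [hu, hq], .refl, ha, hr4, hr1⟩ hm).mono
      le_rfl ?_
    · rintro m₁ k ⟨hk, h⟩ hb
      refine (Reducing.next hT m₁ k h hb).mono le_rfl ?_
      rintro m₂ ⟨k', hk', h'⟩
      exact ⟨k', hk', by omega, h'⟩
    · rintro m₁ ⟨hb, k, hk, s', l', u, rfl, hR', hg, hu', hl', ha, hr4, hr1⟩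
      have h11 : m₁.reg 11 = u := by simpa [addr, hu'] using (hR'.reg 0).2.1
      obtain rfl : u = 0 := by
        simp only [RAM.Term.eval, h11] at hb
        split_ifs at hb with h <;> omega
      refine ⟨s', l', le_trans ?_ hk, hR', hg, hl', ha, hr4, hr1⟩
      have := length_le_weight s'.q
      simp only [measure]
      omega
  · generalize RAM.bound initCode = a
    generalize RAM.bound readCode = b
    generalize RAM.bound (compile (gapProg lin)) = c
    generalize RAM.bound (compile stepProg) = d
    nlinarith

end ReducingTriangulation

namespace ReducingTriangulation

variable {D : Type*} {T : ReducingTriangulation D}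

/-! ### The end of the reduction of walks -/

/-- Send the first cell to the end of the queue. -/
def turnProg : Prog := block [.popF 1, .pushB 1]

open RAM in
/-- Put the gap in front of the queue, and remove it. -/
def gapCode : Program :=
  .seq (.while (.eq (.eq (.read 11 (.reg 2)) (.const 7)) (.const 0)) (compile turnProg))
    (compile (.popF 1))

theorem CellOk.eq_gap {c : Cell D} {x : Option D} (h : T.CellOk c x) (h7 : c.2.1 = 7) :
    c = (none, 7, 1) := by
  cases h with
  | gap x => rfl
  | run e t k h hk => simp at h7; omega
  | _ => simp at h7

theorem exists_gap {Q : List (Cell D)} (hQ : ∀ c ∈ Q, ∃ x, T.CellOk c x)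
    (hn : none ∈ T.ringDarts Q) : ∃ A B, Q = A ++ (none, 7, 1) :: B := by
  obtain ⟨c, hc, hn⟩ := List.mem_flatMap.1 hn
  obtain ⟨x, hx⟩ := hQ c hc
  obtain rfl : c = (none, 7, 1) := by
    by_cases h7 : c.2.1 = 7
    · exact hx.eq_gap h7
    · obtain ⟨e, he⟩ := hx.exists_eq_some h7
      obtain ⟨o, t, n⟩ := c
      simp only at he
      subst he
      simp [cellDarts] at hn
  obtain ⟨A, B, h⟩ := List.append_of_mem hc
  exact ⟨A, B, h⟩

/-- The reduction leaves the gap at an unknown place of the queue. Rotating the queue brings it to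
the front, the number of cells before it decreasing at each round, and the remaining cells then list
the walk from its start. -/
theorem halts_gap {dn : D → ℤ} {vn : T.Vertex → ℤ} {m : RAM.Memory} (hT : T.StoredIn dn vn m)
    {s : State D} (hR : Rel dn s m) {l : List D} (hok : T.RingOk s.q)
    (hd : (T.ringDarts s.q).IsRotated (none :: l.map some)) :
    RAM.Halts gapCode m ((6 + RAM.bound (compile turnProg) + 1) * (s.q.length + 1) +
      RAM.bound (compile (.popF 1)) + 1) fun m' => ∃ s' : State D, Rel dn s' m' ∧ Frame m m' ∧
        T.Linked s'.q none ∧ T.ringDarts s'.q = l.map some := by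
  obtain ⟨A, B, hAB⟩ := T.exists_gap hok.exists_cellOk (hd.mem_iff.2 (by simp))
  refine (RAM.halts_while (c := RAM.bound (compile turnProg)) (K := s.q.length)
    (fun m' k => ∃ (s' : State D) (A B : List (Cell D)),
      A.length = k ∧ s'.q = A ++ (none, 7, 1) :: B ∧ Rel dn s' m' ∧ Frame m m' ∧ T.RingOk s'.q ∧
      (T.ringDarts s'.q).IsRotated (none :: l.map some)) ?_
    ⟨s, A, B, rfl, hAB, hR, .refl m, hok, hd⟩ (by simp [hAB])).seq ?_
  · rintro m' k ⟨s', A, B, rfl, hq, hR', hF, hok', hd'⟩ hb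
    cases A with
    | nil =>
      have := hR'.cell 0 (none, 7, 1) (by simp [hq])
      simp [CellAt] at this
      simp [RAM.Term.eval, this] at hb
    | cons c A =>
      refine (halts_compile turnProg (hT.congr hF.1) hR' (φ := fun s'' => s''.q =
        A ++ (none, 7, 1) :: (B ++ [c])) ?_).mono le_rfl ?_
      · exact ⟨c, A ++ (none, 7, 1) :: B, hq, by simp [wp]⟩
      · rintro m'' ⟨s'', hR'', hq'', hF'⟩
        have hq2 : s''.q = (A ++ (none, 7, 1) :: B) ++ [c] := by simp [hq'']
        refine ⟨_, by simp, s'', A, B ++ [c], rfl, hq'', hR'', hF.trans hF', ?_, ?_⟩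
        · rw [hq2]
          rw [hq] at hok'
          exact RingOk.comm (A := [c]) hok'
        · refine List.IsRotated.trans ?_ hd'
          rw [hq2, hq, ringDarts_append, List.cons_append, ringDarts_cons]
          simpa using isRotated_append_comm (T.ringDarts (A ++ (none, 7, 1) :: B)) (T.cellDarts c)
  · rintro m' ⟨hb, k, s', A, B, rfl, hq, hR', hF, hok', hd'⟩
    obtain ⟨Q, hQ⟩ : ∃ Q, s'.q = (none, 7, 1) :: Q := by
      cases hs : s'.q with
      | nil => simp [hq] at hs
      | cons c Q =>
        obtain ⟨x, hx⟩ := hok'.exists_cellOk c (by simp [hs])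
        refine ⟨Q, ?_⟩
        rw [hx.eq_gap]
        have := (hR'.cell 0 c (by simp [hs])).2.1
        simp only [Nat.cast_zero, add_zero] at this
        simp only [RAM.Term.eval, this] at hb
        split_ifs at hb <;> simp_all
    refine (halts_compile (.popF 1) (hT.congr hF.1) hR' (φ := fun s'' => s''.q = Q)
      ⟨_, Q, hQ, rfl⟩).mono le_rfl ?_
    rintro m'' ⟨s'', hR'', rfl, hF'⟩
    rw [hQ] at hok' hd'
    refine ⟨s'', hR'', hF.trans hF', by simpa using hok'.2, ?_⟩
    exact (eq_of_isRotated_none (by simp) (by simpa using hd'.symm)).symm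

/-! ### The end of the reduction of closed walks -/

/-- Replace the dart of a register by its shift. -/
def shiftProg (ε : ℤ) (i : ℕ) : Prog :=
  if ε = 1 then block (pushDart 1 i) else block [.rev i, block (pushDart 1 i), .rev i]

/-- The final move on one side. -/
def finalProg (ε : ℤ) : Prog :=
  block [.red 13 1, .ite (.cls 13) (.const (if ε = 1 then 1 else 0))
    (block [.popF 1, shiftProg ε 1, .set 1 (.const (-(ε * 3))) (.cnt 1), .pushF 1]) .skip]

/-- The final move, if it applies. -/
def closeProg : Prog :=
  block [.peekF 1, .peekB 2 (.const 1), .ite (.cls 2) (.const 8)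
    (.ite (.cls 1) (.const 3) (finalProg 1) (.ite (.cls 1) (.const (-3)) (finalProg (-1)) .skip))
    .skip]

/-- The cells describe a reduced closed walk obtained from `l` by at most one final move. -/
def Closed (T : ReducingTriangulation D) (l : List D) (Q : List (Cell D)) : Prop :=
  ∃ L : List D, (L.IsRotated l ∨ T.FinalMove l L) ∧ T.ClosedReduced L ∧ T.FreeHom l L ∧
    (∃ w, T.IsWalk w L w) ∧ L.length = l.length ∧ T.ringDarts Q = L.map some ∧ T.RingOk Q

theorem exists_map_some_of_isRotated {A : List (Option D)} {l : List D}
    (h : A.IsRotated (l.map some)) : ∃ L : List D, A = L.map some ∧ L.IsRotated l := by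
  obtain ⟨n, hn⟩ := h.symm
  exact ⟨l.rotate n, by rw [List.map_rotate, hn], List.IsRotated.symm ⟨n, rfl⟩⟩

theorem Good.closed {l : List D} {Q : List (Cell D)} (h : T.Good false l Q 0)
    (hQ : ∀ e n, Q = [(some e, 3, n)] → T.red e = false)
    (hQ' : ∀ e n, Q = [(some e, -3, n)] → T.red e = true) : T.Closed l Q := by
  obtain ⟨L, hL, hr⟩ := exists_map_some_of_isRotated h.darts
  obtain ⟨w, hw⟩ := h.walk
  obtain ⟨w', hw'⟩ := hw.isRotated hr.symm
  have h' : T.Good false L Q 0 :=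
    ⟨h.ok, by rw [hL]; exact .refl _, ⟨w', hw'⟩, h.verified⟩
  exact ⟨L, .inl hr, h'.closedReduced hQ hQ', T.freeHom_isRotated hr.symm, ⟨w', hw'⟩,
    hr.perm.length_eq, hL, h.ok⟩

theorem Good.closed_final {l : List D} {ε : ℤ} (hε : ε = 1 ∨ ε = -1) {e : D} {n : ℤ}
    (h : T.Good false l [(some e, ε * 3, n)] 0) (hr : T.red e = decide (ε = 1)) :
    T.Closed l [(some (T.shift ε e), -(ε * 3), n)] := by
  obtain ⟨l', h1, h2, h3, h4, h5, h6⟩ := h.final hε hr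
  refine ⟨l', .inr h1, h2, h3, h4, ?_, h5, h6⟩
  have h7 := congrArg List.length h5
  have h8 := h.darts.perm.length_eq
  simp [cellDarts, ringList] at h7 h8
  omega

theorem wp_final {l : List D} {ε : ℤ} (hε : ε = 1 ∨ ε = -1) {s : State D} {e : D} {n : ℤ}
    (hq : s.q = [(some e, ε * 3, n)]) (h : T.Good false l s.q 0) (h1 : (s.r 1).1 = some e) :
    T.wp (finalProg ε) (fun s' => T.Closed l s'.q) s := by
  rw [finalProg, wp_block_cons]
  refine ⟨e, h1, ?_⟩
  rw [wp_block_cons, wp_block_nil']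
  by_cases hr : T.red e = decide (ε = 1)
  · rw [wp_ite_pos (by
      rcases hε with rfl | rfl <;> simp at hr <;> simp [Expr.eval, hr])]
    refine ⟨_, [], hq, ?_⟩
    have h2 := Good.closed_final hε (hq ▸ h) hr
    rcases hε with rfl | rfl
    · simp only [shiftProg, pushDart, if_true, wp_block_cons, wp_block_nil, wp, Expr.eval]
      simpa [shift, push_eq] using h2
    · simp only [shiftProg, pushDart, wp_block_cons]
      norm_num [wp, Expr.eval]
      simpa [shift, push_eq] using h2
  · rw [wp_ite_neg (by
      rcases hε with rfl | rfl <;> simp at hr <;> simp [Expr.eval, hr])]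
    refine h.closed (fun e' n' h => ?_) fun e' n' h => ?_
    · rw [hq] at h
      simp at h
      obtain ⟨rfl, h, -⟩ := h
      obtain rfl : ε = 1 := by omega
      simpa using hr
    · rw [hq] at h
      simp at h
      obtain ⟨rfl, h, -⟩ := h
      obtain rfl : ε = -1 := by omega
      simpa using hr

/-- The absence of a second cell from the end, seen as class `8`, means that the ring has at most
one cell. By `Good.closed`, no final move is needed in the other cases. -/
theorem wp_close {l : List D} {s : State D} (h : T.Good false l s.q 0) :
    T.wp closeProg (fun s' => T.Closed l s'.q) s := by
  rw [closeProg, wp_block_cons, wp, wp_block_cons]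
  refine ⟨by simp [Expr.eval], ?_⟩
  rw [wp_block_cons, wp_block_nil']
  by_cases h8 : (s.q.reverse[1]?.getD noCell).2.1 = 8
  · rw [wp_ite_pos (by simpa [Expr.eval] using h8)]
    cases hq : s.q with
    | nil =>
      rw [wp_ite_neg (by simp [Expr.eval, noCell]), wp_ite_neg (by simp [Expr.eval, noCell])]
      exact h.closed (by simp [hq]) (by simp [hq])
    | cons c Q =>
      obtain rfl : Q = [] := by
        rcases List.eq_nil_or_concat' Q with rfl | ⟨R, a, rfl⟩
        · rfl
        · exfalso
          have : ∃ y ∈ s.q, s.q.reverse[1]? = some y := by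
            refine ⟨_, ?_, List.getElem?_eq_getElem (by simp [hq])⟩
            exact List.mem_reverse.1 (List.getElem_mem _)
          obtain ⟨y, hy, hy'⟩ := this
          have := Linked.bounds h.ok y hy
          rw [hy', Option.getD_some] at h8
          omega
      obtain ⟨o, t, n⟩ := c
      by_cases h3 : t = 3
      · subst h3
        rw [wp_ite_pos (by simp [Expr.eval])]
        have h' := h.ok
        rw [hq] at h'
        obtain ⟨e, k, rfl, rfl, -⟩ := CellOk.of_small h'.1 (by omega)
        exact wp_final (.inl rfl) (by simpa using hq) (by exact h) (by simp)
      · rw [wp_ite_neg (by simpa [Expr.eval] using h3)]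
        by_cases h3' : t = -3
        · subst h3'
          rw [wp_ite_pos (by simp [Expr.eval])]
          have h' := h.ok
          rw [hq] at h'
          obtain ⟨e, k, rfl, rfl, -⟩ := CellOk.of_small h'.1 (by omega)
          exact wp_final (.inr rfl) (by simpa using hq) (by exact h) (by simp)
        · rw [wp_ite_neg (by simpa [Expr.eval] using h3')]
          refine h.closed (fun e n h => ?_) fun e n h => ?_ <;> simp_all
  · rw [wp_ite_neg (by simpa [Expr.eval] using h8)]
    refine h.closed (fun e n h => ?_) fun e n h => ?_ <;> simp [h, noCell] at h8

/-! ### The output -/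

/-- Take the first dart of the queue. -/
def takeProg : Prog := block [.popF 1, dropFirst 1]

open RAM in
/-- Write a dart of the output. -/
def writeCode : Program :=
  .seq (compile takeProg) (.seq (.write 8 (.reg 4) (.reg (addr 1)))
    (.assign 4 (.add (.reg 4) (.const 1))))

open RAM in
/-- Write the output. -/
def outputCode : Program :=
  .seq (.while (.lt (.reg 2) (.reg 3)) writeCode) (.assign 0 (.reg 4))

/-- The memory when `k` darts of the output have not been written. -/
def Writing (T : ReducingTriangulation D) (dn : D → ℤ) (m : RAM.Memory) (L : List D)
    (m' : RAM.Memory) (k : ℕ) : Prop :=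
  ∃ (s : State D) (i : ℕ) (x : Option D), i + k = L.length ∧ Rel dn s m' ∧ T.Linked s.q x ∧
    T.ringDarts s.q = (L.drop i).map some ∧ (∀ a < 8, m'.arr a = m.arr a) ∧ m'.reg 4 = i ∧
    m'.reg 1 = m.reg 1 ∧ ∀ (j : ℕ) (_ : j < i) (h : j < L.length), m'.arr 8 (j : ℤ) = dn L[j]

theorem StoredIn.congr_of_lt_eight {dn : D → ℤ} {vn : T.Vertex → ℤ} {m m' : RAM.Memory}
    (h : T.StoredIn dn vn m) (hm : ∀ a < 8, m'.arr a = m.arr a) : T.StoredIn dn vn m' := by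
  have h' : T.StoredIn dn vn { m with arr := fun a => if a < 8 then m'.arr a else m.arr a } :=
    StoredIn.congr h fun a _ => by
      by_cases ha : a < 8
      · simp [ha, hm]
      · simp [ha]
  exact ⟨h'.1, h'.2, h'.3, h'.4, h'.5, h'.6, h'.7, h'.8, h'.9, h'.10⟩

theorem Writing.next {dn : D → ℤ} {vn : T.Vertex → ℤ} {m : RAM.Memory} {L : List D}
    (hT : T.StoredIn dn vn m) : ∀ m' k, T.Writing dn m L m' k →
      (RAM.Term.lt (.reg 2) (.reg 3)).eval m' ≠ 0 →
      RAM.Halts writeCode m' (RAM.bound writeCode) fun m'' => ∃ k' < k, T.Writing dn m L m'' k' := by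
  rintro m' k ⟨s, i, x, hik, hR, hl, hd, ha, hr4, hr1, h8⟩ hb
  obtain ⟨c, Q, hq⟩ : ∃ c Q, s.q = c :: Q := by
    refine List.exists_cons_of_ne_nil fun h0 => hb ?_
    simp [RAM.Term.eval, hR.size, h0]
  rw [hq] at hl hd
  obtain ⟨hc, hl⟩ := hl
  obtain ⟨h1, h2⟩ := hc.splitFirst
  rw [ringDarts_cons, h1] at hd
  obtain ⟨d, rest, hdr⟩ : ∃ d rest, L.drop i = d :: rest := by
    refine List.exists_cons_of_ne_nil fun h0 => ?_
    rw [h0] at hd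
    simp at hd
  have hi : i < L.length := by
    by_contra h0
    rw [List.drop_eq_nil_of_le (by omega)] at hdr
    simp at hdr
  rw [List.drop_eq_getElem_cons hi] at hdr
  simp only [List.cons.injEq] at hdr
  obtain ⟨rfl, rfl⟩ := hdr
  rw [List.drop_eq_getElem_cons hi] at hd
  simp only [List.cons_append, List.map_cons, List.cons.injEq] at hd
  obtain ⟨s', hR', ⟨hq', h1'⟩, hF⟩ := sim (T := T) takeProg (hT.congr_of_lt_eight ha) hR
    (φ := fun s' => s'.q = T.splitFirst c ++ Q ∧ s'.r 1 = c) (by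
      refine ⟨c, Q, hq, ?_⟩
      rw [wp_block_cons, wp_block_nil']
      refine T.wp_dropFirst (by norm_num) (by simpa using hc.bounds) fun s' hs hk => ?_
      exact ⟨by simpa using hs, by simp [hk]⟩)
  refine RAM.halts_exec (by simp [writeCode, RAM.LoopFree, loopFree_compile]) ?_
  set m₁ := RAM.exec (compile takeProg) m' with hm₁
  have he : RAM.exec writeCode m' =
      (m₁.setArr 8 (m₁.reg 4) (m₁.reg (addr 1))).setReg 4 (m₁.reg 4 + 1) := rfl
  rw [he]
  set m₂ := (m₁.setArr 8 (m₁.reg 4) (m₁.reg (addr 1))).setReg 4 (m₁.reg 4 + 1) with hm₂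
  have hr : ∀ x ≠ 4, m₂.reg x = m₁.reg x := fun x hx => by
    simp [hm₂, RAM.Memory.setReg, RAM.Memory.setArr, hx]
  have har : ∀ x ≠ 8, m₂.arr x = m₁.arr x := fun x hx => by
    simp [hm₂, RAM.Memory.setReg, RAM.Memory.setArr, hx]
  have hr4' : m₁.reg 4 = i := (hF.2 4 (by simp)).trans hr4
  refine ⟨k - 1, by omega, s', i + 1, x, by omega, ?_, ?_, ?_, ?_, ?_, ?_, ?_⟩
  · exact hR'.congr (hr _ (by norm_num)) (hr _ (by norm_num)) (fun x hx => hr x (by omega))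
      fun a ha => har a (by omega)
  · rw [hq', linked_append]
    exact ⟨h2.2, hl⟩
  · rw [hq', ringDarts_append, hd.2]
  · exact fun a h => (har a (by omega)).trans ((hF.1 a (by omega)).trans (ha a h))
  · simp [hm₂, RAM.Memory.setReg, hr4']
  · exact (hr 1 (by norm_num)).trans ((hF.2 1 (by simp)).trans hr1)
  · intro j hj hjL
    have hv : m₂.arr 8 j = if (j : ℤ) = i then m₁.reg (addr 1) else m₁.arr 8 j := by
      simp [hm₂, RAM.Memory.setReg, RAM.Memory.setArr, Function.update_apply, hr4']
    rw [hv]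
    by_cases hji : j = i
    · subst hji
      rw [if_pos rfl]
      exact (hR'.reg 1).1 _ (by rw [h1', hd.1])
    · rw [if_neg (by exact_mod_cast hji), hF.1 8 (by norm_num)]
      exact h8 j (by omega) hjL

/-- Runs are unrolled one dart per round, so the time is linear in the length of the written walk,
whatever the number of cells. -/
theorem halts_output {dn : D → ℤ} {vn : T.Vertex → ℤ} {m : RAM.Memory} {L : List D}
    (hT : T.StoredIn dn vn m) {s : State D} (hR : Rel dn s m) {x : Option D} (hl : T.Linked s.q x)
    (hd : T.ringDarts s.q = L.map some) (hr4 : m.reg 4 = 0) :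
    RAM.Halts outputCode m ((3 + RAM.bound writeCode + 1) * (L.length + 1) + 3) fun m' =>
      m'.reg 0 = L.length ∧ m'.reg 1 = m.reg 1 ∧ (∀ a < 8, m'.arr a = m.arr a) ∧
      ∀ (j : ℕ) (h : j < L.length), m'.arr 8 (j : ℤ) = dn L[j] := by
  refine ((RAM.halts_while (T.Writing dn m L) (Writing.next hT) (k := L.length)
    ⟨s, 0, x, by simp, hR, hl, by simpa using hd, fun _ _ => rfl, hr4, rfl, by simp⟩ le_rfl).seq
    (t' := 2) ?_)
  rintro m' ⟨hb, k, s', i, x, hik, hR', hl', hd', ha, hr4, hr1, h8⟩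
  have hq : s'.q = [] := by
    rw [RAM.Term.eval, RAM.Term.eval, RAM.Term.eval, hR'.size] at hb
    split_ifs at hb with h <;> simp at h hb ⊢
    exact h
  have hi : i = L.length := by
    rw [hq] at hd'
    have := congrArg List.length hd'
    simp at this
    omega
  subst hi
  refine RAM.halts_exec (p := .assign 0 (.reg 4)) trivial ?_
  have he : RAM.exec (.assign 0 (.reg 4)) m' = m'.setReg 0 (m'.reg 4) := rfl
  rw [he]
  refine ⟨?_, ?_, ha, fun j h => h8 j h h⟩
  · simp [RAM.Memory.setReg, hr4]
  · simp [RAM.Memory.setReg, hr1]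

end ReducingTriangulation

namespace ReducingTriangulation

variable {D : Type*} {T : ReducingTriangulation D}

/-! ### The programs -/

theorem moves_spec {u v : T.Vertex} {l l' : List D} (hl : T.IsWalk u l v)
    (h : Relation.ReflTransGen T.Move l l') : T.IsWalk u l' v ∧
      T.potential l' ≤ T.potential l ∧
      ∀ hl' : T.IsWalk u l' v, PathHom (T.listPath u l v hl) (T.listPath u l' v hl') := by
  induction h with
  | refl => exact ⟨hl, le_rfl, fun _ => .refl _⟩
  | tail _ h ih =>
    obtain ⟨h1, h2, h3⟩ := ih
    obtain ⟨h4, h5⟩ := Move.spec h1 h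
    exact ⟨h4, h5.le.trans h2, fun hl' => (h3 h1).trans (h.pathHom h1 hl')⟩

theorem FreeHom.trans {l l' l'' : List D} (h : T.FreeHom l l') (h' : T.FreeHom l' l'')
    (hl : ∃ w, T.IsWalk w l' w) : T.FreeHom l l'' := by
  obtain ⟨w, hw⟩ := hl
  exact fun u hu u' hu' => (h u hu w hw).trans (h' w hw u' hu')

theorem closedMoves_spec {u : T.Vertex} {l l' : List D} (hl : T.IsWalk u l u)
    (h : Relation.ReflTransGen T.ClosedMove l l') : (∃ w, T.IsWalk w l' w) ∧
      T.closedPotential l' ≤ T.closedPotential l ∧ T.FreeHom l l' := by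
  induction h with
  | refl => exact ⟨⟨u, hl⟩, le_rfl, T.freeHom_refl _⟩
  | tail _ h ih =>
    obtain ⟨⟨w, h1⟩, h2, h3⟩ := ih
    obtain ⟨h4, -, h5, -⟩ := ClosedMove.spec h1 h
    refine ⟨h4, ?_, h3.trans h.freeHom ⟨w, h1⟩⟩
    rcases h5 with h5 | ⟨-, h5, -⟩ <;> omega

/-- The program that reduces walks. -/
def walkCode : RAM.Program := .seq (.seq (reduceCode true) gapCode) outputCode

open RAM in
/-- The program that reduces closed walks. -/
def closedWalkCode : Program :=
  .seq (.seq (.seq (reduceCode false) (compile closeProg)) outputCode)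
    (.ite (.reg 0) (.assign 1 (.read 1 (.read 8 (.const 0)))) .skip)

theorem walkCode_spec : ∃ c : ℕ, ∀ {D : Type u} (T : ReducingTriangulation D)
      (dn : D → ℤ) (vn : T.Vertex → ℤ) (s : RAM.Memory) (u v : T.Vertex) (W : T.Walk u v),
      T.StoredIn dn vn s → T.WalkIn dn vn 7 u W.darts s →
      ∃ (s' : RAM.Memory) (t : ℕ) (W' : T.Walk u v),
        RAM.Run walkCode s s' t ∧ t ≤ c * (W.darts.length + 1) ∧
        T.WalkIn dn vn 8 u W'.darts s' ∧
        T.Reduced W'.darts ∧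
        Path.Homotopic W.path W'.path ∧
        Relation.ReflTransGen T.Move W.darts W'.darts := by
  obtain ⟨c, hc⟩ := exists_halts_reduce.{u} true
  refine ⟨c + (6 + RAM.bound (compile turnProg) + 1) * 2229 + RAM.bound (compile (.popF 1)) +
    2 * (3 + RAM.bound writeCode + 1) + 6, fun {D} T dn vn m u v W hT hW => ?_⟩
  obtain ⟨l, hl⟩ := W
  obtain ⟨h0, h1, h7⟩ := hW
  simp only at h0 h7 ⊢
  have key : RAM.Halts walkCode m (c * (l.length + 1) +
      ((6 + RAM.bound (compile turnProg) + 1) * (2229 * (l.length + 1)) +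
        RAM.bound (compile (.popF 1)) + 1) + 1 +
        ((3 + RAM.bound writeCode + 1) * (2 * (l.length + 1)) + 3) + 1) fun m' =>
      ∃ l', T.Reduced l' ∧ Relation.ReflTransGen T.Move l l' ∧ m'.reg 0 = l'.length ∧
        m'.reg 1 = m.reg 1 ∧ ∀ (j : ℕ) (h : j < l'.length), m'.arr 8 (j : ℤ) = dn l'[j] := by
    refine RAM.Halts.seq (RAM.Halts.seq (hc (T := T) (dn := dn) hT ⟨u, v, hl⟩ h0 h7) (R := fun m' =>
      ∃ (s : State D) (l' : List D), Rel dn s m' ∧ T.Reduced l' ∧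
        Relation.ReflTransGen T.Move l l' ∧ T.Linked s.q none ∧ T.ringDarts s.q = l'.map some ∧
        (∀ a < 10, m'.arr a = m.arr a) ∧ m'.reg 4 = 0 ∧ m'.reg 1 = m.reg 1) ?_) ?_
    · rintro m₁ ⟨s, l', hlen, hR, hg, hm, ha, hr4, hr1⟩
      refine (halts_gap (hT.congr ha) hR hg.ok hg.darts).mono ?_ ?_
      · gcongr
        omega
      · rintro m₂ ⟨s', hR', hF, hL, hd⟩
        exact ⟨s', l', hR', hg.reduced, hm, hL, hd, fun a h => (hF.1 a h).trans (ha a h),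
          (hF.2 4 (by simp)).trans hr4, (hF.2 1 (by simp)).trans hr1⟩
    · rintro m₁ ⟨s, l', hR, hr, hm, hL, hd, ha, hr4, hr1⟩
      obtain ⟨-, h3, -⟩ := moves_spec hl hm
      -- Three times the new length is at most the new potential, hence at most the old one, hence
      -- at most four times the old length.
      have h4 : l'.length ≤ 2 * l.length := by
        have := T.potential_le l
        simp only [potential] at h3 this
        omega
      refine (halts_output (hT.congr ha) hR hL hd hr4).mono ?_ ?_
      · gcongr
        omega
      · rintro m₂ ⟨h0', h1', -, h8⟩
        exact ⟨l', hr, hm, h0', h1'.trans hr1, h8⟩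
  obtain ⟨m', t, hrun, ht, l', hr, hm, h0', h1', h8⟩ := key
  obtain ⟨hl', -, hp⟩ := moves_spec hl hm
  refine ⟨m', t, ⟨l', hl'⟩, hrun, ht.trans ?_, ⟨h0', h1'.trans h1, h8⟩, hr, (hp hl').homotopic, hm⟩
  generalize RAM.bound (compile turnProg) = a
  generalize RAM.bound (compile (.popF 1)) = b
  generalize RAM.bound writeCode = d
  nlinarith

theorem closedWalkCode_spec : ∃ c : ℕ, ∀ {D : Type u} (T : ReducingTriangulation D)
      (dn : D → ℤ) (vn : T.Vertex → ℤ) (s : RAM.Memory) (u : T.Vertex) (C : T.Walk u u),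
      T.StoredIn dn vn s → T.WalkIn dn vn 7 u C.darts s →
      ∃ (s' : RAM.Memory) (t : ℕ) (u' : T.Vertex) (C' : T.Walk u' u'),
        RAM.Run closedWalkCode s s' t ∧ t ≤ c * (C.darts.length + 1) ∧
        T.WalkIn dn vn 8 u' C'.darts s' ∧
        T.ClosedReduced C'.darts ∧
        FreelyHomotopic C.path C'.path ∧
        ∃ l : List D, Relation.ReflTransGen T.ClosedMove C.darts l ∧
          (C'.darts.IsRotated l ∨ T.FinalMove l C'.darts) := by
  obtain ⟨c, hc⟩ := exists_halts_reduce.{u} false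
  refine ⟨c + RAM.bound (compile closeProg) + 2 * (3 + RAM.bound writeCode + 1) + 13,
    fun {D} T dn vn m u W hT hW => ?_⟩
  obtain ⟨l, hl⟩ := W
  obtain ⟨h0, h1, h7⟩ := hW
  simp only at h0 h7 ⊢
  have key : ∃ K, K = c * (l.length + 1) + RAM.bound (compile closeProg) + 1 +
      ((3 + RAM.bound writeCode + 1) * (2 * (l.length + 1)) + 3) + 1 + 7 + 1 ∧
      RAM.Halts closedWalkCode m K fun m' =>
      ∃ (L : List D) (l' : List D) (w : T.Vertex), T.ClosedReduced L ∧
        Relation.ReflTransGen T.ClosedMove l l' ∧ (L.IsRotated l' ∨ T.FinalMove l' L) ∧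
        T.FreeHom l' L ∧ T.IsWalk w L w ∧ m'.reg 0 = L.length ∧ m'.reg 1 = vn w ∧
        ∀ (j : ℕ) (h : j < L.length), m'.arr 8 (j : ℤ) = dn L[j] := by
    refine ⟨_, ?_, RAM.Halts.seq (t' := 7) (RAM.Halts.seq
      (t' := (3 + RAM.bound writeCode + 1) * (2 * (l.length + 1)) + 3)
      (RAM.Halts.seq (t' := RAM.bound (compile closeProg)) (hc (T := T) (dn := dn) hT ⟨u, hl⟩ h0 h7) (R := fun m' =>
      ∃ (s : State D) (l' : List D), Rel dn s m' ∧ Relation.ReflTransGen T.ClosedMove l l' ∧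
        T.Closed l' s.q ∧ (∀ a < 10, m'.arr a = m.arr a) ∧ m'.reg 4 = 0 ∧ m'.reg 1 = m.reg 1) ?_)
      (R := fun m' => ∃ (L : List D) (l' : List D), T.ClosedReduced L ∧
        Relation.ReflTransGen T.ClosedMove l l' ∧ (L.IsRotated l' ∨ T.FinalMove l' L) ∧
        T.FreeHom l' L ∧ (∃ w, T.IsWalk w L w) ∧ m'.reg 0 = L.length ∧ m'.reg 1 = m.reg 1 ∧
        m'.arr 1 = m.arr 1 ∧ ∀ (j : ℕ) (h : j < L.length), m'.arr 8 (j : ℤ) = dn L[j]) ?_) ?_⟩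
    · rfl
    · rintro m₁ ⟨s, l', hlen, hR, hg, hm, ha, hr4, hr1⟩
      refine (halts_compile closeProg (hT.congr ha) hR (wp_close hg)).mono le_rfl ?_
      rintro m₂ ⟨s', hR', hcl, hF⟩
      exact ⟨s', l', hR', hm, hcl, fun a h => (hF.1 a h).trans (ha a h),
        (hF.2 4 (by simp)).trans hr4, (hF.2 1 (by simp)).trans hr1⟩
    · rintro m₁ ⟨s, l', hR, hm, ⟨L, hL, hr, hfree, hw, hlen, hd, hok⟩, ha, hr4, hr1⟩
      obtain ⟨-, h3, -⟩ := closedMoves_spec hl hm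
      have h4 : L.length ≤ 2 * l.length := by
        have := T.closedPotential_le l
        simp only [closedPotential] at h3 this
        omega
      refine (halts_output (hT.congr ha) hR hok hd hr4).mono ?_ ?_
      · gcongr
        omega
      · rintro m₂ ⟨h0', h1', ha', h8⟩
        exact ⟨L, l', hr, hm, hL, hfree, hw, h0', h1'.trans hr1,
          (ha' 1 (by norm_num)).trans (ha 1 (by norm_num)), h8⟩
    · rintro m₁ ⟨L, l', hr, hm, hL, hfree, ⟨w, hw⟩, h0', h1', ha, h8⟩
      refine (RAM.halts_exec (by simp [RAM.LoopFree]) ?_).mono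
        (by simp [RAM.bound, RAM.Term.cost]) fun _ h => h
      cases L with
      | nil =>
        -- A closed walk of length zero may be based at any vertex, so the vertex `u` still in
        -- register `1` is kept. Otherwise the base vertex is the source of the first dart written.
        rw [RAM.exec_ite_zero (by simp [RAM.Term.eval, h0'])]
        exact ⟨[], l', u, hr, hm, hL, hfree, rfl, h0', h1'.trans h1, h8⟩
      | cons d L =>
        rw [RAM.exec_ite_one (by simp [RAM.Term.eval, h0']; omega)]
        refine ⟨d :: L, l', w, hr, hm, hL, hfree, hw, ?_, ?_, h8⟩
        · simpa [RAM.exec, RAM.Memory.setReg] using h0'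
        · have := h8 0 (by simp)
          simp only [List.getElem_cons_zero, Nat.cast_zero] at this
          simp [RAM.exec, RAM.Memory.setReg, RAM.Term.eval, this, ha, hT.src, hw.1]
  obtain ⟨K, hK, m', t, hrun, ht, L, l', w, hr, hm, hL, hfree, hw, h0', h1', h8⟩ := key
  obtain ⟨hl', -, hp⟩ := closedMoves_spec hl hm
  refine ⟨m', t, w, ⟨L, hw⟩, hrun, ht.trans ?_, ⟨h0', h1', h8⟩, hr,
    (hp.trans hfree hl') u hl w hw, l', hm, hL⟩
  rw [hK]
  generalize RAM.bound (compile closeProg) = a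
  generalize RAM.bound writeCode = d
  nlinarith

end ReducingTriangulation

theorem mainTheorem6 :
    -- reduction of walks in linear time
    (∃ (P : RAM.Program) (c : ℕ), ∀ {D : Type u} (T : ReducingTriangulation D)
      (dn : D → ℤ) (vn : T.Vertex → ℤ) (s : RAM.Memory) (u v : T.Vertex) (W : T.Walk u v),
      T.StoredIn dn vn s → T.WalkIn dn vn 7 u W.darts s →
      ∃ (s' : RAM.Memory) (t : ℕ) (W' : T.Walk u v),
        RAM.Run P s s' t ∧ t ≤ c * (W.darts.length + 1) ∧
        T.WalkIn dn vn 8 u W'.darts s' ∧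
        T.Reduced W'.darts ∧
        Path.Homotopic W.path W'.path ∧
        Relation.ReflTransGen T.Move W.darts W'.darts) ∧
    -- reduction of closed walks in linear time
    (∃ (P : RAM.Program) (c : ℕ), ∀ {D : Type u} (T : ReducingTriangulation D)
      (dn : D → ℤ) (vn : T.Vertex → ℤ) (s : RAM.Memory) (u : T.Vertex) (C : T.Walk u u),
      T.StoredIn dn vn s → T.WalkIn dn vn 7 u C.darts s →
      ∃ (s' : RAM.Memory) (t : ℕ) (u' : T.Vertex) (C' : T.Walk u' u'),
        RAM.Run P s s' t ∧ t ≤ c * (C.darts.length + 1) ∧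
        T.WalkIn dn vn 8 u' C'.darts s' ∧
        T.ClosedReduced C'.darts ∧
        FreelyHomotopic C.path C'.path ∧
        ∃ l : List D, Relation.ReflTransGen T.ClosedMove C.darts l ∧
          (C'.darts.IsRotated l ∨ T.FinalMove l C'.darts)) ∧
    -- every reduction move on a walk strictly decreases the potential
    (∀ {D : Type u} (T : ReducingTriangulation D) (u v : T.Vertex) (W : T.Walk u v)
      (l : List D), T.Move W.darts l → T.potential l < T.potential W.darts) ∧
    -- every sequence of moves starting at a walk of length `n` has length at most `4 * n`
    (∀ {D : Type u} (T : ReducingTriangulation D) (u v : T.Vertex) (W : T.Walk u v)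
      (L : List (List D)), List.IsChain T.Move (W.darts :: L) →
      L.length ≤ 4 * W.darts.length) ∧
    -- every reduction move on a closed walk strictly decreases the potential, except in the
    -- heart-like case, where it may leave it unchanged
    (∀ {D : Type u} (T : ReducingTriangulation D) (u : T.Vertex) (C : T.Walk u u)
      (l : List D), T.ClosedMove C.darts l →
      T.closedPotential l < T.closedPotential C.darts ∨
        (T.Heart C.darts ∧ T.closedPotential l = T.closedPotential C.darts)) ∧
    -- every sequence of moves starting at a closed walk of length `n` has length at most
    -- `4 * n + 1`
    (∀ {D : Type u} (T : ReducingTriangulation D) (u : T.Vertex) (C : T.Walk u u)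
      (L : List (List D)), List.IsChain T.ClosedMove (C.darts :: L) →
      L.length ≤ 4 * C.darts.length + 1) := by
  exact ⟨⟨ReducingTriangulation.walkCode, ReducingTriangulation.walkCode_spec⟩,
    ⟨ReducingTriangulation.closedWalkCode, ReducingTriangulation.closedWalkCode_spec⟩,
    fun T _ _ W l h => (ReducingTriangulation.Move.spec W.isWalk h).2,
    fun T _ _ W L h => (T.length_chain_le W.isWalk h).trans (T.potential_le W.darts),
    fun T u C l h =>
      (ReducingTriangulation.ClosedMove.spec C.isWalk h).2.2.1.imp id fun h => ⟨h.1, h.2.1⟩,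
    fun T u C L h => (T.length_closed_chain_le C.isWalk h).trans
      (Nat.succ_le_succ (T.closedPotential_le C.darts))⟩
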